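/- **Setting.** Let $p\ge 1$, $\gcd(p,q)=1$, $-p<q<p$. The Heegaard torus of $L(p,q)$ is ruled by $N\ge 1$ parallel horizontal $\alpha$-circles and $N$ parallel $\beta$-circles of slope $-p/q$ (each pair meets in $p$ points), oriented by (right, up). A grid diagram $g$ carries marks $O$, $X$, $XX$, at most one in each cell, such that each row and each column contains either one $X$ and one $O$ (regular), or one $XX$ and two $O$'s (singular). A possibly singular link in $L(p,q)$ is drawn by vertical arcs running upwards from each $X$ or $XX$ to the $O$'s of its column, and, below them, horizontal arcs running (in directions that are fixed as part of $g$) from each $O$ to the $X$ or $XX$ of its row. A crossing square is a cell that contains a crossing; $C(g)$ is the set of crossings. Since the over-strand runs upwards, a crossing is positive if its under-strand runs to the left, and negative if it runs to the right. The diagram is *special* if each row and each column has at most one crossing square, no two crossing squares share a corner, each crossing square shares a vertical and a horizontal side with squares marked $X$, and every embedded rectangle two of whose corners are crossing corners contains an $X$. (The crossing corner $p_c$ is the corner shared by the two $X$-squares adjacent to the crossing square of $c$.) It has the *standard picture* at $c$ if the over-strand starts at an $X$ just below the crossing square, the under-strand ends at another $X$ just beside it, and the fourth square of the $2\times2$ block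 around $p_c$ is unmarked. The two $X$'s are called the $X$'s of $c$. *Smoothing* $c$ moves its two $X$'s to the other diagonal of this block. *Singularizing* $c$ deletes the $\alpha$- and the $\beta$-curve through $p_c$ and replaces the two $X$'s by one $XX$ in the merged cell. For a positive crossing the $0$-resolution is the singularization and the $1$-resolution is the smoothing; for a negative crossing the roles are exchanged. For $I:C(g)\to\{0,1\}$ let $g_I$ be the diagram resolved according to $I$. **Complexes.** Let $\mathbb k=\mathbb Z/2$, or $\mathbb k=\mathbb Z$ with a sign assignment $\mathbf S$ on the rectangles of the ruling (alternative pairs $r_1*r_2=r_1'*r_2'$ with different intermediate generators have opposite signs; a horizontal, resp. vertical, annulus $r_1*r_2$ has $\mathbf S(r_1)\mathbf S(r_2)=1$, resp. $-1$). Let $R=\mathbb k[U_O: O\text{ an }O\text{-mark}]$. $CFK^-$ of a diagram is the free $R$-module on the sets $\mathbf x$ of intersection points with one point on each $\alpha$- and each $\beta$-curve, with $\partial^-\mathbf x=\sum_{\mathbf y}\sum_r \mathbf S(r)\prod_O U_O^{n_O(r)}\,\mathbf y$, where $r$ runs over the empty embedded rectangles from $\mathbf x$ to $\mathbf y$ without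 $X$ or $XX$ ($\mathbf S=1$ if $\mathbb k=\mathbb Z/2$; $g_I$ carries the signs obtained by adding the points $p_c$ of the singularized crossings to the generators). $HFK^-(g)$ is the homology of $CFK^-(g)$. For a crossing $c$ put $u^{(c)}=U_a+U_b-U_c-U_d$, where $O_a,O_b$ are the $O$-marks in the columns, and $O_c,O_d$ those in the rows, of the two $X$'s of $c$. Let $$V(g_I)=H_*\Bigl(CFK^-(g_I)\otimes_R\bigotimes_{c\text{ singularized in }I}R/(u^{(c)})\Bigr),\qquad V(g)=\bigoplus_I V(g_I).$$ **Zip and unzip.** Let $I(c)=0$ and let $I'$ differ from $I$ only by $I'(c)=1$. On the diagram among $g_I,g_{I'}$ in which $c$ is smoothed, let $\Phi_B$ be the (signed, weighted) count of the empty rectangles that contain exactly one of the two $X$'s of $c$ and no other $X$ or $XX$, and run between generators of which exactly one contains $p_c$. Identify the generators of the diagram in which $c$ is singularized with the generators containing $p_c$ of the one in which it is smoothed. If $c$ is negative, the zip map $V(g_I)\to V(g_{I'})$ is induced by $\Phi_B$ followed by the projection to the generators containing $p_c$. If $c$ is positive, the unzip map $V(g_I)\to V(g_{I'})$ is $[w]\mapsto[w+\Phi_B(z)]$,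 where $\partial w=u^{(c)}z$ modulo the other $u^{(c')}$ (this is the map induced by replacing $R/(u^{(c)})$ by the mapping cone of $u^{(c)}$). **Theorem.** Let $g$ be a special grid diagram of a possibly singular link in $L(p,q)$ with the standard picture at every crossing. Assume that, following the link from any $X$ of a crossing, one meets an $X$ or $XX$ that is not one of the $X$'s of a crossing. Then, over $\mathbb Z/2$, and over $\mathbb Z$ for every sign assignment, $\partial^-\circ\partial^-=0$ on $CFK^-(g)$ and on all $CFK^-(g_I)$, the zip and unzip maps are well defined, and there is a spectral sequence of $R$-modules, graded by the cube degree $|I|=\sum_c I(c)$, with $d_r$ of degree $r$, whose $E_1$ page is $V(g)$, whose differential $d_1$ is the sum, up to signs, of the zip and unzip maps over the edges of the cube, and which converges to $HFK^-(g)$: it degenerates at a finite page, and $E_\infty$ is the associated graded module of a finite filtration of $HFK^-(g)$ by $R$-submodules. -/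

import Mathlib

open CategoryTheory
open scoped DirectSum

namespace LensGrid

/-! ### The Heegaard torus of `L(p,q)` with its ruling by `N` parallel `α`- and `β`-curves -/

/-- The lattice generated by `(pN, 0)` and `(qN, N)`.  An element `(a, b)` of `ℤ × ℤ` stands for
the point `a v₁ + b v₂` of the plane, where `v₁` is a horizontal step of length `1 / (pN)`
and `v₂ = (-q / (pN), 1 / N)` is a step along a `β`-curve (slope `-p / q`). -/
def lattice (p : ℕ) (q : ℤ) (N : ℕ) : AddSubgroup (ℤ × ℤ) :=
  AddSubgroup.closure {((p : ℤ) * N, 0), (q * N, (N : ℤ))}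

/-- The `pN²` intersection points of the `α`- and `β`-curves on the torus.  The same type indexes
the `pN²` cells of the ruled torus: a cell is named by its lower left corner. -/
abbrev Torus (p : ℕ) (q : ℤ) (N : ℕ) : Type := (ℤ × ℤ) ⧸ lattice p q N

variable {p : ℕ} {q : ℤ} {N : ℕ}

instance instFiniteTorus [NeZero p] [NeZero N] : Finite (Torus p q N) := by
  have hN : (0 : ℤ) < N := by exact_mod_cast Nat.pos_of_ne_zero (NeZero.ne N)
  have hp : (0 : ℤ) < p := by exact_mod_cast Nat.pos_of_ne_zero (NeZero.ne p)
  have hpN : (0 : ℤ) < (p : ℤ) * N := mul_pos hp hN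
  have hfin : (Set.Ico (0 : ℤ) ((p : ℤ) * N) ×ˢ Set.Ico (0 : ℤ) (N : ℤ)).Finite :=
    (Set.finite_Ico _ _).prod (Set.finite_Ico _ _)
  have : Finite (Set.Ico (0 : ℤ) ((p : ℤ) * N) ×ˢ Set.Ico (0 : ℤ) (N : ℤ) : Set (ℤ × ℤ)) :=
    hfin.to_subtype
  refine Finite.of_surjective
    (fun v : (Set.Ico (0 : ℤ) ((p : ℤ) * N) ×ˢ Set.Ico (0 : ℤ) (N : ℤ) : Set (ℤ × ℤ)) =>
      (QuotientAddGroup.mk v.1 : Torus p q N)) ?_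
  intro t
  induction t using QuotientAddGroup.induction_on with
  | H v =>
    obtain ⟨a, b⟩ := v
    refine ⟨⟨((a - b / N * (q * N)) % ((p : ℤ) * N), b % N), ?_⟩, ?_⟩
    · exact ⟨⟨Int.emod_nonneg _ hpN.ne', Int.emod_lt_of_pos _ hpN⟩,
        ⟨Int.emod_nonneg _ hN.ne', Int.emod_lt_of_pos _ hN⟩⟩
    · refine QuotientAddGroup.eq.2 ?_
      have h1 : (((p : ℤ) * N, 0) : ℤ × ℤ) ∈ lattice p q N :=
        AddSubgroup.subset_closure (by simp)
      have h2 : ((q * N, (N : ℤ)) : ℤ × ℤ) ∈ lattice p q N :=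
        AddSubgroup.subset_closure (by simp)
      have h3 := (lattice p q N).add_mem
        ((lattice p q N).zsmul_mem h1 ((a - b / N * (q * N)) / ((p : ℤ) * N)))
        ((lattice p q N).zsmul_mem h2 (b / N))
      convert h3 using 1
      have e1 := Int.mul_ediv_add_emod (a - b / N * (q * N)) ((p : ℤ) * N)
      have e2 := Int.mul_ediv_add_emod b N
      ext
      · simp
        linarith
      · simp
        linarith

noncomputable instance instFintypeTorus [NeZero p] [NeZero N] : Fintype (Torus p q N) :=
  Fintype.ofFinite _

noncomputable instance instDecidableEqTorus : DecidableEq (Torus p q N) := Classical.decEq _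

/-- Move `a` steps to the right and `b` steps upwards along the `β`-direction. -/
def shift (t : Torus p q N) (a b : ℤ) : Torus p q N := t + QuotientAddGroup.mk (a, b)

/-- The `α`-curve through a point; equivalently the row (annulus above that curve) of a cell. -/
def row : Torus p q N →+ ZMod N :=
  QuotientAddGroup.lift (lattice p q N)
    ((Int.castAddHom (ZMod N)).comp (AddMonoidHom.snd ℤ ℤ)) (by
      rw [lattice, AddSubgroup.closure_le]
      rintro v (rfl | rfl) <;> simp)

/-- The `β`-curve through a point; equivalently the column (annulus to the right of that curve)
of a cell. -/
def col : Torus p q N →+ ZMod N :=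
  QuotientAddGroup.lift (lattice p q N)
    ((Int.castAddHom (ZMod N)).comp (AddMonoidHom.fst ℤ ℤ)) (by
      rw [lattice, AddSubgroup.closure_le]
      rintro v (rfl | rfl) <;> simp)

/-! ### Rectangles -/

/-- A rectangle given by its lower left corner, its width and its height. An embedded rectangle
has width and height less than `pN`. -/
@[ext]
structure Rect (p : ℕ) (q : ℤ) (N : ℕ) where
  sw : Torus p q N
  width : Fin (p * N)
  height : Fin (p * N)

noncomputable instance instFintypeRect [NeZero p] [NeZero N] : Fintype (Rect p q N) :=
  Fintype.ofInjective
    (fun r : Rect p q N => ((r.sw, r.width, r.height) :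
      Torus p q N × Fin (p * N) × Fin (p * N)))
    (by
      rintro ⟨a, b, c⟩ ⟨a', b', c'⟩ h
      simpa using h)

namespace Rect

def se (r : Rect p q N) : Torus p q N := shift r.sw r.width 0
def nw (r : Rect p q N) : Torus p q N := shift r.sw 0 r.height
def ne (r : Rect p q N) : Torus p q N := shift r.sw r.width r.height

/-- The four corners. -/
def corners (r : Rect p q N) : Set (Torus p q N) := {r.sw, r.se, r.nw, r.ne}

/-- The cells contained in `r`. -/
def cells (r : Rect p q N) : Set (Torus p q N) :=
  {t | ∃ i j : ℕ, i < r.width ∧ j < r.height ∧ t = shift r.sw i j}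

/-- The points of the ruling in the interior of `r`. -/
def interior (r : Rect p q N) : Set (Torus p q N) :=
  {t | ∃ i j : ℕ, 0 < i ∧ i < r.width ∧ 0 < j ∧ j < r.height ∧ t = shift r.sw i j}

/-- The closed rectangle is nondegenerate and embedded in the torus. -/
def Embedded (r : Rect p q N) : Prop :=
  0 < (r.width : ℕ) ∧ 0 < (r.height : ℕ) ∧
    ∀ i j i' j' : ℕ, i ≤ r.width → j ≤ r.height → i' ≤ r.width → j' ≤ r.height →
      shift r.sw i j = shift r.sw i' j' → i = i' ∧ j = j'

open scoped Classical in
/-- The multiplicity of (the 2-chain) `r` at a cell. -/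
noncomputable def mult (r : Rect p q N) (t : Torus p q N) : ℕ := if t ∈ r.cells then 1 else 0

/-- The multiplicity of `r` at a finite set of cells. -/
noncomputable def multAt (r : Rect p q N) (T : Finset (Torus p q N)) : ℕ := ∑ t ∈ T, r.mult t

/-- `r` is a rectangle from `x` to `y`: its lower left and upper right corners are in `x`, the
other two corners are in `y`, and `x` and `y` agree otherwise. -/
def IsFromTo (r : Rect p q N) (x y : Finset (Torus p q N)) : Prop :=
  r.Embedded ∧ r.sw ∈ x ∧ r.ne ∈ x ∧ y = (x \ {r.sw, r.ne}) ∪ {r.se, r.nw}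

/-- `r` is an empty rectangle from `x` to `y`. -/
def IsEmptyFromTo (r : Rect p q N) (x y : Finset (Torus p q N)) : Prop :=
  r.IsFromTo x y ∧ (∀ t ∈ x, t ∉ r.interior) ∧ (∀ t ∈ y, t ∉ r.interior)

end Rect

/-! ### Multi-based diagrams, states, and the unblocked complex -/

/-- A multi-based diagram on the torus with prescribed set `O` of `O`-marks.
The `α`-curves (resp. `β`-curves) are a subfamily `rows` (resp. `cols`) of the `N` parallel
curves, and `X` and `XX` are the other two kinds of marks, each placed in a cell. Forgetting
an `α`-curve (resp. a `β`-curve) merges the two rows (resp. columns) adjacent to it. -/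
structure Diagram (p : ℕ) (q : ℤ) (N : ℕ) (O : Finset (Torus p q N)) where
  rows : Finset (ZMod N)
  cols : Finset (ZMod N)
  X : Finset (Torus p q N)
  XX : Finset (Torus p q N)

/-- `x` consists of intersection points of the chosen curves, exactly one on each of them. -/
def IsState (rows cols : Finset (ZMod N)) (x : Finset (Torus p q N)) : Prop :=
  (∀ t ∈ x, row t ∈ rows ∧ col t ∈ cols) ∧
    (∀ i ∈ rows, ∃! t, t ∈ x ∧ row t = i) ∧ (∀ j ∈ cols, ∃! t, t ∈ x ∧ col t = j)

/-- A choice of signs for rectangles from one state to another (arbitrary on other triples). -/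
abbrev Signs (p : ℕ) (q : ℤ) (N : ℕ) : Type :=
  Finset (Torus p q N) → Finset (Torus p q N) → Rect p q N → ℤˣ

/-- Sign assignments for the full `N × N` ruling: alternative pairs have opposite signs,
horizontal annuli have sign `1`, vertical annuli have sign `-1`. -/
structure IsSignAssignment [NeZero N] (S : Signs p q N) : Prop where
  alternative : ∀ (x w y z : Finset (Torus p q N)) (r₁ r₂ r₁' r₂' : Rect p q N),
    IsState Finset.univ Finset.univ x → IsState Finset.univ Finset.univ w →
    IsState Finset.univ Finset.univ y → IsState Finset.univ Finset.univ z →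
    r₁.IsFromTo x w → r₂.IsFromTo w z → r₁'.IsFromTo x y → r₂'.IsFromTo y z → y ≠ w →
    (∀ t, r₁.mult t + r₂.mult t = r₁'.mult t + r₂'.mult t) →
    S x w r₁ * S w z r₂ = -(S x y r₁' * S y z r₂')
  horizontal : ∀ (x y : Finset (Torus p q N)) (r₁ r₂ : Rect p q N),
    IsState Finset.univ Finset.univ x → IsState Finset.univ Finset.univ y →
    r₁.IsFromTo x y → r₂.IsFromTo y x →
    (∃ (i : ZMod N) (h : ℕ), h < N ∧
      (∀ t, (∃ k : ℕ, k < h ∧ row t = i + (k : ZMod N)) → r₁.mult t + r₂.mult t = 1) ∧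
      (∀ t, (¬ ∃ k : ℕ, k < h ∧ row t = i + (k : ZMod N)) → r₁.mult t + r₂.mult t = 0)) →
    S x y r₁ * S y x r₂ = 1
  vertical : ∀ (x y : Finset (Torus p q N)) (r₁ r₂ : Rect p q N),
    IsState Finset.univ Finset.univ x → IsState Finset.univ Finset.univ y →
    r₁.IsFromTo x y → r₂.IsFromTo y x →
    (∃ (j : ZMod N) (h : ℕ), h < N ∧
      (∀ t, (∃ k : ℕ, k < h ∧ col t = j + (k : ZMod N)) → r₁.mult t + r₂.mult t = 1) ∧
      (∀ t, (¬ ∃ k : ℕ, k < h ∧ col t = j + (k : ZMod N)) → r₁.mult t + r₂.mult t = 0)) →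
    S x y r₁ * S y x r₂ = -1

namespace Diagram

variable {O : Finset (Torus p q N)}

/-- The generating set of the complex. -/
def State (D : Diagram p q N O) : Type := {x : Finset (Torus p q N) // IsState D.rows D.cols x}

noncomputable instance [NeZero p] [NeZero N] (D : Diagram p q N O) : Fintype D.State :=
  have : Finite D.State := Subtype.finite
  Fintype.ofFinite _

noncomputable instance (D : Diagram p q N O) : DecidableEq D.State := Classical.decEq _

/-- The chain group: the free module on the states over the polynomial ring with one variable
for each `O`-mark. -/
abbrev CFK (D : Diagram p q N O) (𝕜 : Type) [CommRing 𝕜] : Type := D.State → MvPolynomial O 𝕜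

variable [NeZero p] [NeZero N]

open scoped Classical in
/-- The signed and weighted count of the empty rectangles from `x` to `y` that satisfy `P`. -/
noncomputable def count (𝕜 : Type) [CommRing 𝕜] (S : Signs p q N) (P : Rect p q N → Prop)
    (x y : Finset (Torus p q N)) : MvPolynomial O 𝕜 :=
  ∑ r : Rect p q N,
    if r.IsEmptyFromTo x y ∧ P r then
      MvPolynomial.C (((S x y r : ℤˣ) : ℤ) : 𝕜) *
        ∏ o : O, (MvPolynomial.X o : MvPolynomial O 𝕜) ^ r.mult o.1
    else 0

/-- The differential `∂⁻`. -/
noncomputable def boundary (D : Diagram p q N O) (𝕜 : Type) [CommRing 𝕜] (S : Signs p q N) :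
    D.CFK 𝕜 →ₗ[MvPolynomial O 𝕜] D.CFK 𝕜 :=
  Matrix.mulVecLin (Matrix.of fun y x : D.State =>
    count 𝕜 S (fun r => r.multAt (D.X ∪ D.XX) = 0) x.1 y.1)

end Diagram

/-! ### Homology of an endomorphism of square zero, and reduction modulo an ideal -/

section Algebra

variable {R : Type} [CommRing R] {M : Type} [AddCommGroup M] [Module R M]

/-- `ker d / im d`. -/
abbrev Homology (d : M →ₗ[R] M) : Type :=
  LinearMap.ker d ⧸ (LinearMap.range d).submoduleOf (LinearMap.ker d)

/-- The homology class of a cycle. -/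
def Homology.cls (d : M →ₗ[R] M) (z : M) (hz : d z = 0) : Homology d :=
  Submodule.Quotient.mk ⟨z, LinearMap.mem_ker.2 hz⟩

/-- `M ⊗ R / J`, that is `M / JM`. -/
abbrev Reduction (J : Ideal R) (M : Type) [AddCommGroup M] [Module R M] : Type :=
  M ⧸ (J • ⊤ : Submodule R M)

/-- The endomorphism induced by `d` on `M / JM`. -/
def reduce (J : Ideal R) (d : M →ₗ[R] M) : Reduction J M →ₗ[R] Reduction J M :=
  Submodule.mapQ _ _ d (by
    rw [← Submodule.map_le_iff_le_comap, Submodule.map_smul'']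
    exact Submodule.smul_mono le_rfl le_top)

/-- A spectral sequence of `R`-modules graded by `ℤ`, starting at the first page, with
differentials `d_r : E_r^s → E_r^{s+r}`. -/
abbrev SpecSeq (R : Type) [CommRing R] : Type 1 :=
  SpectralSequence (ModuleCat.{0} R) (fun r : ℤ => ComplexShape.up' (α := ℤ) r) 1

/-- The spectral sequence `E` degenerates at a finite page, and its limit is the associated graded
of a finite decreasing filtration of `H`. -/
def ConvergesTo (E : SpecSeq R) (H : Type) [AddCommGroup H] [Module R H] : Prop :=
  ∃ F : ℤ → Submodule R H, Antitone F ∧ (∃ a, F a = ⊤) ∧ (∃ b, F b = ⊥) ∧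
    ∃ r₀ : ℤ, 1 ≤ r₀ ∧ ∀ (r : ℤ) (hr : 1 ≤ r), r₀ ≤ r →
      (∀ s t : ℤ, (E.page r hr).d s t = 0) ∧
      ∀ s : ℤ, Nonempty ((E.page r hr).X s ≃ₗ[R] (F s ⧸ (F (s + 1)).submoduleOf (F s)))

end Algebra

/-! ### Grid diagrams of singular links, crossings, special diagrams -/

/-- A grid diagram of size `N` for a (possibly singular) link in `L(p,q)`, together with a choice
of the horizontal arcs of the link projection. -/
structure LinkGrid (p : ℕ) (q : ℤ) (N : ℕ) where
  O : Finset (Torus p q N)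
  X : Finset (Torus p q N)
  XX : Finset (Torus p q N)
  disjoint_O_X : Disjoint O X
  disjoint_O_XX : Disjoint O XX
  disjoint_X_XX : Disjoint X XX
  /-- each row is regular (one `O`, one `X`) or singular (two `O`, one `XX`) -/
  row_cond : ∀ i : ZMod N,
    ((X.filter (row · = i)).card = 1 ∧ (XX.filter (row · = i)).card = 0 ∧
      (O.filter (row · = i)).card = 1) ∨
    ((X.filter (row · = i)).card = 0 ∧ (XX.filter (row · = i)).card = 1 ∧
      (O.filter (row · = i)).card = 2)
  /-- each column is regular (one `O`, one `X`) or singular (two `O`, one `XX`) -/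
  col_cond : ∀ j : ZMod N,
    ((X.filter (col · = j)).card = 1 ∧ (XX.filter (col · = j)).card = 0 ∧
      (O.filter (col · = j)).card = 1) ∨
    ((X.filter (col · = j)).card = 0 ∧ (XX.filter (col · = j)).card = 1 ∧
      (O.filter (col · = j)).card = 2)
  /-- whether the horizontal arc that leaves an `O`-mark runs to the right -/
  toRight : O → Bool

namespace LinkGrid

variable (g : LinkGrid p q N)

/-- The cell `t` is in the interior of the vertical arc that runs upwards from the `X` or `XX` in
the column of `o` to `o`. -/
def OnVertical (o : g.O) (t : Torus p q N) : Prop :=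
  ∃ m ∈ g.X ∪ g.XX, ∃ k l : ℕ, 0 < k ∧ k < l ∧ l < p * N ∧ shift m 0 l = o.1 ∧ shift m 0 k = t

/-- The cell `t` is in the interior of the horizontal arc that runs, in the chosen direction, from
`o` to the `X` or `XX` in the row of `o`. -/
def OnHorizontal (o : g.O) (t : Torus p q N) : Prop :=
  ∃ m ∈ g.X ∪ g.XX, ∃ k l : ℕ, 0 < k ∧ k < l ∧ l < p * N ∧
    ((g.toRight o = true ∧ shift o.1 l 0 = m ∧ shift o.1 k 0 = t) ∨
      (g.toRight o = false ∧ shift o.1 (-l) 0 = m ∧ shift o.1 (-k) 0 = t))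

/-- Crossing squares. -/
def IsCrossing (t : Torus p q N) : Prop :=
  (∃ o, g.OnVertical o t) ∧ ∃ o, g.OnHorizontal o t

/-- The set `C(g)` of crossings. -/
def Crossing : Type := {t : Torus p q N // g.IsCrossing t}

noncomputable instance [NeZero p] [NeZero N] : Fintype g.Crossing :=
  have : Finite g.Crossing := Subtype.finite
  Fintype.ofFinite _

noncomputable instance : DecidableEq g.Crossing := Classical.decEq _

variable {g}

/-- The vertical strand is the over-strand and runs upwards, so the crossing is positive if and
only if the horizontal strand runs to the left. -/
def Crossing.Positive (c : g.Crossing) : Prop := ∃ o, g.OnHorizontal o c.1 ∧ g.toRight o = false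

open scoped Classical in
/-- The cell next to the crossing square into which the under-strand runs. -/
noncomputable def Crossing.side (c : g.Crossing) : Torus p q N :=
  if c.Positive then shift c.1 (-1) 0 else shift c.1 1 0

/-- The cell below the crossing square. -/
def Crossing.below (c : g.Crossing) : Torus p q N := shift c.1 0 (-1)

open scoped Classical in
/-- The cell that completes the crossing square, `side` and `below` to a `2 × 2` block. -/
noncomputable def Crossing.opposite (c : g.Crossing) : Torus p q N :=
  if c.Positive then shift c.1 (-1) (-1) else shift c.1 1 (-1)

open scoped Classical in
/-- The crossing corner: the centre of that `2 × 2` block, shared by the cells `side`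
and `below`. -/
noncomputable def Crossing.corner (c : g.Crossing) : Torus p q N :=
  if c.Positive then c.1 else shift c.1 1 0

/-- The cells that carry the `X`-marks of `g` at `c`. -/
noncomputable def Crossing.A (c : g.Crossing) : Finset (Torus p q N) := {c.side, c.below}

/-- The cells that carry the `X`-marks at `c` after smoothing. -/
noncomputable def Crossing.B (c : g.Crossing) : Finset (Torus p q N) := {c.1, c.opposite}

variable (g)

/-- Special grid diagrams. -/
structure IsSpecial : Prop where
  row_inj : ∀ c c' : g.Crossing, row c.1 = row c'.1 → c = c'
  col_inj : ∀ c c' : g.Crossing, col c.1 = col c'.1 → c = c'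
  /-- no two crossing squares share a corner -/
  no_common_corner : ∀ c c' : g.Crossing, c ≠ c' →
    ∀ a b : ℤ, |a| ≤ 1 → |b| ≤ 1 → c'.1 ≠ shift c.1 a b
  /-- each crossing square shares a vertical and a horizontal side with squares marked `X` -/
  adjacent_X : ∀ c : g.Crossing, ∃ a b : ℤ, |a| = 1 ∧ |b| = 1 ∧
    shift c.1 a 0 ∈ g.X ∧ shift c.1 0 b ∈ g.X
  /-- a rectangle with two corners at crossing corners contains an `X` -/
  rect_X : ∀ (r : Rect p q N) (c c' : g.Crossing), r.Embedded → c.corner ≠ c'.corner →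
    c.corner ∈ r.corners → c'.corner ∈ r.corners → ∃ t ∈ g.X, t ∈ r.cells

/-- The standard picture at a crossing: the over-strand starts at an `X` in the square just below
the crossing square, the under-strand ends at another `X` in the square just beside it, and the
remaining square of the `2 × 2` block formed by these three is unmarked (as is the crossing
square). -/
structure IsStandardAt (c : g.Crossing) : Prop where
  side_mem : c.side ∈ g.X
  below_mem : c.below ∈ g.X
  side_ne_below : c.side ≠ c.below
  opposite_unmarked : c.opposite ∉ g.O ∪ g.X ∪ g.XX

/-- From the mark `m` the link runs through an `O`-mark in the column of `m` to the mark `m'`. -/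
def Next (m m' : Torus p q N) : Prop :=
  m' ∈ g.X ∪ g.XX ∧ ∃ o ∈ g.O, col o = col m ∧ row o = row m'

/-- Following the link from any `X` beside a crossing square one meets an `X` or `XX` that is not
beside a crossing square. -/
def HasFreeMarks : Prop :=
  ∀ (c : g.Crossing), ∀ m ∈ c.A, ∃ m' ∈ g.X ∪ g.XX,
    (∀ c' : g.Crossing, m' ∉ c'.A) ∧ Relation.ReflTransGen g.Next m m'

/-! ### Complete resolutions -/

/-- The grid diagram itself, with all `α`- and `β`-curves. -/
def toDiagram [NeZero N] : Diagram p q N g.O where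
  rows := Finset.univ
  cols := Finset.univ
  X := g.X
  XX := g.XX

/-- A complete resolution chooses the `0`-resolution (`false`) or the `1`-resolution (`true`) of
each crossing. -/
abbrev Resolution : Type := g.Crossing → Bool

variable {g}

/-- The `0`-resolution of a positive crossing and the `1`-resolution of a negative crossing are the
singularization; the other resolutions are the smoothing. -/
def Resolution.Singular (I : g.Resolution) (c : g.Crossing) : Prop :=
  (c.Positive ∧ I c = false) ∨ (¬ c.Positive ∧ I c = true)

variable [NeZero p] [NeZero N]

open scoped Classical in
/-- The crossings that are singularized in `I`. -/
noncomputable def Resolution.sing (I : g.Resolution) : Finset g.Crossing :=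
  Finset.univ.filter fun c => I.Singular c

open scoped Classical in
/-- The crossings that are smoothed in `I`. -/
noncomputable def Resolution.smooth (I : g.Resolution) : Finset g.Crossing :=
  Finset.univ.filter fun c => ¬ I.Singular c

/-- The grid diagram `g_I`: at a smoothed crossing the two `X` move to the other diagonal of the
`2 × 2` block; at a singularized crossing the two columns and the two rows of the block are merged
and the two `X` are replaced by one `XX` in the merged cell. -/
noncomputable def Resolution.diagram (I : g.Resolution) : Diagram p q N g.O where
  rows := Finset.univ \ I.sing.image fun c => row c.corner
  cols := Finset.univ \ I.sing.image fun c => col c.corner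
  X := (g.X \ Finset.univ.biUnion fun c : g.Crossing => c.A) ∪ I.smooth.biUnion fun c => c.B
  XX := g.XX ∪ I.sing.image fun c => c.1

/-- The signs on `g_I` induced by signs `S` on `g`: a state of `g_I` becomes a state of `g` when the
crossing corners of the singularized crossings are added. -/
noncomputable def Resolution.signs (I : g.Resolution) (S : Signs p q N) : Signs p q N :=
  fun x y r => S (x ∪ I.sing.image fun c => c.corner) (y ∪ I.sing.image fun c => c.corner) r

/-- The number of crossings with the `1`-resolution. -/
noncomputable def Resolution.deg (I : g.Resolution) : ℕ := (Finset.univ.filter fun c => I c = true).card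

/-- Change the resolution at `c` from `0` to `1`. -/
noncomputable def Resolution.flip (I : g.Resolution) (c : g.Crossing) : g.Resolution :=
  Function.update I c true

theorem Resolution.deg_flip (I : g.Resolution) (c : g.Crossing) (hc : I c = false) :
    (I.flip c).deg = I.deg + 1 := by
  classical
  have h : (Finset.univ.filter fun c' => I.flip c c' = true)
      = insert c (Finset.univ.filter fun c' => I c' = true) := by
    ext c'
    rw [Finset.mem_insert, Finset.mem_filter, Finset.mem_filter]
    by_cases h : c' = c
    · subst h; simp [flip]
    · simp [flip, h]
  rw [deg, h, Finset.card_insert_of_notMem (by rw [Finset.mem_filter]; simp [hc]), deg]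

/-- `u^{(c)} = U_a + U_b - U_c - U_d`: the sum of the variables of the `O`-marks in the columns of
the two `X` at `c`, minus the sum of the variables of the `O`-marks in their rows. -/
noncomputable def Crossing.u (c : g.Crossing) (𝕜 : Type) [CommRing 𝕜] : MvPolynomial g.O 𝕜 :=
  ∑ o ∈ Finset.univ.filter (fun o : g.O => col o.1 = col c.side ∨ col o.1 = col c.below),
      MvPolynomial.X o -
    ∑ o ∈ Finset.univ.filter (fun o : g.O => row o.1 = row c.side ∨ row o.1 = row c.below),
      MvPolynomial.X o

namespace Resolution

variable (I : g.Resolution) (𝕜 : Type) [CommRing 𝕜] (S : Signs p q N)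

/-- The ideal generated by the `u^{(c)}`, `c` a singularized crossing. -/
noncomputable def ideal : Ideal (MvPolynomial g.O 𝕜) :=
  Ideal.span ((fun c : g.Crossing => c.u 𝕜) '' {c | I.Singular c})

/-- The differential of `g_I`. -/
noncomputable def boundary : I.diagram.CFK 𝕜 →ₗ[MvPolynomial g.O 𝕜] I.diagram.CFK 𝕜 :=
  I.diagram.boundary 𝕜 (I.signs S)

/-- The chain group `CFK⁻(g_I) ⊗ ⨂ R / u^{(c)}`, over the singularized crossings `c`. -/
abbrev Chain : Type := Reduction (I.ideal 𝕜) (I.diagram.CFK 𝕜)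

/-- The image of a chain of `CFK⁻(g_I)`. -/
noncomputable def mk (v : I.diagram.CFK 𝕜) : I.Chain 𝕜 := Submodule.Quotient.mk v

/-- The differential of `CFK⁻(g_I) ⊗ ⨂ R / u^{(c)}`. -/
noncomputable def dif : I.Chain 𝕜 →ₗ[MvPolynomial g.O 𝕜] I.Chain 𝕜 :=
  reduce (I.ideal 𝕜) (I.boundary 𝕜 S)

/-- `V(g_I)`. -/
abbrev V : Type := Homology (I.dif 𝕜 S)

/-- `Φ_B` at `c`, on a diagram in which `c` is smoothed: the count of the empty rectangles that
contain exactly one of the two `X` at `c`, no other `X` or `XX`, and that run between a state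
containing the crossing corner of `c` and one not containing it. -/
noncomputable def phiB (c : g.Crossing) :
    I.diagram.CFK 𝕜 →ₗ[MvPolynomial g.O 𝕜] I.diagram.CFK 𝕜 :=
  open scoped Classical in
  Matrix.mulVecLin (Matrix.of fun y x : I.diagram.State =>
    if (c.corner ∈ x.1 ∧ c.corner ∉ y.1) ∨ (c.corner ∉ x.1 ∧ c.corner ∈ y.1) then
      Diagram.count 𝕜 (I.signs S)
        (fun r => r.multAt c.B = 1 ∧ r.multAt ((I.diagram.X ∪ I.diagram.XX) \ c.B) = 0) x.1 y.1
    else 0)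

/-- For resolutions `I` and `K` that agree except that `c` is singularized in `I` and smoothed in
`K`, the map `CFK⁻(g_I) → CFK⁻(g_K)` that adds the crossing corner of `c` to each state. -/
noncomputable def addCorner (K : g.Resolution) (c : g.Crossing) :
    I.diagram.CFK 𝕜 →ₗ[MvPolynomial g.O 𝕜] K.diagram.CFK 𝕜 :=
  Matrix.mulVecLin (Matrix.of fun (y : K.diagram.State) (x : I.diagram.State) =>
    if y.1 = insert c.corner x.1 then 1 else 0)

/-- For resolutions `I` and `K` that agree except that `c` is smoothed in `I` and singularized in
`K`, the map `CFK⁻(g_I) → CFK⁻(g_K)` that removes the crossing corner of `c` from each state that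
contains it and kills the other states. -/
noncomputable def removeCorner (K : g.Resolution) (c : g.Crossing) :
    I.diagram.CFK 𝕜 →ₗ[MvPolynomial g.O 𝕜] K.diagram.CFK 𝕜 :=
  Matrix.mulVecLin (Matrix.of fun (y : K.diagram.State) (x : I.diagram.State) =>
    if x.1 = insert c.corner y.1 then 1 else 0)

/-- The zip homomorphism at a negative crossing `c` with `I c = 0`: it is induced by the
chain-level map `Φ_B`, followed by the identification of the states that contain the crossing
corner with the states of the singularized diagram. -/
def IsZip (c : g.Crossing)
    (f : I.V 𝕜 S →ₗ[MvPolynomial g.O 𝕜] (I.flip c).V 𝕜 S) : Prop :=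
  ∀ (v : I.diagram.CFK 𝕜) (hv : I.dif 𝕜 S (I.mk 𝕜 v) = 0),
    ∃ hv' : (I.flip c).dif 𝕜 S
        ((I.flip c).mk 𝕜 (I.removeCorner 𝕜 (I.flip c) c (I.phiB 𝕜 S c v))) = 0,
      f (Homology.cls _ (I.mk 𝕜 v) hv) = Homology.cls _ _ hv'

/-- The unzip homomorphism at a positive crossing `c` with `I c = 0`. The complex of `g_I` reduced
modulo `u^{(c)}` is replaced by the mapping cone of `u^{(c)}`: a cycle `w` of the former lifts to a
pair `(z, w)` with `∂ w = u^{(c)} z` modulo the other `u`'s, and the pair is sent to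
`w + Φ_B z`, both terms being regarded as chains of `g_K`, `K` the resolution with `c` smoothed. -/
def IsUnzip (c : g.Crossing)
    (f : I.V 𝕜 S →ₗ[MvPolynomial g.O 𝕜] (I.flip c).V 𝕜 S) : Prop :=
  ∀ (w z : I.diagram.CFK 𝕜) (hw : I.dif 𝕜 S (I.mk 𝕜 w) = 0),
    I.boundary 𝕜 S w - c.u 𝕜 • z ∈
        ((I.flip c).ideal 𝕜 • ⊤ : Submodule (MvPolynomial g.O 𝕜) (I.diagram.CFK 𝕜)) →
    ∃ hw' : (I.flip c).dif 𝕜 S ((I.flip c).mk 𝕜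
        (I.addCorner 𝕜 (I.flip c) c w +
          (I.flip c).phiB 𝕜 S c (I.addCorner 𝕜 (I.flip c) c z))) = 0,
      f (Homology.cls _ (I.mk 𝕜 w) hw) = Homology.cls _ _ hw'

/-- `f` is the edge homomorphism of the cube from `I` to `I.flip c`. -/
def IsEdge (c : g.Crossing)
    (f : I.V 𝕜 S →ₗ[MvPolynomial g.O 𝕜] (I.flip c).V 𝕜 S) : Prop :=
  (c.Positive → I.IsUnzip 𝕜 S c f) ∧ (¬ c.Positive → I.IsZip 𝕜 S c f)

end Resolution

variable (g)

/-- The part of `V(g)` in cube degree `s`. -/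
abbrev Cube (𝕜 : Type) [CommRing 𝕜] (S : Signs p q N) (s : ℤ) : Type :=
  ⨁ I : {I : g.Resolution // (I.deg : ℤ) = s}, I.1.V 𝕜 S

open scoped Classical in
/-- The inclusion of the summand `V(g_I)`. -/
noncomputable def cubeOf (𝕜 : Type) [CommRing 𝕜] (S : Signs p q N) (s : ℤ) (I : g.Resolution)
    (hI : (I.deg : ℤ) = s) : I.V 𝕜 S →ₗ[MvPolynomial g.O 𝕜] g.Cube 𝕜 S s :=
  DirectSum.lof (MvPolynomial g.O 𝕜) {I : g.Resolution // (I.deg : ℤ) = s}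
    (fun I => I.1.V 𝕜 S) ⟨I, hI⟩

/-- `HFK⁻(g)`. -/
abbrev HFK (𝕜 : Type) [CommRing 𝕜] (S : Signs p q N) : Type :=
  Homology (g.toDiagram.boundary 𝕜 S)

/-- The complexes of `g` and of all its complete resolutions are chain complexes, the zip and unzip
homomorphisms are defined on homology, and there is a spectral sequence of modules over
`𝕜[U_O]` whose first page is `V(g)`, graded by the cube degree, with `d_1` the sum of
the zip and unzip homomorphisms up to signs, and which converges to `HFK⁻(g)`. -/
def HasResolutionSpectralSequence (𝕜 : Type) [CommRing 𝕜] (S : Signs p q N) : Prop :=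
  g.toDiagram.boundary 𝕜 S ∘ₗ g.toDiagram.boundary 𝕜 S = 0 ∧
  (∀ I : g.Resolution, I.boundary 𝕜 S ∘ₗ I.boundary 𝕜 S = 0) ∧
  ∃ f : ∀ (I : g.Resolution) (c : g.Crossing),
      I.V 𝕜 S →ₗ[MvPolynomial g.O 𝕜] (I.flip c).V 𝕜 S,
    (∀ (I : g.Resolution) (c : g.Crossing), I c = false → I.IsEdge 𝕜 S c (f I c)) ∧
    ∃ (E : SpecSeq (MvPolynomial g.O 𝕜))
      (φ : ∀ s : ℤ, (E.page 1).X s ≃ₗ[MvPolynomial g.O 𝕜] g.Cube 𝕜 S s)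
      (σ : g.Resolution → g.Crossing → ℤˣ),
      (∀ (s : ℤ) (I : g.Resolution) (hI : (I.deg : ℤ) = s) (v : I.V 𝕜 S),
        φ (s + 1) ((E.page 1).d s (s + 1) ((φ s).symm (g.cubeOf 𝕜 S s I hI v))) =
          ∑ c : {c : g.Crossing // I c = false},
            ((σ I c.1 : ℤˣ) : ℤ) • g.cubeOf 𝕜 S (s + 1) (I.flip c.1)
              (by rw [I.deg_flip c.1 c.2]; push_cast; rw [hI]) (f I c.1 v)) ∧
      ConvergesTo E (g.HFK 𝕜 S)

end LinkGrid

end LensGrid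

/-!
The theorem is proved by building one filtered complex `T` over `R` whose associated graded
complex computes `V(g)` and whose homology is `HFK⁻(g)`.

A generator of `T` (`Dec`) is a state of the full ruling together with a label for each crossing:
`away` if the state avoids the crossing corner, and one of `p₀`, `p₁`, `p₂` if it contains it. The
differential `totalD` has two parts. `rectD` counts the empty rectangles without free marks; a
rectangle may cover at most one cell of the block at a crossing corner, and one cell exactly when
the label changes `p₀ → away` or `away → p₂`. The maps `koszul` are the arrows `p₀ → p₁ → p₂` at
a crossing, with coefficients `u, 1` at a positive and `1, u` at a negative crossing.

* *The square of the differential.* Lifting rectangles to the plane reduces the cancellation of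
  pairs of consecutive rectangles to a statement about a lattice (`exists_alt`, `exists_commute`,
  `Alt.unique`). On the torus only the annuli survive (`sum_pairs`), and those without free marks
  pass through a mark of a crossing; they add up to `-u` from `p₀` to `p₂`, which the square of
  the arrows cancels (`rectD_sq`, `totalD_sq`).
* *The first page.* A label belongs to a resolution of its crossing: `p₀, p₁` to the `0`- and
  `p₂, away` to the `1`-resolution of a positive, `p₀, away` to the `0`- and `p₁, p₂` to the
  `1`-resolution of a negative crossing. The differential never decreases the cube degree. A piece
  of the associated graded complex is the iterated mapping cone of the `u^{(c)}` of the singularized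
  crossings on `CFK⁻(g_I)`. As every crossing leads to a free mark, the linear forms `u^{(c)}` have
  triangular pivots, hence are a regular sequence (`u_regular`), and the cone computes `V(g_I)`
  (`exists_blockD_eq`, `pageMap_surjective`, `pageMap_eq_zero_iff`). The components of the
  differential that change one resolution are the zip and unzip maps (`zip_component`,
  `unzip_component`, `edgeMap_isEdge`, `map_cubeOf`).
* *The limit.* The arrows with coefficient `1` can be cancelled. What remains are the states with
  the labels `p₀, away` at positive and `p₂, away` at negative crossings, that is, `CFK⁻(g)`
  (`exists_sub_mem_goodChains`, `exists_totalD_eq_of_good`, `exists_totalD_homology_map`).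

The spectral sequence of the bounded filtration of `T` by cube degree (`specSeq`, `convergesTo`)
is then the one asserted.
-/

set_option linter.unusedSectionVars false

noncomputable section

namespace LensGrid

/-! ### Rectangles in the plane, modulo a lattice -/

namespace Planar

/-- `L` is (the membership predicate of) a subgroup of `ℤ × ℤ`. -/
structure IsLat (L : ℤ → ℤ → Prop) : Prop where
  zero : L 0 0
  add : ∀ {i j k l}, L i j → L k l → L (i + k) (j + l)
  neg : ∀ {i j}, L i j → L (-i) (-j)

/-- `P` is the preimage in `ℤ × ℤ` of a set of points of the torus `ℤ × ℤ / L` with exactly one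
point on each horizontal and one on each vertical curve. -/
structure IsSt (L P : ℤ → ℤ → Prop) : Prop where
  inv : ∀ {i j k l}, P i j → L k l → P (i + k) (j + l)
  row : ∀ {i i' j}, P i j → P i' j → L (i' - i) 0
  col : ∀ {i j j'}, P i j → P i j' → L 0 (j' - j)
  rowex : ∀ j, ∃ i, P i j
  colex : ∀ i, ∃ j, P i j

/-- The closed rectangle with lower left corner `(a, b)` meets `P` at most in its lower left and
upper right corners. -/
def Emp (P : ℤ → ℤ → Prop) (a b w h : ℤ) : Prop :=
  ∀ i j, P i j → a ≤ i → i ≤ a + w → b ≤ j → j ≤ b + h →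
    (i = a ∧ j = b) ∨ (i = a + w ∧ j = b + h)

/-- A closed `w × h` rectangle is embedded in the torus. -/
def Emb (L : ℤ → ℤ → Prop) (w h : ℤ) : Prop :=
  ∀ i j, L i j → -w ≤ i → i ≤ w → -h ≤ j → j ≤ h → i = 0 ∧ j = 0

/-- The rectangle with lower left corner `(a, b)`, width `w` and height `h` is an empty embedded
rectangle from `P` to `Q`. -/
structure Step (L P Q : ℤ → ℤ → Prop) (a b w h : ℤ) : Prop where
  hw : 0 < w
  hh : 0 < h
  sw : P a b
  ne : P (a + w) (b + h)
  emp : Emp P a b w h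
  emb : Emb L w h
  se : Q (a + w) b
  nw : Q a (b + h)
  rest : ∀ i j, P i j → Q i j ∨ L (i - a) (j - b) ∨ L (i - (a + w)) (j - (b + h))

section

variable {L P Q W Y Z : ℤ → ℤ → Prop} {a b w h c d w' h' : ℤ}

theorem IsLat.of (_ : IsLat L) {i j i' j' : ℤ} (h : L i j) (e₁ : i' = i := by omega)
    (e₂ : j' = j := by omega) : L i' j' := by
  subst e₁ e₂; exact h

theorem IsLat.neg' (hL : IsLat L) {i j i' j' : ℤ} (h : L i j) (e₁ : i' = -i := by omega)
    (e₂ : j' = -j := by omega) : L i' j' := by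
  subst e₁ e₂; exact hL.neg h

theorem IsLat.add' (hL : IsLat L) {i j k l i' j' : ℤ} (h : L i j) (h' : L k l)
    (e₁ : i' = i + k := by omega) (e₂ : j' = j + l := by omega) : L i' j' := by
  subst e₁ e₂; exact hL.add h h'

theorem IsLat.sub' (hL : IsLat L) {i j k l i' j' : ℤ} (h : L i j) (h' : L k l)
    (e₁ : i' = i - k := by omega) (e₂ : j' = j - l := by omega) : L i' j' :=
  hL.add' h (hL.neg h')

theorem IsLat.smul (hL : IsLat L) {i j : ℤ} (h : L i j) (m : ℤ) : L (m * i) (m * j) := by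
  induction m using Int.induction_on with
  | zero => simpa using hL.zero
  | succ m ih => exact hL.add' ih h (by ring) (by ring)
  | pred m ih => exact hL.sub' ih h (by ring) (by ring)

theorem IsSt.tr (hP : IsSt L P) {i j k l i' j' : ℤ} (h : P i j) (hl : L k l)
    (e₁ : i' = i + k := by omega) (e₂ : j' = j + l := by omega) : P i' j' := by
  subst e₁ e₂; exact hP.inv h hl

theorem IsSt.trn (hL : IsLat L) (hP : IsSt L P) {i j k l i' j' : ℤ} (h : P i j) (hl : L k l)
    (e₁ : i' = i - k := by omega) (e₂ : j' = j - l := by omega) : P i' j' :=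
  hP.tr h (hL.neg hl)

theorem IsSt.row' (hP : IsSt L P) {i j i' j' k l : ℤ} (h : P i j) (h' : P i' j')
    (e : j = j' := by omega) (ek : k = i' - i := by omega) (el : l = 0 := by omega) : L k l := by
  subst e ek el; exact hP.row h h'

theorem IsSt.col' (hP : IsSt L P) {i j i' j' k l : ℤ} (h : P i j) (h' : P i' j')
    (e : i = i' := by omega) (ek : k = 0 := by omega) (el : l = j' - j := by omega) : L k l := by
  subst e ek el; exact hP.col h h'

theorem Emb.apply (h : Emb L w h') {i j : ℤ} (hl : L i j) (h₁ : -w ≤ i := by omega)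
    (h₂ : i ≤ w := by omega) (h₃ : -h' ≤ j := by omega) (h₄ : j ≤ h' := by omega) :
    i = 0 ∧ j = 0 := h i j hl h₁ h₂ h₃ h₄

theorem Emp.apply (h : Emp P a b w h') {i j : ℤ} (hp : P i j) (h₁ : a ≤ i := by omega)
    (h₂ : i ≤ a + w := by omega) (h₃ : b ≤ j := by omega) (h₄ : j ≤ b + h' := by omega) :
    (i = a ∧ j = b) ∨ (i = a + w ∧ j = b + h') := h i j hp h₁ h₂ h₃ h₄

/-- An embedding criterion in which only lattice vectors pointing to the right are tested. -/
theorem Emb.of_pos (hL : IsLat L)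
    (H : ∀ i j, L i j → 0 ≤ i → i ≤ w → -h ≤ j → j ≤ h → i = 0 ∧ j = 0) : Emb L w h := by
  intro i j hl h₁ h₂ h₃ h₄
  rcases le_total 0 i with hi | hi
  · exact H i j hl hi h₂ h₃ h₄
  · have := H (-i) (-j) (hL.neg hl) (by omega) (by omega) (by omega) (by omega)
    omega

theorem Step.back (hL : IsLat L) (hP : IsSt L P) (hQ : IsSt L Q) (s : Step L P Q a b w h)
    {i j : ℤ} (hq : Q i j) :
    (P i j ∧ ¬ L (i - a) (j - b) ∧ ¬ L (i - (a + w)) (j - (b + h))) ∨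
      L (i - (a + w)) (j - b) ∨ L (i - a) (j - (b + h)) := by
  have hw := s.hw
  have hh := s.hh
  have n₁ : ¬ L (i - a) (j - b) := fun hl => by
    have := s.emb.apply (hQ.row' (hQ.trn hL hq hl (i' := a) (j' := b)) s.se rfl
      (k := w) (by omega) rfl)
    omega
  have n₂ : ¬ L (i - (a + w)) (j - (b + h)) := fun hl => by
    have := s.emb.apply (hQ.row' (hQ.trn hL hq hl (i' := a + w) (j' := b + h))
      s.nw rfl (k := -w) (by omega) rfl)
    omega
  obtain ⟨i', hp⟩ := hP.rowex j
  rcases s.rest _ _ hp with hq' | hl | hl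
  · exact Or.inl ⟨hP.tr hp (hQ.row hq' hq), n₁, n₂⟩
  · right; left
    have : Q (i' + w) j := hQ.tr s.se hl
    exact hL.add' (hQ.row this hq) hl
  · right; right
    have : Q (i' - w) j := hQ.tr s.nw hl
    exact hL.add' (hQ.row this hq) hl

/-- The target state of an empty rectangle meets the closed rectangle only in the other two
corners. -/
theorem Step.qemp (hL : IsLat L) (hP : IsSt L P) (hQ : IsSt L Q) (s : Step L P Q a b w h)
    {i j : ℤ} (hq : Q i j) (h₁ : a ≤ i) (h₂ : i ≤ a + w) (h₃ : b ≤ j) (h₄ : j ≤ b + h) :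
    (i = a + w ∧ j = b) ∨ (i = a ∧ j = b + h) := by
  rcases s.back hL hP hQ hq with ⟨hp, n₁, n₂⟩ | hl | hl
  · rcases s.emp _ _ hp h₁ h₂ h₃ h₄ with ⟨rfl, rfl⟩ | ⟨rfl, rfl⟩
    · exact (n₁ (hL.of hL.zero)).elim
    · exact (n₂ (hL.of hL.zero)).elim
  · have := s.emb.apply hl
    omega
  · have := s.emb.apply hl
    omega

theorem Step.translate (hL : IsLat L) (hP : IsSt L P) (hQ : IsSt L Q) (s : Step L P Q a b w h)
    {k l a' b' : ℤ} (hl : L k l) (ea : a' = a + k) (eb : b' = b + l) : Step L P Q a' b' w h := by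
  subst ea eb
  refine ⟨s.hw, s.hh, hP.inv s.sw hl, hP.tr s.ne hl, ?_, s.emb,
    hQ.tr s.se hl, hQ.tr s.nw hl, ?_⟩
  · intro i j hp h₁ h₂ h₃ h₄
    have := s.emp (i - k) (j - l) (hP.trn hL hp hl rfl rfl) (by omega) (by omega) (by omega)
      (by omega)
    omega
  · intro i j hp
    rcases s.rest i j hp with h | h | h
    · exact Or.inl h
    · exact Or.inr (Or.inl (hL.sub' h hl))
    · exact Or.inr (Or.inr (hL.sub' h hl))

/-- Every embedded rectangle with two corners in `P` and otherwise disjoint from `P` is a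
rectangle to some state. -/
theorem exists_step (hL : IsLat L) (hP : IsSt L P) (hw : 0 < w) (hh : 0 < h) (sw : P a b)
    (ne : P (a + w) (b + h)) (emp : Emp P a b w h) (emb : Emb L w h) :
    ∃ Q, IsSt L Q ∧ Step L P Q a b w h := by
  have nab : ¬ L w h := fun hl => by
    have := emb _ _ hl (by omega) (by omega) (by omega) (by omega)
    omega
  refine ⟨fun i j => (P i j ∧ ¬ L (i - a) (j - b) ∧ ¬ L (i - (a + w)) (j - (b + h))) ∨
      L (i - (a + w)) (j - b) ∨ L (i - a) (j - (b + h)), ⟨?_, ?_, ?_, ?_, ?_⟩,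
    ⟨hw, hh, sw, ne, emp, emb, ?_, ?_, ?_⟩⟩
  · rintro i j k l (⟨hp, n₁, n₂⟩ | hq | hq) hl
    · exact Or.inl ⟨hP.inv hp hl, fun h => n₁ (hL.sub' h hl),
        fun h => n₂ (hL.sub' h hl)⟩
    · exact Or.inr (Or.inl (hL.add' hq hl))
    · exact Or.inr (Or.inr (hL.add' hq hl))
  · rintro i i' j (⟨hp, n₁, n₂⟩ | hq | hq) (⟨hp', n₁', n₂'⟩ | hq' | hq')
    · exact hP.row hp hp'
    · have := hP.tr sw hq' (i' := i' - w) (j' := j)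
      exact (n₁ (hL.add' (hP.row this hp) hq')).elim
    · have := hP.tr ne hq' (i' := i' + w) (j' := j)
      exact (n₂ (hL.add' (hP.row this hp) hq')).elim
    · have := hP.tr sw hq (i' := i - w) (j' := j)
      exact (n₁' (hL.add' (hP.row this hp') hq)).elim
    · exact hL.sub' hq' hq
    · have h₁ := hP.tr sw hq (i' := i - w) (j' := j)
      have h₂ := hP.tr ne hq' (i' := i' + w) (j' := j)
      refine (nab ?_).elim
      have h₃ := hL.sub' hq hq' (i' := i - i' - w) (j' := h)
      exact hL.add' h₃ (hP.row h₁ h₂)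
    · have := hP.tr ne hq (i' := i + w) (j' := j)
      exact (n₂' (hL.add' (hP.row this hp') hq)).elim
    · have h₁ := hP.tr sw hq' (i' := i' - w) (j' := j)
      have h₂ := hP.tr ne hq (i' := i + w) (j' := j)
      refine (nab ?_).elim
      have h₃ := hL.sub' hq' hq (i' := i' - i - w) (j' := h)
      exact hL.add' h₃ (hP.row h₁ h₂)
    · exact hL.sub' hq' hq
  · rintro i j j' (⟨hp, n₁, n₂⟩ | hq | hq) (⟨hp', n₁', n₂'⟩ | hq' | hq')
    · exact hP.col hp hp'
    · have := hP.tr ne hq' (i' := i) (j' := j' + h)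
      exact (n₂ (hL.add' (hP.col this hp) hq')).elim
    · have := hP.tr sw hq' (i' := i) (j' := j' - h)
      exact (n₁ (hL.add' (hP.col this hp) hq')).elim
    · have := hP.tr ne hq (i' := i) (j' := j + h)
      exact (n₂' (hL.add' (hP.col this hp') hq)).elim
    · exact hL.sub' hq' hq
    · have h₁ := hP.tr ne hq (i' := i) (j' := j + h)
      have h₂ := hP.tr sw hq' (i' := i) (j' := j' - h)
      refine (nab ?_).elim
      have h₃ := hL.sub' hq' hq (i' := w) (j' := j' - j - h)
      exact hL.sub' h₃ (hP.col h₁ h₂)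
    · have := hP.tr sw hq (i' := i) (j' := j - h)
      exact (n₁' (hL.add' (hP.col this hp') hq)).elim
    · have h₁ := hP.tr sw hq (i' := i) (j' := j - h)
      have h₂ := hP.tr ne hq' (i' := i) (j' := j' + h)
      refine (nab ?_).elim
      have h₃ := hL.sub' hq hq' (i' := w) (j' := j - j' - h)
      exact hL.add' h₃ (hP.col h₁ h₂)
    · exact hL.sub' hq' hq
  · intro j
    obtain ⟨i, hp⟩ := hP.rowex j
    by_cases h₁ : L (i - a) (j - b)
    · exact ⟨i + w, Or.inr (Or.inl (hL.of h₁))⟩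
    by_cases h₂ : L (i - (a + w)) (j - (b + h))
    · exact ⟨i - w, Or.inr (Or.inr (hL.of h₂))⟩
    exact ⟨i, Or.inl ⟨hp, h₁, h₂⟩⟩
  · intro i
    obtain ⟨j, hp⟩ := hP.colex i
    by_cases h₁ : L (i - a) (j - b)
    · exact ⟨j + h, Or.inr (Or.inr (hL.of h₁))⟩
    by_cases h₂ : L (i - (a + w)) (j - (b + h))
    · exact ⟨j - h, Or.inr (Or.inl (hL.of h₂))⟩
    exact ⟨j, Or.inl ⟨hp, h₁, h₂⟩⟩
  · exact Or.inr (Or.inl (hL.of hL.zero))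
  · exact Or.inr (Or.inr (hL.of hL.zero))
  · intro i j hp
    by_cases h₁ : L (i - a) (j - b)
    · exact Or.inr (Or.inl h₁)
    by_cases h₂ : L (i - (a + w)) (j - (b + h))
    · exact Or.inr (Or.inr h₂)
    exact Or.inl (Or.inl ⟨hp, h₁, h₂⟩)

/-! ### Symmetries -/

theorem IsLat.transpose (hL : IsLat L) : IsLat (fun i j => L j i) :=
  ⟨hL.zero, fun h h' => hL.add h h', fun h => hL.neg h⟩

theorem IsLat.reflect (hL : IsLat L) : IsLat (fun i j => L (-i) j) :=
  ⟨hL.of hL.zero (by omega) rfl, fun h h' => hL.add' h h',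
    fun h => hL.neg' h⟩

theorem IsSt.transpose (hP : IsSt L P) : IsSt (fun i j => L j i) (fun i j => P j i) :=
  ⟨fun h h' => hP.inv h h', fun h h' => hP.col h h', fun h h' => hP.row h h', hP.colex, hP.rowex⟩

theorem IsSt.reflect (hL : IsLat L) (hP : IsSt L P) :
    IsSt (fun i j => L (-i) j) (fun i j => P (-i) j) :=
  ⟨fun h h' => hP.tr h h',
    fun h h' => hL.of (hP.row h h'),
    fun h h' => hL.of (hP.col h h'),
    fun j => let ⟨i, hi⟩ := hP.rowex j; ⟨-i, by simpa using hi⟩, fun i => hP.colex (-i)⟩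

theorem IsSt.rotate (hL : IsLat L) (hP : IsSt L P) :
    IsSt (fun i j => L (-i) (-j)) (fun i j => P (-i) (-j)) :=
  ⟨fun h h' => hP.tr h h',
    fun h h' => hL.of (hP.row h h'),
    fun h h' => hL.of (hP.col h h'),
    fun j => let ⟨i, hi⟩ := hP.rowex (-j); ⟨-i, by simpa using hi⟩,
    fun i => let ⟨j, hj⟩ := hP.colex (-i); ⟨-j, by simpa using hj⟩⟩

theorem cast2 {P : ℤ → ℤ → Prop} {i j i' j' : ℤ} (h : P i j) (e₁ : i' = i) (e₂ : j' = j) :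
    P i' j' := by
  subst e₁ e₂; exact h

theorem Step.transpose (s : Step L P Q a b w h) :
    Step (fun i j => L j i) (fun i j => P j i) (fun i j => Q j i) b a h w :=
  ⟨s.hh, s.hw, s.sw, s.ne, fun i j hp h₁ h₂ h₃ h₄ => by
    have := s.emp j i hp h₃ h₄ h₁ h₂
    omega, fun i j hl h₁ h₂ h₃ h₄ => by
    have := s.emb j i hl h₃ h₄ h₁ h₂
    omega, s.nw, s.se, fun i j hp => s.rest j i hp⟩

/-- Reflecting in a vertical line reverses the direction of rectangles. -/
theorem Step.reflect (hL : IsLat L) (hP : IsSt L P) (hQ : IsSt L Q) (s : Step L P Q a b w h)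
    {a' : ℤ} (ea : a' = -a - w) :
    Step (fun i j => L (-i) j) (fun i j => Q (-i) j) (fun i j => P (-i) j) a' b w h := by
  subst ea
  refine ⟨s.hw, s.hh, cast2 s.se (by omega) rfl, cast2 s.nw (by omega) rfl, ?_, ?_,
    cast2 s.sw (by omega) rfl, cast2 s.ne (by omega) rfl, ?_⟩
  · intro i j hp h₁ h₂ h₃ h₄
    have := s.qemp hL hP hQ hp (by omega) (by omega) h₃ h₄
    omega
  · intro i j hl h₁ h₂ h₃ h₄
    have := s.emb _ _ hl (by omega) (by omega) h₃ h₄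
    omega
  · intro i j hq
    rcases s.back hL hP hQ hq with ⟨hp, -, -⟩ | hl | hl
    · exact Or.inl hp
    · exact Or.inr (Or.inl (cast2 hl (by omega) rfl))
    · exact Or.inr (Or.inr (cast2 hl (by omega) rfl))

theorem Step.rotate (s : Step L P Q a b w h)
    {a' b' : ℤ} (ea : a' = -a - w) (eb : b' = -b - h) :
    Step (fun i j => L (-i) (-j)) (fun i j => P (-i) (-j)) (fun i j => Q (-i) (-j)) a' b' w h := by
  subst ea eb
  refine ⟨s.hw, s.hh, cast2 s.ne (by omega) (by omega), cast2 s.sw (by omega) (by omega), ?_, ?_,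
    cast2 s.nw (by omega) (by omega), cast2 s.se (by omega) (by omega), ?_⟩
  · intro i j hp h₁ h₂ h₃ h₄
    have := s.emp.apply hp
    omega
  · intro i j hl h₁ h₂ h₃ h₄
    have := s.emb.apply hl
    omega
  · intro i j hq
    rcases s.rest _ _ hq with hp | hl | hl
    · exact Or.inl hp
    · exact Or.inr (Or.inr (cast2 hl (by omega) (by omega)))
    · exact Or.inr (Or.inl (cast2 hl (by omega) (by omega)))

/-- A rectangle can be recognized from its target state. -/
theorem Step.of_target (hP : IsSt L P)
    (hw : 0 < w) (hh : 0 < h) (sw : P a b) (ne : P (a + w) (b + h))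
    (emp : ∀ i j, Q i j → a ≤ i → i ≤ a + w → b ≤ j → j ≤ b + h →
      (i = a + w ∧ j = b) ∨ (i = a ∧ j = b + h))
    (emb : Emb L w h) (se : Q (a + w) b) (nw : Q a (b + h))
    (rest : ∀ i j, P i j → Q i j ∨ L (i - a) (j - b) ∨ L (i - (a + w)) (j - (b + h))) :
    Step L P Q a b w h := by
  refine ⟨hw, hh, sw, ne, ?_, emb, se, nw, rest⟩
  intro i j hp h₁ h₂ h₃ h₄
  rcases rest i j hp with hq | hl | hl
  · rcases emp i j hq h₁ h₂ h₃ h₄ with ⟨rfl, rfl⟩ | ⟨rfl, rfl⟩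
    · have := emb _ _ (hP.row sw hp) (by omega) (by omega) (by omega) (by omega)
      omega
    · have := emb _ _ (hP.row ne hp) (by omega) (by omega) (by omega) (by omega)
      omega
  · have := emb _ _ hl (by omega) (by omega) (by omega) (by omega)
    omega
  · have := emb _ _ hl (by omega) (by omega) (by omega) (by omega)
    omega

/-! ### The other decomposition of a domain -/

/-- Two rectangles without a common corner commute. -/
theorem commute (hL : IsLat L) (hP : IsSt L P) (hW : IsSt L W) (hZ : IsSt L Z)
    (s₁ : Step L P W a b w h) (s₂ : Step L W Z c d w' h')
    (n₁ : ¬ L (c - (a + w)) (d - b)) (n₂ : ¬ L (c - a) (d - (b + h)))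
    (n₃ : ¬ L (c + w' - (a + w)) (d + h' - b)) (n₄ : ¬ L (c + w' - a) (d + h' - (b + h))) :
    ∃ Y, IsSt L Y ∧ Step L P Y c d w' h' ∧ Step L Y Z a b w h ∧ ∃ i j, W i j ∧ ¬ Y i j := by
  have hw := s₁.hw
  have hh := s₁.hh
  have hw' := s₂.hw
  have hh' := s₂.hh
  obtain ⟨pc, ca, cb⟩ : P c d ∧ ¬ L (c - a) (d - b) ∧ ¬ L (c - (a + w)) (d - (b + h)) := by
    rcases s₁.back hL hP hW s₂.sw with h | h | h
    exacts [h, (n₁ h).elim, (n₂ h).elim]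
  obtain ⟨pe, ea, eb⟩ : P (c + w') (d + h') ∧ ¬ L (c + w' - a) (d + h' - b) ∧
      ¬ L (c + w' - (a + w)) (d + h' - (b + h)) := by
    rcases s₁.back hL hP hW s₂.ne with h | h | h
    exacts [h, (n₃ h).elim, (n₄ h).elim]
  have emp : Emp P c d w' h' := by
    intro i j hp g₁ g₂ g₃ g₄
    rcases s₁.rest i j hp with hq | hl | hl
    · exact s₂.emp i j hq g₁ g₂ g₃ g₄
    · exfalso
      have d₁ : ¬ (i = c) := fun e => ca (hL.sub' hl (hP.col' pc hp e.symm (k := 0) rfl rfl))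
      have d₂ : ¬ (j = d) := fun e => ca (hL.sub' hl (hP.row' pc hp e.symm (l := 0) rfl rfl))
      have d₃ : ¬ (i = c + w') := fun e => ea (hL.sub' hl (hP.col' pe hp e.symm (k := 0) rfl rfl))
      have d₄ : ¬ (j = d + h') := fun e => ea (hL.sub' hl (hP.row' pe hp e.symm (l := 0) rfl rfl))
      have se : W (i + w) j := hW.tr s₁.se hl
      have nw : W i (j + h) := hW.tr s₁.nw hl
      have f₁ := s₂.emp _ _ se
      have f₂ := s₂.emp _ _ nw
      have pe' : P (c + w' - (i - a)) (d + h' - (j - b)) := hP.trn hL pe hl rfl rfl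
      have f₃ := s₁.emp.apply pe'
      rcases f₃ with f₃ | f₃
      · exact ea (hL.of hl)
      · exact eb (hL.of hl)
    · exfalso
      have d₁ : ¬ (i = c) := fun e => cb (hL.sub' hl (hP.col' pc hp e.symm (k := 0) rfl rfl))
      have d₂ : ¬ (j = d) := fun e => cb (hL.sub' hl (hP.row' pc hp e.symm (l := 0) rfl rfl))
      have d₃ : ¬ (i = c + w') := fun e => eb (hL.sub' hl (hP.col' pe hp e.symm (k := 0) rfl rfl))
      have d₄ : ¬ (j = d + h') := fun e => eb (hL.sub' hl (hP.row' pe hp e.symm (l := 0) rfl rfl))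
      have se : W i (j - h) := hW.tr s₁.se hl
      have nw : W (i - w) j := hW.tr s₁.nw hl
      have f₁ := s₂.emp _ _ se
      have f₂ := s₂.emp _ _ nw
      have pc' : P (c - (i - (a + w))) (d - (j - (b + h))) := hP.trn hL pc hl rfl rfl
      have f₃ := s₁.emp.apply pc'
      rcases f₃ with f₃ | f₃
      · exact ca (hL.of hl)
      · exact cb (hL.of hl)
  obtain ⟨Y, hY, t₁⟩ := exists_step hL hP hw' hh' pc pe emp s₂.emb
  have ya : Y a b := by
    rcases t₁.rest _ _ s₁.sw with h | h | h
    exacts [h, (ca (hL.neg' h)).elim,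
      (ea (hL.neg' h)).elim]
  have yb : Y (a + w) (b + h) := by
    rcases t₁.rest _ _ s₁.ne with h | h | h
    exacts [h, (cb (hL.neg' h)).elim,
      (eb (hL.neg' h)).elim]
  have zse : Z (a + w) b := by
    rcases s₂.rest _ _ s₁.se with h | h | h
    exacts [h, (n₁ (hL.neg' h)).elim,
      (n₃ (hL.neg' h)).elim]
  have znw : Z a (b + h) := by
    rcases s₂.rest _ _ s₁.nw with h | h | h
    exacts [h, (n₂ (hL.neg' h)).elim,
      (n₄ (hL.neg' h)).elim]
  refine ⟨Y, hY, t₁, ⟨hw, hh, ya, yb, ?_, s₁.emb, zse, znw, ?_⟩, ?_⟩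
  · intro i j hy g₁ g₂ g₃ g₄
    rcases t₁.back hL hP hY hy with ⟨hp, -, -⟩ | hl | hl
    · exact s₁.emp i j hp g₁ g₂ g₃ g₄
    · exfalso
      have pc' : P (i - w') j := hP.tr pc hl
      have pe' : P i (j + h') := hP.tr pe hl
      have d₁ : ¬ (i = a) := fun e => ea (hL.sub' (hP.col' s₁.sw pe' e.symm (k := 0) rfl rfl) hl)
      have d₂ : ¬ (i = a + w) := fun e => eb (hL.sub' (hP.col' s₁.ne pe' e.symm (k := 0) rfl rfl)
        hl)
      have d₃ : ¬ (j = b) := fun e => ca (hL.sub' (hP.row' s₁.sw pc' e.symm (l := 0) rfl rfl) hl)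
      have d₄ : ¬ (j = b + h) := fun e => cb (hL.sub' (hP.row' s₁.ne pc' e.symm (l := 0) rfl rfl)
        hl)
      have f₁ := s₁.emp _ _ pc'
      have f₂ := s₁.emp _ _ pe'
      have nw : W (a - (i - (c + w'))) (b + h - (j - d)) := hW.trn hL s₁.nw hl rfl rfl
      have f₃ := s₂.emp.apply nw
      rcases f₃ with f₃ | f₃
      · exact n₂ (hL.neg' hl)
      · exact n₄ (hL.neg' hl)
    · exfalso
      have pc' : P i (j - h') := hP.tr pc hl
      have pe' : P (i + w') j := hP.tr pe hl
      have d₁ : ¬ (i = a) := fun e => ca (hL.sub' (hP.col' s₁.sw pc' e.symm (k := 0) rfl rfl) hl)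
      have d₂ : ¬ (i = a + w) := fun e => cb (hL.sub' (hP.col' s₁.ne pc' e.symm (k := 0) rfl rfl)
        hl)
      have d₃ : ¬ (j = b) := fun e => ea (hL.sub' (hP.row' s₁.sw pe' e.symm (l := 0) rfl rfl) hl)
      have d₄ : ¬ (j = b + h) := fun e => eb (hL.sub' (hP.row' s₁.ne pe' e.symm (l := 0) rfl rfl)
        hl)
      have f₁ := s₁.emp _ _ pc'
      have f₂ := s₁.emp _ _ pe'
      have se : W (a + w - (i - c)) (b - (j - (d + h'))) := hW.trn hL s₁.se hl rfl rfl
      have f₃ := s₂.emp.apply se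
      rcases f₃ with f₃ | f₃
      · exact n₁ (hL.neg' hl)
      · exact n₃ (hL.neg' hl)
  · intro i j hy
    rcases t₁.back hL hP hY hy with ⟨hp, m₁, m₂⟩ | hl | hl
    · rcases s₁.rest i j hp with hq | hl | hl
      · rcases s₂.rest i j hq with hz | hl | hl
        exacts [Or.inl hz, (m₁ hl).elim, (m₂ hl).elim]
      · exact Or.inr (Or.inl hl)
      · exact Or.inr (Or.inr hl)
    · exact Or.inl (hZ.tr s₂.se hl)
    · exact Or.inl (hZ.tr s₂.nw hl)
  · refine ⟨c, d, s₂.sw, fun hy => ?_⟩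
    have := s₂.emb.apply (hY.row hy t₁.se)
    omega

/-- The L-shape whose reflex corner is the upper right corner of the first rectangle. -/
theorem lshape_upper (hL : IsLat L) (hP : IsSt L P) (hW : IsSt L W) (hZ : IsSt L Z)
    (s₁ : Step L P W a b w h) (s₂ : Step L W Z (a + w) b w' h') (hlt : h < h')
    (nv : ¬ L (w + w') (h' - h)) :
    ∃ Y, IsSt L Y ∧ Step L P Y (a + w) (b + h) w' (h' - h) ∧ Step L Y Z a b (w + w') h ∧
      ∃ i j, W i j ∧ ¬ Y i j := by
  have hw := s₁.hw
  have hh := s₁.hh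
  have hw' := s₂.hw
  have hh' := s₂.hh
  have nl₁ : ¬ L w h := fun hl => by
    have := s₁.emb.apply hl
    omega
  have nl₂ : ¬ L w' h' := fun hl => by
    have := s₂.emb.apply hl
    omega
  obtain ⟨pd, da, db⟩ : P (a + w + w') (b + h') ∧ ¬ L (a + w + w' - a) (b + h' - b) ∧
      ¬ L (a + w + w' - (a + w)) (b + h' - (b + h)) := by
    rcases s₁.back hL hP hW s₂.ne with h | h | h
    exacts [h, (nl₂ (hL.of h)).elim, (nv (hL.of h)).elim]
  have emb : Emb L (w + w') h := by
    refine Emb.of_pos hL fun i j hl g₁ g₂ g₃ g₄ => ?_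
    by_cases c₁ : i ≤ w
    · exact s₁.emb _ _ hl (by omega) c₁ g₃ g₄
    by_cases c₂ : i ≤ w'
    · exact s₂.emb _ _ hl (by omega) c₂ (by omega) (by omega)
    exfalso
    have nw : W (a + i) (b + h + j) := hW.tr s₁.nw hl rfl rfl
    have f₁ := s₂.emp _ _ nw
    have f₂ : ¬ (i = w + w' ∧ j = h' - h) := by rintro ⟨rfl, rfl⟩; exact nv hl
    have pd' : P (a + w + w' - i) (b + h' - j) := hP.trn hL pd hl rfl rfl
    have f₃ := s₁.emp.apply pd'
    rcases f₃ with f₃ | f₃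
    · exact da (hL.of hl)
    · exact db (hL.of hl)
  have emp : Emp P (a + w) (b + h) w' (h' - h) := by
    intro i j hp g₁ g₂ g₃ g₄
    rcases s₁.rest i j hp with hq | hl | hl
    · have := s₂.emp i j hq g₁ g₂ (by omega) (by omega)
      omega
    · exfalso
      have f₁ := s₂.emp _ _ (hW.tr s₁.se hl (i' := i + w) (j' := j))
      have f₂ := s₂.emp _ _ (hW.tr s₁.nw hl (i' := i) (j' := j + h))
      have f₃ : ¬ (i = a + (w + w') ∧ j = b + (h' - h)) := by
        rintro ⟨rfl, rfl⟩; exact nv (hL.of hl)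
      have f₄ : ¬ (i = a + w' ∧ j = b + h') := by
        rintro ⟨rfl, rfl⟩; exact nl₂ (hL.of hl)
      have pd' : P (a + w + w' - (i - a)) (b + h' - (j - b)) := hP.trn hL pd hl rfl rfl
      have f₅ := s₁.emp.apply pd'
      rcases f₅ with f₅ | f₅
      · exact da (hL.of hl)
      · exact db (hL.of hl)
    · have f₁ := s₂.emp _ _ (hW.tr s₁.se hl (i' := i) (j' := j - h))
      omega
  have emb' : Emb L w' (h' - h) := fun i j hl g₁ g₂ g₃ g₄ =>
    s₂.emb i j hl g₁ g₂ (by omega) (by omega)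
  have pd₂ : P (a + w + w') (b + h + (h' - h)) := cast2 pd rfl (by omega)
  obtain ⟨Y, hY, t₁⟩ := exists_step hL hP hw' (by omega) s₁.ne pd₂ emp emb'
  refine ⟨Y, hY, t₁, ⟨by omega, hh, ?_, cast2 t₁.se (by omega) rfl, ?_, emb,
    cast2 s₂.se (by omega) rfl, ?_, ?_⟩, a + w + w', b + h', s₂.ne, ?_⟩
  · rcases t₁.rest _ _ s₁.sw with h | h | h
    exacts [h, (nl₁ (hL.neg' h)).elim,
      (da (hL.neg' h)).elim]
  · intro i j hy g₁ g₂ g₃ g₄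
    rcases t₁.back hL hP hY hy with ⟨hp, m₁, m₂⟩ | hl | hl
    · have m₁' : ¬ (i = a + w ∧ j = b + h) := by
        rintro ⟨rfl, rfl⟩; exact m₁ (hL.of hL.zero)
      by_cases ci : i ≤ a + w
      · have := s₁.emp i j hp g₁ ci g₃ g₄
        omega
      rcases s₁.rest i j hp with hq | hl | hl
      · have m₂' : ¬ (i = a + w + w' ∧ j = b + h') := by
          rintro ⟨rfl, rfl⟩; exact m₂ (hL.of hL.zero)
        have := s₂.emp i j hq (by omega) (by omega) g₃ (by omega)
        omega
      · have := emb _ _ hl (by omega) (by omega) (by omega) (by omega)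
        omega
      · exact (m₁ hl).elim
    · have := emb _ _ hl (by omega) (by omega) (by omega) (by omega)
      omega
    · exfalso
      by_cases c₁ : -w' ≤ i - (a + w)
      · by_cases c₂ : i - (a + w) ≤ 0
        · have f₁ := s₂.emp.apply (hW.tr s₂.ne hl (i' := i + w') (j' := j))
          have : i = a + w - w' ∧ j = b := by omega
          exact nl₂ (hL.neg' hl)
        · have := s₂.emb.apply hl
          omega
      · by_cases c₂ : -h ≤ j - (b + h')
        · have := s₁.emb.apply hl
          omega
        have f₁ := s₁.emp.apply (hP.tr pd hl (i' := i + w') (j' := j))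
        rcases f₁ with f₁ | f₁
        · exact da (hL.neg' hl)
        · exact db (hL.neg' hl)
  · rcases s₂.rest _ _ s₁.nw with hz | hl | hl
    · exact hz
    · have := s₁.emb.apply hl
      omega
    · exact (nv (hL.neg' hl)).elim
  · intro i j hy
    rcases t₁.back hL hP hY hy with ⟨hp, m₁, m₂⟩ | hl | hl
    · rcases s₁.rest i j hp with hq | hl | hl
      · rcases s₂.rest i j hq with hz | hl | hl
        · exact Or.inl hz
        · have := s₁.emb.apply (hP.row' (hP.tr s₁.sw hl (i' := i - w) (j' := j))
            hp rfl (k := w) (by omega) rfl)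
          omega
        · exact (m₂ (hL.of hl)).elim
      · exact Or.inr (Or.inl hl)
      · exact (m₁ hl).elim
    · exact Or.inr (Or.inr (hL.of hl))
    · exact Or.inl (hZ.tr s₂.nw hl)
  · intro hy
    have := s₂.emb.apply (hY.row' hy (cast2 t₁.nw rfl (j' := b + h') (by omega)) rfl (k := -w')
      (by omega) rfl)
    omega

/-- The L-shape whose reflex corner is the upper left corner of the second rectangle. -/
theorem lshape_lower (hL : IsLat L) (hP : IsSt L P) (hW : IsSt L W) (hZ : IsSt L Z)
    (s₁ : Step L P W a b w h) (s₂ : Step L W Z (a + w) b w' h') (hlt : h' < h)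
    (nv : ¬ L (w + w') (h' - h)) :
    ∃ Y, IsSt L Y ∧ Step L P Y a b (w + w') h' ∧ Step L Y Z a (b + h') w (h - h') ∧
      ∃ i j, W i j ∧ ¬ Y i j := by
  have hw := s₁.hw
  have hh := s₁.hh
  have hw' := s₂.hw
  have hh' := s₂.hh
  have nl₁ : ¬ L w h := fun hl => by
    have := s₁.emb.apply hl
    omega
  have nl₂ : ¬ L w' h' := fun hl => by
    have := s₂.emb.apply hl
    omega
  obtain ⟨pd, da, db⟩ : P (a + w + w') (b + h') ∧ ¬ L (a + w + w' - a) (b + h' - b) ∧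
      ¬ L (a + w + w' - (a + w)) (b + h' - (b + h)) := by
    rcases s₁.back hL hP hW s₂.ne with h | h | h
    exacts [h, (nl₂ (hL.of h)).elim, (nv (hL.of h)).elim]
  have emb : Emb L (w + w') h' := by
    refine Emb.of_pos hL fun i j hl g₁ g₂ g₃ g₄ => ?_
    by_cases c₁ : i ≤ w
    · exact s₁.emb _ _ hl (by omega) c₁ (by omega) (by omega)
    by_cases c₂ : i ≤ w'
    · exact s₂.emb _ _ hl (by omega) c₂ g₃ g₄
    exfalso
    have nw : W (a + i) (b + h + j) := hW.tr s₁.nw hl rfl rfl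
    have f₁ := s₂.emp _ _ nw
    have f₂ : ¬ (i = w + w' ∧ j = h' - h) := by rintro ⟨rfl, rfl⟩; exact nv hl
    have pd' : P (a + w + w' - i) (b + h' - j) := hP.trn hL pd hl rfl rfl
    have f₃ := s₁.emp.apply pd'
    rcases f₃ with f₃ | f₃
    · exact da (hL.of hl)
    · exact db (hL.of hl)
  have emp : Emp P a b (w + w') h' := by
    intro i j hp g₁ g₂ g₃ g₄
    by_cases ci : i ≤ a + w
    · have := s₁.emp i j hp g₁ ci g₃ (by omega)
      omega
    rcases s₁.rest i j hp with hq | hl | hl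
    · have := s₂.emp i j hq (by omega) (by omega) g₃ g₄
      omega
    · have := emb _ _ hl (by omega) (by omega) (by omega) (by omega)
      omega
    · exfalso
      have f₁ := s₂.emb _ _ hl
      have f₂ := s₁.emb _ _ hl
      have f₃ := s₂.emp _ _ (hW.tr s₁.nw hl (i' := i - w) (j' := j))
      omega
  have pd₂ : P (a + (w + w')) (b + h') := cast2 pd (by omega) rfl
  obtain ⟨Y, hY, t₁⟩ := exists_step hL hP (by omega) hh' s₁.sw pd₂ emp emb
  have emb' : Emb L w (h - h') := fun i j hl g₁ g₂ g₃ g₄ =>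
    s₁.emb i j hl g₁ g₂ (by omega) (by omega)
  refine ⟨Y, hY, t₁, ⟨hw, by omega, t₁.nw, ?_, ?_, emb', s₂.nw, ?_, ?_⟩,
    a + w + w', b + h', s₂.ne, ?_⟩
  · rcases t₁.rest _ _ s₁.ne with h | h | h
    exacts [cast2 h rfl (by omega), (nl₁ (hL.of h)).elim,
      (db (hL.neg' h)).elim]
  · intro i j hy g₁ g₂ g₃ g₄
    rcases t₁.back hL hP hY hy with ⟨hp, m₁, m₂⟩ | hl | hl
    · have := s₁.emp i j hp g₁ g₂ (by omega) (by omega)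
      omega
    · exfalso
      have f₁ := s₁.emp _ _ (hP.tr pd hl (i' := i) (j' := j + h'))
      have f₂ : ¬ (i = a ∧ j + h' = b) := fun f =>
        da (hL.neg' hl)
      have f₃ : ¬ (i = a + w ∧ j + h' = b + h) := fun f =>
        db (hL.neg' hl)
      have f₄ := s₁.emb _ _ hl
      have f₅ := s₂.emp _ _ (hW.trn hL s₁.nw hl rfl rfl)
      have f₆ : ¬ (i - (a + (w + w')) = -w ∧ j - b = h) := fun f => by
        have := s₁.emb.apply hl
        omega
      omega
    · have := s₁.emb.apply hl
      omega
  · rcases s₂.rest _ _ s₁.nw with hz | hl | hl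
    · exact cast2 hz rfl (by omega)
    · have := s₁.emb.apply hl
      omega
    · exact (nv (hL.neg' hl)).elim
  · intro i j hy
    rcases t₁.back hL hP hY hy with ⟨hp, m₁, m₂⟩ | hl | hl
    · rcases s₁.rest i j hp with hq | hl | hl
      · rcases s₂.rest i j hq with hz | hl | hl
        · exact Or.inl hz
        · have := s₁.emb.apply (hP.row' (hP.tr s₁.sw hl (i' := i - w) (j' := j))
            hp rfl (k := w) (by omega) rfl)
          omega
        · exact (m₂ (hL.of hl)).elim
      · exact (m₁ hl).elim
      · exact Or.inr (Or.inr (hL.of hl))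
    · exact Or.inl (hZ.tr s₂.se hl)
    · exact Or.inr (Or.inl hl)
  · intro hy
    have := emb _ _ (hY.row' hy t₁.nw rfl (k := -(w + w')) (by omega) rfl)
      (by omega) (by omega) (by omega) (by omega)
    omega

/-- The first rectangle of the other decomposition of a descending staircase band. -/
theorem band_descending (hL : IsLat L) (hP : IsSt L P) (hW : IsSt L W)
    (s₁ : Step L P W a b w h) (s₂ : Step L W Z (a + w) b w' h') (hlt : h' < h)
    (hv : L (w + w') (h' - h)) {k : ℤ} (hk : 1 ≤ k) (hk₁ : k * (h - h') < h)
    (hk₂ : h < (k + 1) * (h - h')) :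
    Emp P a b (w + k * (w + w')) (h - k * (h - h')) ∧
      Emb L (w + k * (w + w')) (h - k * (h - h')) := by
  have hw := s₁.hw
  have hh := s₁.hh
  have hw' := s₂.hw
  have hh' := s₂.hh
  obtain ⟨V, hV⟩ : ∃ V, V = w + w' := ⟨_, rfl⟩
  obtain ⟨u, hu⟩ : ∃ u, u = h - h' := ⟨_, rfl⟩
  obtain ⟨e, he⟩ : ∃ e, e = h - k * u := ⟨_, rfl⟩
  rw [← hV, ← hu, ← he]
  rw [← hu] at hk₁ hk₂
  replace hv : L V (-u) := hL.of hv
  have hk₂' : h < k * u + u := by linarith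
  have hmul : ∀ m, m ≤ k → m * u ≤ k * u := fun m hm => mul_le_mul_of_nonneg_right hm (by omega)
  have hmul' : ∀ m, m ≤ k - 1 → m * u ≤ k * u - u := fun m hm => by
    have := mul_le_mul_of_nonneg_right hm (show 0 ≤ u by omega)
    linarith
  have hmulV : ∀ m, m ≤ k → m * V ≤ k * V := fun m hm => mul_le_mul_of_nonneg_right hm (by omega)
  have hmul0 : ∀ m, 0 ≤ m → 0 ≤ m * u := fun m hm => mul_nonneg hm (by omega)
  -- the strip under the second rectangle contains no point of the first state
  have band : ∀ c r, P (a + c) (b + r) → w < c → c < V → 0 ≤ r → r ≤ h' → False := by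
    intro c r hp g₁ g₂ g₃ g₄
    rcases s₁.rest _ _ hp with hq | hl | hl
    · have := s₂.emp.apply hq
      omega
    · have f₁ := s₁.emb _ _ (hL.sub' hl hv (i' := c - V) (j' := r + u))
      have f₂ := s₂.emb _ _ hl
      omega
    · have f₁ := s₁.emb _ _ hl
      have f₂ := s₂.emp _ _ (hW.tr s₁.nw hl (i' := a + c - w) (j' := b + r))
      omega
  -- reduction to one period of the band
  have split : ∀ i, 0 ≤ i → i ≤ w + k * V →
      ∃ m c, i = m * V + c ∧ 0 ≤ c ∧ c < V ∧ 0 ≤ m ∧ m ≤ k ∧ (w < c → m ≤ k - 1) := by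
    intro i hi hi'
    have hVp : 0 < V := by omega
    have e₁ := Int.mul_ediv_add_emod i V
    have e₂ := Int.emod_nonneg i hVp.ne'
    have e₃ := Int.emod_lt_of_pos i hVp
    have e₄ : 0 ≤ i / V := Int.ediv_nonneg hi hVp.le
    have e₅ : V * (i / V) = i / V * V := mul_comm _ _
    refine ⟨i / V, i % V, by omega, e₂, e₃, e₄, ?_, ?_⟩
    · by_contra hc
      have := mul_le_mul_of_nonneg_right (show k + 1 ≤ i / V by omega) hVp.le
      have : (k + 1) * V = k * V + V := by ring
      omega
    · intro hwc
      by_contra hc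
      have := mul_le_mul_of_nonneg_right (show k ≤ i / V by omega) hVp.le
      omega
  constructor
  · intro i j hp g₁ g₂ g₃ g₄
    obtain ⟨m, c, hi, hc₀, hc₁, hm₀, hm₁, hm₂⟩ := split (i - a) (by omega) (by omega)
    have hp' : P (a + c) (b + (j - b + m * u)) :=
      hP.trn hL hp (hL.smul hv m) (by linarith) (by ring)
    have hmu := hmul m hm₁
    have hmu0 := hmul0 m hm₀
    by_cases hcw : c ≤ w
    · rcases s₁.emp.apply hp' with f | f
      · left
        have hm : m = 0 := by
          by_contra hm
          have := mul_le_mul_of_nonneg_right (show 1 ≤ m by omega) (show 0 ≤ u by omega)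
          omega
        subst hm
        omega
      · right
        have hm : m = k := by
          by_contra hm
          have := hmul' m (by omega)
          omega
        subst hm
        omega
    · have := hmul' m (hm₂ (by omega))
      exact (band _ _ hp' (by omega) hc₁ (by omega) (by omega)).elim
  · refine Emb.of_pos hL fun i j hl g₁ g₂ g₃ g₄ => ?_
    obtain ⟨m, c, hi, hc₀, hc₁, hm₀, hm₁, hm₂⟩ := split i g₁ g₂
    have hl' : L c (j + m * u) := hL.sub' hl (hL.smul hv m) (by linarith) (by ring)
    have hmu := hmul m hm₁
    have hmu0 := hmul0 m hm₀
    by_cases hcw : c ≤ w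
    · have f := s₁.emb.apply hl'
      have hm : m = 0 := by
        by_contra hm
        have := mul_le_mul_of_nonneg_right (show 1 ≤ m by omega) (show 0 ≤ u by omega)
        omega
      subst hm
      omega
    · exfalso
      have := hmul' m (hm₂ (by omega))
      by_cases hcw' : c ≤ w'
      · have f := s₂.emb.apply hl'
        omega
      · have f := s₁.emb.apply (hL.sub' hl' hv (i' := c - V) (j' := j + m * u + u))
        omega

/-- The first rectangle of the other decomposition of an ascending staircase band. -/
theorem band_ascending (hL : IsLat L) (hP : IsSt L P) (hW : IsSt L W)
    (s₁ : Step L P W a b w h) (s₂ : Step L W Z (a + w) b w' h') (hlt : h < h')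
    (hv : L (w + w') (h' - h)) {k : ℤ} (hk : 0 ≤ k) (hk₁ : k * (h' - h) < h)
    (hk₂ : h < (k + 1) * (h' - h)) :
    Emp P (a + w) (b + h) ((k + 1) * (w + w') - w) ((k + 1) * (h' - h) - h) ∧
      Emb L ((k + 1) * (w + w') - w) ((k + 1) * (h' - h) - h) := by
  have hw := s₁.hw
  have hh := s₁.hh
  have hw' := s₂.hw
  have hh' := s₂.hh
  obtain ⟨V, hV⟩ : ∃ V, V = w + w' := ⟨_, rfl⟩
  obtain ⟨u, hu⟩ : ∃ u, u = h' - h := ⟨_, rfl⟩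
  rw [← hV, ← hu]
  rw [← hu] at hk₁ hk₂
  replace hv : L V u := hL.of hv
  have ek : (k + 1) * u = k * u + u := by ring
  have ekV : (k + 1) * V = k * V + V := by ring
  rw [ek] at hk₂
  have hmul : ∀ m, m ≤ k → m * u ≤ k * u := fun m hm => mul_le_mul_of_nonneg_right hm (by omega)
  have hmul1 : ∀ m, 1 ≤ m → u ≤ m * u := fun m hm => by
    have := mul_le_mul_of_nonneg_right hm (show 0 ≤ u by omega)
    linarith
  have hmul' : ∀ m, m ≤ k - 1 → m * u ≤ k * u - u := fun m hm => by
    have := mul_le_mul_of_nonneg_right hm (show 0 ≤ u by omega)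
    linarith
  have hmul0 : ∀ m, 0 ≤ m → 0 ≤ m * u := fun m hm => mul_nonneg hm (by omega)
  -- the strip of the second rectangle contains no point of the first state
  have band : ∀ c r, P (a + c) (b + r) → w < c → c < V → 0 ≤ r → r ≤ h' → False := by
    intro c r hp g₁ g₂ g₃ g₄
    rcases s₁.rest _ _ hp with hq | hl | hl
    · have := s₂.emp.apply hq
      omega
    · have f₁ := s₁.emb _ _ (hL.sub' hl hv (i' := c - V) (j' := r - u))
      have f₂ := s₂.emp _ _ (hW.tr s₁.nw hl (i' := a + c) (j' := b + h + r))
      have f₃ := s₂.emp _ _ (hW.tr s₁.se hl (i' := a + w + c) (j' := b + r))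
      omega
    · have f₁ := s₁.emb _ _ hl
      have f₂ := s₂.emp _ _ (hW.tr s₁.nw hl (i' := a + c - w) (j' := b + r))
      have f₃ := s₂.emp _ _ (hW.tr s₁.se hl (i' := a + c) (j' := b + r - h))
      omega
  have split : ∀ i, 0 ≤ i → i ≤ (k + 1) * V →
      ∃ m c, i = m * V + c ∧ 0 ≤ c ∧ c < V ∧ 0 ≤ m ∧ m ≤ k + 1 ∧ (m = k + 1 → c = 0) := by
    intro i hi hi'
    have hVp : 0 < V := by omega
    have e₁ := Int.mul_ediv_add_emod i V
    have e₂ := Int.emod_nonneg i hVp.ne'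
    have e₃ := Int.emod_lt_of_pos i hVp
    have e₄ : 0 ≤ i / V := Int.ediv_nonneg hi hVp.le
    have e₅ : V * (i / V) = i / V * V := mul_comm _ _
    refine ⟨i / V, i % V, by omega, e₂, e₃, e₄, ?_, ?_⟩
    · by_contra hc
      have := mul_le_mul_of_nonneg_right (show k + 2 ≤ i / V by omega) hVp.le
      have : (k + 2) * V = k * V + V + V := by ring
      omega
    · intro hc
      have : i / V * V = (k + 1) * V := by rw [hc]
      omega
  have emp : Emp P (a + w) (b + h) ((k + 1) * V - w) ((k + 1) * u - h) := by
    intro i j hp g₁ g₂ g₃ g₄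
    obtain ⟨m, c, hi, hc₀, hc₁, hm₀, hm₁, hm₂⟩ := split (i - a) (by omega) (by omega)
    have hp' : P (a + c) (b + (j - b - m * u)) :=
      hP.trn hL hp (hL.smul hv m) (by linarith) (by ring)
    by_cases hm : m = k + 1
    · right
      have hc := hm₂ hm
      subst hm hc
      have hl : L 0 (j - b - (k + 1) * u) := hP.col' s₁.sw hp' (by omega) rfl
      have := s₂.emb.apply hl
      omega
    have hmu := hmul m (by omega)
    have hmu0 := hmul0 m hm₀
    by_cases hcw : w < c
    · exact (band _ _ hp' hcw hc₁ (by omega) (by omega)).elim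
    by_cases hm0 : m = 0
    · left
      subst hm0
      have hl : L 0 (j - b - 0 * u - h) := hP.col' s₁.ne hp' (by omega) rfl
      have := s₂.emb.apply hl
      omega
    · exfalso
      have hmu1 := hmul1 m (by omega)
      have := s₁.emp.apply hp'
      omega
  refine ⟨emp, Emb.of_pos hL fun i j hl g₁ g₂ g₃ g₄ => ?_⟩
  by_cases hi0 : i = 0
  · exact s₂.emb.apply hl
  exfalso
  have hb : P (a + w + i) (b + h + j) := hP.tr s₁.ne hl
  have nl : ¬ L w h := fun hl => by
    have := s₁.emb.apply hl
    omega
  by_cases hj : 0 ≤ j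
  · rcases emp _ _ hb (by omega) (by omega) (by omega) (by omega) with f | f
    · omega
    · refine nl (hL.sub' (hL.smul hv (k + 1)) hl ?_ ?_) <;> omega
  by_cases hk0 : k = 0
  · subst hk0
    have := s₂.emb.apply hl
    omega
  have hku := hmul1 k (by omega)
  obtain ⟨m, c, hi, hc₀, hc₁, hm₀, hm₁, hm₂⟩ := split (w + i) (by omega) (by omega)
  have hp' : P (a + c) (b + (h + j - m * u)) :=
    hP.trn hL hb (hL.smul hv m) (by linarith) (by ring)
  by_cases hm : m = k + 1
  · have hc := hm₂ hm
    subst hm hc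
    have hl : L 0 (h + j - (k + 1) * u) := hP.col' s₁.sw hp' (by omega) rfl
    have := s₂.emb.apply hl
    omega
  have hmu0 := hmul0 m hm₀
  by_cases hr : 0 ≤ h + j - m * u
  · by_cases hcw : w < c
    · exact band _ _ hp' hcw hc₁ hr (by omega)
    · rcases s₁.emp.apply hp' with f | f
      · refine nl (hL.sub' (hL.smul hv m) hl ?_ ?_) <;> omega
      · omega
  · have hmk : m = k := by
      by_contra hmk
      have := hmul' m (by omega)
      omega
    subst hmk
    -- the vector `λ - k v` is short and points to the lower left
    have hl' : L (c - w) (j - m * u) := hL.sub' hl (hL.smul hv m)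
    by_cases hcw : -w' ≤ c - w
    · have := s₂.emb.apply hl'
      omega
    · have hd : W (a + w' + c) (b + h' + (j - m * u)) := hW.tr s₂.ne hl'
      have := s₁.qemp hL hP hW hd (by omega) (by omega) (by omega) (by omega)
      omega

/-- In the other decomposition of a staircase band, the two rectangles fit together. -/
theorem ascending (hL : IsLat L) (hP : IsSt L P) (hW : IsSt L W) (hZ : IsSt L Z)
    (s₁ : Step L P W a b w h) (s₂ : Step L W Z (a + w) b w' h') (hlt : h < h')
    (hv : L (w + w') (h' - h)) {k : ℤ} (hk : 0 ≤ k) (hk₁ : k * (h' - h) < h)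
    (hk₂ : h < (k + 1) * (h' - h)) :
    ∃ Y, IsSt L Y ∧ Step L P Y (a + w) (b + h) ((k + 1) * (w + w') - w) ((k + 1) * (h' - h) - h) ∧
      Step L Y Z (a + w) (b + (k + 1) * (h' - h)) ((k + 2) * (w + w') - w) (h - k * (h' - h)) ∧
      ∃ i j, W i j ∧ ¬ Y i j := by
  have hw := s₁.hw
  have hh := s₁.hh
  have hw' := s₂.hw
  have hh' := s₂.hh
  obtain ⟨emp, emb⟩ := band_ascending hL hP hW s₁ s₂ hlt hv hk hk₁ hk₂
  have s₁' := s₁.reflect hL hP hW (a' := -a - w' - w + w') (by omega)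
  have s₂' := s₂.reflect hL hW hZ (a' := -a - w' - w) (by omega)
  have hv' : L (-(w' + w)) (h - h') := hL.neg' hv
  obtain ⟨emp', emb'⟩ := band_descending (k := k + 1) hL.reflect (hZ.reflect hL) (hW.reflect hL)
    s₂' s₁' hlt hv' (by omega) (by linarith) (by linarith)
  obtain ⟨V, hV⟩ : ∃ V, V = w + w' := ⟨_, rfl⟩
  obtain ⟨u, hu⟩ : ∃ u, u = h' - h := ⟨_, rfl⟩
  rw [add_comm w' w, ← hV, ← hu] at emp' emb'
  rw [← hV, ← hu] at emp emb ⊢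
  rw [← hu] at hk₁ hk₂
  replace hv : L V u := hL.of hv
  have hku : 0 ≤ k * u := mul_nonneg hk (by omega)
  have hkV : 0 ≤ k * V := mul_nonneg hk (by omega)
  have ek : (k + 1) * u = k * u + u := by ring
  have ekV : (k + 1) * V = k * V + V := by ring
  have ekV' : (k + 2) * V = k * V + V + V := by ring
  rw [ek, ekV] at emp' emb' emp emb ⊢
  rw [ekV'] at *
  rw [ek] at hk₂
  have v₁ : L (k * V + V) (k * u + u) := hL.add' (hL.smul hv k) hv rfl rfl
  have nl₁ : ¬ L w h := fun hl => by
    have := s₁.emb.apply hl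
    omega
  obtain ⟨Y, hY, t₁⟩ := exists_step hL hP (a := a + w) (b := b + h) (w := k * V + V - w)
    (h := k * u + u - h) (by omega) (by omega) s₁.ne (hP.tr s₁.sw v₁) emp emb
  refine ⟨Y, hY, t₁, Step.of_target hY (by omega) (by omega) (cast2 t₁.nw rfl (by omega))
    (hY.tr t₁.se hv) ?_ ?_ (hZ.tr s₂.se v₁)
    (cast2 s₂.nw rfl (by omega)) ?_, ?_⟩
  · intro i j hz g₁ g₂ g₃ g₄
    have := emp' (-(i - (k * V + V))) (j - (k * u + u)) (hZ.trn hL hz v₁)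
      (by omega) (by omega) (by omega) (by omega)
    omega
  · intro i j hl g₁ g₂ g₃ g₄
    have := emb' (-i) j (hL.of hl (by omega) rfl) (by omega) (by omega) (by omega) (by omega)
    omega
  · intro i j hy
    rcases t₁.back hL hP hY hy with ⟨hp, m₁, m₂⟩ | hl | hl
    · have m₂' : ¬ L (i - a) (j - b) := fun h => m₂ (hL.sub' h v₁)
      rcases s₁.rest i j hp with hq | hl | hl
      · rcases s₂.rest i j hq with hz | hl | hl
        · exact Or.inl hz
        · have := s₁.emb.apply (hP.row' (hP.tr s₁.sw hl (i' := i - w) (j' := j))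
            hp rfl (k := w) (by omega) rfl)
          omega
        · have hl' : L (i - a) (j - (b + h)) := hL.add' hl hv
          have := s₁.emb.apply (hP.col' (hP.tr s₁.sw hl' (i' := i) (j' := j - h))
            hp rfl (k := 0) rfl (l := h) (by omega))
          omega
      · exact (m₂' hl).elim
      · exact (m₁ hl).elim
    · exact Or.inr (Or.inr (hL.sub' hl hv))
    · exact Or.inr (Or.inl (hL.of hl))
  · refine ⟨a, b + h, s₁.nw, fun hy => ?_⟩
    have h₁ : Y a (b + h - (k * u + u)) := hY.trn hL t₁.se v₁
    have := s₂.emb.apply (hY.col' h₁ hy rfl (k := 0) rfl (l := k * u + u))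
    omega

theorem descending (hL : IsLat L) (hP : IsSt L P) (hW : IsSt L W) (hZ : IsSt L Z)
    (s₁ : Step L P W a b w h) (s₂ : Step L W Z (a + w) b w' h') (hlt : h' < h)
    (hv : L (w + w') (h' - h)) {k : ℤ} (hk : 1 ≤ k) (hk₁ : k * (h - h') < h)
    (hk₂ : h < (k + 1) * (h - h')) :
    ∃ Y, IsSt L Y ∧ Step L P Y a b (w + k * (w + w')) (h - k * (h - h')) ∧
      Step L Y Z a (b + (h - k * (h - h'))) (w + (k - 1) * (w + w')) ((k + 1) * (h - h') - h) ∧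
      ∃ i j, W i j ∧ ¬ Y i j := by
  have hw := s₁.hw
  have hh := s₁.hh
  have hw' := s₂.hw
  have hh' := s₂.hh
  obtain ⟨emp, emb⟩ := band_descending hL hP hW s₁ s₂ hlt hv hk hk₁ hk₂
  have s₁' := s₁.reflect hL hP hW (a' := -a - w' - w + w') (by omega)
  have s₂' := s₂.reflect hL hW hZ (a' := -a - w' - w) (by omega)
  have hv' : L (-(w' + w)) (h - h') := hL.neg' hv
  obtain ⟨emp', emb'⟩ := band_ascending (k := k - 1) hL.reflect (hZ.reflect hL) (hW.reflect hL)
    s₂' s₁' hlt hv' (by omega) (by linarith) (by linarith)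
  obtain ⟨V, hV⟩ : ∃ V, V = w + w' := ⟨_, rfl⟩
  obtain ⟨u, hu⟩ : ∃ u, u = h - h' := ⟨_, rfl⟩
  rw [add_comm w' w, ← hV, ← hu, sub_add_cancel] at emp' emb'
  rw [← hV, ← hu] at emp emb ⊢
  rw [← hu] at hk₁ hk₂
  replace hv : L V (-u) := hL.of hv
  have ek : (k + 1) * u = k * u + u := by ring
  have ekV' : (k - 1) * V = k * V - V := by ring
  rw [ek] at hk₂ ⊢
  rw [ekV']
  have hku : u ≤ k * u := by
    have := mul_le_mul_of_nonneg_right hk (show 0 ≤ u by omega)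
    linarith
  have hkV : V ≤ k * V := by
    have := mul_le_mul_of_nonneg_right hk (show 0 ≤ V by omega)
    linarith
  have vk : L (k * V) (-(k * u)) := hL.of (hL.smul hv k) rfl (by ring)
  have v₁ : L (k * V - V) (-(k * u) + u) := hL.sub' vk hv rfl
  obtain ⟨Y, hY, t₁⟩ := exists_step hL hP (a := a) (b := b) (w := w + k * V)
    (h := h - k * u) (by omega) (by omega) s₁.sw (hP.tr s₁.ne vk) emp emb
  refine ⟨Y, hY, t₁, Step.of_target hY (by omega) (by omega) t₁.nw
    (hY.trn hL t₁.se hv) ?_ ?_ (hZ.tr s₂.nw v₁)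
    (hZ.trn hL s₂.se hv) ?_, ?_⟩
  · intro i j hz g₁ g₂ g₃ g₄
    have := emp' (-(i - (k * V - V))) (j - (-(k * u) + u)) (hZ.trn hL hz v₁)
      (by omega) (by omega) (by omega) (by omega)
    omega
  · intro i j hl g₁ g₂ g₃ g₄
    have := emb' (-i) j (hL.of hl (by omega) rfl) (by omega) (by omega) (by omega) (by omega)
    omega
  · intro i j hy
    rcases t₁.back hL hP hY hy with ⟨hp, m₁, m₂⟩ | hl | hl
    · have m₂' : ¬ L (i - (a + w)) (j - (b + h)) := fun h =>
        m₂ (hL.sub' h vk)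
      rcases s₁.rest i j hp with hq | hl | hl
      · rcases s₂.rest i j hq with hz | hl | hl
        · exact Or.inl hz
        · have := s₁.emb.apply (hP.row' (hP.tr s₁.sw hl (i' := i - w) (j' := j))
            hp rfl (k := w) (by omega) rfl)
          omega
        · have hl' : L (i - a) (j - (b + h)) := hL.add' hl hv
          have := s₁.emb.apply (hP.col' (hP.tr s₁.sw hl' (i' := i) (j' := j - h))
            hp rfl (k := 0) rfl (l := h) (by omega))
          omega
      · exact (m₁ hl).elim
      · exact (m₂' hl).elim
    · exact Or.inr (Or.inr (hL.add' hl hv))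
    · exact Or.inr (Or.inl hl)
  · refine ⟨a, b + h, s₁.nw, fun hy => ?_⟩
    have := s₁.emb.apply (hY.col' t₁.nw hy rfl (k := 0) rfl (l := k * u))
    omega

/-- The height of the first rectangle is not a multiple of the slope of a staircase band. -/
theorem band_not_multiple (hL : IsLat L) (hP : IsSt L P) (s₁ : Step L P W a b w h) {V u : ℤ}
    (hv : L V u) (k : ℤ) : h ≠ k * u := by
  intro e
  have hw := s₁.hw
  have hh := s₁.hh
  have hb := hP.tr s₁.sw (hL.smul hv k) (i' := a + k * V) (j' := b + h) rfl
  have hl := hL.add' (hP.row hb s₁.ne) (hL.smul hv k) (i' := w) (j' := h)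
  have := s₁.emb.apply hl
  omega

end

/-! ### Multiplicities -/

/-- The sum of `f` over the cells of a rectangle. -/
def rsum (f : ℤ → ℤ → ℕ) (a b w h : ℤ) : ℕ :=
  ∑ i ∈ Finset.Ico a (a + w), ∑ j ∈ Finset.Ico b (b + h), f i j

theorem rsum_transpose (f : ℤ → ℤ → ℕ) (a b w h : ℤ) :
    rsum (fun i j => f j i) b a h w = rsum f a b w h := Finset.sum_comm

theorem sum_Ico_add (f : ℤ → ℕ) (a : ℤ) {w w' : ℤ} (hw : 0 ≤ w) (hw' : 0 ≤ w') :
    ∑ i ∈ Finset.Ico a (a + (w + w')), f i =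
      ∑ i ∈ Finset.Ico a (a + w), f i + ∑ i ∈ Finset.Ico (a + w) (a + w + w'), f i := by
  rw [← Finset.sum_union]
  · congr 1
    ext i
    simp only [Finset.mem_union, Finset.mem_Ico]
    omega
  · rw [Finset.disjoint_left]
    intro i
    simp only [Finset.mem_Ico]
    omega

theorem rsum_add_width (f : ℤ → ℤ → ℕ) (a b : ℤ) {w w' : ℤ} (h : ℤ) (hw : 0 ≤ w) (hw' : 0 ≤ w') :
    rsum f a b (w + w') h = rsum f a b w h + rsum f (a + w) b w' h :=
  sum_Ico_add _ a hw hw'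

theorem rsum_add_height (f : ℤ → ℤ → ℕ) (a b w : ℤ) {h h' : ℤ} (hh : 0 ≤ h) (hh' : 0 ≤ h') :
    rsum f a b w (h + h') = rsum f a b w h + rsum f a (b + h) w h' := by
  rw [← rsum_transpose f a b w (h + h'), rsum_add_width _ _ _ _ hh hh', rsum_transpose f,
    rsum_transpose f]

theorem rsum_rotate (f : ℤ → ℤ → ℕ) (a b w h : ℤ) :
    rsum (fun i j => f (-1 - i) (-1 - j)) (-a - w) (-b - h) w h = rsum f a b w h := by
  unfold rsum
  refine Finset.sum_nbij' (fun i => -1 - i) (fun i => -1 - i) ?_ ?_ ?_ ?_ ?_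
  · intro i; simp only [Finset.mem_Ico]; omega
  · intro i; simp only [Finset.mem_Ico]; omega
  · intro i _; ring
  · intro i _; ring
  intro i _
  refine Finset.sum_nbij' (fun i => -1 - i) (fun i => -1 - i) ?_ ?_ ?_ ?_ ?_
  · intro i; simp only [Finset.mem_Ico]; omega
  · intro i; simp only [Finset.mem_Ico]; omega
  · intro i _; ring
  · intro i _; ring
  intro j _
  rfl

theorem rsum_translate {f : ℤ → ℤ → ℕ} {k l : ℤ} (hf : ∀ i j, f (i + k) (j + l) = f i j)
    {a b a' b' w h : ℤ} (ea : a' = a + k) (eb : b' = b + l) : rsum f a' b' w h = rsum f a b w h := by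
  subst ea eb
  unfold rsum
  refine Finset.sum_nbij' (fun i => i - k) (fun i => i + k) ?_ ?_ ?_ ?_ ?_
  · intro i; simp only [Finset.mem_Ico]; omega
  · intro i; simp only [Finset.mem_Ico]; omega
  · intro i _; ring
  · intro i _; ring
  intro i _
  refine Finset.sum_nbij' (fun i => i - l) (fun i => i + l) ?_ ?_ ?_ ?_ ?_
  · intro i; simp only [Finset.mem_Ico]; omega
  · intro i; simp only [Finset.mem_Ico]; omega
  · intro i _; ring
  · intro i _; ring
  intro j _
  rw [← hf (i - k) (j - l)]
  congr 1 <;> ring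

/-- The two decompositions of an ascending staircase band have the same multiplicities. -/
theorem rsum_ascending {f : ℤ → ℤ → ℕ} {V u : ℤ} (hf : ∀ i j, f (i + V) (j + u) = f i j)
    {a b w h : ℤ} (hw : 0 ≤ w) (hwV : w ≤ V) (hu : 0 ≤ u) (k : ℕ) :
    k * u ≤ h → rsum f (a + w) (b + k * u) ((k + 1) * V - w) u +
      rsum f (a + w - V) (b + k * u) V (h - k * u) =
      rsum f a b w h + rsum f (a + w) b (V - w) (h + u) := by
  induction k with
  | zero =>
    intro hk
    simp only [Nat.cast_zero, zero_mul, add_zero, zero_add, one_mul, sub_zero] at hk ⊢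
    have e₁ : rsum f (a + w - V) b V h = rsum f (a + w - V) b (V - w) h + rsum f a b w h := by
      have := rsum_add_width f (a + w - V) b (w := V - w) (w' := w) h (by omega) (by omega)
      rw [sub_add_cancel, show a + w - V + (V - w) = a by ring] at this
      exact this
    have e₂ := rsum_add_height f (a + w) b (V - w) (h := u) (h' := h) (by omega) (by omega)
    rw [rsum_translate hf (a := a + w - V) (b := b) (a' := a + w) (b' := b + u) (by ring) rfl] at e₂
    rw [add_comm h u, e₂, e₁]
    ring
  | succ k ih =>
    intro hk
    push_cast at hk ⊢
    have hku : (k : ℤ) * u ≤ h := by nlinarith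
    have hkV : 0 ≤ (k : ℤ) * V := mul_nonneg (by positivity) (by omega)
    rw [← ih hku]
    have e₁ : rsum f (a + w) (b + (k + 1) * u) ((k + 1 + 1) * V - w) u =
        rsum f (a + w - V) (b + k * u) V u + rsum f (a + w) (b + k * u) ((k + 1) * V - w) u := by
      rw [rsum_translate hf (a := a + w - V) (b := b + k * u) (by ring) (by ring),
        show ((k : ℤ) + 1 + 1) * V - w = V + ((k + 1) * V - w) by ring,
        rsum_add_width f _ _ _ (by omega) (by nlinarith), sub_add_cancel]
    have e₂ : rsum f (a + w - V) (b + k * u) V (h - k * u) = rsum f (a + w - V) (b + k * u) V u +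
        rsum f (a + w - V) (b + (k + 1) * u) V (h - (k + 1) * u) := by
      rw [show h - (k : ℤ) * u = u + (h - (k + 1) * u) by ring,
        rsum_add_height f _ _ _ (by omega) (by linarith)]
      congr 2
      ring
    rw [e₁, e₂]
    ring

theorem rsum_reflect (f : ℤ → ℤ → ℕ) (a b w h : ℤ) :
    rsum (fun i j => f (-1 - i) j) (-a - w) b w h = rsum f a b w h := by
  unfold rsum
  refine Finset.sum_nbij' (fun i => -1 - i) (fun i => -1 - i) ?_ ?_ ?_ ?_ ?_
  · intro i; simp only [Finset.mem_Ico]; omega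
  · intro i; simp only [Finset.mem_Ico]; omega
  · intro i _; ring
  · intro i _; ring
  intro i _
  rfl

theorem rsum_alt_ascending {f : ℤ → ℤ → ℕ} {V u : ℤ} (hf : ∀ i j, f (i + V) (j + u) = f i j)
    {a b w h : ℤ} (hw : 0 ≤ w) (hwV : w ≤ V) (hu : 0 ≤ u) {k : ℤ} (hk : 0 ≤ k) (h₁ : k * u ≤ h)
    (h₂ : h ≤ (k + 1) * u) :
    rsum f (a + w) (b + h) ((k + 1) * V - w) ((k + 1) * u - h) +
      rsum f (a + w) (b + (k + 1) * u) ((k + 2) * V - w) (h - k * u) =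
      rsum f a b w h + rsum f (a + w) b (V - w) (h + u) := by
  obtain ⟨n, rfl⟩ := Int.eq_ofNat_of_zero_le hk
  rw [← rsum_ascending hf hw hwV hu n h₁]
  have hkV : 0 ≤ (n : ℤ) * V := mul_nonneg (by positivity) (by omega)
  have x₂ := rsum_add_height f (a + w) (b + n * u) ((n + 1) * V - w) (h := h - n * u)
    (h' := (n + 1) * u - h) (by omega) (by omega)
  rw [show h - (n : ℤ) * u + ((n + 1) * u - h) = u by ring,
    show b + (n : ℤ) * u + (h - n * u) = b + h by ring] at x₂
  have x₃ := rsum_add_width f (a + w - V) (b + n * u) (w := V) (w' := (n + 1) * V - w) (h - n * u)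
    (by omega) (by linarith)
  rw [sub_add_cancel, show V + (((n : ℤ) + 1) * V - w) = (n + 2) * V - w by ring,
    ← rsum_translate hf (a' := a + w) (b' := b + (n + 1) * u) (by ring) (by ring)] at x₃
  rw [x₂, x₃]
  ring

theorem rsum_smul {f : ℤ → ℤ → ℕ} {V u : ℤ} (hf : ∀ i j, f (i + V) (j + u) = f i j) (k : ℤ) :
    ∀ i j, f (i + k * V) (j + k * u) = f i j := by
  induction k using Int.induction_on with
  | zero => simp
  | succ m ih =>
    intro i j
    rw [← ih i j, ← hf (i + m * V)]
    congr 1 <;> ring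
  | pred m ih =>
    intro i j
    rw [← ih i j, ← hf (i + (-m - 1) * V)]
    congr 1 <;> ring

theorem rsum_alt_descending {f : ℤ → ℤ → ℕ} {V u : ℤ} (hf : ∀ i j, f (i + V) (j - u) = f i j)
    {a b w h : ℤ} (hw : 0 ≤ w) (hwV : w ≤ V) (hu : 0 ≤ u) {k : ℤ} (hk : 1 ≤ k) (h₁ : k * u ≤ h)
    (h₂ : h ≤ (k + 1) * u) :
    rsum f a b (w + k * V) (h - k * u) +
      rsum f a (b + (h - k * u)) (w + (k - 1) * V) ((k + 1) * u - h) =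
      rsum f a b w h + rsum f (a + w) b (V - w) (h - u) := by
  have hf' : ∀ i j, f (-1 - (i + V)) (j + u) = f (-1 - i) j := fun i j => by
    rw [← hf (-1 - (i + V))]
    congr 1 <;> ring
  have hf₂ : ∀ i j, f (i + V) (j + -u) = f i j := hf
  have key := rsum_alt_ascending (f := fun i j => f (-1 - i) j) hf' (a := -a - V) (b := b)
    (w := V - w) (h := h - u) (by omega) (by omega) hu (k := k - 1) (by omega) (by linarith)
    (by linarith)
  have y : ∀ x y w h x', x = -x' - w → rsum (fun i j => f (-1 - i) j) x y w h =
      rsum f x' y w h := fun x y w h x' e => by rw [e, rsum_reflect]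
  rw [y _ _ _ _ (a - (k - 1) * V) (by ring), y _ _ _ _ (a - k * V) (by ring),
    y _ _ _ _ (a + w) (by ring), y _ _ _ _ a (by ring)] at key
  rw [← rsum_translate (rsum_smul hf₂ (k - 1)) (a := a - (k - 1) * V)
    (b := b + (h - u)) (a' := a) (b' := b + (h - k * u)) (by ring)
    (by ring), 
    ← rsum_translate (rsum_smul hf₂ k) (a := a - k * V) (b := b + (k - 1 + 1) * u) (a' := a)
    (b' := b) (by ring) (by ring)] at key
  rw [show (k - 1 + 1) * V - (V - w) = w + (k - 1) * V by ring,
    show (k - 1 + 2) * V - (V - w) = w + k * V by ring,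
    show (k - 1 + 1) * u - (h - u) = (k + 1) * u - h by ring,
    show h - u - (k - 1) * u = h - k * u by ring, show V - (V - w) = w by ring,
    show h - u + u = h by ring] at key
  rw [add_comm, key, add_comm]

/-! ### Pairs of consecutive rectangles -/

/-- A rectangle in the plane. -/
structure PRect where
  x : ℤ
  y : ℤ
  w : ℤ
  h : ℤ

namespace PRect

/-- The image under the reflection in the diagonal. -/
def T (r : PRect) : PRect := ⟨r.y, r.x, r.h, r.w⟩

/-- The image under the half turn about the origin. -/
def R (r : PRect) : PRect := ⟨-r.x - r.w, -r.y - r.h, r.w, r.h⟩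

/-- Equality up to a lattice translation. -/
def Eqv (L : ℤ → ℤ → Prop) (r r' : PRect) : Prop :=
  L (r'.x - r.x) (r'.y - r.y) ∧ r'.w = r.w ∧ r'.h = r.h

end PRect

open PRect

/-- The second rectangle of a pair starts at the lower right corner of the first one. -/
def C1 (L : ℤ → ℤ → Prop) (r s : PRect) : Prop := L (s.x - (r.x + r.w)) (s.y - r.y)

/-- The second rectangle of a pair ends at the upper left corner of the first one. -/
def C4 (L : ℤ → ℤ → Prop) (r s : PRect) : Prop := L (s.x + s.w - r.x) (s.y + s.h - (r.y + r.h))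

/-- The two decompositions of an L-shape of the first kind. -/
structure AltI (L : ℤ → ℤ → Prop) (r s r' s' : PRect) : Prop where
  c₁ : C1 L r s
  c₄ : ¬ C4 L r s
  lt : r.h < s.h
  p₁ : L (r'.x - (r.x + r.w)) (r'.y - (r.y + r.h))
  w₁ : r'.w = s.w
  h₁ : r'.h = s.h - r.h
  p₂ : L (s'.x - r.x) (s'.y - r.y)
  w₂ : s'.w = r.w + s.w
  h₂ : s'.h = r.h
  c₂ : ¬ L (s'.x - r'.x) (s'.y - (r'.y + r'.h))

/-- The two decompositions of an L-shape of the second kind. -/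
structure AltII (L : ℤ → ℤ → Prop) (r s r' s' : PRect) : Prop where
  c₁ : C1 L r s
  c₄ : ¬ C4 L r s
  lt : s.h < r.h
  p₁ : L (r'.x - r.x) (r'.y - r.y)
  w₁ : r'.w = r.w + s.w
  h₁ : r'.h = s.h
  p₂ : L (s'.x - r'.x) (s'.y - (r'.y + r'.h))
  w₂ : s'.w = r.w
  h₂ : s'.h = r.h - s.h
  c₃ : ¬ L (s'.x + s'.w - (r'.x + r'.w)) (s'.y + s'.h - r'.y)

/-- The two decompositions of an ascending staircase band. -/
structure AltP (L : ℤ → ℤ → Prop) (r s r' s' : PRect) : Prop where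
  c₁ : C1 L r s
  c₄ : C4 L r s
  lt : r.h < s.h
  p₁ : L (r'.x - (r.x + r.w)) (r'.y - (r.y + r.h))
  mul : ∃ k : ℤ, r.w + r'.w = k * (r.w + s.w) ∧ r.h + r'.h = k * (s.h - r.h)
  p₂ : L (s'.x - r'.x) (s'.y - (r'.y + r'.h))
  w₂ : s'.w = r'.w + (r.w + s.w)
  h₂ : s'.h = s.h - r.h - r'.h

/-- The two decompositions of a descending staircase band. -/
structure AltM (L : ℤ → ℤ → Prop) (r s r' s' : PRect) : Prop where
  c₁ : C1 L r s
  c₄ : C4 L r s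
  lt : s.h < r.h
  p₁ : L (r'.x - r.x) (r'.y - r.y)
  mul : ∃ k : ℤ, r'.w - r.w = k * (r.w + s.w) ∧ r.h - r'.h = k * (r.h - s.h)
  p₂ : L (s'.x - r'.x) (s'.y - (r'.y + r'.h))
  w₂ : s'.w = r'.w - (r.w + s.w)
  h₂ : s'.h = r.h - s.h - r'.h

/-- The pairs `(r, s)` and `(r', s')` of rectangles arise by cutting the same domain vertically
and horizontally, respectively. -/
def Alt (L : ℤ → ℤ → Prop) (r s r' s' : PRect) : Prop :=
  AltI L r s r' s' ∨ AltI L r.R s.R r'.R s'.R ∨ AltII L r s r' s' ∨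
    AltII L r.R s.R r'.R s'.R ∨ AltP L r s r' s' ∨ AltM L r s r' s'

section

variable {L P Q W Y Z : ℤ → ℤ → Prop} {r s r' s' r'' s'' : PRect}

/-- All sides of a rectangle are positive. -/
def PRect.Pos (r : PRect) : Prop := 0 < r.w ∧ 0 < r.h

theorem AltI.transpose (hL : IsLat L) (hr : r.Pos)
    (h : AltI (fun i j => L j i) r.T s.T r'.T s'.T) : AltI L r'.R s'.R r.R s.R := by
  obtain ⟨c₁, c₄, lt, p₁, w₁, h₁, p₂, w₂, h₂, c₂⟩ := h
  simp only [PRect.T, C1, C4, PRect.Pos] at *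
  constructor <;> simp only [PRect.R, C1, C4]
  · exact hL.sub' p₁ p₂
  · exact fun hc => c₂ (hL.neg' hc)
  · omega
  · exact hL.of p₁
  · omega
  · omega
  · exact hL.sub' p₁ c₁
  · omega
  · omega
  · exact fun hc => c₄ (hL.neg' hc)

theorem AltII.transpose (hL : IsLat L) (hs : s.Pos)
    (h : AltII (fun i j => L j i) r.T s.T r'.T s'.T) : AltII L r' s' r s := by
  obtain ⟨c₁, c₄, lt, p₁, w₁, h₁, p₂, w₂, h₂, c₃⟩ := h
  simp only [PRect.T, C1, C4, PRect.Pos] at *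
  refine ⟨?_, ?_, ?_, ?_, ?_, ?_, ?_, ?_, ?_, ?_⟩
  · exact hL.of p₂
  · exact fun hc => c₃ (hL.of hc)
  · omega
  · exact hL.neg' p₁
  · omega
  · omega
  · exact hL.of c₁
  · omega
  · omega
  · exact fun hc => c₄ (hL.of hc)

theorem AltP.transpose (hL : IsLat L) (hr : r.Pos) (hs : s.Pos)
    (h : AltP (fun i j => L j i) r.T s.T r'.T s'.T) : AltP L r' s' r s := by
  obtain ⟨c₁, c₄, lt, p₁, ⟨k, k₁, k₂⟩, p₂, w₂, h₂⟩ := h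
  simp only [PRect.T, C1, C4, PRect.Pos] at *
  have hv : L (s.w - r.w) (r.h + s.h) := hL.sub' c₄ c₁
  refine ⟨?_, ?_, ?_, ?_, ?_, ?_, ?_, ?_⟩
  · exact hL.of p₂
  · exact hL.add' p₂ hv
  · omega
  · exact hL.sub' (hL.neg p₁) (hL.smul hv k) (by linarith) (by linarith)
  · exact ⟨k, by rw [add_comm, k₂]; congr 1; omega, by rw [add_comm, k₁]; congr 1; omega⟩
  · exact hL.of c₁
  · omega
  · omega

theorem AltM.transpose (hL : IsLat L) (hr : r.Pos) (hs : s.Pos)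
    (h : AltM (fun i j => L j i) r.T s.T r'.T s'.T) : AltM L r' s' r s := by
  obtain ⟨c₁, c₄, lt, p₁, ⟨k, k₁, k₂⟩, p₂, w₂, h₂⟩ := h
  simp only [PRect.T, C1, C4, PRect.Pos] at *
  have hv : L (s.w - r.w) (r.h + s.h) := hL.sub' c₄ c₁
  refine ⟨?_, ?_, ?_, ?_, ?_, ?_, ?_, ?_⟩
  · exact hL.of p₂
  · exact hL.sub' p₂ hv
  · omega
  · exact hL.neg' p₁
  · exact ⟨k, by rw [k₂]; congr 1; omega, by rw [k₁]; congr 1; omega⟩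
  · exact hL.of c₁
  · omega
  · omega

theorem PRect.R_R (r : PRect) : r.R.R = r := by
  obtain ⟨x, y, w, h⟩ := r
  show PRect.mk (-(-x - w) - w) (-(-y - h) - h) w h = _
  congr 1 <;> omega

theorem Alt.transpose (hL : IsLat L) (hr : r.Pos) (hs : s.Pos)
    (h : Alt (fun i j => L j i) r.T s.T r'.T s'.T) : Alt L r' s' r s := by
  rcases h with h | h | h | h | h | h
  · exact Or.inr (Or.inl (AltI.transpose hL hr h))
  · have := AltI.transpose (r := r.R) (s := s.R) (r' := r'.R) (s' := s'.R) hL hr h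
    simp only [PRect.R_R] at this
    exact Or.inl this
  · exact Or.inr (Or.inr (Or.inl (AltII.transpose hL hs h)))
  · exact Or.inr (Or.inr (Or.inr (Or.inl (AltII.transpose (r := r.R) (s := s.R) (r' := r'.R)
      (s' := s'.R) hL hs h))))
  · exact Or.inr (Or.inr (Or.inr (Or.inr (Or.inl (AltP.transpose hL hr hs h)))))
  · exact Or.inr (Or.inr (Or.inr (Or.inr (Or.inr (AltM.transpose hL hr hs h)))))

theorem C1_R (hL : IsLat L) : C1 L r.R s.R ↔ C4 L r s :=
  ⟨fun h => hL.neg' h (by simp only [PRect.R]; omega) (by simp only [PRect.R]; omega),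
    fun h => hL.neg' h (by simp only [PRect.R]; omega) (by simp only [PRect.R]; omega)⟩

theorem C4_R (hL : IsLat L) : C4 L r.R s.R ↔ C1 L r s :=
  ⟨fun h => hL.neg' h (by simp only [PRect.R]; omega) (by simp only [PRect.R]; omega),
    fun h => hL.neg' h (by simp only [PRect.R]; omega) (by simp only [PRect.R]; omega)⟩

theorem PRect.Eqv.of_R (hL : IsLat L) (h : Eqv L r.R r'.R) : Eqv L r r' := by
  obtain ⟨h₁, h₂, h₃⟩ := h
  simp only [PRect.R] at *
  exact ⟨hL.neg' h₁, h₂, h₃⟩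

theorem AltI.unique (hL : IsLat L) (h : AltI L r s r' s') (h' : AltI L r s r'' s'') :
    Eqv L r' r'' ∧ Eqv L s' s'' := by
  have := h.w₁; have := h'.w₁; have := h.h₁; have := h'.h₁
  have := h.w₂; have := h'.w₂; have := h.h₂; have := h'.h₂
  exact ⟨⟨hL.sub' h'.p₁ h.p₁, by omega, by omega⟩,
    hL.sub' h'.p₂ h.p₂, by omega, by omega⟩

theorem AltII.unique (hL : IsLat L) (h : AltII L r s r' s') (h' : AltII L r s r'' s'') :
    Eqv L r' r'' ∧ Eqv L s' s'' := by
  have := h.w₁; have := h'.w₁; have := h.h₁; have := h'.h₁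
  have := h.w₂; have := h'.w₂; have := h.h₂; have := h'.h₂
  have hp := hL.sub' h'.p₁ h.p₁ (i' := r''.x - r'.x) (j' := r''.y - r'.y)
  exact ⟨⟨hp, by omega, by omega⟩,
    hL.add' hp (hL.sub' h'.p₂ h.p₂ rfl rfl), by omega, by omega⟩

theorem eq_of_mul_near {k k' u d : ℤ} (h : k * u - k' * u = d) (h₁ : -u < d) (h₂ : d < u) :
    k = k' := by
  have hu : 0 < u := by omega
  rcases lt_trichotomy k k' with hk | hk | hk
  · have := mul_le_mul_of_nonneg_right (show k + 1 ≤ k' by omega) hu.le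
    have : (k + 1) * u = k * u + u := by ring
    omega
  · exact hk
  · have := mul_le_mul_of_nonneg_right (show k' + 1 ≤ k by omega) hu.le
    have : (k' + 1) * u = k' * u + u := by ring
    omega

theorem AltP.unique (hL : IsLat L) (hr' : r'.Pos) (hs' : s'.Pos) (hr'' : r''.Pos) (hs'' : s''.Pos)
    (h : AltP L r s r' s') (h' : AltP L r s r'' s'') : Eqv L r' r'' ∧ Eqv L s' s'' := by
  obtain ⟨k, k₁, k₂⟩ := h.mul
  obtain ⟨l, l₁, l₂⟩ := h'.mul
  have := hr'.2; have := hs'.2; have := hr''.2; have := hs''.2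
  have := h.w₂; have := h'.w₂; have := h.h₂; have := h'.h₂
  have hkl : k = l := eq_of_mul_near (u := s.h - r.h) (d := r'.h - r''.h) (by linarith) (by omega)
    (by omega)
  subst hkl
  have hp := hL.sub' h'.p₁ h.p₁ (i' := r''.x - r'.x) (j' := r''.y - r'.y)
  exact ⟨⟨hp, by omega, by omega⟩,
    hL.add' hp (hL.sub' h'.p₂ h.p₂ rfl rfl), by omega, by omega⟩

theorem AltM.unique (hL : IsLat L) (hr' : r'.Pos) (hs' : s'.Pos) (hr'' : r''.Pos) (hs'' : s''.Pos)
    (h : AltM L r s r' s') (h' : AltM L r s r'' s'') : Eqv L r' r'' ∧ Eqv L s' s'' := by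
  obtain ⟨k, k₁, k₂⟩ := h.mul
  obtain ⟨l, l₁, l₂⟩ := h'.mul
  have := hr'.2; have := hs'.2; have := hr''.2; have := hs''.2
  have := h.w₂; have := h'.w₂; have := h.h₂; have := h'.h₂
  have hkl : k = l := eq_of_mul_near (u := r.h - s.h) (d := r''.h - r'.h) (by linarith) (by omega)
    (by omega)
  subst hkl
  have hp := hL.sub' h'.p₁ h.p₁ (i' := r''.x - r'.x) (j' := r''.y - r'.y)
  exact ⟨⟨hp, by omega, by omega⟩,
    hL.add' hp (hL.sub' h'.p₂ h.p₂ rfl rfl), by omega, by omega⟩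

/-- The horizontally cut pair is determined by the vertically cut one. -/
theorem Alt.unique (hL : IsLat L) (hr' : r'.Pos) (hs' : s'.Pos) (hr'' : r''.Pos) (hs'' : s''.Pos)
    (h : Alt L r s r' s') (h' : Alt L r s r'' s'') : Eqv L r' r'' ∧ Eqv L s' s'' := by
  rcases h with h | h | h | h | h | h <;> rcases h' with h' | h' | h' | h' | h' | h' <;>
  first
  | exact AltI.unique hL h h'
  | exact AltII.unique hL h h'
  | exact AltP.unique hL hr' hs' hr'' hs'' h h'
  | exact AltM.unique hL hr' hs' hr'' hs'' h h'
  | exact ⟨(AltI.unique hL h h').1.of_R hL, (AltI.unique hL h h').2.of_R hL⟩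
  | exact ⟨(AltII.unique hL h h').1.of_R hL, (AltII.unique hL h h').2.of_R hL⟩
  | exact (lt_asymm h.lt h'.lt).elim
  | exact (h.c₄ h'.c₄).elim
  | exact (h'.c₄ h.c₄).elim
  | exact (h'.c₄ ((C4_R hL).2 h.c₁)).elim
  | exact (h.c₄ ((C4_R hL).2 h'.c₁)).elim

theorem Alt.class (hL : IsLat L) (h : Alt L r s r' s') : C1 L r s ∨ C4 L r s := by
  rcases h with h | h | h | h | h | h
  exacts [Or.inl h.c₁, Or.inr ((C1_R hL).1 h.c₁), Or.inl h.c₁, Or.inr ((C1_R hL).1 h.c₁),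
    Or.inl h.c₁, Or.inl h.c₁]

theorem Alt.heights (h : Alt L r s r' s') : r.h ≠ s.h := by
  rcases h with h | h | h | h | h | h
  exacts [h.lt.ne, h.lt.ne, h.lt.ne', h.lt.ne', h.lt.ne, h.lt.ne']

/-- `r` is an empty rectangle from `P` to `Q`. -/
def SStep (L P Q : ℤ → ℤ → Prop) (r : PRect) : Prop := Step L P Q r.x r.y r.w r.h

/-- The number of times a rectangle covers a cell, weighted by `f`. -/
def PRect.sum (f : ℤ → ℤ → ℕ) (r : PRect) : ℕ := rsum f r.x r.y r.w r.h

/-- `(r', s')` is a decomposition from `P` to `Z` of the same domain as `(r, s)`, with an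
intermediate state different from `W`. -/
def Partner (L P W Z : ℤ → ℤ → Prop) (r s r' s' : PRect) : Prop :=
  (∃ Y, IsSt L Y ∧ SStep L P Y r' ∧ SStep L Y Z s' ∧ ∃ i j, W i j ∧ ¬ Y i j) ∧
    ∀ f : ℤ → ℤ → ℕ, (∀ i j k l, L k l → f (i + k) (j + l) = f i j) →
      r'.sum f + s'.sum f = r.sum f + s.sum f

theorem SStep.pos (h : SStep L P Q r) : r.Pos := ⟨h.hw, h.hh⟩

theorem exists_alt_of_C1 (hL : IsLat L) (hP : IsSt L P) (hW : IsSt L W) (hZ : IsSt L Z)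
    (h₁ : SStep L P W r) (h₂ : SStep L W Z s) (hc : C1 L r s) (hne : r.h ≠ s.h) :
    ∃ r' s', Partner L P W Z r s r' s' ∧ (AltI L r s r' s' ∨ AltII L r s r' s' ∨
      AltP L r s r' s' ∨ AltM L r s r' s') := by
  obtain ⟨a, b, w, h⟩ := r
  obtain ⟨c, d, w', h'⟩ := s
  simp only [SStep, C1] at h₁ h₂ hc
  simp only at hne
  have hs : ∀ f : ℤ → ℤ → ℕ, (∀ i j k l, L k l → f (i + k) (j + l) = f i j) →
      rsum f c d w' h' = rsum f (a + w) b w' h' := fun f hf =>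
    rsum_translate (k := c - (a + w)) (l := d - b) (fun i j => hf i j _ _ hc) (by omega) (by omega)
  have h₂' := h₂.translate hL hW hZ (a' := a + w) (b' := b) (hL.neg hc) (by omega) (by omega)
  have hw := h₁.hw
  have hh := h₁.hh
  have hw' := h₂.hw
  have hh' := h₂.hh
  by_cases hv : L (w + w') (h' - h)
  · have hc₄ : C4 L ⟨a, b, w, h⟩ ⟨c, d, w', h'⟩ := hL.add' hc hv (by dsimp; omega) (by dsimp; omega)
    rcases lt_or_gt_of_ne hne with hlt | hlt
    · obtain ⟨k, hk⟩ : ∃ k, k = h / (h' - h) := ⟨_, rfl⟩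
      have e₁ := Int.mul_ediv_add_emod h (h' - h)
      have e₂ := Int.emod_nonneg h (show h' - h ≠ 0 by omega)
      have e₃ := Int.emod_lt_of_pos h (show 0 < h' - h by omega)
      have e₄ : 0 ≤ k := hk ▸ Int.ediv_nonneg (by omega) (by omega)
      rw [← hk, mul_comm] at e₁
      have e₅ := band_not_multiple hL hP h₁ hv k
      have e₆ : (k + 1) * (h' - h) = k * (h' - h) + (h' - h) := by ring
      obtain ⟨Y, hY, t₁, t₂, hne⟩ := ascending hL hP hW hZ h₁ h₂' hlt hv e₄ (by omega) (by omega)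
      refine ⟨⟨_, _, _, _⟩, ⟨_, _, _, _⟩, ⟨⟨Y, hY, t₁, t₂, hne⟩, ?_⟩,
        Or.inr (Or.inr (Or.inl ⟨hc, hc₄, hlt, ?_, ⟨k + 1, ?_, ?_⟩, ?_, ?_, ?_⟩))⟩
      · intro f hf
        simp only [PRect.sum]
        rw [hs f hf]
        have := rsum_alt_ascending (f := f) (V := w + w') (u := h' - h)
          (fun i j => hf i j _ _ hv) (a := a) (b := b) (w := w) (h := h) (by omega) (by omega)
          (by omega) e₄ (by omega) (by omega)
        rwa [show w + w' - w = w' by ring, show h + (h' - h) = h' by ring] at this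
      · exact hL.of hL.zero (by dsimp; omega) (by dsimp; omega)
      · dsimp; ring
      · dsimp; ring
      · exact hL.of hL.zero (by dsimp; omega) (by dsimp; ring)
      · dsimp; ring
      · dsimp; ring
    · obtain ⟨k, hk⟩ : ∃ k, k = h / (h - h') := ⟨_, rfl⟩
      have e₁ := Int.mul_ediv_add_emod h (h - h')
      have e₂ := Int.emod_nonneg h (show h - h' ≠ 0 by omega)
      have e₃ := Int.emod_lt_of_pos h (show 0 < h - h' by omega)
      have e₄ : 1 ≤ k := hk ▸ (Int.le_ediv_iff_mul_le (by omega)).2 (by omega)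
      rw [← hk, mul_comm] at e₁
      have e₅ := band_not_multiple hL hP h₁ hv (-k)
      have e₅' : -k * (h' - h) = k * (h - h') := by ring
      have e₆ : (k + 1) * (h - h') = k * (h - h') + (h - h') := by ring
      obtain ⟨Y, hY, t₁, t₂, hne⟩ := descending hL hP hW hZ h₁ h₂' hlt hv e₄ (by omega) (by omega)
      refine ⟨⟨_, _, _, _⟩, ⟨_, _, _, _⟩, ⟨⟨Y, hY, t₁, t₂, hne⟩, ?_⟩,
        Or.inr (Or.inr (Or.inr ⟨hc, hc₄, hlt, ?_, ⟨k, ?_, ?_⟩, ?_, ?_, ?_⟩))⟩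
      · intro f hf
        simp only [PRect.sum]
        rw [hs f hf]
        have := rsum_alt_descending (f := f) (V := w + w') (u := h - h')
          (fun i j => hf i j _ (-(h - h')) (hL.of hv rfl)) (a := a) (b := b) (w := w)
          (h := h) (by omega) (by omega) (by omega) e₄ (by omega) (by omega)
        rwa [show w + w' - w = w' by ring, show h - (h - h') = h' by ring] at this
      · exact hL.of hL.zero (by dsimp; omega) (by dsimp; omega)
      · dsimp; ring
      · dsimp; ring
      · exact hL.of hL.zero (by dsimp; omega) (by dsimp; ring)
      · dsimp; ring
      · dsimp; ring
  · have hc₄ : ¬ C4 L ⟨a, b, w, h⟩ ⟨c, d, w', h'⟩ := fun h =>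
      hv (hL.sub' h hc (by dsimp; omega) (by dsimp; omega))
    rcases lt_or_gt_of_ne hne with hlt | hlt
    · obtain ⟨Y, hY, t₁, t₂, hne⟩ := lshape_upper hL hP hW hZ h₁ h₂' hlt hv
      refine ⟨⟨_, _, _, _⟩, ⟨_, _, _, _⟩, ⟨⟨Y, hY, t₁, t₂, hne⟩, ?_⟩,
        Or.inl ⟨hc, hc₄, hlt, ?_, rfl, rfl, ?_, rfl, rfl, ?_⟩⟩
      · intro f hf
        simp only [PRect.sum]
        rw [hs f hf, rsum_add_width f a b h (by omega) (by omega)]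
        have := rsum_add_height f (a + w) b w' (h := h) (h' := h' - h) (by omega) (by omega)
        rw [add_sub_cancel] at this
        rw [this]
        ring
      · exact hL.of hL.zero (by dsimp; omega) (by dsimp; omega)
      · exact hL.of hL.zero (by dsimp; omega) (by dsimp; omega)
      · intro hl
        dsimp at hl
        have hx : P (a + w) (b + h') := hP.trn hL h₁.sw hl
        have := h₁.emb.apply (hL.sub' (hP.col hx h₁.ne) hl (i' := w) (j' := h))
        omega
    · obtain ⟨Y, hY, t₁, t₂, hne⟩ := lshape_lower hL hP hW hZ h₁ h₂' hlt hv
      refine ⟨⟨_, _, _, _⟩, ⟨_, _, _, _⟩, ⟨⟨Y, hY, t₁, t₂, hne⟩, ?_⟩,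
        Or.inr (Or.inl ⟨hc, hc₄, hlt, ?_, rfl, rfl, ?_, rfl, rfl, ?_⟩)⟩
      · intro f hf
        simp only [PRect.sum]
        rw [hs f hf, rsum_add_width f a b h' (by omega) (by omega)]
        have := rsum_add_height f a b w (h := h') (h' := h - h') (by omega) (by omega)
        rw [add_sub_cancel] at this
        rw [this]
        ring
      · exact hL.of hL.zero (by dsimp; omega) (by dsimp; omega)
      · exact hL.of hL.zero (by dsimp; omega) (by dsimp; omega)
      · intro hl
        dsimp at hl
        have hx : P (a + (w + w')) b := hP.trn hL h₁.ne hl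
        have := h₁.emb.apply (hL.add' (hP.row h₁.sw hx) hl (i' := w) (j' := h))
        omega

theorem SStep.transpose (h : SStep L P Q r) :
    SStep (fun i j => L j i) (fun i j => P j i) (fun i j => Q j i) r.T := Step.transpose h

theorem SStep.rotate (h : SStep L P Q r) :
    SStep (fun i j => L (-i) (-j)) (fun i j => P (-i) (-j)) (fun i j => Q (-i) (-j)) r.R :=
  Step.rotate h rfl rfl

theorem PRect.sum_R (f : ℤ → ℤ → ℕ) (r : PRect) :
    r.R.sum (fun i j => f (-1 - i) (-1 - j)) = r.sum f := rsum_rotate _ _ _ _ _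

theorem Partner.rotate (hL : IsLat L) (h : Partner L P W Z r s r' s') :
    Partner (fun i j => L (-i) (-j)) (fun i j => P (-i) (-j)) (fun i j => W (-i) (-j))
      (fun i j => Z (-i) (-j)) r.R s.R r'.R s'.R := by
  obtain ⟨⟨Y, hY, t₁, t₂, i, j, hw, hy⟩, hf⟩ := h
  refine ⟨⟨_, hY.rotate hL, t₁.rotate, t₂.rotate, -i, -j, by simpa using hw, by simpa using hy⟩,
    fun f hf' => ?_⟩
  have := hf (fun i j => f (-1 - i) (-1 - j)) fun i j k l hl => by
    rw [← hf' (-1 - (i + k)) (-1 - (j + l)) k l (hL.neg hl)]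
    congr 1 <;> ring
  rw [← PRect.sum_R _ r', ← PRect.sum_R _ s', ← PRect.sum_R _ r, ← PRect.sum_R _ s] at this
  simpa using this

theorem Partner.transpose (h : Partner L P W Z r s r' s') :
    Partner (fun i j => L j i) (fun i j => P j i) (fun i j => W j i)
      (fun i j => Z j i) r.T s.T r'.T s'.T := by
  obtain ⟨⟨Y, hY, t₁, t₂, i, j, hw, hy⟩, hf⟩ := h
  refine ⟨⟨_, hY.transpose, t₁.transpose, t₂.transpose, j, i, hw, hy⟩, fun f hf' => ?_⟩
  have := hf (fun i j => f j i) fun i j k l hl => hf' j i l k hl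
  simpa only [PRect.sum, PRect.T, rsum_transpose (fun i j => f j i)] using this

/-- A pair of consecutive rectangles that has a vertical cut, and is not an annulus, has a
partner with a horizontal cut. -/
theorem exists_alt (hL : IsLat L) (hP : IsSt L P) (hW : IsSt L W) (hZ : IsSt L Z)
    (h₁ : SStep L P W r) (h₂ : SStep L W Z s) (hc : C1 L r s ∨ C4 L r s) (hh : r.h ≠ s.h) :
    ∃ r' s', Partner L P W Z r s r' s' ∧ Alt L r s r' s' := by
  rcases hc with hc | hc
  · obtain ⟨r', s', hp, h⟩ := exists_alt_of_C1 hL hP hW hZ h₁ h₂ hc hh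
    refine ⟨r', s', hp, ?_⟩
    rcases h with h | h | h | h
    exacts [Or.inl h, Or.inr (Or.inr (Or.inl h)), Or.inr (Or.inr (Or.inr (Or.inr (Or.inl h)))),
      Or.inr (Or.inr (Or.inr (Or.inr (Or.inr h))))]
  by_cases hc₁ : C1 L r s
  · obtain ⟨r', s', hp, h⟩ := exists_alt_of_C1 hL hP hW hZ h₁ h₂ hc₁ hh
    refine ⟨r', s', hp, ?_⟩
    rcases h with h | h | h | h
    exacts [(h.c₄ hc).elim, (h.c₄ hc).elim, Or.inr (Or.inr (Or.inr (Or.inr (Or.inl h)))),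
      Or.inr (Or.inr (Or.inr (Or.inr (Or.inr h))))]
  have eL : (fun i j => L (-i) (-j)) = L := by
    funext i j
    exact propext ⟨fun h => hL.neg' h, fun h => hL.neg h⟩
  have hP' := hP.rotate hL
  have hW' := hW.rotate hL
  have hZ' := hZ.rotate hL
  have h₁' := h₁.rotate
  have h₂' := h₂.rotate
  rw [eL] at hP' hW' hZ' h₁' h₂'
  obtain ⟨r', s', hp, h⟩ := exists_alt_of_C1 hL hP' hW' hZ' h₁' h₂' ((C1_R hL).2 hc) hh
  have hp' := hp.rotate hL
  rw [eL] at hp'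
  simp only [neg_neg, PRect.R_R] at hp'
  refine ⟨r'.R, s'.R, hp', ?_⟩
  have hn : ¬ C4 L r.R s.R := fun h => hc₁ ((C4_R hL).1 h)
  rcases h with h | h | h | h
  · exact Or.inr (Or.inl (by simpa only [PRect.R_R] using h))
  · exact Or.inr (Or.inr (Or.inr (Or.inl (by simpa only [PRect.R_R] using h))))
  · exact (hn h.c₄).elim
  · exact (hn h.c₄).elim

/-- A pair of consecutive rectangles that has a horizontal cut, and is not an annulus, has a
partner with a vertical cut. -/
theorem exists_alt' (hL : IsLat L) (hP : IsSt L P) (hW : IsSt L W) (hZ : IsSt L Z)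
    (h₁ : SStep L P W r) (h₂ : SStep L W Z s)
    (hc : C1 (fun i j => L j i) r.T s.T ∨ C4 (fun i j => L j i) r.T s.T) (hh : r.w ≠ s.w) :
    ∃ r' s', Partner L P W Z r s r' s' ∧ Alt L r' s' r s := by
  obtain ⟨r', s', hp, h⟩ := exists_alt hL.transpose hP.transpose hW.transpose hZ.transpose
    h₁.transpose h₂.transpose hc hh
  refine ⟨r'.T, s'.T, hp.transpose, Alt.transpose (r' := r'.T) (s' := s'.T) hL h₁.pos h₂.pos h⟩

/-- A pair of consecutive rectangles cannot have both a vertical and a horizontal cut. -/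
theorem not_both_cuts (hL : IsLat L) (h₁ : SStep L P W r) (h₂ : SStep L W Z s)
    (hc : C1 L r s ∨ C4 L r s)
    (hc' : C1 (fun i j => L j i) r.T s.T ∨ C4 (fun i j => L j i) r.T s.T) : False := by
  have := h₁.hw; have := h₁.hh; have := h₂.hw; have := h₂.hh
  rcases hc with hc | hc <;> rcases hc' with hc' | hc' <;> simp only [C1, C4, PRect.T] at hc hc'
  · have := h₁.emb.apply (hL.sub' hc hc' (i' := -r.w) (j' := r.h))
    omega
  · have := h₂.emb.apply (hL.sub' hc' hc (i' := s.w) (j' := s.h))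
    omega
  · have := h₂.emb.apply (hL.sub' hc hc' (i' := s.w) (j' := s.h))
    omega
  · have := h₁.emb.apply (hL.sub' hc hc' (i' := r.w) (j' := -r.h))
    omega

/-- A pair of consecutive rectangles has neither a vertical nor a horizontal cut. -/
def NoCut (L : ℤ → ℤ → Prop) (r s : PRect) : Prop :=
  ¬ (C1 L r s ∨ C4 L r s) ∧ ¬ (C1 (fun i j => L j i) r.T s.T ∨ C4 (fun i j => L j i) r.T s.T)

/-- Rectangles without a cut can be exchanged. -/
theorem exists_commute (hL : IsLat L) (hP : IsSt L P) (hW : IsSt L W) (hZ : IsSt L Z)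
    (h₁ : SStep L P W r) (h₂ : SStep L W Z s) (hc : NoCut L r s) :
    Partner L P W Z r s s r ∧ NoCut L s r := by
  have hc' := hc
  simp only [NoCut, not_or, C1, C4, PRect.T] at hc'
  obtain ⟨⟨n₁, n₂⟩, n₃, n₄⟩ := hc'
  obtain ⟨Y, hY, t₁, t₂, hne⟩ := commute hL hP hW hZ h₁ h₂ n₁ n₃ n₄ n₂
  refine ⟨⟨⟨Y, hY, t₁, t₂, hne⟩, fun f _ => add_comm _ _⟩, ?_⟩
  have := t₁.hw; have := t₁.hh
  simp only [NoCut, not_or, C1, C4, PRect.T]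
  refine ⟨⟨fun h => ?_, fun h => ?_⟩, fun h => ?_, fun h => ?_⟩
  · have hx : P (s.x + s.w) s.y := hP.trn hL h₁.sw h
    have := t₁.emb.apply (hP.row t₁.sw hx)
    omega
  · have hx : P s.x (s.y + s.h) := hP.trn hL h₁.ne h
    have := t₁.emb.apply (hP.col t₁.sw hx)
    omega
  · have hx : P s.x (s.y + s.h) := hP.trn hL h₁.sw h
    have := t₁.emb.apply (hP.col t₁.sw hx)
    omega
  · have hx : P (s.x + s.w) s.y := hP.trn hL h₁.ne h
    have := t₁.emb.apply (hP.row t₁.sw hx)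
    omega

/-- A horizontal annulus has height one, and returns to the initial state. -/
theorem annulus (hL : IsLat L) (hP : IsSt L P) (hW : IsSt L W) (hZ : IsSt L Z)
    (h₁ : SStep L P W r) (h₂ : SStep L W Z s) (hc : C1 L r s ∨ C4 L r s) (hh : r.h = s.h) :
    C1 L r s ∧ L (r.w + s.w) 0 ∧ r.h = 1 ∧ ∀ i j, P i j → Z i j := by
  have := h₁.hw; have := h₁.hh; have := h₂.hw; have := h₂.hh
  have key : C1 L r s ∧ L (r.w + s.w) 0 := by
    rcases hc with hc | hc
    · refine ⟨hc, ?_⟩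
      have hx : W (r.x + (r.w + s.w)) (r.y + r.h) := hW.trn hL h₂.ne hc
      exact hL.of (hW.row h₁.nw hx) (by omega) rfl
    · have hx : W (r.x - s.w) r.y := hW.trn hL h₂.sw hc
      have hl := hL.of (hW.row hx h₁.se) (i' := r.w + s.w) (by omega) rfl
      exact ⟨hL.sub' hc hl, hl⟩
  obtain ⟨hc, hv⟩ := key
  have h₂' := h₂.translate hL hW hZ (a' := r.x + r.w) (b' := r.y) (hL.neg hc) (by omega) (by omega)
  refine ⟨hc, hv, ?_, ?_⟩
  · by_contra hne
    obtain ⟨i, hi⟩ := hP.rowex (r.y + 1)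
    have e₁ := Int.mul_ediv_add_emod (i - r.x) (r.w + s.w)
    have e₂ := Int.emod_nonneg (i - r.x) (show r.w + s.w ≠ 0 by omega)
    have e₃ := Int.emod_lt_of_pos (i - r.x) (show 0 < r.w + s.w by omega)
    obtain ⟨c, hc'⟩ : ∃ c, c = (i - r.x) % (r.w + s.w) := ⟨_, rfl⟩
    rw [← hc'] at e₁ e₂ e₃
    have hi' : P (r.x + c) (r.y + 1) := hP.trn hL hi (hL.smul hv ((i - r.x) / (r.w + s.w)))
      (by linarith) (by ring)
    by_cases hcw : c ≤ r.w
    · have := h₁.emp.apply hi'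
      omega
    rcases h₁.rest _ _ hi' with hq | hl | hl
    · have := h₂'.emp.apply hq
      omega
    · by_cases hcw' : c ≤ s.w
      · have := h₂.emb.apply hl
        omega
      · have := h₁.emb.apply (hL.sub' hl hv (i' := c - (r.w + s.w)) (j' := 1))
        omega
    · have := h₂.emb.apply hl
      omega
  · intro i j hp
    rcases h₁.rest _ _ hp with hq | hl | hl
    · rcases h₂'.rest _ _ hq with hz | hl | hl
      · exact hz
      · have hx : P (i - r.w) j := hP.tr h₁.sw hl
        have := h₁.emb.apply (hP.row hx hp)
        omega
      · have hx : P (i - s.w) j := hP.tr h₁.ne hl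
        have := h₂.emb.apply (hP.row hx hp)
        omega
    · exact hZ.tr h₂'.se (hL.sub' hl hv rfl rfl)
    · exact hZ.tr h₂'.nw hl

end

end Planar

open Planar

/-! ### Lifting to the plane -/

section

variable {p : ℕ} {q : ℤ} {N : ℕ}

/-- The point of the torus with the given coordinates. -/
def pt (i j : ℤ) : Torus p q N := QuotientAddGroup.mk (i, j)

variable (p q N) in
/-- Membership in the lattice, in coordinates. -/
def lat (i j : ℤ) : Prop := (i, j) ∈ lattice p q N

/-- The preimage in the plane of a set of points of the torus. -/
def lift (x : Finset (Torus p q N)) (i j : ℤ) : Prop := pt i j ∈ x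

theorem isLat_lat : IsLat (lat p q N) :=
  ⟨(lattice p q N).zero_mem, fun h h' => (lattice p q N).add_mem h h',
    fun h => (lattice p q N).neg_mem h⟩

theorem lat_iff {i j : ℤ} :
    lat p q N i j ↔ ∃ m n : ℤ, i = m * (p * N) + n * (q * N) ∧ j = n * N := by
  unfold lat lattice
  rw [AddSubgroup.mem_closure_pair]
  simp only [Prod.smul_mk, smul_eq_mul, mul_zero, Prod.mk_add_mk, zero_add, Prod.mk.injEq]
  constructor
  · rintro ⟨m, n, h₁, h₂⟩
    exact ⟨m, n, h₁.symm, h₂.symm⟩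
  · rintro ⟨m, n, h₁, h₂⟩
    exact ⟨m, n, h₁.symm, h₂.symm⟩

theorem pt_eq_iff {i j i' j' : ℤ} :
    (pt i j : Torus p q N) = pt i' j' ↔ lat p q N (i' - i) (j' - j) := by
  unfold pt lat
  rw [QuotientAddGroup.eq]
  simp only [Prod.neg_mk, Prod.mk_add_mk]
  rw [neg_add_eq_sub, neg_add_eq_sub]

theorem exists_pt (t : Torus p q N) : ∃ i j, pt i j = t := by
  induction t using QuotientAddGroup.induction_on with
  | H v => exact ⟨v.1, v.2, rfl⟩

theorem shift_pt (a b i j : ℤ) : shift (pt a b : Torus p q N) i j = pt (a + i) (b + j) := rfl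

theorem row_pt (i j : ℤ) : row (pt i j : Torus p q N) = (j : ZMod N) := rfl

theorem col_pt (i j : ℤ) : col (pt i j : Torus p q N) = (i : ZMod N) := rfl

theorem shift_shift (t : Torus p q N) (a b c d : ℤ) :
    shift (shift t a b) c d = shift t (a + c) (b + d) := by
  obtain ⟨i, j, rfl⟩ := exists_pt t
  simp only [shift_pt, add_assoc]

theorem shift_zero (t : Torus p q N) : shift t 0 0 = t := by
  obtain ⟨i, j, rfl⟩ := exists_pt t
  simp only [shift_pt, add_zero]

section

variable [NeZero p] [NeZero N]

theorem lat_zero_right {k : ℤ} : lat p q N k 0 ↔ ((p : ℤ) * N) ∣ k := by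
  have hN : (N : ℤ) ≠ 0 := by exact_mod_cast NeZero.ne N
  rw [lat_iff]
  constructor
  · rintro ⟨m, n, h₁, h₂⟩
    have : n = 0 := by
      rcases mul_eq_zero.1 h₂.symm with h | h
      · exact h
      · exact (hN h).elim
    subst this
    exact ⟨m, by rw [h₁]; ring⟩
  · rintro ⟨m, rfl⟩
    exact ⟨m, 0, by ring, by ring⟩

theorem lat_zero_left (hpq : Int.gcd (p : ℤ) q = 1) {k : ℤ} :
    lat p q N 0 k ↔ ((p : ℤ) * N) ∣ k := by
  have hN : (N : ℤ) ≠ 0 := by exact_mod_cast NeZero.ne N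
  rw [lat_iff]
  constructor
  · rintro ⟨m, n, h₁, h₂⟩
    have h₃ : n * q = p * (-m) := by
      have : (m * p + n * q) * N = 0 := by rw [h₁]; ring
      rcases mul_eq_zero.1 this with h | h
      · linarith
      · exact (hN h).elim
    have h₄ : (p : ℤ) ∣ n := by
      have hc : IsCoprime (p : ℤ) q := Int.isCoprime_iff_gcd_eq_one.2 hpq
      exact hc.dvd_of_dvd_mul_right ⟨-m, h₃⟩
    rw [h₂]
    exact mul_dvd_mul_right h₄ _
  · rintro ⟨m, rfl⟩
    exact ⟨-m * q, m * p, by ring, by ring⟩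

theorem lat_height_dvd {i j : ℤ} (h : lat p q N i j) : (N : ℤ) ∣ j := by
  obtain ⟨m, n, -, h₂⟩ := lat_iff.1 h
  exact ⟨n, by rw [h₂]; ring⟩

theorem lat_width_dvd {i j : ℤ} (h : lat p q N i j) : (N : ℤ) ∣ i := by
  obtain ⟨m, n, h₁, -⟩ := lat_iff.1 h
  exact ⟨m * p + n * q, by rw [h₁]; ring⟩

/-- Two points on the same horizontal curve have representatives of equal height. -/
theorem exists_pt_row {t : Torus p q N} {j : ℤ} (h : row t = (j : ZMod N)) : ∃ i, pt i j = t := by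
  obtain ⟨i, j', rfl⟩ := exists_pt t
  rw [row_pt] at h
  obtain ⟨k, hk⟩ := (ZMod.intCast_eq_intCast_iff_dvd_sub _ _ _).1 h
  refine ⟨i + k * (q * N), pt_eq_iff.2 (lat_iff.2 ⟨0, -k, by ring, by linarith⟩)⟩

theorem exists_pt_col (hpq : Int.gcd (p : ℤ) q = 1) {t : Torus p q N} {i : ℤ}
    (h : col t = (i : ZMod N)) : ∃ j, pt i j = t := by
  obtain ⟨i', j, rfl⟩ := exists_pt t
  rw [col_pt] at h
  obtain ⟨k, hk⟩ := (ZMod.intCast_eq_intCast_iff_dvd_sub _ _ _).1 h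
  have hb := Int.gcd_eq_gcd_ab (p : ℤ) q
  rw [hpq] at hb
  push_cast at hb
  refine ⟨j + k * Int.gcdB p q * N, pt_eq_iff.2 (lat_iff.2
    ⟨-k * Int.gcdA p q, -k * Int.gcdB p q, ?_, by ring⟩)⟩
  have : -k * Int.gcdA p q * (p * N) + -k * Int.gcdB p q * (q * N) =
    -(N * k) * (p * Int.gcdA p q + q * Int.gcdB p q) := by ring
  rw [this, ← hb]
  linarith

/-- The states of the full ruling. -/
abbrev FState (p : ℕ) (q : ℤ) (N : ℕ) [NeZero N] : Type :=
  {x : Finset (Torus p q N) // IsState Finset.univ Finset.univ x}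

theorem IsState.eq_of_row {x : Finset (Torus p q N)} (hx : IsState Finset.univ Finset.univ x)
    {t t' : Torus p q N} (ht : t ∈ x) (ht' : t' ∈ x) (h : row t = row t') : t = t' :=
  (hx.2.1 (row t') (Finset.mem_univ _)).unique ⟨ht, h⟩ ⟨ht', rfl⟩

theorem IsState.eq_of_col {x : Finset (Torus p q N)} (hx : IsState Finset.univ Finset.univ x)
    {t t' : Torus p q N} (ht : t ∈ x) (ht' : t' ∈ x) (h : col t = col t') : t = t' :=
  (hx.2.2 (col t') (Finset.mem_univ _)).unique ⟨ht, h⟩ ⟨ht', rfl⟩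

theorem isSt_lift (hpq : Int.gcd (p : ℤ) q = 1) {x : Finset (Torus p q N)}
    (hx : IsState Finset.univ Finset.univ x) : IsSt (lat p q N) (lift x) := by
  refine ⟨?_, ?_, ?_, ?_, ?_⟩
  · intro i j k l h hl
    have : (pt i j : Torus p q N) = pt (i + k) (j + l) :=
      pt_eq_iff.2 (isLat_lat.of hl (by ring) (by ring))
    simpa only [lift, this] using h
  · intro i i' j h h'
    exact isLat_lat.of (pt_eq_iff.1 (hx.eq_of_row h h' rfl)) rfl (by ring)
  · intro i j j' h h'
    exact isLat_lat.of (pt_eq_iff.1 (hx.eq_of_col h h' rfl)) (by ring) rfl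
  · intro j
    obtain ⟨t, ⟨ht, hr⟩, -⟩ := hx.2.1 (j : ZMod N) (Finset.mem_univ _)
    obtain ⟨i, rfl⟩ := exists_pt_row hr
    exact ⟨i, ht⟩
  · intro i
    obtain ⟨t, ⟨ht, hr⟩, -⟩ := hx.2.2 (i : ZMod N) (Finset.mem_univ _)
    obtain ⟨j, rfl⟩ := exists_pt_col hpq hr
    exact ⟨j, ht⟩

theorem exists_state (hpq : Int.gcd (p : ℤ) q = 1) {Y : ℤ → ℤ → Prop}
    (hY : IsSt (lat p q N) Y) : ∃ y : FState p q N, lift y.1 = Y := by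
  classical
  have hmem : ∀ i j, lift (Finset.univ.filter fun t : Torus p q N =>
      ∃ i j, pt i j = t ∧ Y i j) i j ↔ Y i j := by
    intro i j
    simp only [lift, Finset.mem_filter, Finset.mem_univ, true_and]
    constructor
    · rintro ⟨i', j', h, hy⟩
      exact hY.tr hy (pt_eq_iff.1 h) (by ring) (by ring)
    · exact fun h => ⟨i, j, rfl, h⟩
  refine ⟨⟨Finset.univ.filter fun t => ∃ i j, pt i j = t ∧ Y i j, ?_, ?_, ?_⟩, ?_⟩
  · exact fun t _ => ⟨Finset.mem_univ _, Finset.mem_univ _⟩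
  · intro i _
    obtain ⟨k, rfl⟩ := ZMod.intCast_surjective i
    obtain ⟨i, hi⟩ := hY.rowex k
    refine ⟨pt i k, ⟨(hmem _ _).2 hi, rfl⟩, ?_⟩
    rintro t ⟨ht, hr⟩
    obtain ⟨i', rfl⟩ := exists_pt_row hr
    exact pt_eq_iff.2 (isLat_lat.of (hY.row ((hmem _ _).1 ht) hi) rfl (by ring))
  · intro i _
    obtain ⟨k, rfl⟩ := ZMod.intCast_surjective i
    obtain ⟨i, hi⟩ := hY.colex k
    refine ⟨pt k i, ⟨(hmem _ _).2 hi, rfl⟩, ?_⟩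
    rintro t ⟨ht, hr⟩
    obtain ⟨i', rfl⟩ := exists_pt_col hpq hr
    exact pt_eq_iff.2 (isLat_lat.of (hY.col ((hmem _ _).1 ht) hi) (by ring) rfl)
  · funext i j
    exact propext (hmem i j)

end

namespace Rect

/-- A lift of a rectangle to the plane. -/
def toP (r : Rect p q N) : PRect :=
  ⟨(Classical.choose (exists_pt r.sw)), Classical.choose (Classical.choose_spec (exists_pt r.sw)),
    (r.width : ℕ), (r.height : ℕ)⟩

theorem pt_toP (r : Rect p q N) : (pt r.toP.x r.toP.y : Torus p q N) = r.sw :=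
  Classical.choose_spec (Classical.choose_spec (exists_pt r.sw))

theorem toP_w (r : Rect p q N) : r.toP.w = (r.width : ℕ) := rfl

theorem toP_h (r : Rect p q N) : r.toP.h = (r.height : ℕ) := rfl

theorem pt_se (r : Rect p q N) : (pt (r.toP.x + r.toP.w) r.toP.y : Torus p q N) = r.se := by
  rw [se, ← pt_toP, shift_pt, add_zero, toP_w]

theorem pt_nw (r : Rect p q N) : (pt r.toP.x (r.toP.y + r.toP.h) : Torus p q N) = r.nw := by
  rw [nw, ← pt_toP, shift_pt, add_zero, toP_h]

theorem pt_ne (r : Rect p q N) :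
    (pt (r.toP.x + r.toP.w) (r.toP.y + r.toP.h) : Torus p q N) = r.ne := by
  rw [ne, ← pt_toP, shift_pt, toP_w, toP_h]

theorem eq_of_eqv {r r' : Rect p q N} (h : PRect.Eqv (lat p q N) r.toP r'.toP) : r = r' := by
  obtain ⟨h₁, h₂, h₃⟩ := h
  ext
  · rw [← pt_toP r, ← pt_toP r']
    exact pt_eq_iff.2 h₁
  · rw [toP_w, toP_w] at h₂; exact_mod_cast h₂.symm
  · rw [toP_h, toP_h] at h₃; exact_mod_cast h₃.symm

theorem Embedded.emb {r : Rect p q N} (h : r.Embedded) : Emb (lat p q N) r.toP.w r.toP.h := by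
  intro i j hl h₁ h₂ h₃ h₄
  rw [toP_w] at h₁ h₂
  rw [toP_h] at h₃ h₄
  have := h.2.2 (i.toNat) (j.toNat) ((-i).toNat) ((-j).toNat) (by omega) (by omega) (by omega)
    (by omega) (by
      rw [← pt_toP, shift_pt, shift_pt, pt_eq_iff]
      exact isLat_lat.neg' hl)
  omega

theorem embedded_of_emb {r : Rect p q N} (hw : 0 < (r.width : ℕ)) (hh : 0 < (r.height : ℕ))
    (h : Emb (lat p q N) r.toP.w r.toP.h) : r.Embedded := by
  refine ⟨hw, hh, fun i j i' j' h₁ h₂ h₃ h₄ he => ?_⟩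
  rw [← pt_toP, shift_pt, shift_pt, pt_eq_iff] at he
  have := h _ _ he (by rw [toP_w]; omega) (by rw [toP_w]; omega) (by rw [toP_h]; omega)
    (by rw [toP_h]; omega)
  omega

/-- The multiplicity as a sum over the cells of a lift. -/
theorem mult_eq_sum {r : Rect p q N} (h : r.Embedded) (t : Torus p q N) :
    r.mult t = r.toP.sum fun i j => if pt i j = t then 1 else 0 := by
  classical
  unfold mult PRect.sum rsum
  split_ifs with ht
  · obtain ⟨i, j, hi, hj, rfl⟩ := ht
    rw [← pt_toP r, shift_pt]
    have key : ∀ i' ∈ Finset.Ico r.toP.x (r.toP.x + r.toP.w),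
        ∀ j' ∈ Finset.Ico r.toP.y (r.toP.y + r.toP.h),
        (pt i' j' : Torus p q N) = pt (r.toP.x + i) (r.toP.y + j) →
          i' = r.toP.x + i ∧ j' = r.toP.y + j := by
      intro i' hi' j' hj' he
      rw [Finset.mem_Ico, toP_w] at hi'
      rw [Finset.mem_Ico, toP_h] at hj'
      have := h.emb _ _ (pt_eq_iff.1 he) (by rw [toP_w]; omega) (by rw [toP_w]; omega)
        (by rw [toP_h]; omega) (by rw [toP_h]; omega)
      omega
    have hi₀ : r.toP.x + i ∈ Finset.Ico r.toP.x (r.toP.x + r.toP.w) := by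
      rw [Finset.mem_Ico, toP_w]; omega
    have hj₀ : r.toP.y + (j : ℤ) ∈ Finset.Ico r.toP.y (r.toP.y + r.toP.h) := by
      rw [Finset.mem_Ico, toP_h]; omega
    rw [Finset.sum_eq_single_of_mem _ hi₀, Finset.sum_eq_single_of_mem _ hj₀]
    · exact (if_pos rfl).symm
    · intro j' hj' hne
      exact if_neg fun he => hne (key _ hi₀ j' hj' he).2
    · intro i' hi' hne
      refine Finset.sum_eq_zero fun j' hj' => ?_
      exact if_neg fun he => hne (key i' hi' j' hj' he).1
  · symm
    refine Finset.sum_eq_zero fun i hi => Finset.sum_eq_zero fun j hj => if_neg ?_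
    rintro rfl
    rw [Finset.mem_Ico, toP_w] at hi
    rw [Finset.mem_Ico, toP_h] at hj
    refine ht ⟨(i - r.toP.x).toNat, (j - r.toP.y).toNat, by omega, by omega, ?_⟩
    rw [← pt_toP r, shift_pt]
    congr 1 <;> omega

variable [NeZero p] [NeZero N]

theorem IsEmptyFromTo.step (hpq : Int.gcd (p : ℤ) q = 1) {r : Rect p q N}
    {x y : Finset (Torus p q N)} (hx : IsState Finset.univ Finset.univ x)
    (h : r.IsEmptyFromTo x y) : SStep (lat p q N) (lift x) (lift y) r.toP := by
  classical
  obtain ⟨⟨he, hsw, hne, hy⟩, hx₀, -⟩ := h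
  have hP := isSt_lift hpq hx
  have hsw' : lift x r.toP.x r.toP.y := by rw [lift, pt_toP]; exact hsw
  have hne' : lift x (r.toP.x + r.toP.w) (r.toP.y + r.toP.h) := by rw [lift, pt_ne]; exact hne
  have ew := r.toP_w
  have eh := r.toP_h
  have hw := he.1
  have hh := he.2.1
  refine ⟨by omega, by omega, hsw', hne', ?_, he.emb, ?_, ?_, ?_⟩
  · intro i j hp h₁ h₂ h₃ h₄
    have e₁ : i = r.toP.x → j = r.toP.y := fun e => by
      subst e
      have := he.emb.apply (hP.col hsw' hp)
      omega
    have e₂ : j = r.toP.y → i = r.toP.x := fun e => by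
      subst e
      have := he.emb.apply (hP.row hsw' hp)
      omega
    have e₃ : i = r.toP.x + r.toP.w → j = r.toP.y + r.toP.h := fun e => by
      subst e
      have := he.emb.apply (hP.col hne' hp)
      omega
    have e₄ : j = r.toP.y + r.toP.h → i = r.toP.x + r.toP.w := fun e => by
      subst e
      have := he.emb.apply (hP.row hne' hp)
      omega
    by_contra hcon
    refine hx₀ _ hp ⟨(i - r.toP.x).toNat, (j - r.toP.y).toNat, by omega, by omega, by omega,
      by omega, ?_⟩
    rw [← pt_toP r, shift_pt]
    congr 1 <;> omega
  · rw [lift, pt_se, hy]; simp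
  · rw [lift, pt_nw, hy]; simp
  · intro i j hp
    by_cases h₁ : (pt i j : Torus p q N) = r.sw
    · rw [← pt_toP, eq_comm, pt_eq_iff] at h₁
      exact Or.inr (Or.inl h₁)
    by_cases h₂ : (pt i j : Torus p q N) = r.ne
    · rw [← pt_ne, eq_comm, pt_eq_iff] at h₂
      exact Or.inr (Or.inr h₂)
    left
    rw [lift, hy, Finset.mem_union, Finset.mem_sdiff]
    exact Or.inl ⟨hp, by simp [h₁, h₂]⟩

theorem IsEmptyFromTo.of_step (hpq : Int.gcd (p : ℤ) q = 1) {r : Rect p q N}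
    {x y : Finset (Torus p q N)} (hx : IsState Finset.univ Finset.univ x)
    (hy : IsState Finset.univ Finset.univ y)
    (h : SStep (lat p q N) (lift x) (lift y) r.toP) : r.IsEmptyFromTo x y := by
  classical
  have hP := isSt_lift hpq hx
  have hQ := isSt_lift hpq hy
  have ew := r.toP_w
  have eh := r.toP_h
  have hw := h.hw
  have hh := h.hh
  have hse := h.se
  have hnw := h.nw
  have hsw := h.sw
  have hne := h.ne
  rw [lift, pt_se] at hse
  rw [lift, pt_nw] at hnw
  rw [lift, pt_toP] at hsw
  rw [lift, pt_ne] at hne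
  refine ⟨⟨embedded_of_emb (by omega) (by omega) h.emb, hsw, hne, ?_⟩, ?_, ?_⟩
  · ext t
    obtain ⟨i, j, rfl⟩ := exists_pt t
    simp only [Finset.mem_union, Finset.mem_sdiff, Finset.mem_insert, Finset.mem_singleton]
    rw [← pt_toP r, ← pt_se, ← pt_ne, ← pt_nw]
    have e : ∀ i j i' j', (pt i j : Torus p q N) = pt i' j' ↔ lat p q N (i - i') (j - j') :=
      fun i j i' j' => by rw [eq_comm, pt_eq_iff]
    rw [e, e, e, e]
    constructor
    · intro ht
      rcases h.back isLat_lat hP hQ ht with ⟨h₁, h₂, h₃⟩ | h₁ | h₁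
      · exact Or.inl ⟨h₁, by tauto⟩
      · exact Or.inr (Or.inl h₁)
      · exact Or.inr (Or.inr h₁)
    · rintro (⟨h₁, h₂⟩ | h₁ | h₁)
      · rcases h.rest i j h₁ with h₃ | h₃ | h₃
        exacts [h₃, (h₂ (Or.inl h₃)).elim, (h₂ (Or.inr h₃)).elim]
      · exact hQ.tr h.se h₁
      · exact hQ.tr h.nw h₁
  · rintro t ht ⟨i, j, h₁, h₂, h₃, h₄, rfl⟩
    rw [← pt_toP r, shift_pt] at ht
    have := h.emp.apply ht
    omega
  · rintro t ht ⟨i, j, h₁, h₂, h₃, h₄, rfl⟩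
    rw [← pt_toP r, shift_pt] at ht
    have := h.qemp isLat_lat hP hQ ht (by omega) (by omega) (by omega) (by omega)
    omega

/-- Every planar rectangle between states descends to the torus. -/
theorem exists_of_step (hpq : Int.gcd (p : ℤ) q = 1) {P Q : ℤ → ℤ → Prop} {R : PRect}
    (h : SStep (lat p q N) P Q R) : ∃ r : Rect p q N, PRect.Eqv (lat p q N) R r.toP := by
  have hw := h.hw
  have hh := h.hh
  have e : ((p * N : ℕ) : ℤ) = (p : ℤ) * N := by push_cast; ring
  have hpN : (0 : ℤ) < (p : ℤ) * N := by
    have := NeZero.pos p; have := NeZero.pos N; positivity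
  have h₁ : R.w < (p : ℤ) * N := by
    by_contra hc
    have := h.emb.apply (lat_zero_right.2 (dvd_refl _))
    omega
  have h₂ : R.h < (p : ℤ) * N := by
    by_contra hc
    have := h.emb.apply ((lat_zero_left hpq).2 (dvd_refl _))
    omega
  refine ⟨⟨pt R.x R.y, ⟨R.w.toNat, by omega⟩, ⟨R.h.toNat, by omega⟩⟩, ?_, ?_, ?_⟩
  · rw [← pt_eq_iff, pt_toP]
  · rw [toP_w]; simp only; omega
  · rw [toP_h]; simp only; omega

end Rect

end

namespace Planar

open PRect

section

variable {L P Q W Y Z : ℤ → ℤ → Prop} {r s r' s' r'' s'' : PRect}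

theorem PRect.Eqv.R (hL : IsLat L) (h : Eqv L r r') : Eqv L r.R r'.R := by
  obtain ⟨h₁, h₂, h₃⟩ := h
  exact ⟨hL.neg' h₁ (by simp only [PRect.R]; omega) (by simp only [PRect.R]; omega), h₂, h₃⟩

theorem PRect.Eqv.T (h : Eqv L r r') : Eqv (fun i j => L j i) r.T r'.T := ⟨h.1, h.2.2, h.2.1⟩

theorem PRect.Eqv.sum_eq {f : ℤ → ℤ → ℕ} (hf : ∀ i j k l, L k l → f (i + k) (j + l) = f i j)
    (h : Eqv L r r') : r'.sum f = r.sum f := by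
  obtain ⟨h₁, h₂, h₃⟩ := h
  unfold PRect.sum
  rw [h₂, h₃]
  exact rsum_translate (fun i j => hf i j _ _ h₁) (by omega) (by omega)

theorem SStep.congr (hL : IsLat L) (hP : IsSt L P) (hQ : IsSt L Q) (h : SStep L P Q r)
    (e : Eqv L r r') : SStep L P Q r' := by
  obtain ⟨h₁, h₂, h₃⟩ := e
  unfold SStep at *
  rw [h₂, h₃]
  exact h.translate hL hP hQ h₁ (by omega) (by omega)

theorem AltI.congr (hL : IsLat L) (h : AltI L r s r' s') (e : Eqv L r' r'') (e' : Eqv L s' s'') :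
    AltI L r s r'' s'' := by
  obtain ⟨c₁, c₄, lt, p₁, w₁, h₁, p₂, w₂, h₂, c₂⟩ := h
  obtain ⟨e₁, e₂, e₃⟩ := e
  obtain ⟨e₁', e₂', e₃'⟩ := e'
  exact ⟨c₁, c₄, lt, hL.add' p₁ e₁, by omega, by omega,
    hL.add' p₂ e₁', by omega, by omega,
    fun hc => c₂ (hL.sub' (hL.add' hc e₁ rfl rfl) e₁')⟩

theorem AltII.congr (hL : IsLat L) (h : AltII L r s r' s') (e : Eqv L r' r'') (e' : Eqv L s' s'') :
    AltII L r s r'' s'' := by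
  obtain ⟨c₁, c₄, lt, p₁, w₁, h₁, p₂, w₂, h₂, c₂⟩ := h
  obtain ⟨e₁, e₂, e₃⟩ := e
  obtain ⟨e₁', e₂', e₃'⟩ := e'
  exact ⟨c₁, c₄, lt, hL.add' p₁ e₁, by omega, by omega,
    hL.sub' (hL.add' p₂ e₁' rfl rfl) e₁, by omega, by omega,
    fun hc => c₂ (hL.sub' (hL.add' hc e₁ rfl rfl) e₁')⟩

theorem AltP.congr (hL : IsLat L) (h : AltP L r s r' s') (e : Eqv L r' r'') (e' : Eqv L s' s'') :
    AltP L r s r'' s'' := by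
  obtain ⟨c₁, c₄, lt, p₁, ⟨k, k₁, k₂⟩, p₂, w₂, h₂⟩ := h
  obtain ⟨e₁, e₂, e₃⟩ := e
  obtain ⟨e₁', e₂', e₃'⟩ := e'
  exact ⟨c₁, c₄, lt, hL.add' p₁ e₁, ⟨k, by rw [e₂, k₁], by rw [e₃, k₂]⟩,
    hL.sub' (hL.add' p₂ e₁' rfl rfl) e₁, by omega, by omega⟩

theorem AltM.congr (hL : IsLat L) (h : AltM L r s r' s') (e : Eqv L r' r'') (e' : Eqv L s' s'') :
    AltM L r s r'' s'' := by
  obtain ⟨c₁, c₄, lt, p₁, ⟨k, k₁, k₂⟩, p₂, w₂, h₂⟩ := h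
  obtain ⟨e₁, e₂, e₃⟩ := e
  obtain ⟨e₁', e₂', e₃'⟩ := e'
  exact ⟨c₁, c₄, lt, hL.add' p₁ e₁, ⟨k, by rw [e₂, k₁], by rw [e₃, k₂]⟩,
    hL.sub' (hL.add' p₂ e₁' rfl rfl) e₁, by omega, by omega⟩

theorem Alt.congr (hL : IsLat L) (h : Alt L r s r' s') (e : Eqv L r' r'') (e' : Eqv L s' s'') :
    Alt L r s r'' s'' := by
  rcases h with h | h | h | h | h | h
  · exact Or.inl (h.congr hL e e')
  · exact Or.inr (Or.inl (h.congr hL (e.R hL) (e'.R hL)))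
  · exact Or.inr (Or.inr (Or.inl (h.congr hL e e')))
  · exact Or.inr (Or.inr (Or.inr (Or.inl (h.congr hL (e.R hL) (e'.R hL)))))
  · exact Or.inr (Or.inr (Or.inr (Or.inr (Or.inl (h.congr hL e e')))))
  · exact Or.inr (Or.inr (Or.inr (Or.inr (Or.inr (h.congr hL e e')))))

theorem PRect.Pos.T (h : r.Pos) : r.T.Pos := ⟨h.2, h.1⟩

theorem Alt.transpose' (hL : IsLat L) (hr : r.Pos) (hs : s.Pos) (h : Alt L r s r' s') :
    Alt (fun i j => L j i) r'.T s'.T r.T s.T :=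
  Alt.transpose (L := fun i j => L j i) (r := r.T) (s := s.T) (r' := r'.T) (s' := s'.T)
    hL.transpose hr.T hs.T h

theorem Alt.congr_left (hL : IsLat L) (hr : r.Pos) (hs : s.Pos) (hr' : r'.Pos) (hs' : s'.Pos)
    (h : Alt L r s r' s') (e : Eqv L r r'') (e' : Eqv L s s'') : Alt L r'' s'' r' s' :=
  ((h.transpose' hL hr hs).congr hL.transpose e.T e'.T).transpose (r' := r'') (s' := s'') hL hr' hs'

theorem PRect.Eqv.of_T (h : Eqv (fun i j => L j i) r.T r'.T) : Eqv L r r' := ⟨h.1, h.2.2, h.2.1⟩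

theorem Alt.unique_left (hL : IsLat L) (hr : r.Pos) (hs : s.Pos) (hr'' : r''.Pos) (hs'' : s''.Pos)
    (h : Alt L r s r' s') (h' : Alt L r'' s'' r' s') : Eqv L r r'' ∧ Eqv L s s'' := by
  have := (h.transpose' hL hr hs).unique hL.transpose hr.T hs.T hr''.T hs''.T
    (h'.transpose' hL hr'' hs'')
  exact ⟨this.1.of_T, this.2.of_T⟩

/-- A horizontal annulus of height one, cut into two rectangles. -/
theorem exists_annulus (hL : IsLat L) (hP : IsSt L P) {V a b w : ℤ} (hV : L V 0)
    (hmin : ∀ i j, L i j → -V < i → i < V → -1 ≤ j → j ≤ 1 → i = 0 ∧ j = 0)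
    (hw : 0 < w) (hwV : w < V) (h₁ : P a b) (h₂ : P (a + w) (b + 1)) :
    ∃ W, IsSt L W ∧ SStep L P W ⟨a, b, w, 1⟩ ∧ SStep L W P ⟨a + w, b, V - w, 1⟩ := by
  have emb : Emb L w 1 := fun i j hl _ _ h₃ h₄ => hmin i j hl (by omega) (by omega) h₃ h₄
  have emp : Emp P a b w 1 := by
    intro i j hp k₁ k₂ k₃ k₄
    rcases (show j = b ∨ j = b + 1 by omega) with rfl | rfl
    · have := hmin _ _ (hP.row h₁ hp) (by omega) (by omega) (by omega) (by omega)
      omega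
    · have := hmin _ _ (hP.row h₂ hp) (by omega) (by omega) (by omega) (by omega)
      omega
  obtain ⟨W, hW, st⟩ := exists_step hL hP hw one_pos h₁ h₂ emp emb
  have se := st.se
  have nw : W (a + V) (b + 1) := hW.tr st.nw hV
  refine ⟨W, hW, st, ⟨by dsimp; omega, one_pos, se, cast2 nw (by dsimp; omega) rfl, ?_, ?_,
    hP.tr h₁ hV (by dsimp; omega) (by dsimp; omega), h₂, ?_⟩⟩
  · intro i j hp k₁ k₂ k₃ k₄
    dsimp at *
    rcases (show j = b ∨ j = b + 1 by omega) with rfl | rfl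
    · have := hmin _ _ (hW.row se hp) (by omega) (by omega) (by omega) (by omega)
      omega
    · have := hmin _ _ (hW.row nw hp) (by omega) (by omega) (by omega) (by omega)
      omega
  · exact fun i j hl _ _ h₃ h₄ => hmin i j hl (by dsimp at *; omega) (by dsimp at *; omega) h₃ h₄
  · intro i j hq
    dsimp
    rcases st.back hL hP hW hq with h | h | h
    · exact Or.inl h.1
    · exact Or.inr (Or.inl h)
    · exact Or.inr (Or.inr (hL.sub' h hV))

theorem sum_period {V : ℤ} (hV : 0 < V) (a i₀ : ℤ) {Q : ℤ → Prop} [DecidablePred Q]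
    (hQ : ∀ i, Q i ↔ V ∣ i₀ - i) : ∑ i ∈ Finset.Ico a (a + V), (if Q i then 1 else 0) = 1 := by
  have e₁ := Int.mul_ediv_add_emod (i₀ - a) V
  have e₂ := Int.emod_nonneg (i₀ - a) hV.ne'
  have e₃ := Int.emod_lt_of_pos (i₀ - a) hV
  have hi : a + (i₀ - a) % V ∈ Finset.Ico a (a + V) := by rw [Finset.mem_Ico]; omega
  rw [Finset.sum_eq_single_of_mem _ hi, if_pos]
  · exact (hQ _).2 ⟨(i₀ - a) / V, by linarith⟩
  · intro i hi' hne
    refine if_neg fun hq => hne ?_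
    obtain ⟨k, hk⟩ := (hQ i).1 hq
    rw [Finset.mem_Ico] at hi'
    have := eq_of_mul_near (k := k) (k' := (i₀ - a) / V) (u := V)
      (d := a + (i₀ - a) % V - i) (by rw [mul_comm, ← hk, mul_comm]; linarith) (by omega) (by omega)
    rw [this] at hk
    linarith

end

end Planar

/-! ### Pairs of consecutive rectangles on the torus -/

section

variable {p : ℕ} {q : ℤ} {N : ℕ}

theorem sum_eq_zero_of_matching {α M : Type*} [AddCommGroup M] (s : Finset α) (f : α → M)
    (Rel : α → α → Prop) (hex : ∀ t ∈ s, ∃ t' ∈ s, t' ≠ t ∧ Rel t t' ∧ f t' = -f t)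
    (symm : ∀ t u, Rel t u → Rel u t)
    (uniq : ∀ t ∈ s, ∀ u ∈ s, ∀ v ∈ s, Rel t u → Rel t v → u = v) : ∑ t ∈ s, f t = 0 := by
  choose φ h₁ h₂ h₃ h₄ using hex
  refine Finset.sum_involution φ ?_ ?_ h₁ ?_
  · intro t ht
    rw [h₄, add_neg_cancel]
  · intro t ht _
    exact h₂ t ht
  · intro t ht
    exact uniq (φ t ht) (h₁ t ht) _ (h₁ _ _) t ht (h₃ _ _) (symm _ _ (h₃ t ht))

/-- The sign of a rectangle as an element of a ring. -/
def sgn (A : Type) [CommRing A] (S : Signs p q N) (x y : Finset (Torus p q N)) (r : Rect p q N) :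
    A := ((S x y r : ℤ) : A)

variable [NeZero p] [NeZero N]

/-- The properties of a sign assignment, for its image in a ring. -/
structure GoodSigns (A : Type) [CommRing A] (S : Signs p q N) : Prop where
  alt : ∀ (x w y z : FState p q N) (r₁ r₂ r₁' r₂' : Rect p q N),
    r₁.IsFromTo x.1 w.1 → r₂.IsFromTo w.1 z.1 → r₁'.IsFromTo x.1 y.1 → r₂'.IsFromTo y.1 z.1 →
    y ≠ w → (∀ t, r₁.mult t + r₂.mult t = r₁'.mult t + r₂'.mult t) →
    sgn A S x.1 w.1 r₁ * sgn A S w.1 z.1 r₂ = -(sgn A S x.1 y.1 r₁' * sgn A S y.1 z.1 r₂')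
  hor : 2 ≤ N → ∀ (x w : FState p q N) (r₁ r₂ : Rect p q N),
    r₁.IsFromTo x.1 w.1 → r₂.IsFromTo w.1 x.1 →
    (∃ i : ZMod N, ∀ t, r₁.mult t + r₂.mult t = if row t = i then 1 else 0) →
    sgn A S x.1 w.1 r₁ * sgn A S w.1 x.1 r₂ = 1
  ver : 2 ≤ N → ∀ (x w : FState p q N) (r₁ r₂ : Rect p q N),
    r₁.IsFromTo x.1 w.1 → r₂.IsFromTo w.1 x.1 →
    (∃ i : ZMod N, ∀ t, r₁.mult t + r₂.mult t = if col t = i then 1 else 0) →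
    sgn A S x.1 w.1 r₁ * sgn A S w.1 x.1 r₂ = -1

theorem IsSignAssignment.goodSigns {S : Signs p q N} (hS : IsSignAssignment S) (A : Type)
    [CommRing A] : GoodSigns A S := by
  refine ⟨?_, ?_, ?_⟩
  · intro x w y z r₁ r₂ r₁' r₂' h₁ h₂ h₃ h₄ hne hm
    have := hS.alternative x.1 w.1 y.1 z.1 r₁ r₂ r₁' r₂' x.2 w.2 y.2 z.2 h₁ h₂ h₃ h₄
      (fun h => hne (Subtype.ext h)) hm
    have := congrArg (fun u : ℤˣ => ((u : ℤ) : A)) this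
    simpa [sgn] using this
  · rintro hN x w r₁ r₂ h₁ h₂ ⟨i, hi⟩
    have := hS.horizontal x.1 w.1 r₁ r₂ x.2 w.2 h₁ h₂ ⟨i, 1, by omega, fun t ⟨k, hk, ht⟩ => ?_,
      fun t ht => ?_⟩
    · have := congrArg (fun u : ℤˣ => ((u : ℤ) : A)) this
      simpa [sgn] using this
    · obtain rfl : k = 0 := by omega
      rw [hi, if_pos (by simpa using ht)]
    · rw [hi, if_neg fun h => ht ⟨0, one_pos, by simpa using h⟩]
  · rintro hN x w r₁ r₂ h₁ h₂ ⟨i, hi⟩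
    have := hS.vertical x.1 w.1 r₁ r₂ x.2 w.2 h₁ h₂ ⟨i, 1, by omega, fun t ⟨k, hk, ht⟩ => ?_,
      fun t ht => ?_⟩
    · have := congrArg (fun u : ℤˣ => ((u : ℤ) : A)) this
      simpa [sgn] using this
    · obtain rfl : k = 0 := by omega
      rw [hi, if_pos (by simpa using ht)]
    · rw [hi, if_neg fun h => ht ⟨0, one_pos, by simpa using h⟩]

theorem goodSigns_one (A : Type) [CommRing A] (hA : (1 : A) = -1) :
    GoodSigns A (fun _ _ _ => 1 : Signs p q N) := by
  refine ⟨?_, ?_, ?_⟩ <;> intros <;> simp [sgn, ← hA]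

/-- `(w, r₁, r₂)` is a pair of consecutive empty rectangles from `x` via `w` to `z`. -/
def IsPair (x z : FState p q N) (t : FState p q N × Rect p q N × Rect p q N) : Prop :=
  t.2.1.IsEmptyFromTo x.1 t.1.1 ∧ t.2.2.IsEmptyFromTo t.1.1 z.1

/-- The pair of rectangles has a vertical cut. -/
def VCut (r s : PRect) : Prop := C1 (lat p q N) r s ∨ C4 (lat p q N) r s

/-- The pair of rectangles has a horizontal cut. -/
def HCut (r s : PRect) : Prop :=
  C1 (fun i j => lat p q N j i) r.T s.T ∨ C4 (fun i j => lat p q N j i) r.T s.T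

/-- The two pairs of rectangles are the two decompositions of the same domain. -/
def PairRel (t t' : FState p q N × Rect p q N × Rect p q N) : Prop :=
  Alt (lat p q N) t.2.1.toP t.2.2.toP t'.2.1.toP t'.2.2.toP ∨
  Alt (lat p q N) t'.2.1.toP t'.2.2.toP t.2.1.toP t.2.2.toP ∨
  (NoCut (lat p q N) t.2.1.toP t.2.2.toP ∧ NoCut (lat p q N) t'.2.1.toP t'.2.2.toP ∧
    t.2.1 = t'.2.2 ∧ t.2.2 = t'.2.1)

theorem PairRel.symm {t t' : FState p q N × Rect p q N × Rect p q N} (h : PairRel t t') :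
    PairRel t' t := by
  rcases h with h | h | h
  · exact Or.inr (Or.inl h)
  · exact Or.inl h
  · exact Or.inr (Or.inr ⟨h.2.1, h.1, h.2.2.2.symm, h.2.2.1.symm⟩)

/-- The pair is a horizontal annulus. -/
def IsHor (t : FState p q N × Rect p q N × Rect p q N) : Prop :=
  VCut (p := p) (q := q) (N := N) t.2.1.toP t.2.2.toP ∧ t.2.1.toP.h = t.2.2.toP.h

/-- The pair is a vertical annulus. -/
def IsVer (t : FState p q N × Rect p q N × Rect p q N) : Prop :=
  HCut (p := p) (q := q) (N := N) t.2.1.toP t.2.2.toP ∧ t.2.1.toP.w = t.2.2.toP.w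

theorem Rect.mult_invariant (t : Torus p q N) (i j k l : ℤ) (h : lat p q N k l) :
    (if (pt (i + k) (j + l) : Torus p q N) = t then 1 else 0) =
      if (pt i j : Torus p q N) = t then 1 else 0 := by
  have : (pt i j : Torus p q N) = pt (i + k) (j + l) :=
    pt_eq_iff.2 (isLat_lat.of h (by ring) (by ring))
  rw [this]

variable (hpq : Int.gcd (p : ℤ) q = 1)

section

include hpq

theorem IsPair.unique {x z : FState p q N} {t u v : FState p q N × Rect p q N × Rect p q N}
    (ht : IsPair x z t) (hu : IsPair x z u) (hv : IsPair x z v) (h₁ : PairRel t u)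
    (h₂ : PairRel t v) : u = v := by
  have st₁ := ht.1.step hpq x.2
  have st₂ := ht.2.step hpq t.1.2
  have su₁ := (hu.1.step hpq x.2).pos
  have su₂ := (hu.2.step hpq u.1.2).pos
  have sv₁ := (hv.1.step hpq x.2).pos
  have sv₂ := (hv.2.step hpq v.1.2).pos
  have hL := isLat_lat (p := p) (q := q) (N := N)
  have key : u.2.1 = v.2.1 ∧ u.2.2 = v.2.2 := by
    rcases h₁ with h₁ | h₁ | h₁ <;> rcases h₂ with h₂ | h₂ | h₂
    · have := h₁.unique hL su₁ su₂ sv₁ sv₂ h₂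
      exact ⟨Rect.eq_of_eqv this.1, Rect.eq_of_eqv this.2⟩
    · exact (not_both_cuts hL st₁ st₂ (h₁.class hL)
        ((h₂.transpose' hL sv₁ sv₂).class hL.transpose)).elim
    · exact (h₂.1.1 (h₁.class hL)).elim
    · exact (not_both_cuts hL st₁ st₂ (h₂.class hL)
        ((h₁.transpose' hL su₁ su₂).class hL.transpose)).elim
    · have := h₁.unique_left hL su₁ su₂ sv₁ sv₂ h₂
      exact ⟨Rect.eq_of_eqv this.1, Rect.eq_of_eqv this.2⟩
    · exact (h₂.1.2 ((h₁.transpose' hL su₁ su₂).class hL.transpose)).elim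
    · exact (h₁.1.1 (h₂.class hL)).elim
    · exact (h₁.1.2 ((h₂.transpose' hL sv₁ sv₂).class hL.transpose)).elim
    · exact ⟨h₁.2.2.2.symm.trans h₂.2.2.2, h₁.2.2.1.symm.trans h₂.2.2.1⟩
  have hw : u.1 = v.1 := Subtype.ext (by rw [hu.1.1.2.2.2, hv.1.1.2.2.2, key.1])
  exact Prod.ext hw (Prod.ext key.1 key.2)

theorem PairRel.not_annular {x z : FState p q N} {t u : FState p q N × Rect p q N × Rect p q N}
    (ht : IsPair x z t) (hu : IsPair x z u) (h : PairRel t u) : ¬ IsHor t ∧ ¬ IsVer t := by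
  have st₁ := ht.1.step hpq x.2
  have st₂ := ht.2.step hpq t.1.2
  have su₁ := (hu.1.step hpq x.2).pos
  have su₂ := (hu.2.step hpq u.1.2).pos
  have hL := isLat_lat (p := p) (q := q) (N := N)
  rcases h with h | h | h
  · exact ⟨fun hh => h.heights hh.2, fun hv => not_both_cuts hL st₁ st₂ (h.class hL) hv.1⟩
  · have h' := h.transpose' hL su₁ su₂
    exact ⟨fun hh => not_both_cuts hL st₁ st₂ hh.1 (h'.class hL.transpose),
      fun hv => h'.heights hv.2⟩
  · exact ⟨fun hh => h.1.1 hh.1, fun hv => h.1.2 hv.1⟩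

/-- A pair of consecutive rectangles that is not an annulus has a partner with the same
multiplicities. -/
theorem IsPair.exists_partner {x z : FState p q N} {t : FState p q N × Rect p q N × Rect p q N}
    (ht : IsPair x z t) (h₁ : ¬ IsHor t) (h₂ : ¬ IsVer t) :
    ∃ u, IsPair x z u ∧ u.1 ≠ t.1 ∧ PairRel t u ∧
      ∀ c, u.2.1.mult c + u.2.2.mult c = t.2.1.mult c + t.2.2.mult c := by
  have st₁ := ht.1.step hpq x.2
  have st₂ := ht.2.step hpq t.1.2
  have hL := isLat_lat (p := p) (q := q) (N := N)
  have hx := isSt_lift hpq x.2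
  have hw := isSt_lift hpq t.1.2
  have hz := isSt_lift hpq z.2
  -- every planar partner descends to the torus
  have main : ∀ r' s', Partner (lat p q N) (lift x.1) (lift t.1.1) (lift z.1) t.2.1.toP t.2.2.toP
      r' s' → ∃ u, IsPair x z u ∧ u.1 ≠ t.1 ∧
      (∀ c, u.2.1.mult c + u.2.2.mult c = t.2.1.mult c + t.2.2.mult c) ∧
      r'.Pos ∧ s'.Pos ∧
      PRect.Eqv (lat p q N) r' u.2.1.toP ∧ PRect.Eqv (lat p q N) s' u.2.2.toP := by
    rintro r' s' ⟨⟨Y, hY, t₁, t₂, i, j, hi, hj⟩, hf⟩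
    obtain ⟨y, rfl⟩ := exists_state hpq hY
    obtain ⟨r, hr⟩ := Rect.exists_of_step hpq t₁
    obtain ⟨s, hs⟩ := Rect.exists_of_step hpq t₂
    have k₁ := Rect.IsEmptyFromTo.of_step hpq x.2 y.2 (t₁.congr hL hx hY hr)
    have k₂ := Rect.IsEmptyFromTo.of_step hpq y.2 z.2 (t₂.congr hL hY hz hs)
    refine ⟨⟨y, r, s⟩, ⟨k₁, k₂⟩, ?_, fun c => ?_, t₁.pos, t₂.pos, hr, hs⟩
    · intro h
      dsimp at h
      rw [h] at hj
      exact hj hi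
    · rw [Rect.mult_eq_sum k₁.1.1, Rect.mult_eq_sum k₂.1.1, Rect.mult_eq_sum ht.1.1.1,
        Rect.mult_eq_sum ht.2.1.1, hr.sum_eq (Rect.mult_invariant c),
        hs.sum_eq (Rect.mult_invariant c)]
      exact hf _ (Rect.mult_invariant c)
  by_cases hv : VCut (p := p) (q := q) (N := N) t.2.1.toP t.2.2.toP
  · obtain ⟨r', s', hp, ha⟩ := exists_alt hL hx hw hz st₁ st₂ hv fun h => h₁ ⟨hv, h⟩
    obtain ⟨u, hu, hne, hm, -, -, e₁, e₂⟩ := main r' s' hp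
    exact ⟨u, hu, hne, Or.inl (ha.congr hL e₁ e₂), hm⟩
  by_cases hh : HCut (p := p) (q := q) (N := N) t.2.1.toP t.2.2.toP
  · obtain ⟨r', s', hp, ha⟩ := exists_alt' hL hx hw hz st₁ st₂ hh fun h => h₂ ⟨hh, h⟩
    obtain ⟨u, hu, hne, hm, p₁, p₂, e₁, e₂⟩ := main r' s' hp
    exact ⟨u, hu, hne, Or.inr (Or.inl (ha.congr_left hL p₁ p₂ st₁.pos st₂.pos e₁ e₂)), hm⟩
  · obtain ⟨hp, ha⟩ := exists_commute hL hx hw hz st₁ st₂ ⟨hv, hh⟩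
    obtain ⟨u, hu, hne, hm, p₁, p₂, e₁, e₂⟩ := main _ _ hp
    have e₁' := Rect.eq_of_eqv e₁
    have e₂' := Rect.eq_of_eqv e₂
    exact ⟨u, hu, hne, Or.inr (Or.inr ⟨⟨hv, hh⟩, by rw [← e₁', ← e₂']; exact ha, e₂', e₁'⟩), hm⟩

end

end

open PRect

/-! ### Annuli -/

section

variable {p : ℕ} {q : ℤ} {N : ℕ} [NeZero p] [NeZero N]

theorem period_pos : (0 : ℤ) < (p : ℤ) * N := by
  have := NeZero.pos p; have := NeZero.pos N; positivity

theorem eq_of_dvd_sub {V a b : ℤ} (ha : 0 ≤ a) (ha' : a < V) (hb : 0 ≤ b) (hb' : b < V)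
    (h : V ∣ b - a) : a = b := by
  obtain ⟨k, hk⟩ := h
  have := eq_of_mul_near (k := k) (k' := 0) (u := V) (d := b - a) (by rw [hk]; ring) (by omega)
    (by omega)
  subst this
  linarith

theorem lat_flat {i j : ℤ} (hN : 2 ≤ N) (h : lat p q N i j) (h₁ : -1 ≤ j) (h₂ : j ≤ 1) :
    j = 0 := by
  obtain ⟨k, rfl⟩ := lat_height_dvd h
  have := eq_of_mul_near (k := k) (k' := 0) (u := N) (d := N * k) (by ring) (by omega) (by omega)
  subst this
  ring

theorem lat_thin {i j : ℤ} (hN : 2 ≤ N) (h : lat p q N i j) (h₁ : -1 ≤ i) (h₂ : i ≤ 1) :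
    i = 0 := by
  obtain ⟨k, rfl⟩ := lat_width_dvd h
  have := eq_of_mul_near (k := k) (k' := 0) (u := N) (d := N * k) (by ring) (by omega) (by omega)
  subst this
  ring

theorem IsState.eq_of_subset {x z : FState p q N} (h : x.1 ⊆ z.1) : x = z := by
  refine Subtype.ext (Finset.Subset.antisymm h fun t ht => ?_)
  obtain ⟨t', ⟨ht', hr⟩, -⟩ := x.2.2.1 (row t) (Finset.mem_univ _)
  rwa [← z.2.eq_of_row (h ht') ht hr]

section

variable (hpq : Int.gcd (p : ℤ) q = 1)

include hpq

/-- The two rectangles of a horizontal annulus. -/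
theorem IsPair.hor {x z : FState p q N} {t : FState p q N × Rect p q N × Rect p q N}
    (ht : IsPair x z t) (h : IsHor t) : x = z ∧ (t.2.1.height : ℕ) = 1 ∧ (t.2.2.height : ℕ) = 1 ∧
      t.2.2.sw = t.2.1.se ∧ (t.2.1.width : ℕ) + (t.2.2.width : ℕ) = p * N ∧
      ∀ c, t.2.1.mult c + t.2.2.mult c = if row c = row t.2.1.sw then 1 else 0 := by
  have st₁ := ht.1.step hpq x.2
  have st₂ := ht.2.step hpq t.1.2
  have hL := isLat_lat (p := p) (q := q) (N := N)
  obtain ⟨hc, hV, h₁, hPZ⟩ := annulus hL (isSt_lift hpq x.2) (isSt_lift hpq t.1.2)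
    (isSt_lift hpq z.2) st₁ st₂ h.1 h.2
  have hxz : x = z := by
    refine IsState.eq_of_subset fun c hc => ?_
    obtain ⟨i, j, rfl⟩ := exists_pt c
    exact hPZ _ _ hc
  have h₂ := h.2
  rw [h₁] at h₂
  have k₁ := st₁.hw; have k₂ := st₂.hw
  have hV' : t.2.1.toP.w + t.2.2.toP.w = (p : ℤ) * N := by
    have hd := lat_zero_right.1 hV
    have l₁ := t.2.1.width.2
    have l₂ := t.2.2.width.2
    zify at l₁ l₂
    obtain ⟨k, hk⟩ := hd
    simp only [Rect.toP_w] at *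
    have := eq_of_mul_near (k := k) (k' := 1) (u := (p : ℤ) * N)
      (d := ((t.2.1.width : ℕ) : ℤ) + ((t.2.2.width : ℕ) : ℤ) - p * N)
      (by rw [hk]; ring) (by omega) (by omega)
    rw [hk, this, mul_one]
  refine ⟨hxz, ?_, ?_, ?_, ?_, fun c => ?_⟩
  · rw [Rect.toP_h] at h₁; exact_mod_cast h₁
  · rw [Rect.toP_h] at h₂; exact_mod_cast h₂.symm
  · rw [← Rect.pt_toP, ← Rect.pt_se, eq_comm, pt_eq_iff]
    exact hc
  · rw [Rect.toP_w, Rect.toP_w] at hV'; exact_mod_cast hV'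
  rw [Rect.mult_eq_sum ht.1.1.1, Rect.mult_eq_sum ht.2.1.1]
  rcases hr : t.2.1.toP with ⟨a, b, w, hh⟩
  have e₀ : t.2.1.sw = pt a b := by rw [← Rect.pt_toP, hr]
  rw [hr] at hc hV h₁ k₁ hV'
  simp only [C1] at hc hV h₁ k₁ hV'
  subst h₁
  have e : Eqv (lat p q N) t.2.2.toP ⟨a + w, b, t.2.2.toP.w, 1⟩ :=
    ⟨hL.neg' hc (by dsimp; omega) (by dsimp; omega), rfl, h₂⟩
  rw [← e.sum_eq (Rect.mult_invariant c)]
  unfold PRect.sum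
  dsimp only
  rw [← rsum_add_width _ _ _ _ k₁.le k₂.le, hV', e₀, row_pt]
  unfold rsum
  have : ∀ f : ℤ → ℕ, ∑ j ∈ Finset.Ico b (b + 1), f j = f b := fun f => by
    rw [show Finset.Ico b (b + 1) = {b} by ext j; simp only [Finset.mem_Ico, Finset.mem_singleton]; omega,
      Finset.sum_singleton]
  simp only [this]
  split_ifs with hrow
  · obtain ⟨i, rfl⟩ := exists_pt_row hrow
    refine sum_period period_pos _ i fun j => ?_
    rw [pt_eq_iff, sub_self, lat_zero_right]
  · refine Finset.sum_eq_zero fun i _ => if_neg ?_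
    rintro rfl
    exact hrow (row_pt _ _)

/-- The two rectangles of a vertical annulus. -/
theorem IsPair.ver {x z : FState p q N} {t : FState p q N × Rect p q N × Rect p q N}
    (ht : IsPair x z t) (h : IsVer t) : x = z ∧ (t.2.1.width : ℕ) = 1 ∧ (t.2.2.width : ℕ) = 1 ∧
      t.2.2.sw = t.2.1.nw ∧ (t.2.1.height : ℕ) + (t.2.2.height : ℕ) = p * N ∧
      ∀ c, t.2.1.mult c + t.2.2.mult c = if col c = col t.2.1.sw then 1 else 0 := by
  have st₁ := ht.1.step hpq x.2
  have st₂ := ht.2.step hpq t.1.2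
  have hL := isLat_lat (p := p) (q := q) (N := N)
  obtain ⟨hc, hV, h₁, hPZ⟩ := annulus hL.transpose (isSt_lift hpq x.2).transpose
    (isSt_lift hpq t.1.2).transpose (isSt_lift hpq z.2).transpose st₁.transpose st₂.transpose h.1 h.2
  have hxz : x = z := by
    refine IsState.eq_of_subset fun c hc => ?_
    obtain ⟨i, j, rfl⟩ := exists_pt c
    exact hPZ _ _ hc
  have h₂ := h.2
  simp only [PRect.T] at hc hV h₁
  rw [h₁] at h₂
  have k₁ := st₁.hh; have k₂ := st₂.hh
  have hV' : t.2.1.toP.h + t.2.2.toP.h = (p : ℤ) * N := by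
    have hd := (lat_zero_left hpq).1 hV
    have l₁ := t.2.1.height.2
    have l₂ := t.2.2.height.2
    zify at l₁ l₂
    obtain ⟨k, hk⟩ := hd
    simp only [Rect.toP_h] at *
    have := eq_of_mul_near (k := k) (k' := 1) (u := (p : ℤ) * N)
      (d := ((t.2.1.height : ℕ) : ℤ) + ((t.2.2.height : ℕ) : ℤ) - p * N)
      (by rw [hk]; ring) (by omega) (by omega)
    rw [hk, this, mul_one]
  refine ⟨hxz, ?_, ?_, ?_, ?_, fun c => ?_⟩
  · rw [Rect.toP_w] at h₁; exact_mod_cast h₁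
  · rw [Rect.toP_w] at h₂; exact_mod_cast h₂.symm
  · rw [← Rect.pt_toP, ← Rect.pt_nw, eq_comm, pt_eq_iff]
    exact hc
  · rw [Rect.toP_h, Rect.toP_h] at hV'; exact_mod_cast hV'
  rw [Rect.mult_eq_sum ht.1.1.1, Rect.mult_eq_sum ht.2.1.1]
  rcases hr : t.2.1.toP with ⟨a, b, w, hh⟩
  have e₀ : t.2.1.sw = pt a b := by rw [← Rect.pt_toP, hr]
  rw [hr] at hc hV h₁ k₁ hV'
  simp only [C1] at hc hV h₁ k₁ hV'
  subst h₁
  have e : Eqv (lat p q N) t.2.2.toP ⟨a, b + hh, 1, t.2.2.toP.h⟩ :=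
    ⟨hL.neg' hc (by dsimp; omega) (by dsimp; omega), h₂, rfl⟩
  rw [← e.sum_eq (Rect.mult_invariant c)]
  unfold PRect.sum
  dsimp only
  rw [← rsum_add_height _ _ _ _ k₁.le k₂.le, hV', e₀, col_pt]
  unfold rsum
  have : ∀ f : ℤ → ℕ, ∑ j ∈ Finset.Ico a (a + 1), f j = f a := fun f => by
    rw [show Finset.Ico a (a + 1) = {a} by ext j; simp only [Finset.mem_Ico, Finset.mem_singleton]; omega,
      Finset.sum_singleton]
  simp only [this]
  split_ifs with hrow
  · obtain ⟨i, rfl⟩ := exists_pt_col hpq hrow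
    refine sum_period period_pos _ i fun j => ?_
    rw [pt_eq_iff, sub_self, lat_zero_left hpq]
  · refine Finset.sum_eq_zero fun i _ => if_neg ?_
    rintro rfl
    exact hrow (col_pt _ _)

theorem IsPair.hor_unique {x : FState p q N} {t u : FState p q N × Rect p q N × Rect p q N}
    (ht : IsPair x x t) (h : IsHor t) (hu : IsPair x x u) (h' : IsHor u)
    (hr : row t.2.1.sw = row u.2.1.sw) : t = u := by
  obtain ⟨-, h₁, h₂, h₃, h₄, -⟩ := ht.hor hpq h
  obtain ⟨-, k₁, k₂, k₃, k₄, -⟩ := hu.hor hpq h'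
  have e₁ : t.2.1.sw = u.2.1.sw := x.2.eq_of_row ht.1.1.2.1 hu.1.1.2.1 hr
  have e₂ : t.2.1.ne = u.2.1.ne := by
    refine x.2.eq_of_row ht.1.1.2.2.1 hu.1.1.2.2.1 ?_
    rw [Rect.ne, Rect.ne, e₁, h₁, k₁]
    obtain ⟨i, j, e⟩ := exists_pt u.2.1.sw
    rw [← e]
    rfl
  have e₃ : (t.2.1.width : ℕ) = (u.2.1.width : ℕ) := by
    rw [Rect.ne, Rect.ne, e₁, h₁, k₁, ← Rect.pt_toP, shift_pt, shift_pt, pt_eq_iff] at e₂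
    have := lat_zero_right.1 (isLat_lat.of e₂ (j' := 0) rfl (by ring))
    have l₁ := t.2.1.width.2
    have l₂ := u.2.1.width.2
    zify at l₁ l₂
    have := eq_of_dvd_sub (V := (p : ℤ) * N) (a := (t.2.1.width : ℕ)) (b := (u.2.1.width : ℕ))
      (by omega) l₁ (by omega) l₂ (by convert this using 1; ring)
    exact_mod_cast this
  have e₄ : t.2.1 = u.2.1 := Rect.ext e₁ (Fin.ext e₃) (Fin.ext (h₁.trans k₁.symm))
  have e₅ : t.2.2 = u.2.2 := Rect.ext (by rw [h₃, k₃, e₄]) (Fin.ext (by omega))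
    (Fin.ext (h₂.trans k₂.symm))
  exact Prod.ext (Subtype.ext (by rw [ht.1.1.2.2.2, hu.1.1.2.2.2, e₄])) (Prod.ext e₄ e₅)

theorem IsPair.ver_unique {x : FState p q N} {t u : FState p q N × Rect p q N × Rect p q N}
    (ht : IsPair x x t) (h : IsVer t) (hu : IsPair x x u) (h' : IsVer u)
    (hr : col t.2.1.sw = col u.2.1.sw) : t = u := by
  obtain ⟨-, h₁, h₂, h₃, h₄, -⟩ := ht.ver hpq h
  obtain ⟨-, k₁, k₂, k₃, k₄, -⟩ := hu.ver hpq h'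
  have e₁ : t.2.1.sw = u.2.1.sw := x.2.eq_of_col ht.1.1.2.1 hu.1.1.2.1 hr
  have e₂ : t.2.1.ne = u.2.1.ne := by
    refine x.2.eq_of_col ht.1.1.2.2.1 hu.1.1.2.2.1 ?_
    rw [Rect.ne, Rect.ne, e₁, h₁, k₁]
    obtain ⟨i, j, e⟩ := exists_pt u.2.1.sw
    rw [← e]
    rfl
  have e₃ : (t.2.1.height : ℕ) = (u.2.1.height : ℕ) := by
    rw [Rect.ne, Rect.ne, e₁, h₁, k₁, ← Rect.pt_toP, shift_pt, shift_pt, pt_eq_iff] at e₂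
    have := (lat_zero_left hpq).1 (isLat_lat.of e₂ (i' := 0) (by ring) rfl)
    have l₁ := t.2.1.height.2
    have l₂ := u.2.1.height.2
    zify at l₁ l₂
    have := eq_of_dvd_sub (V := (p : ℤ) * N) (a := (t.2.1.height : ℕ)) (b := (u.2.1.height : ℕ))
      (by omega) l₁ (by omega) l₂ (by convert this using 1; ring)
    exact_mod_cast this
  have e₄ : t.2.1 = u.2.1 := Rect.ext e₁ (Fin.ext (h₁.trans k₁.symm)) (Fin.ext e₃)
  have e₅ : t.2.2 = u.2.2 := Rect.ext (by rw [h₃, k₃, e₄]) (Fin.ext (h₂.trans k₂.symm))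
    (Fin.ext (by omega))
  exact Prod.ext (Subtype.ext (by rw [ht.1.1.2.2.2, hu.1.1.2.2.2, e₄])) (Prod.ext e₄ e₅)

/-- Every horizontal annulus arises. -/
theorem exists_hor (hN : 2 ≤ N) (x : FState p q N) (i : ZMod N) :
    ∃ t, IsPair x x t ∧ IsHor t ∧ row t.2.1.sw = i := by
  have hL := isLat_lat (p := p) (q := q) (N := N)
  have hx := isSt_lift hpq x.2
  obtain ⟨b, rfl⟩ := ZMod.intCast_surjective i
  obtain ⟨a, ha⟩ := hx.rowex b
  obtain ⟨a', ha'⟩ := hx.rowex (b + 1)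
  have hV := period_pos (p := p) (N := N)
  have e₁ := Int.mul_ediv_add_emod (a' - a) (p * N)
  have e₂ := Int.emod_nonneg (a' - a) hV.ne'
  have e₃ := Int.emod_lt_of_pos (a' - a) hV
  obtain ⟨w, hw⟩ : ∃ w, w = (a' - a) % (p * N) := ⟨_, rfl⟩
  rw [← hw] at e₁ e₂ e₃
  have hl : lat p q N (p * N) 0 := lat_zero_right.2 dvd_rfl
  have ha'' : lift x.1 (a + w) (b + 1) :=
    hx.trn hL ha' (hL.smul hl ((a' - a) / (p * N))) (by linarith) (by ring)
  have hw0 : w ≠ 0 := by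
    rintro rfl
    have := lat_flat hN (hx.col ha (cast2 ha'' (by omega) rfl)) (by omega) (by omega)
    omega
  obtain ⟨W, hW, s₁, s₂⟩ := exists_annulus hL hx hl (w := w) (fun i j h k₁ k₂ k₃ k₄ => by
    have := lat_flat hN h k₃ k₄
    subst this
    obtain ⟨k, hk⟩ := lat_zero_right.1 h
    have := eq_of_mul_near (k := k) (k' := 0) (u := (p : ℤ) * N) (d := i) (by rw [hk]; ring)
      (by omega) (by omega)
    subst this
    exact ⟨by linarith, rfl⟩) (by omega) e₃ ha ha''
  obtain ⟨y, rfl⟩ := exists_state hpq hW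
  obtain ⟨r, hr⟩ := Rect.exists_of_step hpq s₁
  obtain ⟨s, hs⟩ := Rect.exists_of_step hpq s₂
  have k₁ := Rect.IsEmptyFromTo.of_step hpq x.2 y.2 (s₁.congr hL hx hW hr)
  have k₂ := Rect.IsEmptyFromTo.of_step hpq y.2 x.2 (s₂.congr hL hW hx hs)
  refine ⟨⟨y, r, s⟩, ⟨k₁, k₂⟩, ⟨Or.inl ?_, ?_⟩, ?_⟩
  · obtain ⟨r₁, r₂, r₃⟩ := hr
    obtain ⟨r₁', r₂', r₃'⟩ := hs
    dsimp only at *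
    exact hL.sub' r₁' r₁
  · exact hr.2.2.trans hs.2.2.symm
  · rw [← Rect.pt_toP, ← pt_eq_iff.2 hr.1, row_pt]

theorem exists_ver (hN : 2 ≤ N) (x : FState p q N) (i : ZMod N) :
    ∃ t, IsPair x x t ∧ IsVer t ∧ col t.2.1.sw = i := by
  have hL := isLat_lat (p := p) (q := q) (N := N)
  have hx := isSt_lift hpq x.2
  obtain ⟨b, rfl⟩ := ZMod.intCast_surjective i
  obtain ⟨a, ha⟩ := hx.colex b
  obtain ⟨a', ha'⟩ := hx.colex (b + 1)
  have hV := period_pos (p := p) (N := N)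
  have e₁ := Int.mul_ediv_add_emod (a' - a) (p * N)
  have e₂ := Int.emod_nonneg (a' - a) hV.ne'
  have e₃ := Int.emod_lt_of_pos (a' - a) hV
  obtain ⟨w, hw⟩ : ∃ w, w = (a' - a) % (p * N) := ⟨_, rfl⟩
  rw [← hw] at e₁ e₂ e₃
  have hl : lat p q N 0 (p * N) := (lat_zero_left hpq).2 dvd_rfl
  have ha'' : lift x.1 (b + 1) (a + w) :=
    hx.trn hL ha' (hL.smul hl ((a' - a) / (p * N))) (by ring) (by linarith)
  have hw0 : w ≠ 0 := by
    rintro rfl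
    have := lat_thin hN (hx.row ha (cast2 ha'' rfl (by omega))) (by omega) (by omega)
    omega
  obtain ⟨W, hW, s₁, s₂⟩ := exists_annulus hL.transpose hx.transpose hl (w := w)
    (fun i j h k₁ k₂ k₃ k₄ => by
    have := lat_thin hN h k₃ k₄
    subst this
    obtain ⟨k, hk⟩ := (lat_zero_left hpq).1 h
    have := eq_of_mul_near (k := k) (k' := 0) (u := (p : ℤ) * N) (d := i) (by rw [hk]; ring)
      (by omega) (by omega)
    subst this
    exact ⟨by linarith, rfl⟩) (by omega) e₃ ha ha''
  have hW' := hW.transpose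
  have s₁' := s₁.transpose
  have s₂' := s₂.transpose
  obtain ⟨y, hy⟩ := exists_state hpq hW'
  rw [← hy] at s₁' s₂' hW'
  obtain ⟨r, hr⟩ := Rect.exists_of_step hpq s₁'
  obtain ⟨s, hs⟩ := Rect.exists_of_step hpq s₂'
  have k₁ := Rect.IsEmptyFromTo.of_step hpq x.2 y.2 (s₁'.congr hL hx hW' hr)
  have k₂ := Rect.IsEmptyFromTo.of_step hpq y.2 x.2 (s₂'.congr hL hW' hx hs)
  refine ⟨⟨y, r, s⟩, ⟨k₁, k₂⟩, ⟨Or.inl ?_, ?_⟩, ?_⟩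
  · obtain ⟨r₁, r₂, r₃⟩ := hr
    obtain ⟨r₁', r₂', r₃'⟩ := hs
    simp only [PRect.T, C1] at *
    exact hL.sub' r₁' r₁
  · exact hr.2.1.trans hs.2.1.symm
  · rw [← Rect.pt_toP, ← pt_eq_iff.2 hr.1, col_pt]
    rfl

omit hpq in
theorem two_le_of_rect {x y : FState p q N} {r : Rect p q N} (h : r.IsFromTo x.1 y.1) : 2 ≤ N := by
  by_contra hN
  have hN1 : N = 1 := by have := NeZero.pos N; omega
  have : Subsingleton (ZMod N) := by rw [hN1]; infer_instance
  have e : r.sw = r.ne := x.2.eq_of_row h.2.1 h.2.2.1 (Subsingleton.elim _ _)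
  have := h.1.2.2 0 0 r.width r.height (by omega) (by omega) (by omega) (by omega) (by
    push_cast
    rw [shift_zero]; exact e)
  have := h.1.1
  omega

open scoped Classical in
/-- The weighted count of the pairs of consecutive empty rectangles, for a weight that depends
only on the sum of their multiplicities: all pairs cancel except the annuli. -/
theorem sum_pairs {A : Type} [CommRing A] {S : Signs p q N} (hS : GoodSigns A S)
    (W : (Torus p q N → ℕ) → A) (x z : FState p q N) :
    ∑ t ∈ Finset.univ.filter (IsPair x z), sgn A S x.1 t.1.1 t.2.1 * sgn A S t.1.1 z.1 t.2.2 *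
      W (fun c => t.2.1.mult c + t.2.2.mult c) =
    if x = z then ∑ i, W (fun c => if row c = i then 1 else 0) -
      ∑ j, W (fun c => if col c = j then 1 else 0) else 0 := by
  rcases Nat.lt_or_ge N 2 with hN | hN
  · have hN1 : N = 1 := by have := NeZero.pos N; omega
    have hs : Subsingleton (ZMod N) := by rw [hN1]; infer_instance
    rw [Finset.sum_eq_zero]
    · rw [Finset.sum_congr rfl fun i _ => congrArg W (funext fun c =>
        if_pos (Subsingleton.elim (row c) i)), Finset.sum_congr rfl fun i _ => congrArg W
        (funext fun c => if_pos (Subsingleton.elim (col c) i)), sub_self, ite_self]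
    · intro t ht
      have := two_le_of_rect (Finset.mem_filter.1 ht).2.1.1
      omega
  have hL := isLat_lat (p := p) (q := q) (N := N)
  set F : FState p q N × Rect p q N × Rect p q N → A := fun t =>
    sgn A S x.1 t.1.1 t.2.1 * sgn A S t.1.1 z.1 t.2.2 *
      W (fun c => t.2.1.mult c + t.2.2.mult c) with hF
  set P := Finset.univ.filter (IsPair x z) with hP
  have memP : ∀ t, t ∈ P ↔ IsPair x z t := fun t => by rw [hP, Finset.mem_filter]; simp
  rw [← Finset.sum_filter_add_sum_filter_not P IsHor F,
    ← Finset.sum_filter_add_sum_filter_not (P.filter fun t => ¬ IsHor t) IsVer F]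
  have h₀ : ∑ t ∈ (P.filter fun t => ¬ IsHor t).filter (fun t => ¬ IsVer t), F t = 0 := by
    have mem : ∀ t, t ∈ (P.filter fun t => ¬ IsHor t).filter (fun t => ¬ IsVer t) ↔
        IsPair x z t ∧ ¬ IsHor t ∧ ¬ IsVer t := fun t => by
      rw [Finset.mem_filter, Finset.mem_filter, memP, and_assoc]
    refine sum_eq_zero_of_matching _ F PairRel ?_ (fun t u h => h.symm) ?_
    · intro t ht
      obtain ⟨ht, n₁, n₂⟩ := (mem t).1 ht
      obtain ⟨u, hu, hne, hr, hm⟩ := ht.exists_partner hpq n₁ n₂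
      refine ⟨u, (mem u).2 ⟨hu, hr.symm.not_annular hpq hu ht⟩, fun h => hne (by rw [h]), hr, ?_⟩
      simp only [hF, hm]
      rw [hS.alt x t.1 u.1 z _ _ _ _ ht.1.1 ht.2.1 hu.1.1 hu.2.1 hne fun c => (hm c).symm]
      ring
    · intro t ht u hu v hv h₁ h₂
      exact IsPair.unique hpq ((mem t).1 ht).1 ((mem u).1 hu).1 ((mem v).1 hv).1 h₁ h₂
  rw [h₀, add_zero]
  split_ifs with hxz
  · subst hxz
    rw [sub_eq_add_neg, ← Finset.sum_neg_distrib]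
    congr 1
    · refine Finset.sum_nbij (fun t => row t.2.1.sw) (fun _ _ => Finset.mem_univ _) ?_ ?_ ?_
      · intro t ht u hu h
        rw [Finset.mem_coe, Finset.mem_filter, memP] at ht hu
        exact ht.1.hor_unique hpq ht.2 hu.1 hu.2 h
      · intro i _
        obtain ⟨t, h₁, h₂, h₃⟩ := exists_hor hpq hN x i
        exact ⟨t, by rw [Finset.mem_coe, Finset.mem_filter, memP]; exact ⟨h₁, h₂⟩, h₃⟩
      · intro t ht
        rw [Finset.mem_filter, memP] at ht
        obtain ⟨-, -, -, -, -, hm⟩ := ht.1.hor hpq ht.2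
        simp only [hF]
        rw [hS.hor hN x t.1 _ _ ht.1.1.1 ht.1.2.1 ⟨_, hm⟩, one_mul]
        exact congrArg W (funext hm)
    · refine Finset.sum_nbij (fun t => col t.2.1.sw) (fun _ _ => Finset.mem_univ _) ?_ ?_ ?_
      · intro t ht u hu h
        rw [Finset.mem_coe, Finset.mem_filter, Finset.mem_filter, memP] at ht hu
        exact ht.1.1.ver_unique hpq ht.2 hu.1.1 hu.2 h
      · intro i _
        obtain ⟨t, h₁, h₂, h₃⟩ := exists_ver hpq hN x i
        refine ⟨t, ?_, h₃⟩
        rw [Finset.mem_coe, Finset.mem_filter, Finset.mem_filter, memP]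
        exact ⟨⟨h₁, fun hh => not_both_cuts hL (h₁.1.step hpq x.2) (h₁.2.step hpq t.1.2) hh.1 h₂.1⟩,
          h₂⟩
      · intro t ht
        rw [Finset.mem_filter, Finset.mem_filter, memP] at ht
        obtain ⟨-, -, -, -, -, hm⟩ := ht.1.1.ver hpq ht.2
        simp only [hF]
        rw [hS.ver hN x t.1 _ _ ht.1.1.1.1 ht.1.1.2.1 ⟨_, hm⟩, neg_one_mul]
        exact congrArg (fun m => -W m) (funext hm)
  · rw [Finset.sum_eq_zero, Finset.sum_eq_zero, add_zero]
    · intro t ht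
      rw [Finset.mem_filter, Finset.mem_filter, memP] at ht
      exact (hxz (ht.1.1.ver hpq ht.2).1).elim
    · intro t ht
      rw [Finset.mem_filter, memP] at ht
      exact (hxz (ht.1.hor hpq ht.2).1).elim

end

end

/-! ### The block at a crossing corner -/

section

variable {p : ℕ} {q : ℤ} {N : ℕ}

theorem Rect.mult_eq_zero {r : Rect p q N} {t : Torus p q N} : r.mult t = 0 ↔ t ∉ r.cells := by
  unfold Rect.mult; split_ifs with h <;> simp [h]

theorem Rect.mult_eq_one {r : Rect p q N} {t : Torus p q N} : r.mult t = 1 ↔ t ∈ r.cells := by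
  unfold Rect.mult; split_ifs with h <;> simp [h]

theorem Rect.mem_cells {r : Rect p q N} {t : Torus p q N} : t ∈ r.cells ↔ ∃ i j, pt i j = t ∧
    r.toP.x ≤ i ∧ i < r.toP.x + r.toP.w ∧ r.toP.y ≤ j ∧ j < r.toP.y + r.toP.h := by
  have ew := r.toP_w
  have eh := r.toP_h
  constructor
  · rintro ⟨i, j, hi, hj, rfl⟩
    exact ⟨r.toP.x + i, r.toP.y + j, by rw [← Rect.pt_toP, shift_pt], by omega, by omega, by omega,
      by omega⟩
  · rintro ⟨i, j, rfl, h₁, h₂, h₃, h₄⟩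
    refine ⟨(i - r.toP.x).toNat, (j - r.toP.y).toNat, by omega, by omega, ?_⟩
    rw [← Rect.pt_toP, shift_pt]
    congr 1 <;> omega

theorem Rect.multAt_eq_zero {r : Rect p q N} {T : Finset (Torus p q N)} :
    r.multAt T = 0 ↔ ∀ t ∈ T, t ∉ r.cells := by
  unfold Rect.multAt
  rw [Finset.sum_eq_zero_iff]
  exact forall₂_congr fun t _ => Rect.mult_eq_zero

/-- A cell of the block around the point `t`, given by its lower left corner relative to `t`, lies
in `r` if and only if some lift of `t` is placed accordingly. -/
theorem Rect.shift_mem_cells {r : Rect p q N} {t : Torus p q N} (a b : ℤ) :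
    shift t a b ∈ r.cells ↔ ∃ i j, pt i j = t ∧ r.toP.x ≤ i + a ∧ i + a < r.toP.x + r.toP.w ∧
      r.toP.y ≤ j + b ∧ j + b < r.toP.y + r.toP.h := by
  rw [Rect.mem_cells]
  constructor
  · rintro ⟨i, j, h, h₁⟩
    refine ⟨i - a, j - b, ?_, by omega⟩
    have : shift (shift t a b) (-a) (-b) = t := by
      rw [shift_shift, add_neg_cancel, add_neg_cancel, shift_zero]
    rw [← this, ← h, shift_pt]
    rfl
  · rintro ⟨i, j, rfl, h⟩
    exact ⟨i + a, j + b, rfl, h⟩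

variable [NeZero p] [NeZero N] {r : Rect p q N} {x y : FState p q N} {t : Torus p q N}

section

variable (hpq : Int.gcd (p : ℤ) q = 1) (h : r.IsEmptyFromTo x.1 y.1)

include hpq h

theorem Rect.IsEmptyFromTo.target_corner (ht : t ∈ y.1) {i j : ℤ} (hij : pt i j = t)
    (h₁ : r.toP.x ≤ i) (h₂ : i ≤ r.toP.x + r.toP.w) (h₃ : r.toP.y ≤ j)
    (h₄ : j ≤ r.toP.y + r.toP.h) :
    (i = r.toP.x + r.toP.w ∧ j = r.toP.y) ∨ (i = r.toP.x ∧ j = r.toP.y + r.toP.h) := by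
  have st := h.step hpq x.2
  have := st.qemp isLat_lat (isSt_lift hpq x.2) (isSt_lift hpq y.2) (i := i) (j := j)
    (by rw [lift, hij]; exact ht) h₁ h₂ h₃ h₄
  omega

theorem Rect.IsEmptyFromTo.source_corner (ht : t ∈ x.1) {i j : ℤ} (hij : pt i j = t)
    (h₁ : r.toP.x ≤ i) (h₂ : i ≤ r.toP.x + r.toP.w) (h₃ : r.toP.y ≤ j)
    (h₄ : j ≤ r.toP.y + r.toP.h) :
    (i = r.toP.x ∧ j = r.toP.y) ∨ (i = r.toP.x + r.toP.w ∧ j = r.toP.y + r.toP.h) :=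
  (h.step hpq x.2).emp i j (by rw [lift, hij]; exact ht) h₁ h₂ h₃ h₄

/-- The four cells around a point that stays are not covered. -/
theorem Rect.IsEmptyFromTo.mult_stay (hx : t ∈ x.1) (hy : t ∈ y.1) {a b : ℤ} (ha : -1 ≤ a)
    (ha' : a ≤ 0) (hb : -1 ≤ b) (hb' : b ≤ 0) : r.mult (shift t a b) = 0 := by
  rw [Rect.mult_eq_zero, Rect.shift_mem_cells]
  rintro ⟨i, j, hij, h₁, h₂, h₃, h₄⟩
  have k₁ := h.source_corner hpq hx hij (by omega) (by omega) (by omega) (by omega)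
  have k₂ := h.target_corner hpq hy hij (by omega) (by omega) (by omega) (by omega)
  have st := h.step hpq x.2
  have := st.hw; have := st.hh
  omega

/-- Around a point of `x` that leaves, one of the two diagonal cells is covered. -/
theorem Rect.IsEmptyFromTo.mult_leave (hx : t ∈ x.1) (hy : t ∉ y.1) :
    r.mult (shift t 0 0) + r.mult (shift t (-1) (-1)) = 1 ∧
      r.mult (shift t (-1) 0) = 0 ∧ r.mult (shift t 0 (-1)) = 0 := by
  have st := h.step hpq x.2
  have hw := st.hw; have hh := st.hh
  have k₁ : ¬ (shift t 0 0 ∈ r.cells ∧ shift t (-1) (-1) ∈ r.cells) := by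
    rw [Rect.shift_mem_cells, Rect.shift_mem_cells]
    rintro ⟨⟨i, j, hij, h₁, h₂, h₃, h₄⟩, i', j', hij', h₁', h₂', h₃', h₄'⟩
    have k₁ := h.source_corner hpq hx hij (by omega) (by omega) (by omega) (by omega)
    have k₂ := h.source_corner hpq hx hij' (by omega) (by omega) (by omega) (by omega)
    have := st.emb _ _ (pt_eq_iff.1 (hij.trans hij'.symm)) (by omega) (by omega) (by omega)
      (by omega)
    omega
  have k₂ : shift t 0 0 ∈ r.cells ∨ shift t (-1) (-1) ∈ r.cells := by
    obtain ⟨i, j, rfl⟩ := exists_pt t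
    rw [Rect.shift_mem_cells, Rect.shift_mem_cells]
    rcases st.rest i j hx with hq | hl | hl
    · exact (hy hq).elim
    · exact Or.inl ⟨r.toP.x, r.toP.y, pt_eq_iff.2 hl, by omega, by omega, by omega, by omega⟩
    · exact Or.inr ⟨r.toP.x + r.toP.w, r.toP.y + r.toP.h, pt_eq_iff.2 hl, by omega, by omega,
        by omega, by omega⟩
  refine ⟨?_, ?_, ?_⟩
  · rcases k₂ with k | k
    · rw [Rect.mult_eq_one.2 k, Rect.mult_eq_zero.2 fun k' => k₁ ⟨k, k'⟩]
    · rw [Rect.mult_eq_one.2 k, Rect.mult_eq_zero.2 fun k' => k₁ ⟨k', k⟩]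
  all_goals
    rw [Rect.mult_eq_zero, Rect.shift_mem_cells]
    rintro ⟨i, j, hij, h₁, h₂, h₃, h₄⟩
    have := h.source_corner hpq hx hij (by omega) (by omega) (by omega) (by omega)
    omega

/-- Around a point of `y` that arrives, one of the two antidiagonal cells is covered. -/
theorem Rect.IsEmptyFromTo.mult_arrive (hx : t ∉ x.1) (hy : t ∈ y.1) :
    r.mult (shift t (-1) 0) + r.mult (shift t 0 (-1)) = 1 ∧
      r.mult (shift t 0 0) = 0 ∧ r.mult (shift t (-1) (-1)) = 0 := by
  have st := h.step hpq x.2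
  have hw := st.hw; have hh := st.hh
  have k₁ : ¬ (shift t (-1) 0 ∈ r.cells ∧ shift t 0 (-1) ∈ r.cells) := by
    rw [Rect.shift_mem_cells, Rect.shift_mem_cells]
    rintro ⟨⟨i, j, hij, h₁, h₂, h₃, h₄⟩, i', j', hij', h₁', h₂', h₃', h₄'⟩
    have k₁ := h.target_corner hpq hy hij (by omega) (by omega) (by omega) (by omega)
    have k₂ := h.target_corner hpq hy hij' (by omega) (by omega) (by omega) (by omega)
    have := st.emb _ _ (pt_eq_iff.1 (hij.trans hij'.symm)) (by omega) (by omega) (by omega)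
      (by omega)
    omega
  have k₂ : shift t (-1) 0 ∈ r.cells ∨ shift t 0 (-1) ∈ r.cells := by
    obtain ⟨i, j, rfl⟩ := exists_pt t
    rw [Rect.shift_mem_cells, Rect.shift_mem_cells]
    rcases st.back isLat_lat (isSt_lift hpq x.2) (isSt_lift hpq y.2) (i := i) (j := j) hy with
      hq | hl | hl
    · exact (hx hq.1).elim
    · exact Or.inl ⟨r.toP.x + r.toP.w, r.toP.y, pt_eq_iff.2 hl, by omega, by omega, by omega,
        by omega⟩
    · exact Or.inr ⟨r.toP.x, r.toP.y + r.toP.h, pt_eq_iff.2 hl, by omega, by omega,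
        by omega, by omega⟩
  refine ⟨?_, ?_, ?_⟩
  · rcases k₂ with k | k
    · rw [Rect.mult_eq_one.2 k, Rect.mult_eq_zero.2 fun k' => k₁ ⟨k, k'⟩]
    · rw [Rect.mult_eq_one.2 k, Rect.mult_eq_zero.2 fun k' => k₁ ⟨k', k⟩]
  all_goals
    rw [Rect.mult_eq_zero, Rect.shift_mem_cells]
    rintro ⟨i, j, hij, h₁, h₂, h₃, h₄⟩
    have := h.target_corner hpq hy hij (by omega) (by omega) (by omega) (by omega)
    omega

/-- Around a point that is not a corner, a diagonal cell is covered if and only if an antidiagonal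
cell is. -/
theorem Rect.IsEmptyFromTo.mult_away (hx : t ∉ x.1) (hy : t ∉ y.1) :
    (r.mult (shift t 0 0) = 0 ∧ r.mult (shift t (-1) (-1)) = 0) ↔
      (r.mult (shift t (-1) 0) = 0 ∧ r.mult (shift t 0 (-1)) = 0) := by
  have st := h.step hpq x.2
  have hw := st.hw; have hh := st.hh
  have e : ∀ i j, pt i j = t → ¬ (i = r.toP.x ∧ j = r.toP.y) ∧
      ¬ (i = r.toP.x + r.toP.w ∧ j = r.toP.y + r.toP.h) ∧ ¬ (i = r.toP.x + r.toP.w ∧ j = r.toP.y) ∧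
      ¬ (i = r.toP.x ∧ j = r.toP.y + r.toP.h) := by
    rintro i j rfl
    refine ⟨?_, ?_, ?_, ?_⟩ <;> rintro ⟨rfl, rfl⟩
    exacts [hx st.sw, hx st.ne, hy st.se, hy st.nw]
  simp only [Rect.mult_eq_zero, Rect.shift_mem_cells]
  constructor
  · rintro ⟨n₁, n₂⟩
    constructor <;>
    · rintro ⟨i, j, hij, h₁, h₂, h₃, h₄⟩
      have := e i j hij
      by_cases h₅ : i < r.toP.x + r.toP.w ∧ r.toP.x ≤ i ∧ j < r.toP.y + r.toP.h ∧ r.toP.y ≤ j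
      · exact n₁ ⟨i, j, hij, by omega, by omega, by omega, by omega⟩
      · exact n₂ ⟨i, j, hij, by omega, by omega, by omega, by omega⟩
  · rintro ⟨n₁, n₂⟩
    constructor <;>
    · rintro ⟨i, j, hij, h₁, h₂, h₃, h₄⟩
      have := e i j hij
      by_cases h₅ : i - 1 < r.toP.x + r.toP.w ∧ r.toP.x ≤ i - 1 ∧ j < r.toP.y + r.toP.h ∧ r.toP.y ≤ j
      · exact n₁ ⟨i, j, hij, by omega, by omega, by omega, by omega⟩
      · exact n₂ ⟨i, j, hij, by omega, by omega, by omega, by omega⟩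

end

end

namespace LinkGrid

section

variable {p : ℕ} {q : ℤ} {N : ℕ} {g : LinkGrid p q N}

namespace Crossing

theorem corner_pos {c : g.Crossing} (h : c.Positive) : c.corner = c.1 := by rw [corner, if_pos h]

theorem corner_neg {c : g.Crossing} (h : ¬ c.Positive) : c.corner = shift c.1 1 0 := by
  rw [corner, if_neg h]

theorem side_pos {c : g.Crossing} (h : c.Positive) : c.side = shift c.corner (-1) 0 := by
  rw [side, if_pos h, corner_pos h]

theorem side_neg {c : g.Crossing} (h : ¬ c.Positive) : c.side = shift c.corner 0 0 := by
  rw [side, if_neg h, corner_neg h, shift_zero]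

theorem below_pos {c : g.Crossing} (h : c.Positive) : c.below = shift c.corner 0 (-1) := by
  rw [below, corner_pos h]

theorem below_neg {c : g.Crossing} (h : ¬ c.Positive) : c.below = shift c.corner (-1) (-1) := by
  rw [below, corner_neg h, shift_shift]; rfl

theorem self_pos {c : g.Crossing} (h : c.Positive) : c.1 = shift c.corner 0 0 := by
  rw [shift_zero, corner_pos h]

theorem self_neg {c : g.Crossing} (h : ¬ c.Positive) : c.1 = shift c.corner (-1) 0 := by
  rw [corner_neg h, shift_shift]; exact (shift_zero _).symm

theorem opposite_pos {c : g.Crossing} (h : c.Positive) :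
    c.opposite = shift c.corner (-1) (-1) := by
  rw [opposite, if_pos h, corner_pos h]

theorem opposite_neg {c : g.Crossing} (h : ¬ c.Positive) :
    c.opposite = shift c.corner 0 (-1) := by
  rw [opposite, if_neg h, corner_neg h, shift_shift]; rfl

/-- The number of times a domain covers the `2 × 2` block of `c`. -/
def n (c : g.Crossing) (m : Torus p q N → ℕ) : ℕ :=
  m c.side + m c.below + m c.1 + m c.opposite

theorem n_eq (c : g.Crossing) (m : Torus p q N → ℕ) : c.n m = m (shift c.corner 0 0) +
    m (shift c.corner (-1) (-1)) + m (shift c.corner (-1) 0) + m (shift c.corner 0 (-1)) := by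
  unfold n
  by_cases h : c.Positive
  · rw [side_pos h, below_pos h, self_pos h, opposite_pos h]
    rw [← self_pos h]; ring
  · rw [side_neg h, below_neg h, opposite_neg h]
    nth_rw 1 [self_neg h]

theorem n_add (c : g.Crossing) (m m' : Torus p q N → ℕ) :
    c.n (fun t => m t + m' t) = c.n m + c.n m' := by
  unfold n; ring

end Crossing

theorem shift_row (t : Torus p q N) (a b : ℤ) : row (shift t a b) = row t + (b : ZMod N) := by
  obtain ⟨i, j, rfl⟩ := exists_pt t
  rw [shift_pt, row_pt, row_pt]; push_cast; rfl

theorem shift_col (t : Torus p q N) (a b : ℤ) : col (shift t a b) = col t + (a : ZMod N) := by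
  obtain ⟨i, j, rfl⟩ := exists_pt t
  rw [shift_pt, col_pt, col_pt]; push_cast; rfl

namespace Crossing

theorem row_side (c : g.Crossing) : row c.side = row c.1 := by
  by_cases h : c.Positive
  · rw [side, if_pos h, shift_row]; simp
  · rw [side, if_neg h, shift_row]; simp

theorem col_below (c : g.Crossing) : col c.below = col c.1 := by
  rw [below, shift_col]; simp

theorem row_opposite (c : g.Crossing) : row c.opposite = row c.below := by
  by_cases h : c.Positive
  · rw [opposite, if_pos h, below, shift_row, shift_row]
  · rw [opposite, if_neg h, below, shift_row, shift_row]

theorem col_opposite (c : g.Crossing) : col c.opposite = col c.side := by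
  by_cases h : c.Positive
  · rw [opposite, if_pos h, side, if_pos h, shift_col, shift_col]
  · rw [opposite, if_neg h, side, if_neg h, shift_col, shift_col]

end Crossing

theorem eq_of_row_X (g : LinkGrid p q N) {t t' : Torus p q N} (ht : t ∈ g.X) (ht' : t' ∈ g.X)
    (h : row t = row t') : t = t' := by
  have hc : (g.X.filter (row · = row t')).card ≤ 1 := by
    rcases g.row_cond (row t') with h | h <;> omega
  exact Finset.card_le_one.1 hc _ (Finset.mem_filter.2 ⟨ht, h⟩) _ (Finset.mem_filter.2 ⟨ht', rfl⟩)

theorem eq_of_col_X (g : LinkGrid p q N) {t t' : Torus p q N} (ht : t ∈ g.X) (ht' : t' ∈ g.X)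
    (h : col t = col t') : t = t' := by
  have hc : (g.X.filter (col · = col t')).card ≤ 1 := by
    rcases g.col_cond (col t') with h | h <;> omega
  exact Finset.card_le_one.1 hc _ (Finset.mem_filter.2 ⟨ht, h⟩) _ (Finset.mem_filter.2 ⟨ht', rfl⟩)

/-- The two marks of a crossing. -/
def Crossing.mark (c : g.Crossing) (b : Bool) : Torus p q N :=
  if b then c.side else c.below

theorem Crossing.mem_A {c : g.Crossing} {t : Torus p q N} : t ∈ c.A ↔ ∃ b, t = c.mark b := by
  simp only [Crossing.A, Finset.mem_insert, Finset.mem_singleton, Crossing.mark]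
  constructor
  · rintro (h | h)
    exacts [⟨true, h⟩, ⟨false, h⟩]
  · rintro ⟨_ | _, h⟩
    exacts [Or.inr h, Or.inl h]

section

variable (hsp : g.IsSpecial) (hst : ∀ c : g.Crossing, g.IsStandardAt c)

include hst in
theorem mark_mem (c : g.Crossing) (b : Bool) : c.mark b ∈ g.X := by
  cases b
  exacts [(hst c).below_mem, (hst c).side_mem]

theorem side_ne_below_of_ne (hsp : g.IsSpecial) {c c' : g.Crossing} (hne : c ≠ c') :
    c.side ≠ c'.below := by
  intro h
  have e : c'.1 = shift c.side 0 1 := by rw [h, Crossing.below, shift_shift]; exact (shift_zero _).symm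
  by_cases hp : c.Positive
  · rw [Crossing.side, if_pos hp, shift_shift] at e
    exact hsp.no_common_corner c c' hne _ _ (by norm_num) (by norm_num) e
  · rw [Crossing.side, if_neg hp, shift_shift] at e
    exact hsp.no_common_corner c c' hne _ _ (by norm_num) (by norm_num) e

include hsp hst in
theorem mark_injective : Function.Injective fun a : g.Crossing × Bool => a.1.mark a.2 := by
  rintro ⟨c, b⟩ ⟨c', b'⟩ h
  simp only [Crossing.mark] at h
  by_cases hcc : c = c'
  · subst hcc
    cases b <;> cases b' <;> simp_all [(hst c).side_ne_below, (hst c).side_ne_below.symm]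
  · exfalso
    cases b <;> cases b' <;> simp only [if_true, Bool.false_eq_true, if_false] at h
    · exact hcc (hsp.col_inj _ _ (by rw [← Crossing.col_below, h, Crossing.col_below]))
    · exact side_ne_below_of_ne hsp (Ne.symm hcc) h.symm
    · exact side_ne_below_of_ne hsp hcc h
    · exact hcc (hsp.row_inj _ _ (by rw [← Crossing.row_side, h, Crossing.row_side]))

include hsp hst in
theorem mark_row_injective :
    Function.Injective fun a : g.Crossing × Bool => row (a.1.mark a.2) := fun _ _ h =>
  mark_injective hsp hst (g.eq_of_row_X (mark_mem hst _ _) (mark_mem hst _ _) h)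

include hsp hst in
theorem mark_col_injective :
    Function.Injective fun a : g.Crossing × Bool => col (a.1.mark a.2) := fun _ _ h =>
  mark_injective hsp hst (g.eq_of_col_X (mark_mem hst _ _) (mark_mem hst _ _) h)

include hsp hst in
theorem n_row (c : g.Crossing) (i : ZMod N) :
    c.n (fun t => if row t = i then 1 else 0) = if ∃ b, i = row (c.mark b) then 2 else 0 := by
  have hne : row c.side ≠ row c.below := fun h => by
    have := mark_row_injective hsp hst (a₁ := (c, true)) (a₂ := (c, false)) h
    simp at this
  unfold Crossing.n
  simp only [Crossing.row_opposite, ← Crossing.row_side, Bool.exists_bool, Crossing.mark, if_true,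
    Bool.false_eq_true, if_false]
  by_cases h₁ : row c.side = i
  · have h₂ : row c.below ≠ i := fun h => hne (h₁.trans h.symm)
    simp [h₁, h₂]
  · by_cases h₂ : row c.below = i
    · simp [h₁, h₂]
    · simp [h₁, h₂, Ne.symm h₁, Ne.symm h₂]

include hsp hst in
theorem n_col (c : g.Crossing) (i : ZMod N) :
    c.n (fun t => if col t = i then 1 else 0) = if ∃ b, i = col (c.mark b) then 2 else 0 := by
  have hne : col c.side ≠ col c.below := fun h => by
    have := mark_col_injective hsp hst (a₁ := (c, true)) (a₂ := (c, false)) h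
    simp at this
  unfold Crossing.n
  simp only [Crossing.col_opposite, ← Crossing.col_below, Bool.exists_bool, Crossing.mark, if_true,
    Bool.false_eq_true, if_false]
  by_cases h₁ : col c.side = i
  · have h₂ : col c.below ≠ i := fun h => hne (h₁.trans h.symm)
    simp [h₁, h₂]
  · by_cases h₂ : col c.below = i
    · simp [h₁, h₂]
    · simp [h₁, h₂, Ne.symm h₁, Ne.symm h₂]

end

end

/-! ### The total complex -/

/-- The label of a crossing in the total complex: `away` for states that avoid the crossing corner,
and three copies `p₀`, `p₁`, `p₂` of the states that contain it. -/
inductive Loc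
  | p₀ | p₁ | p₂ | away
  deriving DecidableEq

namespace Loc

instance : Fintype Loc := ⟨{p₀, p₁, p₂, away}, fun l => by cases l <;> simp⟩

/-- The transitions of a label along a rectangle that covers `n` cells of the block. -/
def Lam (l l' : Loc) (n : ℕ) : Prop :=
  (n = 0 ∧ l = l') ∨ (n = 1 ∧ ((l = p₀ ∧ l' = away) ∨ (l = away ∧ l' = p₂)))

/-- The order on the labels along which the differential of the total complex moves. -/
def Le (l l' : Loc) : Prop := l = l' ∨ l = p₀ ∨ l' = p₂

theorem Lam.le {l l' : Loc} {n : ℕ} (h : Lam l l' n) : Le l l' := by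
  rcases h with ⟨-, rfl⟩ | ⟨-, ⟨rfl, rfl⟩ | ⟨rfl, rfl⟩⟩ <;> simp [Le]

/-- The transitions of a label along two consecutive rectangles. -/
def Mu (l l' : Loc) (n : ℕ) : Prop := Lam l l' n ∨ (n = 2 ∧ l = p₀ ∧ l' = p₂)

instance (l l' : Loc) (n : ℕ) : Decidable (Lam l l' n) := by unfold Lam; infer_instance

instance (l l' : Loc) (n : ℕ) : Decidable (Mu l l' n) := by unfold Mu; infer_instance

/-- The label of the middle state of two consecutive rectangles. -/
def mid (l : Loc) (away' : Prop) [Decidable away'] : Loc :=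
  if away' then away else if l = away then p₂ else l

/-- The sign that a label contributes to the differential. -/
def sign (A : Type) [CommRing A] (l : Loc) : A := if l = p₁ then -1 else 1

theorem sign_mul_self (A : Type) [CommRing A] (l : Loc) : sign A l * sign A l = 1 := by
  unfold sign; split_ifs <;> simp

theorem Lam.p₁_iff {l l' : Loc} {n : ℕ} (h : Lam l l' n) : l = p₁ ↔ l' = p₁ := by
  rcases h with ⟨-, rfl⟩ | ⟨-, ⟨rfl, rfl⟩ | ⟨rfl, rfl⟩⟩ <;> simp

theorem Lam.sign_eq {l l' : Loc} {n : ℕ} (A : Type) [CommRing A] (h : Lam l l' n) :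
    sign A l = sign A l' := by
  unfold sign; simp only [h.p₁_iff]

theorem lam_p₀ {l : Loc} {n : ℕ} : Lam l p₀ n ↔ n = 0 ∧ l = p₀ := by
  unfold Lam; simp

theorem lam_p₁ {l : Loc} {n : ℕ} : Lam l p₁ n ↔ n = 0 ∧ l = p₁ := by
  unfold Lam; simp

theorem p₁_lam {l : Loc} {n : ℕ} : Lam p₁ l n ↔ n = 0 ∧ l = p₁ := by
  unfold Lam; simp [eq_comm]

theorem p₂_lam {l : Loc} {n : ℕ} : Lam p₂ l n ↔ n = 0 ∧ l = p₂ := by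
  unfold Lam; simp [eq_comm]

end Loc

open Loc

section

variable {p : ℕ} {q : ℤ} {N : ℕ} [NeZero N] (g : LinkGrid p q N)

/-- The generators of the total complex: states of the full ruling, with labels of the crossings. -/
abbrev Dec : Type := {a : FState p q N × (g.Crossing → Loc) //
  ∀ c, a.2 c = away ↔ c.corner ∉ a.1.1}

variable {g}

/-- Change the label at a crossing whose corner is contained in the state. The junk value, for a
state that avoids the corner or the new label `away`, is `a`. -/
def Dec.set (a : g.Dec) (c : g.Crossing) (v : Loc) : g.Dec :=
  open scoped Classical in
  if h : a.1.2 c ≠ away ∧ v ≠ away then ⟨(a.1.1, Function.update a.1.2 c v), fun c' => by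
    by_cases hc : c' = c
    · subst hc
      have := a.2 c'
      simp only [Function.update_self, h.2, false_iff, not_not]
      by_contra hn
      exact h.1 (this.2 hn)
    · simp only [Function.update_of_ne hc]
      exact a.2 c'⟩
  else a

namespace Dec

variable {a b : g.Dec} {c c' : g.Crossing} {v v' : Loc}

theorem set_state (a : g.Dec) (c : g.Crossing) (v : Loc) : (a.set c v).1.1 = a.1.1 := by
  unfold set; split_ifs <;> rfl

theorem set_self (h : a.1.2 c ≠ away) (hv : v ≠ away) : (a.set c v).1.2 c = v := by
  rw [set, dif_pos ⟨h, hv⟩]; exact Function.update_self ..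

theorem set_of_ne (h : c' ≠ c) : (a.set c v).1.2 c' = a.1.2 c' := by
  unfold set; split_ifs
  · exact Function.update_of_ne h _ _
  · rfl

theorem ext' (h : a.1.1 = b.1.1) (h' : ∀ c, a.1.2 c = b.1.2 c) : a = b :=
  Subtype.ext (Prod.ext h (funext h'))

theorem set_set (h : a.1.2 c ≠ away) (hv : v ≠ away) : (a.set c v).set c v' =
    if v' = away then a.set c v else a.set c v' := by
  split_ifs with hv'
  · subst hv'
    rw [set, dif_neg (by simp)]
  refine ext' (by simp only [set_state]) fun d => ?_
  by_cases hd : d = c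
  · subst hd
    rw [set_self (by rwa [set_self h hv]) hv', set_self h hv']
  · rw [set_of_ne hd, set_of_ne hd, set_of_ne hd]

theorem set_eq_self (h : a.1.2 c = v) : a.set c v = a := by
  refine ext' (by simp only [set_state]) fun d => ?_
  by_cases hd : d = c
  · subst hd
    unfold set
    split_ifs with hh
    · exact (Function.update_self ..).trans h.symm
    · rfl
  · rw [set_of_ne hd]

theorem set_of_not (h : ¬ (a.1.2 c ≠ away ∧ v ≠ away)) : a.set c v = a := by
  rw [set, dif_neg h]

theorem set_comm (h : c ≠ c') : (a.set c v).set c' v' = (a.set c' v').set c v := by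
  refine ext' (by simp only [set_state]) fun d => ?_
  by_cases h₁ : d = c
  · subst h₁
    rw [set_of_ne h]
    by_cases ha : a.1.2 d ≠ away ∧ v ≠ away
    · rw [set_self ha.1 ha.2, set_self (by rw [set_of_ne h]; exact ha.1) ha.2]
    · rw [set_of_not ha, set_of_not (by rw [set_of_ne h]; exact ha), set_of_ne h]
  by_cases h₂ : d = c'
  · subst h₂
    rw [set_of_ne (a := a.set d v') h.symm]
    by_cases ha : a.1.2 d ≠ away ∧ v' ≠ away
    · rw [set_self ha.1 ha.2, set_self (by rw [set_of_ne h.symm]; exact ha.1) ha.2]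
    · rw [set_of_not (by rw [set_of_ne h.symm]; exact ha), set_of_not ha, set_of_ne h.symm]
  · rw [set_of_ne h₁, set_of_ne h₂, set_of_ne h₁, set_of_ne h₂]

end Dec

variable [NeZero p]

instance : Fintype g.Dec := Fintype.ofFinite _

/-- The sign of a generator in the differential. -/
def Dec.par (A : Type) [CommRing A] (a : g.Dec) : A := ∏ c, sign A (a.1.2 c)

open scoped Classical in
/-- The sign of the arrows at the crossing `c`, with respect to some enumeration of the crossings. -/
def Dec.eta (A : Type) [CommRing A] (a : g.Dec) (c : g.Crossing) : A :=
  ∏ c' ∈ Finset.univ.filter (fun c' => Fintype.equivFin g.Crossing c' < Fintype.equivFin g.Crossing c),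
    sign A (a.1.2 c')

section

variable {A : Type} [CommRing A] {a b : g.Dec} {c c' : g.Crossing} {v : Loc}

theorem Dec.par_mul_self (a : g.Dec) : a.par A * a.par A = 1 := by
  unfold Dec.par
  rw [← Finset.prod_mul_distrib]
  exact Finset.prod_eq_one fun c _ => sign_mul_self A _

theorem Dec.eta_mul_self (a : g.Dec) (c : g.Crossing) : a.eta A c * a.eta A c = 1 := by
  unfold Dec.eta
  rw [← Finset.prod_mul_distrib]
  exact Finset.prod_eq_one fun c _ => sign_mul_self A _

theorem Dec.prod_set (s : Finset g.Crossing) (hc : c ∈ s)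
    (h : sign A (v) = -sign A (a.1.2 c)) (ha : a.1.2 c ≠ away) (hv : v ≠ away) :
    ∏ c' ∈ s, sign A ((a.set c v).1.2 c') = -∏ c' ∈ s, sign A (a.1.2 c') := by
  classical
  rw [← Finset.mul_prod_erase s _ hc, ← Finset.mul_prod_erase s (fun c' => sign A (a.1.2 c')) hc,
    Dec.set_self ha hv, h, neg_mul]
  congr 2
  exact Finset.prod_congr rfl fun d hd => by rw [Dec.set_of_ne (Finset.ne_of_mem_erase hd)]

theorem Dec.par_set (h : sign A v = -sign A (a.1.2 c)) (ha : a.1.2 c ≠ away) (hv : v ≠ away) :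
    (a.set c v).par A = -a.par A := Dec.prod_set _ (Finset.mem_univ c) h ha hv

theorem Dec.eta_set_self : (a.set c v).eta A c = a.eta A c := by
  unfold Dec.eta
  refine Finset.prod_congr rfl fun d hd => ?_
  rw [Dec.set_of_ne]
  rintro rfl
  simp at hd

theorem Dec.eta_set_of_lt (hlt : Fintype.equivFin g.Crossing c < Fintype.equivFin g.Crossing c')
    (h : sign A v = -sign A (a.1.2 c)) (ha : a.1.2 c ≠ away) (hv : v ≠ away) :
    (a.set c v).eta A c' = -a.eta A c' :=
  Dec.prod_set _ (by simpa using hlt) h ha hv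

theorem Dec.eta_set_of_gt (hlt : Fintype.equivFin g.Crossing c' < Fintype.equivFin g.Crossing c) :
    (a.set c v).eta A c' = a.eta A c' := by
  unfold Dec.eta
  refine Finset.prod_congr rfl fun d hd => ?_
  rw [Dec.set_of_ne]
  rintro rfl
  exact lt_asymm hlt (Finset.mem_filter.1 hd).2

end

variable (g) in
/-- The marks `X` and `XX` that are not marks of crossings. -/
def free : Finset (Torus p q N) :=
  (g.X \ Finset.univ.biUnion fun c : g.Crossing => c.A) ∪ g.XX

section

variable (𝕜 : Type) [CommRing 𝕜] (S : Signs p q N)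

/-- The monomial of a domain. -/
def mono (m : Torus p q N → ℕ) : MvPolynomial g.O 𝕜 :=
  ∏ o : g.O, MvPolynomial.X o ^ m o.1

theorem mono_add (m m' : Torus p q N → ℕ) :
    mono (g := g) 𝕜 (fun t => m t + m' t) = mono 𝕜 m * mono 𝕜 m' := by
  unfold mono
  rw [← Finset.prod_mul_distrib]
  exact Finset.prod_congr rfl fun o _ => pow_add _ _ _

/-- The rectangle contributes to the differential of the total complex. -/
def RectOK (a b : g.Dec) (r : Rect p q N) : Prop :=
  r.IsEmptyFromTo a.1.1.1 b.1.1.1 ∧ (∀ t ∈ g.free, r.mult t = 0) ∧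
    ∀ c : g.Crossing, Lam (a.1.2 c) (b.1.2 c) (c.n r.mult)

open scoped Classical in
/-- The matrix of the part of the differential that counts rectangles. -/
def rectCoeff (a b : g.Dec) : MvPolynomial g.O 𝕜 :=
  a.par _ * ∑ r ∈ Finset.univ.filter (RectOK a b), sgn _ S a.1.1.1 b.1.1.1 r * mono 𝕜 r.mult

/-- The chains of the total complex. -/
abbrev Chains (g : LinkGrid p q N) (𝕜 : Type) [CommRing 𝕜] : Type := g.Dec → MvPolynomial g.O 𝕜

/-- The part of the differential of the total complex that counts rectangles. -/
def rectD : (g.Chains 𝕜) →ₗ[MvPolynomial g.O 𝕜]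
    (g.Chains 𝕜) where
  toFun f b := ∑ a, rectCoeff 𝕜 S a b * f a
  map_add' f f' := by
    funext b; simp only [Pi.add_apply, mul_add, Finset.sum_add_distrib]
  map_smul' r f := by
    funext b
    simp only [Pi.smul_apply, smul_eq_mul, RingHom.id_apply, Finset.mul_sum]
    exact Finset.sum_congr rfl fun a _ => by ring

theorem rectD_apply (f : g.Chains 𝕜) (b : g.Dec) :
    rectD 𝕜 S f b = ∑ a, rectCoeff 𝕜 S a b * f a := rfl

open scoped Classical in
/-- The coefficient of the arrow `p₀ → p₁` at `c`. -/
def kA (c : g.Crossing) : MvPolynomial g.O 𝕜 := if c.Positive then c.u 𝕜 else 1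

open scoped Classical in
/-- The coefficient of the arrow `p₁ → p₂` at `c`. -/
def kB (c : g.Crossing) : MvPolynomial g.O 𝕜 := if c.Positive then 1 else c.u 𝕜

theorem kA_mul_kB (c : g.Crossing) : kA 𝕜 c * kB 𝕜 c = c.u 𝕜 := by
  unfold kA kB; split_ifs <;> simp

/-- The arrows `p₀ → p₁ → p₂` at the crossing `c`. -/
def koszul (c : g.Crossing) : (g.Chains 𝕜) →ₗ[MvPolynomial g.O 𝕜]
    (g.Chains 𝕜) where
  toFun f b := if b.1.2 c = p₁ then b.eta _ c * kA 𝕜 c * f (b.set c p₀) else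
    if b.1.2 c = p₂ then b.eta _ c * kB 𝕜 c * f (b.set c p₁) else 0
  map_add' f f' := by
    funext b; simp only [Pi.add_apply]; split_ifs <;> ring
  map_smul' r f := by
    funext b
    simp only [Pi.smul_apply, smul_eq_mul, RingHom.id_apply]; split_ifs <;> ring

theorem koszul_apply (c : g.Crossing) (f : g.Chains 𝕜) (b : g.Dec) :
    koszul 𝕜 c f b = if b.1.2 c = p₁ then b.eta _ c * kA 𝕜 c * f (b.set c p₀) else
      if b.1.2 c = p₂ then b.eta _ c * kB 𝕜 c * f (b.set c p₁) else 0 := rfl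

/-- The differential of the total complex. -/
def totalD : (g.Chains 𝕜) →ₗ[MvPolynomial g.O 𝕜]
    (g.Chains 𝕜) := rectD 𝕜 S + ∑ c, koszul 𝕜 c

theorem totalD_apply (f : g.Chains 𝕜) (b : g.Dec) :
    totalD 𝕜 S f b = rectD 𝕜 S f b + ∑ c, koszul 𝕜 c f b := by
  unfold totalD
  simp only [LinearMap.add_apply, LinearMap.sum_apply, Pi.add_apply, Finset.sum_apply]

/-- The two arrows at a crossing compose to `u`. -/
theorem koszul_sq (c : g.Crossing) (f : g.Chains 𝕜) (b : g.Dec) :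
    koszul 𝕜 c (koszul 𝕜 c f) b = if b.1.2 c = p₂ then c.u 𝕜 * f (b.set c p₀) else 0 := by
  rw [koszul_apply]
  by_cases h₁ : b.1.2 c = p₁
  · have h : (b.set c p₀).1.2 c = p₀ := Dec.set_self (by simp [h₁]) (by simp)
    rw [if_pos h₁, koszul_apply, h]
    simp [h₁]
  · rw [if_neg h₁]
    by_cases h₂ : b.1.2 c = p₂
    · have h : (b.set c p₁).1.2 c = p₁ := Dec.set_self (by simp [h₂]) (by simp)
      rw [if_pos h₂, if_pos h₂, koszul_apply, if_pos h, Dec.set_set (by simp [h₂]) (by simp),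
        if_neg (by simp), Dec.eta_set_self, ← kA_mul_kB]
      linear_combination (kA 𝕜 c * kB 𝕜 c * f (b.set c p₀)) * b.eta_mul_self (A := MvPolynomial g.O 𝕜) c
    · rw [if_neg h₂, if_neg h₂]

theorem koszul_anticomm {c c' : g.Crossing} (h : c ≠ c') (f : g.Chains 𝕜)
    (b : g.Dec) : koszul 𝕜 c (koszul 𝕜 c' f) b + koszul 𝕜 c' (koszul 𝕜 c f) b = 0 := by
  wlog hlt : Fintype.equivFin g.Crossing c < Fintype.equivFin g.Crossing c' generalizing c c'
  · rw [add_comm]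
    exact this h.symm (lt_of_le_of_ne (not_lt.1 hlt)
      fun h' => h ((Fintype.equivFin g.Crossing).injective h').symm)
  simp only [koszul_apply, Dec.set_of_ne h, Dec.set_of_ne h.symm, Dec.eta_set_of_gt hlt]
  by_cases h₁ : b.1.2 c = p₁
  · simp only [if_pos h₁]
    rw [Dec.eta_set_of_lt hlt (by simp [sign, h₁]) (by simp [h₁]) (by simp)]
    split_ifs
    · rw [Dec.set_comm h]; ring
    · rw [Dec.set_comm h]; ring
    · ring
  · simp only [if_neg h₁]
    by_cases h₂ : b.1.2 c = p₂
    · simp only [if_pos h₂]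
      rw [Dec.eta_set_of_lt hlt (by simp [sign, h₂]) (by simp [h₂]) (by simp)]
      split_ifs
      · rw [Dec.set_comm h]; ring
      · rw [Dec.set_comm h]; ring
      · ring
    · simp only [if_neg h₂]
      split_ifs <;> ring

variable {S} {𝕜} in
theorem rectCoeff_eq_zero {a b : g.Dec} (h : ∀ r, ¬ RectOK a b r) : rectCoeff 𝕜 S a b = 0 := by
  classical
  unfold rectCoeff
  rw [Finset.filter_false_of_mem fun r _ => h r, Finset.sum_empty, mul_zero]

variable {S} {𝕜} in
theorem exists_rect_of_ne {a b : g.Dec} (h : rectCoeff 𝕜 S a b ≠ 0) : ∃ r, RectOK a b r := by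
  by_contra hn
  exact h (rectCoeff_eq_zero (not_exists.1 hn))

theorem RectOK.set_iff {a b : g.Dec} {c : g.Crossing} {v : Loc} (ha : a.1.2 c ≠ away)
    (hab : a.1.2 c = b.1.2 c) (hv : v ≠ away) (r : Rect p q N) :
    RectOK (a.set c v) (b.set c v) r ↔ RectOK a b r := by
  unfold RectOK
  simp only [Dec.set_state]
  refine and_congr_right fun _ => and_congr_right fun _ => forall_congr' fun d => ?_
  by_cases hd : d = c
  · subst hd
    rw [Dec.set_self ha hv, Dec.set_self (hab ▸ ha) hv, ← hab]
    unfold Lam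
    constructor
    · rintro (⟨h, -⟩ | ⟨-, ⟨-, h⟩ | ⟨h, -⟩⟩)
      · exact Or.inl ⟨h, rfl⟩
      · exact (hv h).elim
      · exact (hv h).elim
    · rintro (⟨h, -⟩ | ⟨-, ⟨h, h'⟩ | ⟨h, -⟩⟩)
      · exact Or.inl ⟨h, rfl⟩
      · exact (ha h').elim
      · exact (ha h).elim
  · rw [Dec.set_of_ne hd, Dec.set_of_ne hd]

variable {S} {𝕜} in
theorem rectCoeff_set {a b : g.Dec} {c : g.Crossing} {v : Loc} (ha : a.1.2 c ≠ away)
    (hab : a.1.2 c = b.1.2 c) (hv : v ≠ away)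
    (h : sign (MvPolynomial g.O 𝕜) v = -sign (MvPolynomial g.O 𝕜) (a.1.2 c)) :
    rectCoeff 𝕜 S (a.set c v) (b.set c v) = -rectCoeff 𝕜 S a b := by
  classical
  unfold rectCoeff
  rw [Dec.par_set h ha hv, neg_mul]
  simp only [Dec.set_state]
  congr 3
  exact Finset.filter_congr fun r _ => RectOK.set_iff ha hab hv r

/-- Reindexing of a sum over the generators whose label at a crossing is given. -/
theorem sum_set {A : Type} [AddCommMonoid A] (c : g.Crossing) {v v' : Loc} (hv : v ≠ away)
    (hv' : v' ≠ away) (f : g.Dec → A) :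
    ∑ a : g.Dec, (if a.1.2 c = v then f (a.set c v') else 0) =
      ∑ a : g.Dec, if a.1.2 c = v' then f a else 0 := by
  rw [← Finset.sum_filter, ← Finset.sum_filter]
  refine Finset.sum_nbij' (fun a => a.set c v') (fun a => a.set c v) ?_ ?_ ?_ ?_ ?_
  · intro a ha
    rw [Finset.mem_filter] at *
    exact ⟨Finset.mem_univ _, Dec.set_self (by rw [ha.2]; exact hv) hv'⟩
  · intro a ha
    rw [Finset.mem_filter] at *
    exact ⟨Finset.mem_univ _, Dec.set_self (by rw [ha.2]; exact hv') hv⟩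
  · intro a ha
    rw [Finset.mem_filter] at ha
    rw [Dec.set_set (by rw [ha.2]; exact hv) hv', if_neg hv, Dec.set_eq_self ha.2]
  · intro a ha
    rw [Finset.mem_filter] at ha
    rw [Dec.set_set (by rw [ha.2]; exact hv') hv, if_neg hv', Dec.set_eq_self ha.2]
  · intro a _
    rfl

theorem Dec.eta_congr {A : Type} [CommRing A] {a b : g.Dec}
    (h : ∀ c, sign A (a.1.2 c) = sign A (b.1.2 c)) (c : g.Crossing) : a.eta A c = b.eta A c :=
  Finset.prod_congr rfl fun d _ => h d

/-- The arrows anticommute with the rectangles: a rectangle that ends at `p₀` or `p₁`, or starts at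
`p₁` or `p₂`, preserves the label, and the arrow changes the sign of the generator. -/
theorem koszul_rectD (c : g.Crossing) (f : g.Chains 𝕜) (b : g.Dec) :
    koszul 𝕜 c (rectD 𝕜 S f) b + rectD 𝕜 S (koszul 𝕜 c f) b = 0 := by
  -- one arrow `v → v'` at a time
  have key : ∀ (v v' : Loc) (k : MvPolynomial g.O 𝕜), v ≠ away → v' ≠ away →
      sign (MvPolynomial g.O 𝕜) v' = -sign (MvPolynomial g.O 𝕜) v →
      (∀ (l : Loc) n, Lam l v n → l ≠ away → l = v) → (∀ (l : Loc) n, Lam v' l n → l = v') →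
      (∀ (l : Loc) n, l = away → Lam l v n → False) →
      (if b.1.2 c = v' then b.eta _ c * k * ∑ a, rectCoeff 𝕜 S a (b.set c v) * f a else 0) +
      ∑ a, (if a.1.2 c = v' then rectCoeff 𝕜 S a b * (a.eta _ c * k * f (a.set c v)) else 0) = 0 := by
    intro v v' k hv hv' hs h₁ h₂ h₃
    have e : ∑ a, (if a.1.2 c = v' then rectCoeff 𝕜 S a b * (a.eta _ c * k * f (a.set c v)) else 0)
        = ∑ a, (if a.1.2 c = v then rectCoeff 𝕜 S (a.set c v') b * (a.eta _ c * k * f a) else 0) := by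
      rw [← sum_set c hv' hv]
      refine Finset.sum_congr rfl fun a _ => ?_
      split_ifs with ha
      · rw [Dec.set_set (by rw [ha]; exact hv') hv, if_neg hv', Dec.set_eq_self ha, Dec.eta_set_self]
      · rfl
    rw [e]
    split_ifs with hb
    · rw [Finset.mul_sum, ← Finset.sum_add_distrib]
      refine Finset.sum_eq_zero fun a _ => ?_
      split_ifs with ha
      · have hb' : (b.set c v).1.2 c = v := Dec.set_self (by rw [hb]; exact hv') hv
        have := rectCoeff_set (𝕜 := 𝕜) (S := S) (a := a) (b := b.set c v) (c := c) (v := v')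
          (by rw [ha]; exact hv) (by rw [ha, hb']) hv' (by rw [hs, ha])
        rw [Dec.set_set (by rw [hb]; exact hv') hv, if_neg hv', Dec.set_eq_self hb] at this
        rw [this]
        by_cases hz : rectCoeff 𝕜 S a (b.set c v) = 0
        · rw [hz]; ring
        · obtain ⟨r, hr⟩ := exists_rect_of_ne hz
          have : a.eta (MvPolynomial g.O 𝕜) c = b.eta _ c := by
            rw [← Dec.eta_set_self (a := b) (v := v)]
            exact Dec.eta_congr (fun d => (hr.2.2 d).sign_eq _) c
          rw [this]; ring
      · rw [add_zero, rectCoeff_eq_zero, zero_mul, mul_zero]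
        intro r hr
        have := hr.2.2 c
        rw [Dec.set_self (by rw [hb]; exact hv') hv] at this
        by_cases hy : a.1.2 c = away
        · exact h₃ _ _ hy this
        · exact ha (h₁ _ _ this hy)
    · rw [zero_add]
      refine Finset.sum_eq_zero fun a _ => ?_
      split_ifs with ha
      · rw [rectCoeff_eq_zero, zero_mul]
        intro r hr
        have := hr.2.2 c
        rw [Dec.set_self (by rw [ha]; exact hv) hv'] at this
        exact hb (h₂ _ _ this)
      · rfl
  have k₁ := key p₀ p₁ (kA 𝕜 c) (by simp) (by simp) (by simp [sign])
    (fun l n h _ => (lam_p₀.1 h).2) (fun l n h => (p₁_lam.1 h).2)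
    (fun l n h h' => by have := (lam_p₀.1 h').2; rw [h] at this; simp at this)
  have k₂ := key p₁ p₂ (kB 𝕜 c) (by simp) (by simp) (by simp [sign])
    (fun l n h _ => (lam_p₁.1 h).2) (fun l n h => (p₂_lam.1 h).2)
    (fun l n h h' => by have := (lam_p₁.1 h').2; rw [h] at this; simp at this)
  have e : rectD 𝕜 S (koszul 𝕜 c f) b =
      ∑ a, (if a.1.2 c = p₁ then rectCoeff 𝕜 S a b * (a.eta _ c * kA 𝕜 c * f (a.set c p₀)) else 0) +
      ∑ a, (if a.1.2 c = p₂ then rectCoeff 𝕜 S a b * (a.eta _ c * kB 𝕜 c * f (a.set c p₁)) else 0) := by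
    rw [rectD_apply, ← Finset.sum_add_distrib]
    refine Finset.sum_congr rfl fun a _ => ?_
    rw [koszul_apply]
    by_cases h₁ : a.1.2 c = p₁
    · simp [h₁]
    · simp [h₁]
  have e' : koszul 𝕜 c (rectD 𝕜 S f) b =
      (if b.1.2 c = p₁ then b.eta _ c * kA 𝕜 c * ∑ a, rectCoeff 𝕜 S a (b.set c p₀) * f a else 0) +
      (if b.1.2 c = p₂ then b.eta _ c * kB 𝕜 c * ∑ a, rectCoeff 𝕜 S a (b.set c p₁) * f a else 0) := by
    rw [koszul_apply, rectD_apply, rectD_apply]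
    by_cases h₁ : b.1.2 c = p₁
    · simp [h₁]
    · simp [h₁]
  rw [e, e']
  linear_combination k₁ + k₂

end

end

/-! ### The square of the differential -/

section

variable {p : ℕ} {q : ℤ} {N : ℕ} [NeZero N] [NeZero p] {g : LinkGrid p q N}
variable (𝕜 : Type) [CommRing 𝕜] (S : Signs p q N)

open scoped Classical in
/-- The weight of the sum of the multiplicities of two consecutive rectangles. -/
def pairWeight (a e : g.Dec) (m : Torus p q N → ℕ) : MvPolynomial g.O 𝕜 :=
  if (∀ t ∈ g.free, m t = 0) ∧ ∀ c : g.Crossing, Mu (a.1.2 c) (e.1.2 c) (c.n m) then mono 𝕜 m else 0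

variable (hpq : Int.gcd (p : ℤ) q = 1)

include hpq in
/-- The covering numbers of the block at a crossing, according to whether its corner is contained in
the initial and in the final state. -/
theorem n_rect {x y : FState p q N} {r : Rect p q N} (h : r.IsEmptyFromTo x.1 y.1)
    (c : g.Crossing) : (c.corner ∈ x.1 → c.corner ∈ y.1 → c.n r.mult = 0) ∧
      (c.corner ∈ x.1 → c.corner ∉ y.1 → c.n r.mult = 1) ∧
      (c.corner ∉ x.1 → c.corner ∈ y.1 → c.n r.mult = 1) := by
  rw [Crossing.n_eq]
  refine ⟨fun hx hy => ?_, fun hx hy => ?_, fun hx hy => ?_⟩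
  · rw [h.mult_stay hpq hx hy, h.mult_stay hpq hx hy, h.mult_stay hpq hx hy,
      h.mult_stay hpq hx hy] <;> norm_num
  · have := h.mult_leave hpq hx hy
    omega
  · have := h.mult_arrive hpq hx hy
    omega

/-- Two consecutive transitions of a label compose to a transition, and conversely. -/
theorem lam_comp {l l'' : Loc} {X W Z : Prop} [Decidable W] [Decidable (¬ W)] {n n' : ℕ}
    (hl : l = away ↔ ¬ X)
    (hl'' : l'' = away ↔ ¬ Z) (h₁ : X → W → n = 0) (h₂ : X → ¬ W → n = 1) (h₃ : ¬ X → W → n = 1)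
    (h₁' : W → Z → n' = 0) (h₂' : W → ¬ Z → n' = 1) (h₃' : ¬ W → Z → n' = 1) :
    (Lam l (mid l (¬ W)) n ∧ Lam (mid l (¬ W)) l'' n') ↔ Mu l l'' (n + n') := by
  unfold Mu Lam mid
  by_cases hX : X <;> by_cases hW : W <;> by_cases hZ : Z <;>
    simp only [hX, hW, hZ, not_true, not_false_eq_true, iff_true, iff_false, true_implies,
      false_implies, if_true, if_false] at *
  all_goals
    cases l <;> cases l'' <;> simp_all

theorem mid_eq {l l' : Loc} {W : Prop} [Decidable (¬ W)] {n : ℕ} (hl : l' = away ↔ ¬ W)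
    (h : Lam l l' n) : l' = mid l (¬ W) := by
  unfold mid
  by_cases hW : W
  · simp only [hW, not_true, iff_false] at hl
    rcases h with ⟨-, rfl⟩ | ⟨-, ⟨rfl, rfl⟩ | ⟨rfl, rfl⟩⟩ <;> simp_all
  · simp only [hW, not_false_eq_true, iff_true] at hl
    simp [hl, hW]

theorem mid_away {l : Loc} {W : Prop} [Decidable (¬ W)] : mid l (¬ W) = away ↔ ¬ W := by
  unfold mid
  by_cases hW : W
  · simp only [hW, not_true, if_false, iff_false]
    split_ifs with h
    · simp
    · exact h
  · simp [hW]

include hpq in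
/-- The square of the rectangle part as a sum over pairs of rectangles, whose terms depend only on
the sum of the multiplicities. -/
theorem sum_rectCoeff_mul (a e : g.Dec) :
    open scoped Classical in
    ∑ b, rectCoeff 𝕜 S a b * rectCoeff 𝕜 S b e =
    ∑ t ∈ Finset.univ.filter (IsPair a.1.1 e.1.1),
      sgn (MvPolynomial g.O 𝕜) S a.1.1.1 t.1.1 t.2.1 * sgn _ S t.1.1 e.1.1.1 t.2.2 *
        pairWeight 𝕜 a e (fun c => t.2.1.mult c + t.2.2.mult c) := by
  classical
  have e₁ : ∀ b, rectCoeff 𝕜 S a b * rectCoeff 𝕜 S b e =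
      ∑ r : Rect p q N × Rect p q N, if RectOK a b r.1 ∧ RectOK b e r.2 then
        sgn (MvPolynomial g.O 𝕜) S a.1.1.1 b.1.1.1 r.1 * sgn _ S b.1.1.1 e.1.1.1 r.2 *
        mono 𝕜 (fun t => r.1.mult t + r.2.mult t) else 0 := by
    intro b
    unfold rectCoeff
    rw [Finset.sum_filter, Finset.sum_filter, Fintype.sum_prod_type, mul_mul_mul_comm,
      Finset.sum_mul_sum, Finset.mul_sum]
    refine Finset.sum_congr rfl fun r _ => ?_
    rw [Finset.mul_sum]
    refine Finset.sum_congr rfl fun s _ => ?_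
    by_cases h₁ : RectOK a b r
    · by_cases h₂ : RectOK b e s
      · have : a.par (MvPolynomial g.O 𝕜) = b.par _ :=
          Finset.prod_congr rfl fun c _ => (h₁.2.2 c).sign_eq _
        rw [if_pos h₁, if_pos h₂, if_pos ⟨h₁, h₂⟩, this, b.par_mul_self, mono_add]
        ring
      · simp [h₂]
    · simp [h₁]
  rw [Finset.sum_congr rfl fun b _ => e₁ b, ← Fintype.sum_prod_type', ← Finset.sum_filter]
  have e₂ : ∀ t : FState p q N × Rect p q N × Rect p q N,
      sgn (MvPolynomial g.O 𝕜) S a.1.1.1 t.1.1 t.2.1 * sgn _ S t.1.1 e.1.1.1 t.2.2 *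
        pairWeight 𝕜 a e (fun c => t.2.1.mult c + t.2.2.mult c) =
      if ((∀ c ∈ g.free, t.2.1.mult c + t.2.2.mult c = 0) ∧
        ∀ c : g.Crossing, Mu (a.1.2 c) (e.1.2 c) (c.n t.2.1.mult + c.n t.2.2.mult)) then
      sgn (MvPolynomial g.O 𝕜) S a.1.1.1 t.1.1 t.2.1 * sgn _ S t.1.1 e.1.1.1 t.2.2 *
        mono 𝕜 (fun c => t.2.1.mult c + t.2.2.mult c) else 0 := by
    intro t
    unfold pairWeight
    simp only [Crossing.n_add]
    rw [mul_ite, mul_zero]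
  rw [Finset.sum_congr rfl fun t _ => e₂ t, ← Finset.sum_filter, Finset.filter_filter]
  have hcomp : ∀ (w : FState p q N) (r s : Rect p q N), r.IsEmptyFromTo a.1.1.1 w.1 →
      s.IsEmptyFromTo w.1 e.1.1.1 → ∀ c : g.Crossing,
      (Lam (a.1.2 c) (mid (a.1.2 c) (c.corner ∉ w.1)) (c.n r.mult) ∧
        Lam (mid (a.1.2 c) (c.corner ∉ w.1)) (e.1.2 c) (c.n s.mult)) ↔
        Mu (a.1.2 c) (e.1.2 c) (c.n r.mult + c.n s.mult) := by
    intro w r s hr hs c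
    obtain ⟨h₁, h₂, h₃⟩ := n_rect hpq hr c
    obtain ⟨h₁', h₂', h₃'⟩ := n_rect hpq hs c
    exact lam_comp (a.2 c) (e.2 c) h₁ h₂ h₃ h₁' h₂' h₃'
  have hmid : ∀ (b : g.Dec) (r : Rect p q N), RectOK a b r → ∀ c,
      b.1.2 c = mid (a.1.2 c) (c.corner ∉ b.1.1.1) := fun b r hr c => mid_eq (b.2 c) (hr.2.2 c)
  refine Finset.sum_nbij (fun t => (t.1.1.1, t.2)) ?_ ?_ ?_ ?_
  · rintro ⟨b, r, s⟩ ht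
    rw [Finset.mem_filter] at *
    obtain ⟨-, h₁, h₂⟩ := ht
    refine ⟨Finset.mem_univ _, ⟨h₁.1, h₂.1⟩, fun c hc => ?_, fun c => ?_⟩
    · rw [h₁.2.1 c hc, h₂.2.1 c hc]
    · refine (hcomp b.1.1 r s h₁.1 h₂.1 c).1 ?_
      rw [← hmid b r h₁ c]
      exact ⟨h₁.2.2 c, h₂.2.2 c⟩
  · rintro ⟨b, r, s⟩ ht ⟨b', r', s'⟩ ht' h
    rw [Finset.mem_coe, Finset.mem_filter] at ht ht'
    simp only [Prod.mk.injEq] at h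
    obtain ⟨h₁, rfl, rfl⟩ := h
    have : b = b' := Dec.ext' h₁ fun c => by
      rw [hmid b r ht.2.1 c, hmid b' r ht'.2.1 c, h₁]
    rw [this]
  · rintro ⟨w, r, s⟩ ht
    rw [Finset.mem_coe, Finset.mem_filter] at ht
    obtain ⟨-, ⟨h₁, h₂⟩, h₃, h₄⟩ := ht
    refine ⟨⟨⟨(w, fun c => mid (a.1.2 c) (c.corner ∉ w.1)), fun c => mid_away⟩, r, s⟩, ?_, rfl⟩
    rw [Finset.mem_coe, Finset.mem_filter]
    refine ⟨Finset.mem_univ _, ⟨h₁, fun t ht => ?_, fun c => ?_⟩, h₂, fun t ht => ?_, fun c => ?_⟩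
    · have := h₃ t ht; dsimp at this ⊢; omega
    · exact ((hcomp w r s h₁ h₂ c).2 (h₄ c)).1
    · have := h₃ t ht; dsimp at this ⊢; omega
    · exact ((hcomp w r s h₁ h₂ c).2 (h₄ c)).2
  · rintro ⟨b, r, s⟩ ht
    rfl

variable (hsp : g.IsSpecial) (hst : ∀ c : g.Crossing, g.IsStandardAt c)

theorem mem_free_iff {t : Torus p q N} :
    t ∈ g.free ↔ (t ∈ g.X ∧ ∀ c : g.Crossing, t ∉ c.A) ∨ t ∈ g.XX := by
  simp only [free, Finset.mem_union, Finset.mem_sdiff, Finset.mem_biUnion, Finset.mem_univ, true_and,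
    not_exists]

theorem mu_two {l l' : Loc} : Mu l l' 2 ↔ l = p₀ ∧ l' = p₂ := by
  unfold Mu Lam; simp

theorem mu_zero {l l' : Loc} : Mu l l' 0 ↔ l = l' := by
  unfold Mu Lam; simp

/-- The annuli: those that contain no free mark pass through a mark of a crossing. -/
theorem sum_annuli (ρ : Torus p q N →+ ZMod N)
    (hρ : ∀ i : ZMod N,
      ((g.X.filter (ρ · = i)).card = 1 ∧ (g.XX.filter (ρ · = i)).card = 0 ∧
        (g.O.filter (ρ · = i)).card = 1) ∨
      ((g.X.filter (ρ · = i)).card = 0 ∧ (g.XX.filter (ρ · = i)).card = 1 ∧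
        (g.O.filter (ρ · = i)).card = 2))
    (hinj : Function.Injective fun a : g.Crossing × Bool => ρ (a.1.mark a.2))
    (hX : ∀ (c : g.Crossing) b, c.mark b ∈ g.X)
    (hn : ∀ (c : g.Crossing) (i : ZMod N), c.n (fun t => if ρ t = i then 1 else 0) =
      if ∃ b, i = ρ (c.mark b) then 2 else 0) (a e : g.Dec) :
    open scoped Classical in
    ∑ i, pairWeight 𝕜 a e (fun c => if ρ c = i then 1 else 0) =
      ∑ c : g.Crossing, if a.1.2 c = p₀ ∧ e.1.2 c = p₂ ∧ ∀ c', c' ≠ c → a.1.2 c' = e.1.2 c' then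
        ∑ o ∈ Finset.univ.filter (fun o : g.O => ρ o.1 = ρ c.side ∨ ρ o.1 = ρ c.below),
          MvPolynomial.X o else 0 := by
  classical
  have unX : ∀ t ∈ g.X, ∀ t' ∈ g.X, ρ t = ρ t' → t = t' := fun t ht t' ht' h => by
    have hc : (g.X.filter (ρ · = ρ t')).card ≤ 1 := by
      rcases hρ (ρ t') with h | h <;> omega
    exact Finset.card_le_one.1 hc _ (Finset.mem_filter.2 ⟨ht, h⟩) _ (Finset.mem_filter.2 ⟨ht', rfl⟩)
  have e₁ : ∀ i, i ∉ Finset.univ.image (fun a : g.Crossing × Bool => ρ (a.1.mark a.2)) →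
      pairWeight 𝕜 a e (fun c => if ρ c = i then 1 else 0) = 0 := by
    intro i hi
    unfold pairWeight
    rw [if_neg]
    rintro ⟨h, -⟩
    obtain ⟨t, ht, hti⟩ : ∃ t ∈ g.free, ρ t = i := by
      rcases hρ i with ⟨h₁, -, -⟩ | ⟨-, h₁, -⟩
      · obtain ⟨t, ht⟩ := Finset.card_pos.1 (by rw [h₁]; exact one_pos)
        rw [Finset.mem_filter] at ht
        refine ⟨t, mem_free_iff.2 (Or.inl ⟨ht.1, fun c hc => hi ?_⟩), ht.2⟩
        obtain ⟨b, rfl⟩ := Crossing.mem_A.1 hc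
        exact Finset.mem_image.2 ⟨(c, b), Finset.mem_univ _, ht.2⟩
      · obtain ⟨t, ht⟩ := Finset.card_pos.1 (by rw [h₁]; exact one_pos)
        rw [Finset.mem_filter] at ht
        exact ⟨t, mem_free_iff.2 (Or.inr ht.1), ht.2⟩
    have := h t ht
    dsimp only at this
    rw [if_pos hti] at this
    exact one_ne_zero this
  rw [← Finset.sum_subset (Finset.subset_univ (Finset.univ.image
      (fun a : g.Crossing × Bool => ρ (a.1.mark a.2)))) fun i _ hi => e₁ i hi,
    Finset.sum_image fun _ _ _ _ h => hinj h, Fintype.sum_prod_type]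
  refine Finset.sum_congr rfl fun c _ => ?_
  -- a line through a mark of `c` contains exactly one mark `O`, and no free mark
  have e₂ : ∀ b, pairWeight 𝕜 a e (fun t => if ρ t = ρ (c.mark b) then 1 else 0) =
      if a.1.2 c = p₀ ∧ e.1.2 c = p₂ ∧ ∀ c', c' ≠ c → a.1.2 c' = e.1.2 c' then
        ∑ o ∈ Finset.univ.filter (fun o : g.O => ρ o.1 = ρ (c.mark b)),
          (MvPolynomial.X o : MvPolynomial g.O 𝕜) else 0 := by
    intro b
    have hreg : (g.XX.filter (ρ · = ρ (c.mark b))).card = 0 ∧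
        (g.O.filter (ρ · = ρ (c.mark b))).card = 1 := by
      rcases hρ (ρ (c.mark b)) with h | h
      · exact h.2
      · have := Finset.card_eq_zero.1 h.1
        have hm : c.mark b ∈ g.X.filter (ρ · = ρ (c.mark b)) := Finset.mem_filter.2 ⟨hX c b, rfl⟩
        rw [this] at hm
        exact (Finset.notMem_empty _ hm).elim
    have hfree : ∀ t ∈ g.free, (if ρ t = ρ (c.mark b) then 1 else 0) = 0 := by
      intro t ht
      refine if_neg fun h => ?_
      rcases mem_free_iff.1 ht with ⟨h₁, h₂⟩ | h₁
      · rw [unX t h₁ _ (hX c b) h] at h₂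
        exact h₂ c (Crossing.mem_A.2 ⟨b, rfl⟩)
      · have hm : t ∈ g.XX.filter (ρ · = ρ (c.mark b)) := Finset.mem_filter.2 ⟨h₁, h⟩
        rw [Finset.card_eq_zero.1 hreg.1] at hm
        exact Finset.notMem_empty _ hm
    obtain ⟨o, ho⟩ := Finset.card_eq_one.1 hreg.2
    have ho' : ∀ t, t ∈ g.O ∧ ρ t = ρ (c.mark b) ↔ t = o := fun t => by
      rw [← Finset.mem_filter (s := g.O) (p := fun t => ρ t = ρ (c.mark b)), ho,
        Finset.mem_singleton]
    have hoO := (ho' o).2 rfl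
    have hsum : ∑ o ∈ Finset.univ.filter (fun o : g.O => ρ o.1 = ρ (c.mark b)),
        (MvPolynomial.X o : MvPolynomial g.O 𝕜) = MvPolynomial.X ⟨o, hoO.1⟩ := by
      rw [show Finset.univ.filter (fun o : g.O => ρ o.1 = ρ (c.mark b)) = {⟨o, hoO.1⟩} from ?_,
        Finset.sum_singleton]
      ext o'
      rw [Finset.mem_filter, Finset.mem_singleton, Subtype.ext_iff, ← ho']
      exact ⟨fun h => ⟨o'.2, h.2⟩, fun h => ⟨Finset.mem_univ _, h.2⟩⟩
    have hmono : mono (g := g) 𝕜 (fun t => if ρ t = ρ (c.mark b) then 1 else 0) =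
        MvPolynomial.X ⟨o, hoO.1⟩ := by
      unfold mono
      rw [Finset.prod_eq_single ⟨o, hoO.1⟩]
      · simp [hoO.2]
      · intro o' _ hne
        have : ρ o'.1 ≠ ρ (c.mark b) := fun h => hne (Subtype.ext ((ho' o'.1).1 ⟨o'.2, h⟩))
        simp [this]
      · exact fun h => (h (Finset.mem_univ _)).elim
    unfold pairWeight
    rw [hsum, hmono]
    refine if_congr ?_ rfl rfl
    rw [and_iff_right hfree]
    have hnc : ∀ c' : g.Crossing, c'.n (fun t => if ρ t = ρ (c.mark b) then 1 else 0) =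
        if c' = c then 2 else 0 := by
      intro c'
      rw [hn]
      refine if_congr ⟨?_, ?_⟩ rfl rfl
      · rintro ⟨b', h⟩
        have := hinj (a₁ := (c, b)) (a₂ := (c', b')) h
        simp only [Prod.mk.injEq] at this
        exact this.1.symm
      · rintro rfl
        exact ⟨b, rfl⟩
    simp only [hnc]
    constructor
    · intro h
      have hc := h c
      rw [if_pos rfl, mu_two] at hc
      refine ⟨hc.1, hc.2, fun c' hne => ?_⟩
      have := h c'
      rwa [if_neg hne, mu_zero] at this
    · rintro ⟨h₁, h₂, h₃⟩ c'
      split_ifs with hcc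
      · subst hcc
        exact mu_two.2 ⟨h₁, h₂⟩
      · exact mu_zero.2 (h₃ c' hcc)
  rw [Fintype.sum_bool, e₂, e₂]
  split_ifs with h
  · rw [← Finset.sum_union]
    · congr 1
      ext o
      simp [Crossing.mark]
    · rw [Finset.disjoint_filter]
      intro o _ h₁ h₂
      have := hinj (a₁ := (c, true)) (a₂ := (c, false)) (h₁.symm.trans h₂)
      simp at this
  · exact add_zero 0

include hpq hsp hst in
/-- The annuli through the marks of a crossing contribute `-u` from `p₀` to `p₂`. -/
theorem rectD_sq (hS : GoodSigns (MvPolynomial g.O 𝕜) S) (f : g.Chains 𝕜)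
    (e : g.Dec) : rectD 𝕜 S (rectD 𝕜 S f) e +
      ∑ c : g.Crossing, (if e.1.2 c = p₂ then c.u 𝕜 * f (e.set c p₀) else 0) = 0 := by
  classical
  have key : ∀ a, ∑ b, rectCoeff 𝕜 S a b * rectCoeff 𝕜 S b e =
      -∑ c : g.Crossing, if a.1.1 = e.1.1 ∧ a.1.2 c = p₀ ∧ e.1.2 c = p₂ ∧
        ∀ c', c' ≠ c → a.1.2 c' = e.1.2 c' then c.u 𝕜 else 0 := by
    intro a
    rw [sum_rectCoeff_mul 𝕜 S hpq, sum_pairs hpq hS]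
    split_ifs with hae
    · rw [sum_annuli 𝕜 row g.row_cond (mark_row_injective hsp hst) (mark_mem hst)
        (n_row hsp hst), sum_annuli 𝕜 col g.col_cond (mark_col_injective hsp hst) (mark_mem hst)
        (n_col hsp hst), ← Finset.sum_sub_distrib, ← Finset.sum_neg_distrib]
      refine Finset.sum_congr rfl fun c _ => ?_
      simp only [hae, true_and]
      split_ifs
      · unfold Crossing.u
        rw [neg_sub]
      · simp
    · simp [hae]
  have e₁ : rectD 𝕜 S (rectD 𝕜 S f) e = ∑ a, (∑ b, rectCoeff 𝕜 S a b * rectCoeff 𝕜 S b e) * f a := by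
    simp only [rectD_apply, Finset.mul_sum, Finset.sum_mul]
    rw [Finset.sum_comm]
    exact Finset.sum_congr rfl fun a _ => Finset.sum_congr rfl fun b _ => by ring
  rw [e₁]
  simp only [key, neg_mul, Finset.sum_neg_distrib, Finset.sum_mul]
  rw [Finset.sum_comm, neg_add_eq_zero]
  refine Finset.sum_congr rfl fun c _ => ?_
  split_ifs with hc
  · have hset : (e.set c p₀).1.2 c = p₀ := Dec.set_self (by rw [hc]; simp) (by simp)
    rw [Finset.sum_eq_single (e.set c p₀), if_pos]
    · exact ⟨Dec.set_state _ _ _, hset, hc, fun c' h => Dec.set_of_ne h⟩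
    · intro a _ hne
      rw [if_neg, zero_mul]
      rintro ⟨h₁, h₂, -, h₃⟩
      refine hne (Dec.ext' (by rw [h₁, Dec.set_state]) fun d => ?_)
      by_cases hd : d = c
      · subst hd
        rw [h₂, hset]
      · rw [h₃ d hd, Dec.set_of_ne hd]
    · exact fun h => (h (Finset.mem_univ _)).elim
  · exact Finset.sum_eq_zero fun a _ => by rw [if_neg fun h => hc h.2.2.1, zero_mul]

include hpq hsp hst in
/-- The total complex is a complex: the annuli that obstruct the rectangle part are cancelled by
the arrows at the crossings. -/
theorem totalD_sq (hS : GoodSigns (MvPolynomial g.O 𝕜) S) (f : g.Chains 𝕜) :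
    totalD 𝕜 S (totalD 𝕜 S f) = 0 := by
  classical
  funext e
  have h₁ := rectD_sq 𝕜 S hpq hsp hst hS f e
  have e₁ : ∀ f' : g.Chains 𝕜, totalD 𝕜 S f' = rectD 𝕜 S f' + ∑ c, koszul 𝕜 c f' := fun f' => by
    unfold totalD
    simp only [LinearMap.add_apply, LinearMap.sum_apply]
  have e₂ : ∑ c, ∑ c', koszul 𝕜 c (koszul 𝕜 c' f) e =
      ∑ c : g.Crossing, (if e.1.2 c = p₂ then c.u 𝕜 * f (e.set c p₀) else 0) := by
    have : ∀ c c', koszul 𝕜 c (koszul 𝕜 c' f) e =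
        (if c = c' then (if e.1.2 c = p₂ then c.u 𝕜 * f (e.set c p₀) else 0) else 0) +
        (if c ≠ c' then koszul 𝕜 c (koszul 𝕜 c' f) e else 0) := by
      intro c c'
      by_cases h : c = c'
      · subst h; simp [koszul_sq]
      · simp [h]
    rw [Finset.sum_congr rfl fun c _ => Finset.sum_congr rfl fun c' _ => this c c']
    simp only [Finset.sum_add_distrib, Finset.sum_ite_eq, Finset.mem_univ, if_true]
    rw [add_eq_left, ← Fintype.sum_prod_type']
    refine Finset.sum_involution (fun t _ => (t.2, t.1)) ?_ ?_ (fun _ _ => Finset.mem_univ _) ?_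
    · rintro ⟨c, c'⟩ -
      by_cases h : c = c'
      · simp [h]
      · simp only [ne_eq, h, not_false_eq_true, if_true, Ne.symm h]
        exact koszul_anticomm 𝕜 h f e
    · rintro ⟨c, c'⟩ - h h'
      simp only [Prod.mk.injEq] at h'
      simp [h'.1] at h
    · rintro ⟨c, c'⟩ -
      rfl
  have e₃ := Finset.sum_congr rfl fun c (_ : c ∈ Finset.univ) => koszul_rectD 𝕜 S c f e
  rw [Finset.sum_add_distrib, Finset.sum_const_zero] at e₃
  rw [e₁ f, map_add, map_sum, Pi.add_apply, Finset.sum_apply, totalD_apply]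
  simp only [totalD_apply, Pi.zero_apply, Finset.sum_add_distrib]
  rw [← e₂] at h₁
  rw [Finset.sum_comm] at h₁
  linear_combination h₁ + e₃

end

end LinkGrid

/-! ### Regularity of the forms `u` -/

/-- A surjective endomorphism of a Noetherian ring is injective. -/
theorem injective_of_surjective_of_noetherian {R : Type*} [CommRing R] [IsNoetherianRing R]
    (f : R →+* R) (hf : Function.Surjective f) : Function.Injective f := by
  have hmono : Monotone fun n : ℕ => RingHom.ker (f ^ n) := by
    refine monotone_nat_of_le_succ fun n x hx => ?_
    rw [RingHom.mem_ker] at *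
    rw [pow_succ', RingHom.mul_def, RingHom.comp_apply, hx, map_zero]
  obtain ⟨n, hn⟩ := monotone_stabilizes_iff_noetherian.2 (inferInstanceAs (IsNoetherian R R))
    ⟨_, hmono⟩
  rw [injective_iff_map_eq_zero]
  intro x hx
  have hs : Function.Surjective (f ^ n : R →+* R) := by
    rw [RingHom.coe_pow]; exact hf.iterate n
  obtain ⟨y, rfl⟩ := hs x
  have h₁ : y ∈ RingHom.ker (f ^ (n + 1)) := by
    rw [RingHom.mem_ker, pow_succ', RingHom.mul_def, RingHom.comp_apply, hx]
  have h₂ := hn (n + 1) (Nat.le_succ n)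
  dsimp at h₂
  rw [← h₂, RingHom.mem_ker] at h₁
  exact h₁

theorem mem_span_X_of_mul_mem {σ 𝕜 : Type*} [CommRing 𝕜] {s : Set σ} {i : σ} (hi : i ∉ s)
    {r : MvPolynomial σ 𝕜} (h : MvPolynomial.X i * r ∈
      Ideal.span (MvPolynomial.X '' s : Set (MvPolynomial σ 𝕜))) :
    r ∈ Ideal.span (MvPolynomial.X '' s : Set (MvPolynomial σ 𝕜)) := by
  classical
  rw [MvPolynomial.mem_ideal_span_X_image] at *
  intro m hm
  obtain ⟨j, hj, hne⟩ := h (Finsupp.single i 1 + m) (by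
    rw [MvPolynomial.mem_support_iff, MvPolynomial.coeff_X_mul]
    exact MvPolynomial.mem_support_iff.1 hm)
  refine ⟨j, hj, ?_⟩
  have hij : i ≠ j := fun e => hi (e ▸ hj)
  simpa [Finsupp.single_apply, hij] using hne

/-- Linear forms with a triangular system of pivot variables can be taken for coordinates, and
so form a regular sequence in any order. -/
theorem mem_span_of_mul_mem {σ ι 𝕜 : Type*} [Finite σ] [Finite ι] [CommRing 𝕜]
    [IsNoetherianRing 𝕜]
    (π : ι → σ) (δ : ι → ℕ) (P M : ι → Finset σ) (h₁ : ∀ i, π i ∈ P i)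
    (h₂ : ∀ i j, π j ∈ P i → i = j) (h₃ : ∀ i j, π j ∈ M i → δ i < δ j) (s : Set ι) {i : ι}
    (hi : i ∉ s) {r : MvPolynomial σ 𝕜}
    (h : (∑ o ∈ P i, MvPolynomial.X o - ∑ o ∈ M i, MvPolynomial.X o) * r ∈
      Ideal.span ((fun i => ∑ o ∈ P i, (MvPolynomial.X o : MvPolynomial σ 𝕜) -
        ∑ o ∈ M i, MvPolynomial.X o) '' s)) :
    r ∈ Ideal.span ((fun i => ∑ o ∈ P i, (MvPolynomial.X o : MvPolynomial σ 𝕜) -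
        ∑ o ∈ M i, MvPolynomial.X o) '' s) := by
  classical
  have hπ : Function.Injective π := fun i j e => h₂ i j (e ▸ h₁ i)
  set u : ι → MvPolynomial σ 𝕜 := fun i => ∑ o ∈ P i, MvPolynomial.X o - ∑ o ∈ M i, MvPolynomial.X o
    with hu
  -- the coordinate change
  let Ψ : MvPolynomial σ 𝕜 →ₐ[𝕜] MvPolynomial σ 𝕜 :=
    MvPolynomial.aeval fun o => if h : ∃ i, π i = o then u h.choose else MvPolynomial.X o
  have hΨ : ∀ i, Ψ (MvPolynomial.X (π i)) = u i := by
    intro i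
    have hex : ∃ j, π j = π i := ⟨i, rfl⟩
    rw [MvPolynomial.aeval_X, dif_pos hex, hπ hex.choose_spec]
  have hΨ' : ∀ o, (∀ i, π i ≠ o) → Ψ (MvPolynomial.X o) = MvPolynomial.X o := by
    intro o ho
    rw [MvPolynomial.aeval_X, dif_neg (not_exists.2 ho)]
  obtain ⟨B, hB⟩ := (Set.finite_range δ).bddAbove
  have hB' : ∀ i, δ i ≤ B := fun i => hB ⟨i, rfl⟩
  have hpiv : ∀ n i, B - δ i ≤ n → MvPolynomial.X (π i) ∈ Ψ.range := by
    intro n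
    induction n using Nat.strong_induction_on with
    | _ n ih =>
      intro i hn
      have hvar : ∀ o, (∀ j, π j = o → δ i < δ j) → MvPolynomial.X o ∈ Ψ.range := by
        intro o ho
        by_cases hex : ∃ j, π j = o
        · obtain ⟨j, rfl⟩ := hex
          have := ho j rfl
          have := hB' j
          exact ih (B - δ j) (by omega) j le_rfl
        · exact ⟨_, hΨ' o (not_exists.1 hex)⟩
      have e : (MvPolynomial.X (π i) : MvPolynomial σ 𝕜) =
          u i - ∑ o ∈ (P i).erase (π i), MvPolynomial.X o + ∑ o ∈ M i, MvPolynomial.X o := by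
        rw [hu]
        dsimp only
        rw [← Finset.add_sum_erase _ _ (h₁ i)]
        ring
      rw [e]
      refine add_mem (sub_mem ⟨_, hΨ i⟩ (sum_mem fun o ho => hvar o ?_))
        (sum_mem fun o ho => hvar o ?_)
      · rintro j rfl
        rw [Finset.mem_erase] at ho
        exact (ho.1 (by rw [h₂ i j ho.2])).elim
      · rintro j rfl
        exact h₃ i j ho
  have hsurj : Function.Surjective Ψ := by
    rw [← AlgHom.range_eq_top, eq_top_iff, ← MvPolynomial.adjoin_range_X, Algebra.adjoin_le_iff]
    rintro _ ⟨o, rfl⟩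
    by_cases hex : ∃ j, π j = o
    · obtain ⟨j, rfl⟩ := hex
      exact hpiv _ j le_rfl
    · exact ⟨_, hΨ' o (not_exists.1 hex)⟩
  have hinj := injective_of_surjective_of_noetherian (Ψ : MvPolynomial σ 𝕜 →+* MvPolynomial σ 𝕜) hsurj
  have hspan : Ideal.span (u '' s) = (Ideal.span (MvPolynomial.X '' (π '' s))).map
      (Ψ : MvPolynomial σ 𝕜 →+* MvPolynomial σ 𝕜) := by
    rw [Ideal.map_span, Set.image_image, Set.image_image]
    congr 1
    exact Set.image_congr fun j _ => (hΨ j).symm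
  obtain ⟨r', rfl⟩ := hsurj r
  rw [hspan] at h ⊢
  rw [show ∑ o ∈ P i, MvPolynomial.X o - ∑ o ∈ M i, MvPolynomial.X o = u i from rfl, ← hΨ,
    ← map_mul] at h
  refine Ideal.mem_map_of_mem _ (mem_span_X_of_mul_mem (i := π i) ?_ ?_)
  · rintro ⟨j, hj, e⟩
    exact hi (hπ e ▸ hj)
  · obtain ⟨z, hz, hze⟩ := (Ideal.mem_map_iff_of_surjective
      (Ψ : MvPolynomial σ 𝕜 →+* MvPolynomial σ 𝕜) hsurj).1 h
    rwa [← hinj hze]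

namespace LinkGrid

variable {p : ℕ} {q : ℤ} {N : ℕ} [NeZero N] [NeZero p] {g : LinkGrid p q N}

/-- A free mark can be reached from `m` in `n` steps along the link. -/
def Reach (g : LinkGrid p q N) : ℕ → Torus p q N → Prop
  | 0, m => m ∈ g.X ∪ g.XX ∧ ∀ c : g.Crossing, m ∉ c.A
  | n + 1, m => ∃ m', g.Next m m' ∧ Reach g n m'

/-- Every `u^{(c)}` is a nonzerodivisor modulo the ideal generated by any set of other ones. -/
def IsRegular (g : LinkGrid p q N) (𝕜 : Type) [CommRing 𝕜] : Prop :=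
  ∀ (s : Set g.Crossing) (c : g.Crossing) (r : MvPolynomial g.O 𝕜), c ∉ s →
    c.u 𝕜 * r ∈ Ideal.span ((fun c : g.Crossing => c.u 𝕜) '' s) →
    r ∈ Ideal.span ((fun c : g.Crossing => c.u 𝕜) '' s)

theorem exists_reach (hfree : g.HasFreeMarks) (c : g.Crossing) : ∃ n, ∃ b, g.Reach n (c.mark b) := by
  obtain ⟨m', h₁, h₂, h₃⟩ := hfree c (c.mark true) (Crossing.mem_A.2 ⟨_, rfl⟩)
  have : ∃ n, g.Reach n (c.mark true) := by
    generalize c.mark true = m at h₃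
    induction h₃ using Relation.ReflTransGen.head_induction_on with
    | refl => exact ⟨0, h₁, h₂⟩
    | head h _ ih =>
      obtain ⟨n, hn⟩ := ih
      exact ⟨n + 1, _, h, hn⟩
  obtain ⟨n, hn⟩ := this
  exact ⟨n, true, hn⟩

/-- The forms `u` of any set of crossings form a regular sequence in any order: the pivot of a
crossing is the mark `O` that follows on the shortest way from the crossing to a free mark. -/
theorem u_regular (hsp : g.IsSpecial) (hst : ∀ c : g.Crossing, g.IsStandardAt c)
    (hfree : g.HasFreeMarks) (𝕜 : Type) [CommRing 𝕜] [IsNoetherianRing 𝕜] :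
    g.IsRegular 𝕜 := by
  intro s c r hc h
  classical
  let δ : g.Crossing → ℕ := fun c => Nat.find (exists_reach hfree c)
  have hδ : ∀ (c : g.Crossing) b n, g.Reach n (c.mark b) → δ c ≤ n := fun c b n hn =>
    Nat.find_min' (exists_reach hfree c) ⟨b, hn⟩
  have hex : ∀ c : g.Crossing, ∃ (o : g.O) (b : Bool), col o.1 = col (c.mark b) ∧
      ∀ (c' : g.Crossing) b', row o.1 = row (c'.mark b') → δ c' < δ c := by
    intro c
    obtain ⟨b, hb⟩ := Nat.find_spec (exists_reach hfree c)
    obtain ⟨k, hk⟩ : ∃ k, δ c = k := ⟨_, rfl⟩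
    change g.Reach (δ c) _ at hb
    rw [hk] at hb
    cases k with
    | zero => exact (hb.2 c (Crossing.mem_A.2 ⟨b, rfl⟩)).elim
    | succ k =>
      obtain ⟨m', ⟨hm', o, ho, h₁, h₂⟩, hr⟩ := hb
      refine ⟨⟨o, ho⟩, b, h₁, fun c' b' h' => ?_⟩
      have hX := mark_mem hst c' b'
      rcases Finset.mem_union.1 hm' with hm | hm
      · rw [g.eq_of_row_X hm hX (h₂.symm.trans h')] at hr
        have := hδ c' b' k hr
        omega
      · exfalso
        have k₁ : 0 < (g.X.filter (row · = row m')).card :=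
          Finset.card_pos.2 ⟨_, Finset.mem_filter.2 ⟨hX, h'.symm.trans h₂⟩⟩
        have k₂ : 0 < (g.XX.filter (row · = row m')).card :=
          Finset.card_pos.2 ⟨_, Finset.mem_filter.2 ⟨hm, rfl⟩⟩
        rcases g.row_cond (row m') with h | h <;> omega
  -- the mark `π c` lies in the column of a mark of `c`, and in the rows of marks of crossings that
  -- are closer to a free mark only
  choose π β h₁ h₂ using hex
  refine mem_span_of_mul_mem π δ
    (fun c => Finset.univ.filter (fun o : g.O => col o.1 = col c.side ∨ col o.1 = col c.below))
    (fun c => Finset.univ.filter (fun o : g.O => row o.1 = row c.side ∨ row o.1 = row c.below))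
    ?_ ?_ ?_ s hc h
  · intro c
    rw [Finset.mem_filter, h₁]
    refine ⟨Finset.mem_univ _, ?_⟩
    cases β c
    exacts [Or.inr rfl, Or.inl rfl]
  · intro i j hj
    rw [Finset.mem_filter, h₁] at hj
    rcases hj.2 with e | e
    · exact (congrArg Prod.fst (mark_col_injective hsp hst (a₁ := (j, β j)) (a₂ := (i, true)) e)).symm
    · exact (congrArg Prod.fst (mark_col_injective hsp hst (a₁ := (j, β j)) (a₂ := (i, false)) e)).symm
  · intro i j hj
    rw [Finset.mem_filter] at hj
    rcases hj.2 with e | e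
    · exact h₂ j i true e
    · exact h₂ j i false e

end LinkGrid

/-! ### The spectral sequence of a filtered module with differential -/

namespace Filtered

variable {R : Type} [CommRing R] {T : Type} [AddCommGroup T] [Module R T] (D : T →ₗ[R] T)
  (F : ℤ → Submodule R T)

/-- The elements of filtration degree `s` whose boundary has filtration degree `s + r`. -/
def Z (r s : ℤ) : Submodule R T := F s ⊓ (F (s + r)).comap D

/-- The elements of `Z r s` that vanish on the page `r`. The offsets are those for which the
differential of a page raises the degree by its number. -/
def B (r s : ℤ) : Submodule R T := Z D F (r - 1) (s + 1) ⊔ (Z D F (r - 1) (s - r + 1)).map D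

/-- The page `r` of the spectral sequence of a filtered differential module. -/
abbrev Page (r s : ℤ) : Type := Z D F r s ⧸ (B D F r s).submoduleOf (Z D F r s)

variable {D F}

theorem mem_Z {r s : ℤ} {v : T} : v ∈ Z D F r s ↔ v ∈ F s ∧ D v ∈ F (s + r) := Iff.rfl

theorem mem_B {r s : ℤ} {v : T} : v ∈ B D F r s ↔
    ∃ z ∈ Z D F (r - 1) (s + 1), ∃ y ∈ Z D F (r - 1) (s - r + 1), z + D y = v := by
  unfold B
  rw [Submodule.mem_sup]
  constructor
  · rintro ⟨z, hz, _, ⟨y, hy, rfl⟩, h⟩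
    exact ⟨z, hz, y, hy, h⟩
  · rintro ⟨z, hz, y, hy, h⟩
    exact ⟨z, hz, _, ⟨y, hy, rfl⟩, h⟩

variable (hD : ∀ v, D (D v) = 0)

include hD in
theorem map_mem {r i j : ℤ} (h : i + r = j) {v : T} (hv : v ∈ Z D F r i) : D v ∈ Z D F r j := by
  refine mem_Z.2 ⟨h ▸ hv.2, ?_⟩
  rw [hD]; exact zero_mem _

include hD in
theorem map_B {r i j : ℤ} (h : i + r = j) {v : T} (hv : v ∈ B D F r i) : D v ∈ B D F r j := by
  obtain ⟨z, hz, y, hy, rfl⟩ := mem_B.1 hv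
  refine mem_B.2 ⟨0, zero_mem _, z, ?_, by rw [map_add, hD, add_zero, zero_add]⟩
  rwa [show j - r + 1 = i + 1 by omega]

/-- The differential of the page `r`. -/
def pageD {r i j : ℤ} (h : i + r = j) : Page D F r i →ₗ[R] Page D F r j :=
  Submodule.mapQ _ _ (D.restrict fun _ hv => map_mem hD h hv) fun _ hv => map_B hD h hv

theorem pageD_mk {r i j : ℤ} (h : i + r = j) (v : Z D F r i) :
    pageD hD h (Submodule.Quotient.mk v) =
      Submodule.Quotient.mk ⟨D v, map_mem hD h v.2⟩ := rfl

open scoped Classical in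
/-- The page `r` as a complex. -/
def page (r : ℤ) :
    HomologicalComplex (ModuleCat.{0} R) (ComplexShape.up' (α := ℤ) r) where
  X s := ModuleCat.of R (Page D F r s)
  d i j := if h : i + r = j then ModuleCat.ofHom (pageD hD h) else 0
  shape i j h := dif_neg h
  d_comp_d' i j k h h' := by
    have h : i + r = j := h
    have h' : j + r = k := h'
    rw [dif_pos h, dif_pos h', ← ModuleCat.ofHom_comp]
    convert ModuleCat.ofHom_zero
    ext v
    change pageD hD h' (pageD hD h (Submodule.Quotient.mk v)) = 0
    rw [pageD_mk, pageD_mk, Submodule.Quotient.mk_eq_zero]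
    change D (D v) ∈ B D F r k
    rw [hD]; exact zero_mem _

theorem page_d {r i j : ℤ} (h : i + r = j) :
    (page (F := F) hD r).d i j = ModuleCat.ofHom (pageD hD h) := dif_pos h

theorem page_d_mk {r i j : ℤ} (h : i + r = j) (v : Z D F r i) :
    ((page (F := F) hD r).d i j).hom (Submodule.Quotient.mk v : Page D F r i) =
      (Submodule.Quotient.mk ⟨D v, map_mem hD h v.2⟩ : Page D F r j) :=
  congrArg (fun f => f.hom (Submodule.Quotient.mk v : Page D F r i)) (page_d hD h)

variable (hF : Antitone F)

/-- The quotients of a module by the kernels of two maps with the same kernel agree. -/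
def equivOfKer {M A A' : Type} [AddCommGroup M] [Module R M] [AddCommGroup A]
    [Module R A] [AddCommGroup A'] [Module R A'] (f : M →ₗ[R] A) (f' : M →ₗ[R] A')
    (hf : Function.Surjective f) (hf' : Function.Surjective f') (h : ∀ m, f m = 0 ↔ f' m = 0) :
    A ≃ₗ[R] A' :=
  (f.quotKerEquivOfSurjective hf).symm ≪≫ₗ
    (Submodule.quotEquivOfEq _ _ (by ext m; exact h m)) ≪≫ₗ f'.quotKerEquivOfSurjective hf'

theorem equivOfKer_apply {M A A' : Type} [AddCommGroup M] [Module R M] [AddCommGroup A]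
    [Module R A] [AddCommGroup A'] [Module R A'] (f : M →ₗ[R] A) (f' : M →ₗ[R] A')
    (hf : Function.Surjective f) (hf' : Function.Surjective f') (h : ∀ m, f m = 0 ↔ f' m = 0)
    (m : M) : equivOfKer f f' hf hf' h (f m) = f' m := by
  unfold equivOfKer
  rw [LinearEquiv.trans_apply, LinearEquiv.trans_apply]
  have : (f.quotKerEquivOfSurjective hf).symm (f m) = Submodule.Quotient.mk m := by
    rw [LinearEquiv.symm_apply_eq]; rfl
  rw [this]
  rfl

include hF in
theorem Z_succ_le (r s : ℤ) : Z D F (r + 1) s ≤ Z D F r s :=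
  fun _ hv => ⟨hv.1, hF (by omega) hv.2⟩

include hF in
theorem succ_mem_ker {r s : ℤ} {v : T} (hv : v ∈ Z D F (r + 1) s) :
    pageD hD (rfl : s + r = s + r) (Submodule.Quotient.mk ⟨v, Z_succ_le hF r s hv⟩) = 0 := by
  rw [pageD_mk, Submodule.Quotient.mk_eq_zero]
  refine mem_B.2 ⟨D v, mem_Z.2 ⟨?_, ?_⟩, 0, zero_mem _, by rw [map_zero, add_zero]; rfl⟩
  · rw [add_assoc]; exact hv.2
  · rw [hD]; exact zero_mem _

/-- The map that presents the homology of the page `r` as a quotient of `Z (r + 1) s`. -/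
def homologyMap (r s : ℤ) : Z D F (r + 1) s →ₗ[R]
    LinearMap.ker (pageD (F := F) hD (rfl : s + r = s + r)) ⧸
      (LinearMap.range (pageD (F := F) hD (sub_add_cancel s r))).submoduleOf
        (LinearMap.ker (pageD (F := F) hD (rfl : s + r = s + r))) :=
  Submodule.mkQ _ ∘ₗ LinearMap.codRestrict _
    (Submodule.mkQ _ ∘ₗ Submodule.inclusion (Z_succ_le hF r s)) fun v => succ_mem_ker hD hF v.2

theorem homologyMap_surjective (r s : ℤ) : Function.Surjective (homologyMap hD hF r s) := by
  intro x
  obtain ⟨⟨y, hy⟩, rfl⟩ := Submodule.Quotient.mk_surjective _ x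
  obtain ⟨⟨v, hv⟩, rfl⟩ := Submodule.Quotient.mk_surjective _ y
  rw [LinearMap.mem_ker, pageD_mk, Submodule.Quotient.mk_eq_zero] at hy
  obtain ⟨z, hz, y, hy', e⟩ := mem_B.1 hy
  change z + D y = D v at e
  have h₁ : v - y ∈ Z D F (r + 1) s := by
    refine mem_Z.2 ⟨sub_mem hv.1 (hF (by omega) hy'.1), ?_⟩
    rw [map_sub, ← e, add_sub_cancel_right]
    exact hF (by omega) hz.1
  refine ⟨⟨v - y, h₁⟩, congrArg Submodule.Quotient.mk (Subtype.ext ?_)⟩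
  change (Submodule.Quotient.mk _ : Page D F r s) = Submodule.Quotient.mk _
  rw [Submodule.Quotient.eq]
  refine mem_B.2 ⟨-y, neg_mem ⟨hF (by omega) hy'.1, hF (by omega) hy'.2⟩, 0, zero_mem _, ?_⟩
  change -y + D 0 = v - y - v
  rw [map_zero]; abel

theorem homologyMap_eq_zero (r s : ℤ) (v : Z D F (r + 1) s) :
    homologyMap hD hF r s v = 0 ↔ v.1 ∈ B D F (r + 1) s := by
  obtain ⟨v, hv⟩ := v
  have e : homologyMap hD hF r s ⟨v, hv⟩ = 0 ↔
      ∃ w : Z D F r (s - r), v - D w ∈ B D F r s := by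
    change (Submodule.Quotient.mk _ : _ ⧸ _) = 0 ↔ _
    rw [Submodule.Quotient.mk_eq_zero]
    change (Submodule.Quotient.mk ⟨v, _⟩ : Page D F r s) ∈ LinearMap.range _ ↔ _
    rw [LinearMap.mem_range]
    constructor
    · rintro ⟨x, hx⟩
      obtain ⟨w, rfl⟩ := Submodule.Quotient.mk_surjective _ x
      refine ⟨w, ?_⟩
      rw [pageD_mk, eq_comm, Submodule.Quotient.eq] at hx
      exact hx
    · rintro ⟨w, hw⟩
      refine ⟨Submodule.Quotient.mk w, ?_⟩
      rw [pageD_mk, eq_comm, Submodule.Quotient.eq]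
      exact hw
  rw [e, mem_B]
  constructor
  · rintro ⟨⟨w, hw⟩, h⟩
    obtain ⟨z, hz, y, hy, e⟩ := mem_B.1 h
    dsimp only at e
    have e' : z = v - D (w + y) := by rw [map_add, ← sub_sub, ← e, add_sub_cancel_right]
    refine ⟨z, mem_Z.2 ⟨hz.1, ?_⟩, w + y, mem_Z.2 ⟨?_, ?_⟩, by rw [e', sub_add_cancel]⟩
    · rw [e', map_sub, hD, sub_zero]
      exact hF (by omega) hv.2
    · exact add_mem (hF (by omega) hw.1) (hF (by omega) hy.1)
    · rw [map_add]
      exact add_mem (hF (by omega) hw.2) (hF (by omega) hy.2)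
  · rintro ⟨z, hz, y, hy, e⟩
    refine ⟨⟨y, hF (by omega) hy.1, hF (by omega) hy.2⟩, mem_B.2 ⟨z, ⟨hz.1, hF (by omega) hz.2⟩, 0,
      zero_mem _, ?_⟩⟩
    change z + D 0 = v - D y
    change z + D y = v at e
    rw [map_zero, add_zero, ← e, add_sub_cancel_right]

theorem pageD_comp (r s : ℤ) : pageD (F := F) hD (rfl : s + r = s + r) ∘ₗ
    pageD (F := F) hD (sub_add_cancel s r) = 0 := by
  ext x
  change pageD hD rfl (pageD hD (sub_add_cancel s r) (Submodule.Quotient.mk x)) = 0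
  rw [pageD_mk, pageD_mk, Submodule.Quotient.mk_eq_zero]
  change D (D x) ∈ B D F r (s + r)
  rw [hD]; exact zero_mem _

/-- The part of the page `r` around the degree `s`. -/
def pageSc (r s : ℤ) : ShortComplex (ModuleCat.{0} R) :=
  ShortComplex.moduleCatMk _ _ (pageD_comp (F := F) hD r s)

/-- `pageSc` is the short complex that defines the homology of the page in the degree `s`. -/
def pageScIso (r s : ℤ) : (page (F := F) hD r).sc s ≅ pageSc (F := F) hD r s :=
  (page (F := F) hD r).isoSc' (s - r) s (s + r)
      (ComplexShape.prev_eq' _ (sub_add_cancel s r)) (ComplexShape.next_eq' _ rfl) ≪≫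
    ShortComplex.isoMk (Iso.refl _) (Iso.refl _) (Iso.refl _)
      ((Category.id_comp _).trans ((page_d hD (sub_add_cancel s r)).symm.trans
        (Category.comp_id _).symm))
      ((Category.id_comp _).trans ((page_d hD rfl).symm.trans (Category.comp_id _).symm))

/-- The homology of a page is the next page. -/
def homologyIso (r s : ℤ) :
    (page (F := F) hD r).homology s ≅ ModuleCat.of R (Page D F (r + 1) s) :=
  ShortComplex.homologyMapIso (pageScIso hD r s) ≪≫
    (pageSc (F := F) hD r s).moduleCatHomologyIso ≪≫ LinearEquiv.toModuleIso
      (Submodule.quotEquivOfEq _ _ (LinearMap.range_codRestrict _ _ _) ≪≫ₗ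
        equivOfKer (homologyMap hD hF r s) (Submodule.mkQ _) (homologyMap_surjective hD hF r s)
          (Submodule.mkQ_surjective _) fun m => (homologyMap_eq_zero hD hF r s m).trans
            (Submodule.Quotient.mk_eq_zero ((B D F (r + 1) s).submoduleOf _)).symm)

variable (F) in
/-- The spectral sequence of a filtered differential module. -/
def specSeq : SpecSeq R where
  page r _ := page (F := F) hD r
  iso r r' s h _ := homologyIso hD hF r s ≪≫ eqToIso (by subst h; rfl)

variable {a b : ℤ} (ha : ∀ s ≤ a, F s = ⊤) (hb : F b = ⊥)

include hF hb in
theorem eq_bot_of_le {s : ℤ} (h : b ≤ s) {v : T} (hv : v ∈ F s) : v = 0 := by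
  have := hF h hv
  rwa [hb, Submodule.mem_bot] at this

include hF ha hb in
/-- On a late page the cycles of the total differential represent everything, and its boundaries
represent zero. -/
theorem mem_B_iff {r s : ℤ} (hr : b - a + 1 ≤ r) (h : a ≤ s) {v : T} (hv : v ∈ F s) :
    v ∈ B D F r s ↔ ∃ z ∈ F (s + 1), ∃ y, z + D y = v ∧ D z = 0 := by
  rw [mem_B]
  constructor
  · rintro ⟨z, hz, y, hy, e⟩
    exact ⟨z, hz.1, y, e, eq_bot_of_le hF hb (by omega) hz.2⟩
  · rintro ⟨z, hz, y, e, hDz⟩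
    rcases le_or_gt b s with hs | hs
    · exact ⟨0, zero_mem _, 0, zero_mem _, by
        rw [map_zero, add_zero, eq_bot_of_le hF hb hs hv]⟩
    refine ⟨z, mem_Z.2 ⟨hz, by rw [hDz]; exact zero_mem _⟩, y, mem_Z.2 ⟨?_, ?_⟩, e⟩
    · rw [ha _ (by omega)]; trivial
    · rw [eq_sub_of_add_eq' e]
      exact hF (by omega) (sub_mem hv (hF (by omega) hz))

variable {H : Type} [AddCommGroup H] [Module R H] (θ : LinearMap.ker D →ₗ[R] H)
  (hθ : Function.Surjective θ) (hθ' : ∀ x, θ x = 0 ↔ x.1 ∈ LinearMap.range D)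

/-- The filtration of the homology. -/
def fil (s : ℤ) : Submodule R H := (((F s).comap (LinearMap.ker D).subtype)).map θ

include hF ha hb hθ' in
/-- From the page `b - a + 1` on, where `a` and `b` bound the filtration, the pages are the graded
pieces of the homology. -/
theorem page_equiv {r : ℤ} (hr : b - a + 1 ≤ r) (s : ℤ) : Nonempty (Page D F r s ≃ₗ[R]
    (fil (F := F) θ s ⧸ (fil (F := F) θ (s + 1)).submoduleOf (fil (F := F) θ s))) := by
  rcases lt_or_ge s a with h | h
  · -- both sides vanish below the filtration
    have h₁ : Subsingleton (Page D F r s) := by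
      rw [Submodule.Quotient.subsingleton_iff, eq_top_iff]
      rintro ⟨v, hv⟩ -
      refine mem_B.2 ⟨v, mem_Z.2 ⟨?_, ?_⟩, 0, zero_mem _, by rw [map_zero, add_zero]; rfl⟩
      · rw [ha _ (by omega)]; trivial
      · rw [show s + 1 + (r - 1) = s + r by omega]; exact hv.2
    have h₂ : Subsingleton (fil (F := F) θ s ⧸
        (fil (F := F) θ (s + 1)).submoduleOf (fil (F := F) θ s)) := by
      rw [Submodule.Quotient.subsingleton_iff, eq_top_iff]
      rintro ⟨v, hv⟩ -
      change v ∈ fil (F := F) θ (s + 1)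
      unfold fil at *
      rwa [ha _ (by omega), ← ha s (by omega)]
    exact ⟨LinearEquiv.ofSubsingleton _ _⟩
  · have hZ : ∀ v, v ∈ Z D F r s → D v = 0 := fun v hv => eq_bot_of_le hF hb (by omega) hv.2
    let f : Z D F r s →ₗ[R] fil (F := F) θ s :=
      LinearMap.codRestrict _ (θ ∘ₗ LinearMap.codRestrict _ (Submodule.subtype _)
        fun v => hZ _ v.2) fun v => ⟨_, v.2.1, rfl⟩
    refine ⟨equivOfKer (Submodule.mkQ _) (Submodule.mkQ _ ∘ₗ f) (Submodule.mkQ_surjective _)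
      ((Submodule.mkQ_surjective _).comp ?_) ?_⟩
    · rintro ⟨_, x, hx, rfl⟩
      exact ⟨⟨x.1, mem_Z.2 ⟨hx, by rw [LinearMap.mem_ker.1 x.2]; exact zero_mem _⟩⟩, rfl⟩
    · rintro ⟨v, hv⟩
      have e₁ : (Submodule.mkQ ((B D F r s).submoduleOf (Z D F r s))) ⟨v, hv⟩ = 0 ↔ v ∈ B D F r s :=
        Submodule.Quotient.mk_eq_zero _
      have e₂ : (Submodule.mkQ _ ∘ₗ f : _ →ₗ[R] (fil (F := F) θ s ⧸
          (fil (F := F) θ (s + 1)).submoduleOf (fil (F := F) θ s))) ⟨v, hv⟩ = 0 ↔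
          θ ⟨v, hZ v hv⟩ ∈ fil (F := F) θ (s + 1) := Submodule.Quotient.mk_eq_zero _
      rw [e₁, e₂, mem_B_iff hF ha hb hr h hv.1]
      constructor
      · rintro ⟨z, hz, y, e, hDz⟩
        refine ⟨⟨z, hDz⟩, hz, ?_⟩
        rw [← sub_eq_zero, ← map_sub, hθ']
        refine ⟨-y, ?_⟩
        change D (-y) = z - v
        rw [map_neg, ← e]; abel
      · rintro ⟨⟨z, hDz⟩, hz, e⟩
        rw [eq_comm, ← sub_eq_zero, ← map_sub, hθ'] at e
        obtain ⟨y, hy⟩ := e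
        change D y = v - z at hy
        exact ⟨z, hz, y, by rw [hy, add_sub_cancel], hDz⟩

include ha hb hθ hθ' in
theorem convergesTo : ConvergesTo (specSeq F hD hF) H := by
  refine ⟨fil (F := F) θ, fun s t h => Submodule.map_mono (Submodule.comap_mono (hF h)), ⟨a, ?_⟩,
    ⟨b, ?_⟩, max 1 (b - a + 1), le_max_left _ _, fun r _ hr' => ⟨fun s t => ?_, fun s =>
      page_equiv hF ha hb θ hθ' ((le_max_right _ _).trans hr') s⟩⟩
  · rw [fil, ha a le_rfl, Submodule.comap_top, Submodule.map_top, LinearMap.range_eq_top.2 hθ]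
  · rw [eq_bot_iff, fil, hb]
    rintro _ ⟨x, hx, rfl⟩
    change x.1 = 0 at hx
    rw [Submodule.mem_bot, hθ', hx]
    exact zero_mem _
  · by_cases h : s + r = t
    · change (page (F := F) hD r).d s t = 0
      rw [page_d hD h]
      refine Eq.trans (congrArg ModuleCat.ofHom ?_) ModuleCat.ofHom_zero
      ext v
      change pageD hD h (Submodule.Quotient.mk v) = 0
      rw [pageD_mk, Submodule.Quotient.mk_eq_zero]
      change D v ∈ B D F r t
      have hr := (le_max_right _ _).trans hr'
      rcases lt_or_ge s a with hs | hs
      · refine mem_B.2 ⟨0, zero_mem _, v, mem_Z.2 ⟨?_, ?_⟩, zero_add _⟩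
        · rw [ha _ (by omega)]; trivial
        · rw [show t - r + 1 + (r - 1) = s + r by omega]
          exact v.2.2
      · rw [eq_bot_of_le hF hb (by omega) v.2.2]
        exact zero_mem _
    · exact (page (F := F) hD r).shape s t h

section

variable {C : ℤ → Type} [∀ s, AddCommGroup (C s)] [∀ s, Module R (C s)]
  (ψ : ∀ s, Z D F 1 s →ₗ[R] C s) (hψ : ∀ s, Function.Surjective (ψ s))
  (hψ' : ∀ s v, ψ s v = 0 ↔ v.1 ∈ B D F 1 s)

/-- A description of the first page. -/
def firstPage (s : ℤ) : ((specSeq F hD hF).page 1).X s ≃ₗ[R] C s :=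
  equivOfKer (Submodule.mkQ _) (ψ s) (Submodule.mkQ_surjective _) (hψ s) fun m =>
    (Submodule.Quotient.mk_eq_zero ((B D F 1 s).submoduleOf _)).trans (hψ' s m).symm

theorem firstPage_mk (s : ℤ) (v : Z D F 1 s) :
    firstPage hD hF ψ hψ hψ' s (Submodule.Quotient.mk v : Page D F 1 s) = ψ s v :=
  equivOfKer_apply ((B D F 1 s).submoduleOf (Z D F 1 s)).mkQ (ψ s) (Submodule.mkQ_surjective _)
    (hψ s) (fun m => (Submodule.Quotient.mk_eq_zero ((B D F 1 s).submoduleOf _)).trans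
      (hψ' s m).symm) v

theorem firstPage_d (s : ℤ) (v : Z D F 1 s) :
    firstPage hD hF ψ hψ hψ' (s + 1) (((specSeq F hD hF).page 1).d s (s + 1)
      ((firstPage hD hF ψ hψ hψ' s).symm (ψ s v))) = ψ (s + 1) ⟨D v, map_mem hD rfl v.2⟩ := by
  have e : (firstPage hD hF ψ hψ hψ' s).symm (ψ s v) = (Submodule.Quotient.mk v : Page D F 1 s) :=
    (LinearEquiv.symm_apply_eq _).2 (firstPage_mk hD hF ψ hψ hψ' s v).symm
  rw [e]
  exact (congrArg (firstPage hD hF ψ hψ hψ' (s + 1)) (page_d_mk (F := F) hD rfl v)).trans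
    (firstPage_mk hD hF ψ hψ hψ' (s + 1) _)

end

end Filtered

namespace LinkGrid

open Loc

/-! ### The associated graded complex -/

section

variable {p : ℕ} {q : ℤ} {N : ℕ} [NeZero N] {g : LinkGrid p q N}

open scoped Classical in
/-- The resolution of a crossing to which a label belongs. -/
def Crossing.bit (c : g.Crossing) (l : Loc) : Bool :=
  if c.Positive then decide (l = p₂ ∨ l = away) else decide (l = p₁ ∨ l = p₂)

open scoped Classical in
/-- A singularized crossing has two labels; the arrow from `src` to `tgt` has coefficient `u`. -/
def Crossing.src (c : g.Crossing) : Loc := if c.Positive then p₀ else p₁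

open scoped Classical in
/-- The target of the arrow with coefficient `u`. -/
def Crossing.tgt (c : g.Crossing) : Loc := if c.Positive then p₁ else p₂

namespace Crossing

variable (c : g.Crossing)

theorem src_ne_away : c.src ≠ away := by unfold src; split_ifs <;> simp

theorem tgt_ne_away : c.tgt ≠ away := by unfold tgt; split_ifs <;> simp

theorem src_ne_tgt : c.src ≠ c.tgt := by unfold src tgt; split_ifs <;> simp

theorem bit_src_eq_bit_tgt : c.bit c.src = c.bit c.tgt := by
  unfold bit src tgt; split_ifs <;> simp

theorem bit_le {l l' : Loc} (h : Le l l') : c.bit l ≤ c.bit l' := by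
  unfold bit
  rcases h with rfl | rfl | rfl <;> split_ifs <;> simp

end Crossing

/-- The resolution to which a generator of the total complex belongs. -/
def Dec.res (a : g.Dec) : g.Resolution := fun c => c.bit (a.1.2 c)

theorem Dec.sing_iff {a : g.Dec} {c : g.Crossing} :
    a.res.Singular c ↔ a.1.2 c = c.src ∨ a.1.2 c = c.tgt := by
  unfold Resolution.Singular res Crossing.bit Crossing.src Crossing.tgt
  generalize a.1.2 c = l
  by_cases h : c.Positive <;> simp only [h, if_true, if_false] <;> cases l <;> simp

theorem Dec.res_set {a : g.Dec} {c : g.Crossing} {v : Loc} (h : c.bit v = c.bit (a.1.2 c)) :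
    (a.set c v).res = a.res := by
  funext d
  unfold res
  by_cases hd : d = c
  · subst hd
    by_cases hh : a.1.2 d ≠ away ∧ v ≠ away
    · rw [Dec.set_self hh.1 hh.2, h]
    · rw [Dec.set_of_not hh]
  · rw [Dec.set_of_ne hd]

variable [NeZero p]

theorem Resolution.eq_of_le {I J : g.Resolution} (h : ∀ c, I c ≤ J c) (hd : J.deg ≤ I.deg) :
    I = J := by
  have hs : Finset.univ.filter (fun c => I c = true) ⊆ Finset.univ.filter fun c => J c = true := by
    intro c hc
    rw [Finset.mem_filter] at hc ⊢
    have := h c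
    rw [hc.2] at this
    exact ⟨hc.1, Bool.eq_true_of_true_le this⟩
  have e := Finset.eq_of_subset_of_card_le hs hd
  funext c
  have := Finset.ext_iff.1 e c
  simp only [Finset.mem_filter, Finset.mem_univ, true_and] at this
  exact Bool.eq_iff_iff.2 this

theorem RectOK.res_le {a b : g.Dec} {r : Rect p q N} (h : RectOK a b r) (c : g.Crossing) :
    a.res c ≤ b.res c := c.bit_le (h.2.2 c).le

/-- Inside a resolution the rectangles preserve the labels of the singularized crossings. -/
theorem RectOK.label_eq {a b : g.Dec} {r : Rect p q N} (h : RectOK a b r) (hab : a.res = b.res)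
    {c : g.Crossing} (hc : a.res.Singular c) : a.1.2 c = b.1.2 c := by
  have hc' := hc
  rw [hab] at hc'
  rw [Dec.sing_iff] at hc hc'
  have := h.2.2 c
  unfold Crossing.src Crossing.tgt at hc hc'
  rcases this with ⟨-, h⟩ | ⟨-, ⟨h, h'⟩ | ⟨h, h'⟩⟩
  · exact h
  · rw [h'] at hc'; split_ifs at hc' <;> simp at hc'
  · rw [h] at hc; split_ifs at hc <;> simp at hc

variable (𝕜 : Type) [CommRing 𝕜] (S : Signs p q N)

open scoped Classical in
/-- The part of the differential of the total complex that preserves the resolution. -/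
def blockD : (g.Chains 𝕜) →ₗ[MvPolynomial g.O 𝕜]
    (g.Chains 𝕜) where
  toFun f b := ∑ a, (if a.res = b.res then rectCoeff 𝕜 S a b * f a else 0) +
    ∑ c, if b.1.2 c = c.tgt then b.eta _ c * c.u 𝕜 * f (b.set c c.src) else 0
  map_add' f f' := by
    funext b
    simp only [Pi.add_apply]
    rw [add_add_add_comm, ← Finset.sum_add_distrib, ← Finset.sum_add_distrib]
    congr 1 <;> refine Finset.sum_congr rfl fun a _ => ?_ <;> split_ifs <;> ring
  map_smul' r f := by
    funext b
    simp only [Pi.smul_apply, smul_eq_mul, RingHom.id_apply, mul_add, Finset.mul_sum]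
    congr 1 <;> refine Finset.sum_congr rfl fun a _ => ?_ <;> split_ifs <;> ring

open scoped Classical in
theorem blockD_apply (f : g.Chains 𝕜) (b : g.Dec) :
    blockD 𝕜 S f b = ∑ a, (if a.res = b.res then rectCoeff 𝕜 S a b * f a else 0) +
      ∑ c, if b.1.2 c = c.tgt then b.eta _ c * c.u 𝕜 * f (b.set c c.src) else 0 := rfl

theorem Dec.res_set_src {b : g.Dec} {c : g.Crossing} (h : b.1.2 c = c.tgt) :
    (b.set c c.src).res = b.res := Dec.res_set (by rw [h, c.bit_src_eq_bit_tgt])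

theorem Dec.res_set_tgt {b : g.Dec} {c : g.Crossing} (h : b.1.2 c = c.src) :
    (b.set c c.tgt).res = b.res := Dec.res_set (by rw [h, c.bit_src_eq_bit_tgt])

variable {𝕜} {S}

theorem blockD_congr {f f' : g.Chains 𝕜} {b : g.Dec}
    (h : ∀ a, a.res = b.res → f a = f' a) : blockD 𝕜 S f b = blockD 𝕜 S f' b := by
  rw [blockD_apply, blockD_apply]
  congr 1 <;> refine Finset.sum_congr rfl fun a _ => ?_ <;> split_ifs with ha
  · rw [h a ha]
  · rfl
  · rw [h _ (Dec.res_set_src ha)]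
  · rfl

/-- On chains without components of smaller degree, the differential of the total complex preserves
the resolution up to terms of larger degree. -/
theorem totalD_eq_blockD {f : g.Chains 𝕜} {b : g.Dec}
    (h : ∀ a : g.Dec, a.res.deg < b.res.deg → f a = 0) : totalD 𝕜 S f b = blockD 𝕜 S f b := by
  classical
  have h' : ∀ a : g.Dec, (∀ c, a.res c ≤ b.res c) → a.res ≠ b.res → f a = 0 := fun a h₁ h₂ =>
    h a (not_le.1 fun h₃ => h₂ (Resolution.eq_of_le h₁ h₃))
  rw [totalD_apply, blockD_apply, rectD_apply]
  congr 1
  · refine Finset.sum_congr rfl fun a _ => ?_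
    split_ifs with ha
    · rfl
    · by_cases hz : rectCoeff 𝕜 S a b = 0
      · rw [hz, zero_mul]
      · obtain ⟨r, hr⟩ := exists_rect_of_ne hz
        rw [h' a hr.res_le ha, mul_zero]
  · refine Finset.sum_congr rfl fun c _ => ?_
    have hset : ∀ {v}, b.1.2 c ≠ away → v ≠ away → c.bit v ≤ c.bit (b.1.2 c) →
        c.bit v ≠ c.bit (b.1.2 c) → f (b.set c v) = 0 := by
      intro v hb hv hle hne
      refine h' _ (fun d => ?_) fun e => ?_
      · unfold Dec.res
        by_cases hd : d = c
        · subst hd; rwa [Dec.set_self hb hv]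
        · rw [Dec.set_of_ne hd]
      · have := congrFun e c
        unfold Dec.res at this
        rw [Dec.set_self hb hv] at this
        exact hne this
    rw [koszul_apply]
    by_cases h₁ : b.1.2 c = p₁
    · rw [if_pos h₁]
      by_cases hc : c.Positive
      · simp [kA, Crossing.src, Crossing.tgt, hc, h₁]
      · rw [hset (by simp [h₁]) (by simp) (h₁ ▸ c.bit_le (by simp [Le]))
          (by simp [Crossing.bit, hc, h₁])]
        simp [Crossing.tgt, hc, h₁]
    · rw [if_neg h₁]
      by_cases h₂ : b.1.2 c = p₂
      · rw [if_pos h₂]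
        by_cases hc : c.Positive
        · rw [hset (by simp [h₂]) (by simp) (h₂ ▸ c.bit_le (by simp [Le]))
            (by simp [Crossing.bit, hc, h₂])]
          simp [Crossing.tgt, hc, h₂]
        · simp [kB, Crossing.src, Crossing.tgt, hc, h₂]
      · rw [if_neg h₂, if_neg]
        unfold Crossing.tgt; split_ifs <;> assumption

theorem totalD_eq_of_res {f : g.Chains 𝕜} {b : g.Dec} (I : g.Resolution)
    (h : ∀ a : g.Dec, a.res ≠ I → f a = 0) (hb : b.res.deg ≤ I.deg) :
    totalD 𝕜 S f b = blockD 𝕜 S f b :=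
  totalD_eq_blockD fun a ha => h a fun e => by rw [e] at ha; omega

variable (hD : ∀ f : g.Chains 𝕜, totalD 𝕜 S (totalD 𝕜 S f) = 0)

include hD in
theorem blockD_sq (f : g.Chains 𝕜) : blockD 𝕜 S (blockD 𝕜 S f) = 0 := by
  classical
  funext b
  let f' : g.Chains 𝕜 := fun a => if a.res = b.res then f a else 0
  have hf' : ∀ a : g.Dec, a.res ≠ b.res → f' a = 0 := fun a ha => if_neg ha
  have hb : ∀ a : g.Dec, a.res = b.res → blockD 𝕜 S f a = totalD 𝕜 S f' a := fun a ha => by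
    rw [totalD_eq_of_res b.res hf' (by rw [ha])]
    exact blockD_congr fun a' ha' => (if_pos (ha'.trans ha)).symm
  rw [blockD_congr hb, ← totalD_eq_blockD, hD]
  intro a ha
  rw [totalD_eq_of_res b.res hf' ha.le, blockD_congr (f' := 0), map_zero, Pi.zero_apply]
  exact fun a' ha' => hf' _ fun e => by rw [ha'] at e; rw [e] at ha; omega

/-- The generators whose labels at the singularized crossings in `s` are targets. -/
def Dec.IsTgt (s : Finset g.Crossing) (a : g.Dec) : Prop :=
  ∀ c ∈ s, a.res.Singular c → a.1.2 c = c.tgt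

variable (𝕜) in
/-- The ideal generated by the forms `u` of the crossings in `s` that are singularized. -/
def Resolution.idealOf (s : Finset g.Crossing) (I : g.Resolution) :
    Ideal (MvPolynomial g.O 𝕜) :=
  Ideal.span ((fun c : g.Crossing => c.u 𝕜) '' {c | c ∈ s ∧ I.Singular c})

theorem Resolution.idealOf_mono {s s' : Finset g.Crossing} (h : s ⊆ s') (I : g.Resolution) :
    I.idealOf 𝕜 s ≤ I.idealOf 𝕜 s' :=
  Ideal.span_mono (Set.image_mono fun _ hc => ⟨h hc.1, hc.2⟩)

theorem Resolution.idealOf_univ (I : g.Resolution) : I.idealOf 𝕜 Finset.univ = I.ideal 𝕜 := by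
  unfold idealOf ideal
  simp

variable (hreg : g.IsRegular 𝕜)

include hD hreg in
/-- The cone of a regular sequence resolves the quotient: inside a resolution, a cycle whose
components at the targets lie in the ideal of the `u` is a boundary. -/
theorem exists_blockD_eq (s : Finset g.Crossing) (z : g.Chains 𝕜)
    (hz : blockD 𝕜 S z = 0) (hzs : ∀ a, Dec.IsTgt s a → z a ∈ a.res.idealOf 𝕜 s) :
    ∃ w, blockD 𝕜 S w = z ∧ ∀ a, Dec.IsTgt s a → w a ∈ a.res.idealOf 𝕜 s := by
  classical
  induction s using Finset.induction_on generalizing z with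
  | empty =>
    refine ⟨0, ?_, fun _ _ => zero_mem _⟩
    rw [map_zero]
    funext a
    have := hzs a fun c hc => by simp at hc
    have e : {c | c ∈ (∅ : Finset g.Crossing) ∧ a.res.Singular c} = ∅ := by
      ext d; simp
    rw [Resolution.idealOf, e, Set.image_empty, Ideal.span_empty, Ideal.mem_bot] at this
    exact this.symm
  | insert c s hc ih =>
    have hins : ∀ a : g.Dec, Dec.IsTgt s a → (a.res.Singular c → a.1.2 c = c.tgt) →
        Dec.IsTgt (insert c s) a := fun a h h' d hd => by
      rcases Finset.mem_insert.1 hd with rfl | hd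
      · exact h'
      · exact h d hd
    -- the coefficient of `u` at the crossing `c`
    have hm : ∀ a : g.Dec, ∃ m, Dec.IsTgt s a → a.1.2 c = c.tgt →
        z a - c.u 𝕜 * m ∈ a.res.idealOf 𝕜 s := by
      intro a
      by_cases h : Dec.IsTgt s a ∧ a.1.2 c = c.tgt
      · have h₁ := hzs a (hins a h.1 fun _ => h.2)
        have e : {d | d ∈ insert c s ∧ a.res.Singular d} =
            insert c {d | d ∈ s ∧ a.res.Singular d} := by
          ext d
          simp only [Set.mem_ofPred_eq, Set.mem_insert_iff, Finset.mem_insert]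
          constructor
          · rintro ⟨rfl | h, h'⟩
            · exact Or.inl rfl
            · exact Or.inr ⟨h, h'⟩
          · rintro (rfl | h')
            · exact ⟨Or.inl rfl, Dec.sing_iff.2 (Or.inr h.2)⟩
            · exact ⟨Or.inr h'.1, h'.2⟩
        rw [Resolution.idealOf, e, Set.image_insert_eq, Ideal.mem_span_insert'] at h₁
        obtain ⟨m, hm⟩ := h₁
        exact ⟨-m, fun _ _ => by
          rw [mul_neg, sub_neg_eq_add, mul_comm]; exact hm⟩
      · exact ⟨0, fun h₁ h₂ => (h ⟨h₁, h₂⟩).elim⟩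
    choose m hm using hm
    let M : g.Chains 𝕜 := fun b =>
      if b.1.2 c = c.src ∧ Dec.IsTgt s b then b.eta _ c * m (b.set c c.tgt) else 0
    have hM : ∀ b : g.Dec, b.1.2 c ≠ c.src → M b = 0 := fun b h => if_neg fun h' => h h'.1
    have hMK : ∀ (a : g.Dec) (d : g.Crossing), d ≠ c → a.1.2 c ≠ c.src →
        M (a.set d d.src) = 0 := fun a d hd ha => hM _ (by rwa [Dec.set_of_ne hd.symm])
    -- away from the source, `blockD M` is the term at `c`
    have hDM : ∀ a : g.Dec, a.1.2 c ≠ c.src → blockD 𝕜 S M a =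
        if a.1.2 c = c.tgt then a.eta _ c * c.u 𝕜 * M (a.set c c.src) else 0 := by
      intro a ha
      rw [blockD_apply, Finset.sum_eq_zero, zero_add, Finset.sum_eq_single c]
      · intro d _ hd
        rw [hMK a d hd ha, mul_zero, ite_self]
      · exact fun h => (h (Finset.mem_univ _)).elim
      · intro b _
        split_ifs with hb
        · by_cases hz : rectCoeff 𝕜 S b a = 0
          · rw [hz, zero_mul]
          · obtain ⟨r, hr⟩ := exists_rect_of_ne hz
            rw [hM, mul_zero]
            intro hs
            have := hr.label_eq hb (Dec.sing_iff.2 (Or.inl hs))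
            exact ha (this ▸ hs)
        · rfl
    have hset : ∀ a : g.Dec, Dec.IsTgt s a → ∀ (d : g.Crossing) (v : Loc), d ∉ s →
        (a.set d v).res = a.res → Dec.IsTgt s (a.set d v) := fun a ha d v hd hres e he h => by
      have hed : e ≠ d := fun e' => hd (e' ▸ he)
      rw [Dec.set_of_ne hed]
      exact ha e he (hres ▸ h)
    have hz' : ∀ a : g.Dec, Dec.IsTgt s a → a.1.2 c ≠ c.src →
        (z - blockD 𝕜 S M) a ∈ a.res.idealOf 𝕜 s := by
      intro a ha hac
      rw [Pi.sub_apply, hDM a hac]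
      split_ifs with hat
      · have e : M (a.set c c.src) = a.eta _ c * m a := by
          have h₁ : (a.set c c.src).1.2 c = c.src :=
            Dec.set_self (by rw [hat]; exact c.tgt_ne_away) c.src_ne_away
          dsimp only [M]
          rw [if_pos ⟨h₁, hset a ha c _ hc (Dec.res_set_src hat)⟩, Dec.eta_set_self,
            Dec.set_set (by rw [hat]; exact c.tgt_ne_away) c.src_ne_away, if_neg c.tgt_ne_away,
            Dec.set_eq_self hat]
        rw [e]
        convert hm a ha hat using 1
        linear_combination (-c.u 𝕜 * m a) * a.eta_mul_self (A := MvPolynomial g.O 𝕜) c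
      · rw [sub_zero]
        have h₁ : ¬ a.res.Singular c := fun h => (Dec.sing_iff.1 h).elim hac hat
        have := hzs a (hins a ha fun h => (h₁ h).elim)
        have e : {d | d ∈ insert c s ∧ a.res.Singular d} = {d | d ∈ s ∧ a.res.Singular d} := by
          ext d
          simp only [Set.mem_ofPred_eq, Finset.mem_insert]
          refine and_congr_left fun h => or_iff_right ?_
          rintro rfl
          exact h₁ h
        rw [Resolution.idealOf, e] at this
        exact this
    have hzD : blockD 𝕜 S (z - blockD 𝕜 S M) = 0 := by
      rw [map_sub, hz, blockD_sq hD, sub_zero]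
    obtain ⟨w, hw, hws⟩ := ih (z - blockD 𝕜 S M) hzD fun a ha => by
      by_cases hac : a.1.2 c = c.src
      · -- the component at the target of the arrow at `c` shows that `u` times the component at the
        -- source lies in the ideal
        have hat : (a.set c c.tgt).1.2 c = c.tgt :=
          Dec.set_self (by rw [hac]; exact c.src_ne_away) c.tgt_ne_away
        have hres := Dec.res_set_tgt hac
        have hta := hset a ha c _ hc hres
        have hne : (a.set c c.tgt).1.2 c ≠ c.src := by rw [hat]; exact c.src_ne_tgt.symm
        have key := congrFun hzD (a.set c c.tgt)
        rw [blockD_apply, Pi.zero_apply, ← Finset.add_sum_erase _ _ (Finset.mem_univ c),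
          if_pos hat, Dec.set_set (by rw [hac]; exact c.src_ne_away) c.tgt_ne_away,
          if_neg c.src_ne_away, Dec.set_eq_self hac] at key
        refine hreg _ c _ (fun h => hc h.1) ?_
        change _ ∈ a.res.idealOf 𝕜 s
        rw [← Ideal.unit_mul_mem_iff_mem _ (IsUnit.of_mul_eq_one _
          ((a.set c c.tgt).eta_mul_self (A := MvPolynomial g.O 𝕜) c)), ← mul_assoc,
          eq_neg_of_add_eq_zero_left ((add_left_comm _ _ _).symm.trans key)]
        refine neg_mem (add_mem (sum_mem fun b _ => ?_) (sum_mem fun d hd => ?_))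
        · split_ifs with hb
          · by_cases hz : rectCoeff 𝕜 S b (a.set c c.tgt) = 0
            · rw [hz, zero_mul]; exact zero_mem _
            · obtain ⟨r, hr⟩ := exists_rect_of_ne hz
              refine Ideal.mul_mem_left _ _ ?_
              rw [← hres, ← hb]
              refine hz' b (fun d hd h => ?_) ?_
              · rw [hr.label_eq hb h]
                exact hta d hd (hb ▸ h)
              · rw [hr.label_eq hb (hb ▸ Dec.sing_iff.2 (Or.inr hat))]
                exact hne
          · exact zero_mem _
        · have hdc : d ≠ c := Finset.ne_of_mem_erase hd
          split_ifs with hdt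
          · by_cases hds : d ∈ s
            · refine Ideal.mul_mem_right _ _ (Ideal.mul_mem_left _ _ (Ideal.subset_span
                ⟨d, ⟨hds, ?_⟩, rfl⟩))
              rw [← hres]
              exact Dec.sing_iff.2 (Or.inr hdt)
            · refine Ideal.mul_mem_left _ _ ?_
              rw [← hres, ← Dec.res_set_src hdt]
              refine hz' _ (hset _ hta d _ hds (Dec.res_set_src hdt)) ?_
              rwa [Dec.set_of_ne hdc.symm]
          · exact zero_mem _
      · exact hz' a ha hac
    refine ⟨M + w, by rw [map_add, hw, add_sub_cancel], fun a ha => ?_⟩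
    have hs : Dec.IsTgt s a := fun d hd => ha d (Finset.mem_insert_of_mem hd)
    rw [Pi.add_apply, hM a, zero_add]
    · exact Resolution.idealOf_mono (Finset.subset_insert c s) _ (hws a hs)
    · intro h
      have := ha c (Finset.mem_insert_self c s) (Dec.sing_iff.2 (Or.inl h))
      exact c.src_ne_tgt (h ▸ this)

end

open Loc

/-! ### Labels and marks -/

section

variable {p : ℕ} {q : ℤ} {N : ℕ} [NeZero N] [NeZero p] {g : LinkGrid p q N}

variable (hpq : Int.gcd (p : ℤ) q = 1)

section

variable {x y : FState p q N} {r : Rect p q N} (h : r.IsEmptyFromTo x.1 y.1) (c : g.Crossing)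
  {l l' : Loc} (hl : l = away ↔ c.corner ∉ x.1) (hl' : l' = away ↔ c.corner ∉ y.1)

include hpq h hl hl' in
theorem lam_iff_antidiag (hv : l = p₀ ∨ l = away) (hv' : l' = p₀ ∨ l' = away) :
    Lam l l' (c.n r.mult) ↔
      r.mult (shift c.corner (-1) 0) = 0 ∧ r.mult (shift c.corner 0 (-1)) = 0 := by
  have hn := c.n_eq r.mult
  have h₁ := n_rect hpq h c
  by_cases hx : c.corner ∈ x.1 <;> by_cases hy : c.corner ∈ y.1
  · have e : l = p₀ := hv.resolve_right fun e => hl.1 e hx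
    have e' : l' = p₀ := hv'.resolve_right fun e => hl'.1 e hy
    subst e; subst e'
    have := h₁.1 hx hy
    simp only [Lam, this, true_and]
    simp; omega
  · have e : l = p₀ := hv.resolve_right fun e => hl.1 e hx
    have e' : l' = away := hl'.2 hy
    subst e; subst e'
    have := h.mult_leave hpq hx hy
    simp [Lam, h₁.2.1 hx hy, this]
  · have e : l = away := hl.2 hx
    have e' : l' = p₀ := hv'.resolve_right fun e => hl'.1 e hy
    subst e; subst e'
    have := h.mult_arrive hpq hx hy
    simp [Lam]; omega
  · have e : l = away := hl.2 hx
    have e' : l' = away := hl'.2 hy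
    subst e; subst e'
    have := h.mult_away hpq hx hy
    simp [Lam]; omega

include hpq h hl hl' in
theorem lam_iff_diag (hv : l = p₂ ∨ l = away) (hv' : l' = p₂ ∨ l' = away) :
    Lam l l' (c.n r.mult) ↔
      r.mult (shift c.corner 0 0) = 0 ∧ r.mult (shift c.corner (-1) (-1)) = 0 := by
  have hn := c.n_eq r.mult
  have h₁ := n_rect hpq h c
  by_cases hx : c.corner ∈ x.1 <;> by_cases hy : c.corner ∈ y.1
  · have e : l = p₂ := hv.resolve_right fun e => hl.1 e hx
    have e' : l' = p₂ := hv'.resolve_right fun e => hl'.1 e hy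
    subst e; subst e'
    have := h₁.1 hx hy
    simp only [Lam, this, true_and]
    simp; omega
  · have e : l = p₂ := hv.resolve_right fun e => hl.1 e hx
    have e' : l' = away := hl'.2 hy
    subst e; subst e'
    have := h.mult_leave hpq hx hy
    simp [Lam]; omega
  · have e : l = away := hl.2 hx
    have e' : l' = p₂ := hv'.resolve_right fun e => hl'.1 e hy
    subst e; subst e'
    have := h.mult_arrive hpq hx hy
    simp [Lam, h₁.2.2 hx hy, this]
  · have e : l = away := hl.2 hx
    have e' : l' = away := hl'.2 hy
    subst e; subst e'
    have := h.mult_away hpq hx hy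
    simp [Lam]; omega

/-- The label, besides `away`, of a crossing that has the marks `A`. -/
def Crossing.ini (c : g.Crossing) : Loc :=
  open scoped Classical in if c.Positive then p₀ else p₂

/-- The label, besides `away`, of a crossing that is smoothed. -/
def Crossing.fin (c : g.Crossing) : Loc :=
  open scoped Classical in if c.Positive then p₂ else p₀

include hpq h hl hl' in
theorem lam_iff_A (hv : l = c.ini ∨ l = away) (hv' : l' = c.ini ∨ l' = away) :
    Lam l l' (c.n r.mult) ↔ ∀ t ∈ c.A, r.mult t = 0 := by
  simp only [Crossing.A, Finset.mem_insert, Finset.mem_singleton, forall_eq_or_imp, forall_eq]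
  by_cases hp : c.Positive
  · simp only [Crossing.ini, hp, if_true] at hv hv'
    rw [Crossing.side_pos hp, Crossing.below_pos hp]
    exact lam_iff_antidiag hpq h c hl hl' hv hv'
  · simp only [Crossing.ini, hp, if_false] at hv hv'
    rw [Crossing.side_neg hp, Crossing.below_neg hp]
    exact lam_iff_diag hpq h c hl hl' hv hv'

include hpq h hl hl' in
theorem lam_iff_B (hv : l = c.fin ∨ l = away) (hv' : l' = c.fin ∨ l' = away) :
    Lam l l' (c.n r.mult) ↔ ∀ t ∈ c.B, r.mult t = 0 := by
  simp only [Crossing.B, Finset.mem_insert, Finset.mem_singleton, forall_eq_or_imp, forall_eq]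
  by_cases hp : c.Positive
  · simp only [Crossing.fin, hp, if_true] at hv hv'
    rw [Crossing.opposite_pos hp]
    have := lam_iff_diag hpq h c hl hl' hv hv'
    rwa [← Crossing.self_pos hp] at this
  · simp only [Crossing.fin, hp, if_false] at hv hv'
    rw [Crossing.opposite_neg hp]
    have := lam_iff_antidiag hpq h c hl hl' hv hv'
    rwa [← Crossing.self_neg hp] at this

end

/-! ### The complete resolutions inside the total complex -/

section

variable (hsp : g.IsSpecial) (hst : ∀ c : g.Crossing, g.IsStandardAt c)

theorem Crossing.row_corner (c : g.Crossing) : row c.corner = row c.1 := by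
  by_cases h : c.Positive
  · rw [corner_pos h]
  · rw [corner_neg h, shift_row]; simp

theorem Crossing.exists_col_corner (c : g.Crossing) : ∃ b, col c.corner = col (c.mark b) := by
  by_cases h : c.Positive
  · exact ⟨false, by rw [corner_pos h]; exact c.col_below.symm⟩
  · exact ⟨true, by rw [mark, if_pos rfl, side_neg h, shift_zero]⟩

include hsp in
theorem row_corner_injective : Function.Injective fun c : g.Crossing => row c.corner :=
  fun c c' h => hsp.row_inj c c' (by rw [← c.row_corner, ← c'.row_corner]; exact h)

include hsp hst in
theorem col_corner_injective : Function.Injective fun c : g.Crossing => col c.corner := by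
  intro c c' h
  obtain ⟨b, hb⟩ := c.exists_col_corner
  obtain ⟨b', hb'⟩ := c'.exists_col_corner
  dsimp only at h
  rw [hb, hb'] at h
  have := mark_col_injective hsp hst (a₁ := (c, b)) (a₂ := (c', b')) h
  exact (Prod.ext_iff.1 this).1

namespace Resolution

variable (I : g.Resolution)

/-- The crossing corners of the singularized crossings. -/
def corners : Finset (Torus p q N) := I.sing.image fun c => c.corner

variable {I}

theorem mem_sing {c : g.Crossing} : c ∈ I.sing ↔ I.Singular c := by
  simp [sing]

theorem mem_smooth {c : g.Crossing} : c ∈ I.smooth ↔ ¬ I.Singular c := by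
  simp [smooth]

theorem mem_corners {t : Torus p q N} : t ∈ I.corners ↔ ∃ c, I.Singular c ∧ c.corner = t := by
  simp [corners, mem_sing]

theorem row_notMem {x : Finset (Torus p q N)} (hx : IsState I.diagram.rows I.diagram.cols x)
    {t : Torus p q N} (ht : t ∈ x) {c : g.Crossing} (hc : I.Singular c) :
    row t ≠ row c.corner ∧ col t ≠ col c.corner := by
  have := hx.1 t ht
  simp only [diagram, Finset.mem_sdiff, Finset.mem_univ, true_and, Finset.mem_image, mem_sing,
    not_exists, not_and] at this
  exact ⟨fun e => this.1 c hc e.symm, fun e => this.2 c hc e.symm⟩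

theorem corner_notMem {x : Finset (Torus p q N)} (hx : IsState I.diagram.rows I.diagram.cols x)
    {c : g.Crossing} (hc : I.Singular c) : c.corner ∉ x := fun h => (row_notMem hx h hc).1 rfl

include hsp hst in
/-- The states of a complete resolution correspond to the states of the full ruling that contain
the corners of the singularized crossings. -/
theorem isState_union {x : Finset (Torus p q N)}
    (hx : IsState I.diagram.rows I.diagram.cols x) :
    IsState Finset.univ Finset.univ (x ∪ I.corners) := by
  refine ⟨fun _ _ => ⟨Finset.mem_univ _, Finset.mem_univ _⟩, fun i _ => ?_, fun j _ => ?_⟩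
  · by_cases hi : ∃ c, I.Singular c ∧ row c.corner = i
    · obtain ⟨c, hc, rfl⟩ := hi
      refine ⟨c.corner, ⟨Finset.mem_union_right _ (mem_corners.2 ⟨c, hc, rfl⟩), rfl⟩, ?_⟩
      rintro t ⟨ht, e⟩
      rcases Finset.mem_union.1 ht with ht | ht
      · exact ((row_notMem hx ht hc).1 e).elim
      · obtain ⟨c', -, rfl⟩ := mem_corners.1 ht
        rw [row_corner_injective hsp e]
    · have : i ∈ I.diagram.rows := by
        simpa [diagram, mem_sing] using hi
      obtain ⟨t, ht, h⟩ := hx.2.1 i this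
      refine ⟨t, ⟨Finset.mem_union_left _ ht.1, ht.2⟩, ?_⟩
      rintro t' ⟨ht', e⟩
      rcases Finset.mem_union.1 ht' with ht' | ht'
      · exact h t' ⟨ht', e⟩
      · obtain ⟨c, hc, rfl⟩ := mem_corners.1 ht'
        exact (hi ⟨c, hc, e⟩).elim
  · by_cases hi : ∃ c, I.Singular c ∧ col c.corner = j
    · obtain ⟨c, hc, rfl⟩ := hi
      refine ⟨c.corner, ⟨Finset.mem_union_right _ (mem_corners.2 ⟨c, hc, rfl⟩), rfl⟩, ?_⟩
      rintro t ⟨ht, e⟩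
      rcases Finset.mem_union.1 ht with ht | ht
      · exact ((row_notMem hx ht hc).2 e).elim
      · obtain ⟨c', -, rfl⟩ := mem_corners.1 ht
        rw [col_corner_injective hsp hst e]
    · have : j ∈ I.diagram.cols := by
        simpa [diagram, mem_sing] using hi
      obtain ⟨t, ht, h⟩ := hx.2.2 j this
      refine ⟨t, ⟨Finset.mem_union_left _ ht.1, ht.2⟩, ?_⟩
      rintro t' ⟨ht', e⟩
      rcases Finset.mem_union.1 ht' with ht' | ht'
      · exact h t' ⟨ht', e⟩
      · obtain ⟨c, hc, rfl⟩ := mem_corners.1 ht'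
        exact (hi ⟨c, hc, e⟩).elim

theorem isState_sdiff {x : Finset (Torus p q N)} (hx : IsState Finset.univ Finset.univ x)
    (h : I.corners ⊆ x) : IsState I.diagram.rows I.diagram.cols (x \ I.corners) := by
  have hr : ∀ t ∈ x \ I.corners, ∀ c, I.Singular c → row c.corner ≠ row t := by
    intro t ht c hc e
    rw [Finset.mem_sdiff, mem_corners] at ht
    exact ht.2 ⟨c, hc, (hx.2.1 (row t) (Finset.mem_univ _)).unique
      ⟨h (mem_corners.2 ⟨c, hc, rfl⟩), e⟩ ⟨ht.1, rfl⟩⟩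
  have hco : ∀ t ∈ x \ I.corners, ∀ c, I.Singular c → col c.corner ≠ col t := by
    intro t ht c hc e
    rw [Finset.mem_sdiff, mem_corners] at ht
    exact ht.2 ⟨c, hc, (hx.2.2 (col t) (Finset.mem_univ _)).unique
      ⟨h (mem_corners.2 ⟨c, hc, rfl⟩), e⟩ ⟨ht.1, rfl⟩⟩
  refine ⟨fun t ht => ?_, fun i hi => ?_, fun j hj => ?_⟩
  · simp only [diagram, Finset.mem_sdiff, Finset.mem_univ, true_and, Finset.mem_image, mem_sing,
      not_exists, not_and]
    exact ⟨hr t ht, hco t ht⟩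
  · obtain ⟨t, ht, hu⟩ := hx.2.1 i (Finset.mem_univ _)
    refine ⟨t, ⟨Finset.mem_sdiff.2 ⟨ht.1, fun hc => ?_⟩, ht.2⟩, fun t' ht' =>
      hu t' ⟨(Finset.mem_sdiff.1 ht'.1).1, ht'.2⟩⟩
    obtain ⟨c, hs, rfl⟩ := mem_corners.1 hc
    simp only [diagram, Finset.mem_sdiff, Finset.mem_univ, true_and, Finset.mem_image, mem_sing,
      not_exists, not_and] at hi
    exact hi c hs ht.2
  · obtain ⟨t, ht, hu⟩ := hx.2.2 j (Finset.mem_univ _)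
    refine ⟨t, ⟨Finset.mem_sdiff.2 ⟨ht.1, fun hc => ?_⟩, ht.2⟩, fun t' ht' =>
      hu t' ⟨(Finset.mem_sdiff.1 ht'.1).1, ht'.2⟩⟩
    obtain ⟨c, hs, rfl⟩ := mem_corners.1 hc
    simp only [diagram, Finset.mem_sdiff, Finset.mem_univ, true_and, Finset.mem_image, mem_sing,
      not_exists, not_and] at hj
    exact hj c hs ht.2

open scoped Classical in
/-- A state of a complete resolution as a generator of the total complex; the labels of the
singularized crossings are the targets of the arrows with coefficient `u`. -/
def gen (I : g.Resolution) (y : I.diagram.State) : g.Dec :=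
  ⟨(⟨y.1 ∪ I.corners, isState_union hsp hst y.2⟩, fun c =>
    if I.Singular c then c.tgt else if c.corner ∈ y.1 ∪ I.corners then c.fin else away), fun c => by
    dsimp only
    split_ifs with h h'
    · simp only [c.tgt_ne_away, false_iff, not_not]
      exact Finset.mem_union_right _ (mem_corners.2 ⟨c, h, rfl⟩)
    · simp only [h', not_true, iff_false]
      unfold Crossing.fin; split_ifs <;> simp
    · simp only [h', not_false_iff]⟩

theorem gen_state (y : I.diagram.State) : (I.gen hsp hst y).1.1.1 = y.1 ∪ I.corners := rfl

theorem gen_sing (y : I.diagram.State) {c : g.Crossing} (hc : I.Singular c) :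
    (I.gen hsp hst y).1.2 c = c.tgt := if_pos hc

theorem gen_smooth (y : I.diagram.State) {c : g.Crossing} (hc : ¬ I.Singular c) :
    (I.gen hsp hst y).1.2 c = c.fin ∨ (I.gen hsp hst y).1.2 c = away := by
  classical
  dsimp only [gen]
  rw [if_neg hc]
  split_ifs
  exacts [Or.inl rfl, Or.inr rfl]

theorem bit_of_smooth {c : g.Crossing} (hc : ¬ I.Singular c) {l : Loc} (h : l = c.fin ∨ l = away) :
    c.bit l = I c := by
  unfold Singular at hc
  unfold Crossing.fin at h
  unfold Crossing.bit
  by_cases hp : c.Positive <;> simp only [hp, if_true, if_false] at h ⊢ <;> rcases h with rfl | rfl <;>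
    cases e : I c <;> simp_all

theorem bit_of_sing {c : g.Crossing} (hc : I.Singular c) : c.bit c.tgt = I c := by
  unfold Singular at hc
  unfold Crossing.bit Crossing.tgt
  by_cases hp : c.Positive <;> simp_all

theorem gen_res (y : I.diagram.State) : (I.gen hsp hst y).res = I := by
  funext c
  by_cases hc : I.Singular c
  · rw [Dec.res, gen_sing hsp hst y hc, bit_of_sing hc]
  · exact bit_of_smooth hc (gen_smooth hsp hst y hc)

theorem gen_isTgt (y : I.diagram.State) : Dec.IsTgt Finset.univ (I.gen hsp hst y) := by
  intro c _ hc
  rw [gen_res] at hc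
  exact gen_sing hsp hst y hc

theorem gen_injective : Function.Injective (I.gen hsp hst) := by
  intro y y' h
  have e : y.1 ∪ I.corners = y'.1 ∪ I.corners := congrArg (fun a : g.Dec => a.1.1.1) h
  have hd : ∀ z : I.diagram.State, (z.1 ∪ I.corners) \ I.corners = z.1 := fun z => by
    rw [Finset.union_sdiff_right, Finset.sdiff_eq_self_iff_disjoint, Finset.disjoint_left]
    intro t ht hc
    obtain ⟨c, hs, rfl⟩ := mem_corners.1 hc
    exact corner_notMem z.2 hs ht
  exact Subtype.ext (by rw [← hd y, e, hd])

theorem exists_gen {a : g.Dec} (ha : Dec.IsTgt Finset.univ a) : ∃ y, a.res.gen hsp hst y = a := by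
  classical
  have hc : a.res.corners ⊆ a.1.1.1 := by
    intro t ht
    obtain ⟨c, hc, rfl⟩ := mem_corners.1 ht
    by_contra h
    have := (a.2 c).2 h
    rw [ha c (Finset.mem_univ _) hc] at this
    exact c.tgt_ne_away this
  refine ⟨⟨_, isState_sdiff a.1.1.2 hc⟩, ?_⟩
  have e : (a.1.1.1 \ a.res.corners) ∪ a.res.corners = a.1.1.1 := Finset.sdiff_union_of_subset hc
  refine Dec.ext' (Subtype.ext e) fun c => ?_
  dsimp only [gen]
  rw [e]
  split_ifs with h h'
  · exact (ha c (Finset.mem_univ _) h).symm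
  · have h₁ : a.1.2 c ≠ away := fun h₁ => (a.2 c).1 h₁ h'
    rw [Dec.sing_iff, not_or] at h
    unfold Crossing.src Crossing.tgt at h
    unfold Crossing.fin
    generalize a.1.2 c = l at *
    by_cases hp : c.Positive <;> simp only [hp, if_true, if_false] at h ⊢ <;> cases l <;> simp_all
  · exact ((a.2 c).2 h').symm

end Resolution

end

end

end LinkGrid

theorem mem_ideal_smul_top_pi {R ι : Type} [CommRing R] [Finite ι] {J : Ideal R} {f : ι → R} :
    f ∈ (J • ⊤ : Submodule R (ι → R)) ↔ ∀ i, f i ∈ J := by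
  classical
  have := Fintype.ofFinite ι
  constructor
  · intro h i
    refine Submodule.smul_induction_on h (fun r hr f _ => J.mul_mem_right _ hr) fun f f' hf hf' =>
      add_mem hf hf'
  · intro h
    rw [← Finset.univ_sum_single f]
    refine sum_mem fun i _ => ?_
    have : Pi.single i (f i) = f i • (Pi.single i 1 : ι → R) := by
      rw [← Pi.single_smul, smul_eq_mul, mul_one]
    rw [this]
    exact Submodule.smul_mem_smul (h i) trivial

namespace LinkGrid

open Loc

section

variable {p : ℕ} {q : ℤ} {N : ℕ} [NeZero N] [NeZero p] {g : LinkGrid p q N}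

theorem Crossing.exists_row_of_mem_B {c : g.Crossing} {t : Torus p q N} (h : t ∈ c.B) :
    ∃ b, row t = row (c.mark b) := by
  simp only [Crossing.B, Finset.mem_insert, Finset.mem_singleton] at h
  rcases h with rfl | rfl
  · exact ⟨true, c.row_side.symm⟩
  · exact ⟨false, c.row_opposite⟩

section

variable (hsp : g.IsSpecial) (hst : ∀ c : g.Crossing, g.IsStandardAt c)

include hsp hst in
theorem eq_of_mem_B {c c' : g.Crossing} {t : Torus p q N} (h : t ∈ c.B) (h' : t ∈ c'.B) :
    c = c' := by
  obtain ⟨b, hb⟩ := c.exists_row_of_mem_B h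
  obtain ⟨b', hb'⟩ := c'.exists_row_of_mem_B h'
  have := mark_row_injective hsp hst (a₁ := (c, b)) (a₂ := (c', b')) (hb.symm.trans hb')
  exact (Prod.ext_iff.1 this).1

include hst in
theorem notMem_free_of_mem_B {c : g.Crossing} {t : Torus p q N} (h : t ∈ c.B) : t ∉ g.free := by
  obtain ⟨b, hb⟩ := c.exists_row_of_mem_B h
  rw [mem_free_iff]
  rintro (⟨hX, hA⟩ | hXX)
  · exact hA c (Crossing.mem_A.2 ⟨b, g.eq_of_row_X hX (mark_mem hst c b) hb⟩)
  · have h₁ : 0 < (g.XX.filter (row · = row t)).card :=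
      Finset.card_pos.2 ⟨t, Finset.mem_filter.2 ⟨hXX, rfl⟩⟩
    have h₂ : 0 < (g.X.filter (row · = row t)).card :=
      Finset.card_pos.2 ⟨_, Finset.mem_filter.2 ⟨mark_mem hst c b, hb.symm⟩⟩
    rcases g.row_cond (row t) with h | h <;> omega

include hsp hst in
theorem multAt_B (c : g.Crossing) (r : Rect p q N) :
    r.multAt c.B = r.mult c.1 + r.mult c.opposite := by
  refine Finset.sum_pair fun h => ?_
  have h' : row c.1 = row c.opposite := congrArg row h
  rw [← c.row_side, c.row_opposite] at h'
  have := mark_row_injective hsp hst (a₁ := (c, true)) (a₂ := (c, false)) h'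
  simp at this

theorem notMem_of_isFromTo {x y C : Finset (Torus p q N)} {r : Rect p q N}
    (hx : IsState Finset.univ Finset.univ x) (h : r.IsFromTo x y) (hCx : C ⊆ x) (hCy : C ⊆ y) :
    r.sw ∉ C ∧ r.ne ∉ C ∧ r.se ∉ C ∧ r.nw ∉ C := by
  obtain ⟨⟨hw, hh, emb⟩, hsw, hne, rfl⟩ := h
  have e₀ : r.sw = shift r.sw ((0 : ℕ) : ℤ) ((0 : ℕ) : ℤ) := (shift_zero _).symm
  have e₁ : r.se = shift r.sw (r.width : ℕ) ((0 : ℕ) : ℤ) := rfl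
  have e₂ : r.nw = shift r.sw ((0 : ℕ) : ℤ) (r.height : ℕ) := rfl
  have e₃ : r.ne = shift r.sw (r.width : ℕ) (r.height : ℕ) := rfl
  have n₁ : r.sw ≠ r.se := fun e => by
    have := emb 0 0 r.width 0 (by omega) (by omega) le_rfl (by omega) (by rw [← e₀, ← e₁]; exact e)
    omega
  have n₂ : r.sw ≠ r.nw := fun e => by
    have := emb 0 0 0 r.height (by omega) (by omega) (by omega) le_rfl (by rw [← e₀, ← e₂]; exact e)
    omega
  have n₃ : r.ne ≠ r.se := fun e => by
    have := emb r.width r.height r.width 0 le_rfl le_rfl le_rfl (by omega) (by rw [← e₁, ← e₃]; exact e)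
    omega
  have n₄ : r.ne ≠ r.nw := fun e => by
    have := emb r.width r.height 0 r.height le_rfl le_rfl (by omega) le_rfl (by rw [← e₂, ← e₃]; exact e)
    omega
  refine ⟨fun hc => ?_, fun hc => ?_, fun hc => ?_, fun hc => ?_⟩
  · have := hCy hc
    simp only [Finset.mem_union, Finset.mem_sdiff, Finset.mem_insert, Finset.mem_singleton] at this
    tauto
  · have := hCy hc
    simp only [Finset.mem_union, Finset.mem_sdiff, Finset.mem_insert, Finset.mem_singleton] at this
    tauto
  · exact n₁ ((hx.2.1 _ (Finset.mem_univ _)).unique ⟨hsw, rfl⟩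
      ⟨hCx hc, by rw [Rect.se, shift_row]; simp⟩)
  · exact n₂ ((hx.2.2 _ (Finset.mem_univ _)).unique ⟨hsw, rfl⟩
      ⟨hCx hc, by rw [Rect.nw, shift_col]; simp⟩)

namespace Resolution

variable {I : g.Resolution} (hpq : Int.gcd (p : ℤ) q = 1)

theorem disjoint_corners (x : I.diagram.State) {t : Torus p q N} (ht : t ∈ I.corners) : t ∉ x.1 := by
  obtain ⟨c, hc, rfl⟩ := mem_corners.1 ht
  exact corner_notMem x.2 hc

include hpq hsp hst in
/-- The `XX` of a singularized crossing prevents a rectangle from containing the crossing corner in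
its interior. -/
theorem isEmptyFromTo_union {x y : I.diagram.State} {r : Rect p q N} :
    r.IsEmptyFromTo (x.1 ∪ I.corners) (y.1 ∪ I.corners) ↔
      r.IsEmptyFromTo x.1 y.1 ∧ ∀ c, I.Singular c → r.mult c.1 = 0 := by
  constructor
  · intro h
    have hn := notMem_of_isFromTo (isState_union hsp hst x.2) h.1 (C := I.corners)
      Finset.subset_union_right Finset.subset_union_right
    obtain ⟨h₁, h₂, h₃, h₄⟩ := hn
    refine ⟨⟨⟨h.1.1, (Finset.mem_union.1 h.1.2.1).resolve_right h₁,
      (Finset.mem_union.1 h.1.2.2.1).resolve_right h₂, ?_⟩, fun t ht =>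
        h.2.1 t (Finset.mem_union_left _ ht), fun t ht => h.2.2 t (Finset.mem_union_left _ ht)⟩, ?_⟩
    · have e := h.1.2.2.2
      ext t
      have et := Finset.ext_iff.1 e t
      have hx := disjoint_corners x (t := t)
      have hy := disjoint_corners y (t := t)
      simp only [Finset.mem_union, Finset.mem_sdiff, Finset.mem_insert, Finset.mem_singleton] at et ⊢
      by_cases hC : t ∈ I.corners
      · have k₁ : t ≠ r.se := fun e => h₃ (e ▸ hC)
        have k₂ : t ≠ r.nw := fun e => h₄ (e ▸ hC)
        simp only [hx hC, hy hC, k₁, k₂, false_and, or_false]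
      · simp only [hC, or_false] at et
        exact et
    · intro c hc
      have hC : c.corner ∈ I.corners := mem_corners.2 ⟨c, hc, rfl⟩
      have key := fun a b : ℤ => Rect.IsEmptyFromTo.mult_stay hpq (a := a) (b := b) (x := ⟨_, isState_union hsp hst x.2⟩)
        (y := ⟨_, isState_union hsp hst y.2⟩) h (t := c.corner) (Finset.mem_union_right _ hC)
        (Finset.mem_union_right _ hC)
      by_cases hp : c.Positive
      · rw [Crossing.self_pos hp]; exact key _ _ (by omega) (by omega) (by omega) (by omega)
      · rw [Crossing.self_neg hp]; exact key _ _ (by omega) (by omega) (by omega) (by omega)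
  · rintro ⟨h, hc⟩
    have hint : ∀ t ∈ I.corners, t ∉ r.interior := by
      rintro t ht ⟨i, j, hi, hi', hj, hj', e⟩
      obtain ⟨c, hs, rfl⟩ := mem_corners.1 ht
      have := Rect.mult_eq_zero.1 (hc c hs)
      by_cases hp : c.Positive
      · exact this ⟨i, j, hi', hj', by rw [← e, Crossing.corner_pos hp]⟩
      · refine this ⟨i - 1, j, by omega, hj', ?_⟩
        rw [Crossing.self_neg hp, e, shift_shift, Nat.cast_sub (by omega), add_zero]
        rfl
    refine ⟨⟨h.1.1, Finset.mem_union_left _ h.1.2.1, Finset.mem_union_left _ h.1.2.2.1, ?_⟩,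
      fun t ht => ?_, fun t ht => ?_⟩
    · have e := h.1.2.2.2
      have n₁ : r.sw ∉ I.corners := fun hh => disjoint_corners x hh h.1.2.1
      have n₂ : r.ne ∉ I.corners := fun hh => disjoint_corners x hh h.1.2.2.1
      ext t
      have et := Finset.ext_iff.1 e t
      simp only [Finset.mem_union, Finset.mem_sdiff, Finset.mem_insert, Finset.mem_singleton] at et ⊢
      by_cases hC : t ∈ I.corners
      · have k₁ : t ≠ r.sw := fun e => n₁ (e ▸ hC)
        have k₂ : t ≠ r.ne := fun e => n₂ (e ▸ hC)
        simp only [hC, k₁, k₂, or_true, or_false, not_false_iff, true_and, true_or]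
      · simp only [hC, or_false]
        exact et
    · exact (Finset.mem_union.1 ht).elim (h.2.1 t) (hint t)
    · exact (Finset.mem_union.1 ht).elim (h.2.2 t) (hint t)

include hpq in
theorem lam_gen {x y : I.diagram.State} {r : Rect p q N}
    (h : r.IsEmptyFromTo (x.1 ∪ I.corners) (y.1 ∪ I.corners)) (c : g.Crossing) :
    Lam ((I.gen hsp hst x).1.2 c) ((I.gen hsp hst y).1.2 c) (c.n r.mult) ↔
      (¬ I.Singular c → ∀ t ∈ c.B, r.mult t = 0) := by
  by_cases hc : I.Singular c
  · rw [gen_sing hsp hst x hc, gen_sing hsp hst y hc]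
    have hC : c.corner ∈ I.corners := mem_corners.2 ⟨c, hc, rfl⟩
    have := (n_rect hpq (x := (I.gen hsp hst x).1.1) (y := (I.gen hsp hst y).1.1) h c).1
      (Finset.mem_union_right _ hC) (Finset.mem_union_right _ hC)
    simp [this, Lam, hc]
  · rw [lam_iff_B hpq (x := (I.gen hsp hst x).1.1) (y := (I.gen hsp hst y).1.1) h c
      ((I.gen hsp hst x).2 c) ((I.gen hsp hst y).2 c) (gen_smooth hsp hst x hc)
      (gen_smooth hsp hst y hc)]
    simp [hc]

theorem multAt_marks {r : Rect p q N} (T : Finset (Torus p q N)) :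
    r.multAt ((I.diagram.X ∪ I.diagram.XX) \ T) = 0 ↔
      (∀ t ∈ g.free, t ∉ T → r.mult t = 0) ∧
      (∀ c, ¬ I.Singular c → ∀ t ∈ c.B, t ∉ T → r.mult t = 0) ∧
      ∀ c, I.Singular c → c.1 ∉ T → r.mult c.1 = 0 := by
  rw [Rect.multAt_eq_zero]
  simp only [← Rect.mult_eq_zero, Finset.mem_sdiff, Finset.mem_union, diagram, Finset.mem_image,
    Finset.mem_biUnion, free, mem_smooth, mem_sing]
  constructor
  · intro h
    exact ⟨fun t ht hT => h t ⟨by tauto, hT⟩, fun c hc t ht hT => h t ⟨Or.inl (Or.inr ⟨c, hc, ht⟩), hT⟩,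
      fun c hc hT => h _ ⟨Or.inr (Or.inr ⟨c, hc, rfl⟩), hT⟩⟩
  · rintro ⟨h₁, h₂, h₃⟩ t ⟨(ht | ⟨c, hc, ht⟩) | (ht | ⟨c, hc, rfl⟩), hT⟩
    · exact h₁ t (Or.inl ht) hT
    · exact h₂ c hc t ht hT
    · exact h₁ t (Or.inr ht) hT
    · exact h₃ c hc hT

include hpq in
theorem rectOK_gen {x y : I.diagram.State} {r : Rect p q N} :
    RectOK (I.gen hsp hst x) (I.gen hsp hst y) r ↔
      r.IsEmptyFromTo x.1 y.1 ∧ r.multAt (I.diagram.X ∪ I.diagram.XX) = 0 := by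
  have hm := multAt_marks (I := I) (r := r) ∅
  rw [Finset.sdiff_empty] at hm
  simp only [Finset.notMem_empty, not_false_iff, true_imp_iff] at hm
  unfold RectOK
  rw [gen_state, gen_state, hm]
  constructor
  · rintro ⟨h, hf, hl⟩
    have h' := (isEmptyFromTo_union hsp hst hpq).1 h
    exact ⟨h'.1, hf, fun c hc => (lam_gen hsp hst hpq h c).1 (hl c) hc, h'.2⟩
  · rintro ⟨h, hf, hl, hc⟩
    have h' := (isEmptyFromTo_union hsp hst hpq).2 ⟨h, hc⟩
    exact ⟨h', hf, fun c => (lam_gen hsp hst hpq h' c).2 (hl c)⟩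

include hpq in
/-- The rectangles counted by the map `Φ_B` at `c`, between states of which exactly one contains the
crossing corner. -/
theorem rectOK_phiB {x y : I.diagram.State} {r : Rect p q N} {a b : g.Dec} {c : g.Crossing}
    (hc : ¬ I.Singular c) (ha : a.1.1 = (I.gen hsp hst x).1.1) (hb : b.1.1 = (I.gen hsp hst y).1.1)
    (ha' : ∀ d, d ≠ c → a.1.2 d = (I.gen hsp hst x).1.2 d)
    (hb' : ∀ d, d ≠ c → b.1.2 d = (I.gen hsp hst y).1.2 d)
    (hab : (c.Positive ∧ a.1.2 c = p₀ ∧ b.1.2 c = away) ∨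
      (¬ c.Positive ∧ a.1.2 c = away ∧ b.1.2 c = p₂)) :
    RectOK a b r ↔ r.IsEmptyFromTo x.1 y.1 ∧
      r.multAt c.B = 1 ∧ r.multAt ((I.diagram.X ∪ I.diagram.XX) \ c.B) = 0 := by
  have key : r.IsEmptyFromTo a.1.1.1 b.1.1.1 →
      r.multAt c.B = 1 ∧ Lam (a.1.2 c) (b.1.2 c) (c.n r.mult) := by
    intro h
    rw [multAt_B hsp hst]
    have hn := n_rect hpq h c
    rcases hab with ⟨hp, h₁, h₂⟩ | ⟨hp, h₁, h₂⟩
    · have hx : c.corner ∈ a.1.1.1 := by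
        by_contra hx; rw [(a.2 c).2 hx] at h₁; simp at h₁
      have hy := (b.2 c).1 h₂
      refine ⟨?_, Or.inr ⟨hn.2.1 hx hy, Or.inl ⟨h₁, h₂⟩⟩⟩
      have := (h.mult_leave hpq hx hy).1
      rwa [← Crossing.self_pos hp, ← Crossing.opposite_pos hp] at this
    · have hx := (a.2 c).1 h₁
      have hy : c.corner ∈ b.1.1.1 := by
        by_contra hy; rw [(b.2 c).2 hy] at h₂; simp at h₂
      refine ⟨?_, Or.inr ⟨hn.2.2 hx hy, Or.inr ⟨h₁, h₂⟩⟩⟩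
      have := (h.mult_arrive hpq hx hy).1
      rwa [← Crossing.self_neg hp, ← Crossing.opposite_neg hp] at this
  have hself : c.1 ∈ c.B := by simp [Crossing.B]
  rw [multAt_marks]
  unfold RectOK
  rw [ha, hb] at key ⊢
  rw [gen_state, gen_state] at key ⊢
  constructor
  · rintro ⟨h, hf, hl⟩
    have h' := (isEmptyFromTo_union hsp hst hpq).1 h
    refine ⟨h'.1, (key h).1, fun t ht _ => hf t ht, fun d hd t ht htc => ?_, fun d hd _ => h'.2 d hd⟩
    have hdc : d ≠ c := by rintro rfl; exact htc ht
    refine (lam_gen hsp hst hpq h d).1 ?_ hd t ht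
    rw [← ha' d hdc, ← hb' d hdc]
    exact hl d
  · rintro ⟨h, hB, hf, hl, hs⟩
    have h' := (isEmptyFromTo_union hsp hst hpq).2 ⟨h, fun d hd => hs d hd fun hm => by
      have : d.1 ∈ d.B := by simp [Crossing.B]
      rw [eq_of_mem_B hsp hst this hm] at hd
      exact hc hd⟩
    refine ⟨h', fun t ht => hf t ht fun hm => notMem_free_of_mem_B hst hm ht, fun d => ?_⟩
    by_cases hdc : d = c
    · subst hdc
      exact (key h').2
    · rw [ha' d hdc, hb' d hdc]
      exact (lam_gen hsp hst hpq h' d).2 fun hd t ht => hl d hd t ht fun hm =>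
        hdc (eq_of_mem_B hsp hst ht hm)

theorem rectCoeff_eq_count (𝕜 : Type) [CommRing 𝕜] (S : Signs p q N) {x y : I.diagram.State}
    {a b : g.Dec} {P : Rect p q N → Prop} (ha : a.1.1 = (I.gen hsp hst x).1.1)
    (hb : b.1.1 = (I.gen hsp hst y).1.1)
    (h : ∀ r, RectOK a b r ↔ r.IsEmptyFromTo x.1 y.1 ∧ P r) :
    rectCoeff 𝕜 S a b = a.par _ * Diagram.count 𝕜 (I.signs S) P x.1 y.1 := by
  classical
  unfold rectCoeff Diagram.count
  rw [Finset.sum_filter]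
  congr 1
  refine Finset.sum_congr rfl fun r _ => ?_
  rw [ha, hb]
  by_cases hr : RectOK a b r
  · rw [if_pos hr, if_pos ((h r).1 hr)]
    unfold sgn mono
    rw [map_intCast]
    rfl
  · rw [if_neg hr, if_neg (fun h' => hr ((h r).2 h'))]

end Resolution

end

end

open Loc Filtered

section

variable {p : ℕ} {q : ℤ} {N : ℕ} [NeZero N] [NeZero p] {g : LinkGrid p q N}

variable (hpq : Int.gcd (p : ℤ) q = 1) (hsp : g.IsSpecial) (hst : ∀ c : g.Crossing, g.IsStandardAt c)

variable {𝕜 : Type} [CommRing 𝕜] {S : Signs p q N}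

namespace Resolution

variable (I : g.Resolution)

open scoped Classical in
variable (𝕜) in
/-- The sign with which the differential of a complete resolution appears in the total complex:
a positive singularized crossing has the label `p₁`. -/
def par : MvPolynomial g.O 𝕜 :=
  ∏ c, if I.Singular c then sign _ c.tgt else 1

variable {I}

theorem gen_par (y : I.diagram.State) : (I.gen hsp hst y).par (MvPolynomial g.O 𝕜) = I.par 𝕜 := by
  refine Finset.prod_congr rfl fun c _ => ?_
  split_ifs with hc
  · rw [gen_sing hsp hst y hc]
  · rcases gen_smooth hsp hst y hc with h | h <;> rw [h]
    · unfold Crossing.fin; split_ifs <;> simp [sign]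
    · simp [sign]

variable (I) in
theorem par_mul_self : I.par 𝕜 * I.par 𝕜 = 1 := by
  unfold par
  rw [← Finset.prod_mul_distrib]
  refine Finset.prod_eq_one fun c _ => ?_
  split_ifs
  · exact sign_mul_self _ _
  · exact one_mul 1

theorem par_mul_mem {J : Ideal (MvPolynomial g.O 𝕜)} {x : MvPolynomial g.O 𝕜}
    (h : I.par 𝕜 * x ∈ J) : x ∈ J := by
  have := J.mul_mem_left (I.par 𝕜) h
  rwa [← mul_assoc, par_mul_self, one_mul] at this

theorem gen_tgt_iff (y : I.diagram.State) (c : g.Crossing) :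
    (I.gen hsp hst y).1.2 c = c.tgt ↔ I.Singular c := by
  refine ⟨fun h => ?_, gen_sing hsp hst y⟩
  have := (Dec.sing_iff (a := I.gen hsp hst y) (c := c)).2 (Or.inr h)
  rwa [gen_res] at this

theorem exists_gen_of_res {a : g.Dec} (ha : Dec.IsTgt Finset.univ a) (h : a.res = I) :
    ∃ y, I.gen hsp hst y = a := by
  subst h
  exact exists_gen hsp hst ha

/-- A rectangle inside a resolution that starts at a generator of the complete resolution ends at
one, and conversely. -/
theorem isTgt_iff_of_rectOK {s : Finset g.Crossing} {a b : g.Dec} {r : Rect p q N}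
    (h : RectOK a b r) (hab : a.res = b.res) : Dec.IsTgt s a ↔ Dec.IsTgt s b := by
  refine forall₂_congr fun c _ => ?_
  rw [← hab]
  exact forall_congr' fun hc => by rw [h.label_eq hab hc]

include hpq in
theorem boundary_apply (v : I.diagram.CFK 𝕜) (y : I.diagram.State) :
    I.boundary 𝕜 S v y =
      I.par 𝕜 * ∑ x, rectCoeff 𝕜 S (I.gen hsp hst x) (I.gen hsp hst y) * v x := by
  have e : ∀ x, rectCoeff 𝕜 S (I.gen hsp hst x) (I.gen hsp hst y) = I.par 𝕜 * Diagram.count 𝕜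
      (I.signs S) (fun r => r.multAt (I.diagram.X ∪ I.diagram.XX) = 0) x.1 y.1 := fun x => by
    rw [rectCoeff_eq_count hsp hst 𝕜 S (x := x) (y := y) rfl rfl fun r => rectOK_gen hsp hst hpq,
      gen_par]
  simp only [e, mul_assoc, ← Finset.mul_sum]
  rw [← mul_assoc, par_mul_self, one_mul]
  rfl

theorem sum_block_gen (f : g.Chains 𝕜) (y : I.diagram.State) [DecidableEq g.Resolution] :
    ∑ a : g.Dec, (if a.res = (I.gen hsp hst y).res then rectCoeff 𝕜 S a (I.gen hsp hst y) * f a else 0)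
      = ∑ x, rectCoeff 𝕜 S (I.gen hsp hst x) (I.gen hsp hst y) * f (I.gen hsp hst x) := by
  symm
  refine Fintype.sum_of_injective _ (gen_injective hsp hst) _ _ (fun a ha => ?_) fun x => ?_
  · split_ifs with h
    · rw [rectCoeff_eq_zero, zero_mul]
      intro r hr
      refine ha (exists_gen_of_res hsp hst ((isTgt_iff_of_rectOK hr h).2 (gen_isTgt hsp hst y)) ?_)
      rw [h, gen_res]
    · rfl
  · rw [if_pos (by rw [gen_res, gen_res])]

open scoped Classical in
include hpq in
theorem blockD_gen (f : g.Chains 𝕜) (y : I.diagram.State) :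
    blockD 𝕜 S f (I.gen hsp hst y) = I.par 𝕜 * I.boundary 𝕜 S (fun x => f (I.gen hsp hst x)) y +
      ∑ c, if I.Singular c then (I.gen hsp hst y).eta _ c * c.u 𝕜 *
        f ((I.gen hsp hst y).set c c.src) else 0 := by
  rw [blockD_apply, boundary_apply hpq hsp hst, ← mul_assoc, par_mul_self, one_mul]
  simp only [gen_tgt_iff]
  rw [sum_block_gen]

include hpq in
theorem blockD_gen_sub_mem (f : g.Chains 𝕜) (y : I.diagram.State) :
    blockD 𝕜 S f (I.gen hsp hst y) - I.par 𝕜 * I.boundary 𝕜 S (fun x => f (I.gen hsp hst x)) y ∈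
      I.ideal 𝕜 := by
  classical
  rw [blockD_gen hpq, add_sub_cancel_left]
  refine sum_mem fun c _ => ?_
  split_ifs with hc
  · exact Ideal.mul_mem_right _ _ (Ideal.mul_mem_left _ _ (Ideal.subset_span ⟨c, hc, rfl⟩))
  · exact zero_mem _

/-- Extension by zero of a chain of a complete resolution. -/
def ext (v : I.diagram.CFK 𝕜) : g.Chains 𝕜 :=
  Function.extend (I.gen hsp hst) v 0

theorem ext_gen (v : I.diagram.CFK 𝕜) (y : I.diagram.State) :
    ext hsp hst v (I.gen hsp hst y) = v y := (gen_injective hsp hst).extend_apply ..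

theorem ext_eq_zero (v : I.diagram.CFK 𝕜) {a : g.Dec} (h : ¬ (a.res = I ∧ Dec.IsTgt Finset.univ a)) :
    ext hsp hst v a = 0 := by
  refine Function.extend_apply' _ _ _ ?_
  rintro ⟨y, rfl⟩
  exact h ⟨gen_res hsp hst y, gen_isTgt hsp hst y⟩

theorem ext_set_src (v : I.diagram.CFK 𝕜) {a : g.Dec} {c : g.Crossing} (hc : a.1.2 c = c.tgt) :
    ext hsp hst v (a.set c c.src) = 0 := by
  refine ext_eq_zero hsp hst v fun h => ?_
  have e : (a.set c c.src).1.2 c = c.src := Dec.set_self (by rw [hc]; exact c.tgt_ne_away) c.src_ne_away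
  have := h.2 c (Finset.mem_univ _) (Dec.sing_iff.2 (Or.inl e))
  exact c.src_ne_tgt (e.symm.trans this)

include hpq in
/-- No arrow starts at a target, so only rectangles act on an extended chain. -/
theorem blockD_ext (v : I.diagram.CFK 𝕜) :
    blockD 𝕜 S (ext hsp hst v) = I.par 𝕜 • ext hsp hst (I.boundary 𝕜 S v) := by
  classical
  funext a
  rw [Pi.smul_apply, smul_eq_mul]
  by_cases ha : a.res = I ∧ Dec.IsTgt Finset.univ a
  · obtain ⟨y, rfl⟩ := exists_gen_of_res hsp hst ha.2 ha.1
    rw [blockD_gen hpq, ext_gen, Finset.sum_eq_zero, add_zero]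
    · simp only [ext_gen]
    · intro c _
      split_ifs with hc
      · rw [ext_set_src hsp hst v (gen_sing hsp hst y hc), mul_zero]
      · rfl
  · rw [ext_eq_zero hsp hst _ ha, mul_zero, blockD_apply, Finset.sum_eq_zero, zero_add,
      Finset.sum_eq_zero]
    · intro c _
      split_ifs with hc
      · rw [ext_set_src hsp hst v hc, mul_zero]
      · rfl
    · intro b _
      split_ifs with hb
      · by_cases hz : rectCoeff 𝕜 S b a = 0
        · rw [hz, zero_mul]
        · obtain ⟨r, hr⟩ := exists_rect_of_ne hz
          rw [ext_eq_zero hsp hst, mul_zero]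
          rw [hb, isTgt_iff_of_rectOK hr hb]
          exact ha
      · rfl

variable (hD : ∀ f : g.Chains 𝕜, totalD 𝕜 S (totalD 𝕜 S f) = 0)

include hpq hsp hst hD in
theorem boundary_sq (v : I.diagram.CFK 𝕜) : I.boundary 𝕜 S (I.boundary 𝕜 S v) = 0 := by
  funext y
  have := congrFun (blockD_sq hD (ext hsp hst v)) (I.gen hsp hst y)
  rw [blockD_ext hpq, map_smul, blockD_ext hpq, smul_smul, par_mul_self, one_smul, ext_gen] at this
  exact this

theorem mk_eq_zero {v : I.diagram.CFK 𝕜} : I.mk 𝕜 v = 0 ↔ ∀ y, v y ∈ I.ideal 𝕜 :=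
  (Submodule.Quotient.mk_eq_zero _).trans mem_ideal_smul_top_pi

theorem mk_eq_mk {v v' : I.diagram.CFK 𝕜} : I.mk 𝕜 v = I.mk 𝕜 v' ↔ ∀ y, v y - v' y ∈ I.ideal 𝕜 :=
  (Submodule.Quotient.eq _).trans mem_ideal_smul_top_pi

theorem dif_mk_eq_zero {v : I.diagram.CFK 𝕜} :
    I.dif 𝕜 S (I.mk 𝕜 v) = 0 ↔ ∀ y, I.boundary 𝕜 S v y ∈ I.ideal 𝕜 := mk_eq_zero

variable (hreg : g.IsRegular 𝕜)

include hD hreg in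
/-- A chain of a resolution that is a cycle modulo the ideal can be completed to a cycle. -/
theorem exists_cycle (s : Finset g.Crossing) {t : g.Chains 𝕜}
    (ht : ∀ a, a.res ≠ I → t a = 0)
    (h : ∀ a, a.res = I → Dec.IsTgt s a → blockD 𝕜 S t a ∈ I.idealOf 𝕜 s) :
    ∃ t' : g.Chains 𝕜, (∀ a, a.res ≠ I → t' a = 0) ∧ blockD 𝕜 S t' = 0 ∧
      ∀ a, a.res = I → Dec.IsTgt s a → t' a - t a ∈ I.idealOf 𝕜 s := by
  classical
  have h₀ : ∀ a, a.res ≠ I → blockD 𝕜 S t a = 0 := fun a ha => by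
    rw [blockD_congr (f' := 0), map_zero, Pi.zero_apply]
    exact fun b hb => ht b (hb ▸ ha)
  obtain ⟨w, hw, hw'⟩ := exists_blockD_eq hD hreg s (blockD 𝕜 S t) (blockD_sq hD t) fun a ha => by
    by_cases e : a.res = I
    · rw [e]; exact h a e ha
    · rw [h₀ a e]; exact zero_mem _
  let w' : g.Chains 𝕜 := fun a => if a.res = I then w a else 0
  refine ⟨t - w', fun a ha => ?_, ?_, fun a ha ha' => ?_⟩
  · rw [Pi.sub_apply, ht a ha, show w' a = 0 from if_neg ha, sub_zero]
  · funext a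
    rw [map_sub, Pi.sub_apply, Pi.zero_apply, sub_eq_zero]
    by_cases e : a.res = I
    · rw [← hw]
      exact blockD_congr fun b hb => (if_pos (hb.trans e)).symm
    · rw [h₀ a e, blockD_congr (f' := 0), map_zero, Pi.zero_apply]
      exact fun b hb => if_neg (hb ▸ e)
  · rw [Pi.sub_apply, sub_sub_cancel_left, show w' a = w a from if_pos ha]
    have := hw' a ha'
    rw [ha] at this
    exact neg_mem this

end Resolution

/-! ### The first page -/

variable (g 𝕜) in
/-- The filtration of the total complex by the cube degree. -/
def filt (s : ℤ) : Submodule (MvPolynomial g.O 𝕜) (g.Chains 𝕜) where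
  carrier := {f | ∀ a : g.Dec, (a.res.deg : ℤ) < s → f a = 0}
  zero_mem' _ _ := rfl
  add_mem' hf hf' a ha := by rw [Pi.add_apply, hf a ha, hf' a ha, add_zero]
  smul_mem' r f hf a ha := by rw [Pi.smul_apply, hf a ha, smul_zero]

theorem filt_antitone : Antitone (g.filt 𝕜) := fun _ _ h _ hf a ha => hf a (by omega)

theorem totalD_apply_of_mem {s : ℤ} {f : g.Chains 𝕜} (hf : f ∈ g.filt 𝕜 s)
    {b : g.Dec} (hb : (b.res.deg : ℤ) ≤ s) : totalD 𝕜 S f b = blockD 𝕜 S f b :=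
  totalD_eq_blockD fun a ha => hf a (by omega)

theorem totalD_mem {s : ℤ} {f : g.Chains 𝕜} (hf : f ∈ g.filt 𝕜 s) :
    totalD 𝕜 S f ∈ g.filt 𝕜 s := fun b hb => by
  rw [totalD_apply_of_mem hf hb.le, blockD_congr (f' := 0), map_zero, Pi.zero_apply]
  exact fun a ha => hf a (by rw [ha]; exact hb)

theorem mem_Z_of_res {I : g.Resolution} {f : g.Chains 𝕜}
    (hf : ∀ a, a.res ≠ I → f a = 0) (h : blockD 𝕜 S f = 0) {s : ℤ} (hs : (I.deg : ℤ) = s) :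
    f ∈ Z (totalD 𝕜 S) (g.filt 𝕜) 1 s := by
  have hf' : f ∈ g.filt 𝕜 s := fun a ha => hf a fun e => by rw [e] at ha; omega
  refine mem_Z.2 ⟨hf', fun b hb => ?_⟩
  rw [totalD_apply_of_mem hf' (by omega), h, Pi.zero_apply]

include hpq in
theorem dif_mk_gen {s : ℤ} {I : g.Resolution} (hI : (I.deg : ℤ) = s)
    (t : Z (totalD 𝕜 S) (g.filt 𝕜) 1 s) :
    I.dif 𝕜 S (I.mk 𝕜 fun y => t.1 (I.gen hsp hst y)) = 0 := by
  rw [Resolution.dif_mk_eq_zero]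
  intro y
  have h := Resolution.blockD_gen_sub_mem (𝕜 := 𝕜) (S := S) hpq hsp hst t.1 y
  have hb : ((I.gen hsp hst y).res.deg : ℤ) = s := by rw [Resolution.gen_res, hI]
  rw [← totalD_apply_of_mem t.2.1 hb.le, t.2.2 _ (by rw [hb]; omega), zero_sub, neg_mem_iff] at h
  exact Resolution.par_mul_mem h

/-- The component of the first page at a complete resolution. -/
def comp (s : ℤ) (I : g.Resolution) (hI : (I.deg : ℤ) = s) :
    Z (totalD 𝕜 S) (g.filt 𝕜) 1 s →ₗ[MvPolynomial g.O 𝕜] I.V 𝕜 S :=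
  Submodule.mkQ _ ∘ₗ LinearMap.codRestrict (LinearMap.ker (I.dif 𝕜 S))
    (Submodule.mkQ _ ∘ₗ LinearMap.funLeft _ _ (I.gen hsp hst) ∘ₗ Submodule.subtype _)
    (dif_mk_gen hpq hsp hst hI)

theorem comp_eq_cls {s : ℤ} {I : g.Resolution} (hI : (I.deg : ℤ) = s)
    (t : Z (totalD 𝕜 S) (g.filt 𝕜) 1 s) {v : I.diagram.CFK 𝕜}
    (h : ∀ y, t.1 (I.gen hsp hst y) - v y ∈ I.ideal 𝕜) :
    ∃ hv : I.dif 𝕜 S (I.mk 𝕜 v) = 0,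
      comp hpq hsp hst s I hI t = Homology.cls _ (I.mk 𝕜 v) hv := by
  have e : (I.mk 𝕜 fun y => t.1 (I.gen hsp hst y)) = I.mk 𝕜 v := Resolution.mk_eq_mk.2 h
  exact ⟨e ▸ dif_mk_gen hpq hsp hst hI t, congrArg Submodule.Quotient.mk (Subtype.ext e)⟩

theorem comp_eq_zero_iff {s : ℤ} {I : g.Resolution} (hI : (I.deg : ℤ) = s)
    (t : Z (totalD 𝕜 S) (g.filt 𝕜) 1 s) : comp hpq hsp hst s I hI t = 0 ↔
      ∃ w : I.diagram.CFK 𝕜, ∀ y, t.1 (I.gen hsp hst y) - I.boundary 𝕜 S w y ∈ I.ideal 𝕜 := by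
  refine (Submodule.Quotient.mk_eq_zero _).trans ?_
  constructor
  · rintro ⟨x, hx⟩
    obtain ⟨w, rfl⟩ := Submodule.Quotient.mk_surjective _ x
    exact ⟨w, Resolution.mk_eq_mk.1 hx.symm⟩
  · rintro ⟨w, hw⟩
    exact ⟨I.mk 𝕜 w, (Resolution.mk_eq_mk.2 hw).symm⟩

theorem comp_eq_zero {s : ℤ} {I : g.Resolution} (hI : (I.deg : ℤ) = s)
    (t : Z (totalD 𝕜 S) (g.filt 𝕜) 1 s) (h : ∀ a : g.Dec, a.res = I → t.1 a = 0) :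
    comp hpq hsp hst s I hI t = 0 := by
  rw [comp_eq_zero_iff]
  refine ⟨0, fun y => ?_⟩
  rw [h _ (Resolution.gen_res hsp hst y), map_zero, Pi.zero_apply, sub_zero]
  exact zero_mem _

variable (𝕜 S) in
/-- The projection to the summand `V(g_I)`. -/
def cubeProj (s : ℤ) (I : g.Resolution) (hI : (I.deg : ℤ) = s) :
    g.Cube 𝕜 S s →ₗ[MvPolynomial g.O 𝕜] I.V 𝕜 S :=
  DirectSum.component _ {I : g.Resolution // (I.deg : ℤ) = s} (fun I => I.1.V 𝕜 S) ⟨I, hI⟩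

theorem cubeProj_self {s : ℤ} {I : g.Resolution} (hI : (I.deg : ℤ) = s) (x : I.V 𝕜 S) :
    cubeProj 𝕜 S s I hI (g.cubeOf 𝕜 S s I hI x) = x := by
  classical
  exact DirectSum.component.lof_self _ _ _

theorem cubeProj_of_ne {s : ℤ} {I J : g.Resolution} (hI : (I.deg : ℤ) = s) (hJ : (J.deg : ℤ) = s)
    (h : J ≠ I) (x : J.V 𝕜 S) : cubeProj 𝕜 S s I hI (g.cubeOf 𝕜 S s J hJ x) = 0 := by
  classical
  unfold cubeProj cubeOf
  rw [DirectSum.component.of, dif_neg]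
  exact fun e => h (congrArg Subtype.val e)

theorem cube_ext {s : ℤ} {x x' : g.Cube 𝕜 S s}
    (h : ∀ I hI, cubeProj 𝕜 S s I hI x = cubeProj 𝕜 S s I hI x') : x = x' :=
  DirectSum.ext_component (MvPolynomial g.O 𝕜) fun I => h I.1 I.2

open scoped Classical in
/-- The class of a cycle of the associated graded complex. -/
def pageMap (s : ℤ) :
    Z (totalD 𝕜 S) (g.filt 𝕜) 1 s →ₗ[MvPolynomial g.O 𝕜] g.Cube 𝕜 S s :=
  ∑ I : {I : g.Resolution // (I.deg : ℤ) = s}, g.cubeOf 𝕜 S s I.1 I.2 ∘ₗ comp hpq hsp hst s I.1 I.2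

theorem cubeProj_pageMap {s : ℤ} {I : g.Resolution} (hI : (I.deg : ℤ) = s)
    (t : Z (totalD 𝕜 S) (g.filt 𝕜) 1 s) :
    cubeProj 𝕜 S s I hI (pageMap hpq hsp hst s t) = comp hpq hsp hst s I hI t := by
  classical
  unfold pageMap
  rw [LinearMap.sum_apply, map_sum, Finset.sum_eq_single ⟨I, hI⟩]
  · exact cubeProj_self hI _
  · exact fun J _ hJ => cubeProj_of_ne hI J.2 (fun e => hJ (Subtype.ext e)) _
  · exact fun h => (h (Finset.mem_univ _)).elim

theorem pageMap_of_res {s : ℤ} {I : g.Resolution} (hI : (I.deg : ℤ) = s)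
    (t : Z (totalD 𝕜 S) (g.filt 𝕜) 1 s) (h : ∀ a : g.Dec, a.res ≠ I → t.1 a = 0) :
    pageMap hpq hsp hst s t = g.cubeOf 𝕜 S s I hI (comp hpq hsp hst s I hI t) := by
  refine cube_ext fun J hJ => ?_
  rw [cubeProj_pageMap]
  by_cases e : J = I
  · subst e
    rw [cubeProj_self]
  · rw [cubeProj_of_ne hJ hI (Ne.symm e), comp_eq_zero]
    exact fun a ha => h a (ha ▸ e)

variable (hD : ∀ f : g.Chains 𝕜, totalD 𝕜 S (totalD 𝕜 S f) = 0)
  (hreg : g.IsRegular 𝕜)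

include hpq hsp hst hD hreg in
/-- Every cycle of the complex that defines `V(g_I)` lifts to a cycle of the graded piece. -/
theorem exists_cycle_of_dif {I : g.Resolution} {v : I.diagram.CFK 𝕜}
    (hv : I.dif 𝕜 S (I.mk 𝕜 v) = 0) :
    ∃ t : g.Chains 𝕜, (∀ a, a.res ≠ I → t a = 0) ∧ blockD 𝕜 S t = 0 ∧
      ∀ y, t (I.gen hsp hst y) - v y ∈ I.ideal 𝕜 := by
  rw [Resolution.dif_mk_eq_zero] at hv
  obtain ⟨t, h₁, h₂, h₃⟩ := Resolution.exists_cycle (I := I) hD hreg Finset.univ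
    (t := Resolution.ext hsp hst v)
    (fun a ha => Resolution.ext_eq_zero hsp hst v fun h => ha h.1) fun a ha ha' => by
      obtain ⟨y, rfl⟩ := Resolution.exists_gen_of_res hsp hst ha' ha
      rw [Resolution.blockD_ext hpq, Pi.smul_apply, Resolution.ext_gen, Resolution.idealOf_univ]
      exact Ideal.mul_mem_left _ _ (hv y)
  refine ⟨t, h₁, h₂, fun y => ?_⟩
  have := h₃ _ (Resolution.gen_res hsp hst y) (Resolution.gen_isTgt hsp hst y)
  rwa [Resolution.ext_gen, Resolution.idealOf_univ] at this

theorem exists_cls {I : g.Resolution} (x : I.V 𝕜 S) :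
    ∃ v, ∃ hv : I.dif 𝕜 S (I.mk 𝕜 v) = 0, x = Homology.cls _ (I.mk 𝕜 v) hv := by
  obtain ⟨⟨y, hy⟩, e⟩ := Submodule.Quotient.mk_surjective _ x
  obtain ⟨v, rfl⟩ := Submodule.Quotient.mk_surjective _ y
  exact ⟨v, LinearMap.mem_ker.1 hy, e.symm⟩

include hD hreg in
theorem exists_pageMap_eq {s : ℤ} {I : g.Resolution} (hI : (I.deg : ℤ) = s) (x : I.V 𝕜 S) :
    ∃ t, pageMap hpq hsp hst s t = g.cubeOf 𝕜 S s I hI x := by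
  obtain ⟨v, hv, e⟩ := exists_cls x
  obtain ⟨t, h₁, h₂, h₃⟩ := exists_cycle_of_dif hpq hsp hst hD hreg hv
  obtain ⟨hv', e'⟩ := comp_eq_cls hpq hsp hst hI ⟨t, mem_Z_of_res h₁ h₂ hI⟩ h₃
  exact ⟨⟨t, mem_Z_of_res h₁ h₂ hI⟩, (pageMap_of_res hpq hsp hst hI ⟨t, mem_Z_of_res h₁ h₂ hI⟩
    h₁).trans (congrArg _ (e'.trans e.symm))⟩

include hD hreg in
theorem pageMap_surjective (s : ℤ) :
    Function.Surjective (pageMap (𝕜 := 𝕜) (S := S) hpq hsp hst s) := by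
  classical
  intro x
  refine DirectSum.induction_on x ⟨0, map_zero _⟩ (fun I x => ?_) ?_
  · exact exists_pageMap_eq hpq hsp hst hD hreg I.2 x
  · rintro _ _ ⟨t, rfl⟩ ⟨t', rfl⟩
    exact ⟨t + t', map_add _ _ _⟩

include hD hreg in
/-- The kernel of `pageMap` consists of the elements that vanish on the first page: by regularity a
cycle with components in the ideal is a boundary. -/
theorem pageMap_eq_zero_iff (s : ℤ) (t : Z (totalD 𝕜 S) (g.filt 𝕜) 1 s) :
    pageMap hpq hsp hst s t = 0 ↔ t.1 ∈ B (totalD 𝕜 S) (g.filt 𝕜) 1 s := by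
  classical
  have e₀ : pageMap hpq hsp hst s t = 0 ↔ ∀ I hI, comp hpq hsp hst s I hI t = 0 := by
    constructor
    · intro h I hI
      rw [← cubeProj_pageMap hpq hsp hst hI, h, map_zero]
    · intro h
      refine cube_ext fun I hI => ?_
      rw [cubeProj_pageMap hpq hsp hst hI, h, map_zero]
  rw [e₀]
  constructor
  · intro h
    have h' : ∀ I : g.Resolution, ∃ w : I.diagram.CFK 𝕜, (I.deg : ℤ) = s →
        ∀ y, t.1 (I.gen hsp hst y) - I.boundary 𝕜 S w y ∈ I.ideal 𝕜 := fun I => by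
      by_cases hI : (I.deg : ℤ) = s
      · obtain ⟨w, hw⟩ := (comp_eq_zero_iff hpq hsp hst hI t).1 (h I hI)
        exact ⟨w, fun _ => hw⟩
      · exact ⟨0, fun h => (hI h).elim⟩
    choose w hw using h'
    let w₁ : g.Chains 𝕜 := fun a =>
      if (a.res.deg : ℤ) = s then a.res.par 𝕜 * Resolution.ext hsp hst (w a.res) a else 0
    let t₁ : g.Chains 𝕜 := fun a => if (a.res.deg : ℤ) = s then t.1 a else 0
    have ht₁ : blockD 𝕜 S t₁ = 0 := by
      funext b
      by_cases hb : (b.res.deg : ℤ) = s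
      · rw [blockD_congr (f := t₁) (f' := t.1) fun a ha => if_pos (by rw [ha, hb]),
          ← totalD_apply_of_mem t.2.1 hb.le, t.2.2 b (by omega), Pi.zero_apply]
      · rw [blockD_congr (f := t₁) (f' := 0) fun a ha => if_neg (by rwa [ha]), map_zero]
    have hw₁ : ∀ b : g.Dec, (b.res.deg : ℤ) = s →
        blockD 𝕜 S w₁ b = Resolution.ext hsp hst (b.res.boundary 𝕜 S (w b.res)) b := by
      intro b hb
      rw [blockD_congr (f' := b.res.par 𝕜 • Resolution.ext hsp hst (w b.res)), map_smul,
        Resolution.blockD_ext hpq, smul_smul, Resolution.par_mul_self, one_smul]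
      intro a ha
      dsimp only [w₁]
      rw [if_pos (by rw [ha, hb]), ha, Pi.smul_apply, smul_eq_mul]
    obtain ⟨v, hv, -⟩ := exists_blockD_eq hD hreg Finset.univ (t₁ - blockD 𝕜 S w₁)
      (by rw [map_sub, ht₁, blockD_sq hD, sub_zero]) fun a ha => by
        rw [Pi.sub_apply, Resolution.idealOf_univ]
        by_cases e : (a.res.deg : ℤ) = s
        · obtain ⟨y, hy⟩ := Resolution.exists_gen hsp hst ha
          have := hw _ e y
          rw [hw₁ a e, show t₁ a = t.1 a from if_pos e]
          generalize hI : a.res = I at *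
          subst hy
          rwa [Resolution.ext_gen]
        · rw [show t₁ a = 0 from if_neg e, blockD_congr (f := w₁) (f' := 0) fun b hb => if_neg (by rwa [hb]),
            map_zero, Pi.zero_apply, sub_zero]
          exact zero_mem _
    let v₁ : g.Chains 𝕜 := fun a => if (a.res.deg : ℤ) = s then v a else 0
    have hmem : w₁ + v₁ ∈ g.filt 𝕜 s := fun a ha => by
      rw [Pi.add_apply, show w₁ a = 0 from if_neg (by omega), show v₁ a = 0 from if_neg (by omega),
        add_zero]
    refine mem_B.2 ⟨t.1 - totalD 𝕜 S (w₁ + v₁), mem_Z.2 ⟨fun b hb => ?_, ?_⟩, w₁ + v₁,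
      mem_Z.2 ⟨?_, ?_⟩, sub_add_cancel _ _⟩
    · rw [Pi.sub_apply]
      rcases lt_or_eq_of_le (show (b.res.deg : ℤ) ≤ s by omega) with hlt | hb'
      · rw [t.2.1 b hlt, totalD_mem hmem b hlt, sub_zero]
      · have h₁ := congrFun hv b
        rw [Pi.sub_apply, show t₁ b = t.1 b from if_pos hb'] at h₁
        rw [totalD_apply_of_mem hmem hb'.le, map_add, Pi.add_apply,
          blockD_congr (f := v₁) (f' := v) fun a ha => if_pos (by rw [ha, hb']), h₁]
        ring
    · rw [map_sub, hD, sub_zero]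
      exact filt_antitone (by omega) t.2.2
    · rw [sub_add_cancel]; exact hmem
    · exact filt_antitone (by omega) (totalD_mem hmem)
  · intro h I hI
    obtain ⟨z, hz, y, hy, e⟩ := mem_B.1 h
    rw [comp_eq_zero_iff]
    have hy' : y ∈ g.filt 𝕜 s := by have := hy.1; rwa [sub_add_cancel] at this
    refine ⟨I.par 𝕜 • fun x => y (I.gen hsp hst x), fun x => ?_⟩
    have hdeg : ((I.gen hsp hst x).res.deg : ℤ) = s := by rw [Resolution.gen_res, hI]
    rw [← e, Pi.add_apply, hz.1 _ (by omega), zero_add, totalD_apply_of_mem hy' hdeg.le, map_smul]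
    exact Resolution.blockD_gen_sub_mem hpq hsp hst y x

open scoped Classical in
/-- The sign that the labels of a complete resolution at a set of crossings contribute to the
differential. -/
def Resolution.sgnOf (I : g.Resolution) (s : Finset g.Crossing) : ℤˣ :=
  ∏ c ∈ s, if I.Singular c ∧ c.Positive then -1 else 1

open scoped Classical in
theorem Resolution.sgnOf_cast (A : Type) [CommRing A] (I : g.Resolution) (s : Finset g.Crossing) :
    (((I.sgnOf s : ℤˣ) : ℤ) : A) = ∏ c ∈ s, if I.Singular c then sign A c.tgt else 1 := by
  unfold sgnOf
  rw [Units.coe_prod, Int.cast_prod]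
  refine Finset.prod_congr rfl fun c _ => ?_
  unfold Crossing.tgt
  by_cases h : I.Singular c <;> by_cases h' : c.Positive <;> simp [h, h', sign]

theorem Resolution.par_eq (I : g.Resolution) :
    I.par 𝕜 = (((I.sgnOf Finset.univ : ℤˣ) : ℤ) : MvPolynomial g.O 𝕜) := (I.sgnOf_cast _ _).symm

open scoped Classical in
/-- The crossings before `c` in the enumeration. -/
def Crossing.before (c : g.Crossing) : Finset g.Crossing :=
  Finset.univ.filter fun c' => Fintype.equivFin g.Crossing c' < Fintype.equivFin g.Crossing c

theorem Crossing.ne_of_mem_before {c d : g.Crossing} (h : d ∈ c.before) : d ≠ c := by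
  rintro rfl
  simp [before] at h

theorem Dec.eta_eq {A : Type} [CommRing A] {a : g.Dec} {c : g.Crossing} (I : g.Resolution)
    (h : ∀ d, d ≠ c → (I.Singular d → a.1.2 d = d.tgt) ∧
      (¬ I.Singular d → a.1.2 d = d.fin ∨ a.1.2 d = away)) :
    a.eta A c = (((I.sgnOf c.before : ℤˣ) : ℤ) : A) := by
  classical
  rw [Resolution.sgnOf_cast]
  refine Finset.prod_congr (by unfold Crossing.before; congr) fun d hd => ?_
  have hd' : d ≠ c := Crossing.ne_of_mem_before (by simpa [Crossing.before] using hd)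
  split_ifs with hs
  · rw [(h d hd').1 hs]
  · rcases (h d hd').2 hs with e | e <;> rw [e]
    · unfold Crossing.fin; split_ifs <;> simp [sign]
    · simp [sign]

theorem Resolution.gen_eta (A : Type) [CommRing A] {I : g.Resolution} (y : I.diagram.State)
    (c : g.Crossing) : (I.gen hsp hst y).eta A c = (((I.sgnOf c.before : ℤˣ) : ℤ) : A) :=
  Dec.eta_eq I fun _ _ => ⟨gen_sing hsp hst y, gen_smooth hsp hst y⟩

theorem units_cast_mul_self (A : Type) [CommRing A] (σ : ℤˣ) :
    ((σ : ℤ) : A) * ((σ : ℤ) : A) = 1 := by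
  rw [← Int.cast_mul, ← Units.val_mul, Int.units_mul_self]; simp

theorem comp_eq_smul_cls {s : ℤ} {I : g.Resolution} (hI : (I.deg : ℤ) = s) (σ : ℤˣ)
    (t : Z (totalD 𝕜 S) (g.filt 𝕜) 1 s) {v : I.diagram.CFK 𝕜}
    (h : ∀ y, t.1 (I.gen hsp hst y) - ((σ : ℤ) : MvPolynomial g.O 𝕜) * v y ∈ I.ideal 𝕜) :
    ∃ hv : I.dif 𝕜 S (I.mk 𝕜 v) = 0,
      (σ : ℤ) • comp hpq hsp hst s I hI t = Homology.cls _ (I.mk 𝕜 v) hv := by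
  obtain ⟨hv, e⟩ := comp_eq_cls hpq hsp hst hI ((σ : ℤ) • t) (v := v) fun y => by
    have := (I.ideal 𝕜).mul_mem_left ((σ : ℤ) : MvPolynomial g.O 𝕜) (h y)
    rw [mul_sub, ← mul_assoc, units_cast_mul_self, one_mul, ← zsmul_eq_mul] at this
    exact this
  exact ⟨hv, (map_zsmul _ _ _).symm.trans e⟩

/-! ### The differential of the first page -/

theorem totalD_eq_zero_of_label_le {f : g.Chains 𝕜} {b : g.Dec}
    (h : ∀ a : g.Dec, (∀ c, Le (a.1.2 c) (b.1.2 c)) → f a = 0) : totalD 𝕜 S f b = 0 := by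
  rw [totalD_apply, rectD_apply, Finset.sum_eq_zero, zero_add, Finset.sum_eq_zero]
  · intro c _
    have hset : ∀ {v}, b.1.2 c ≠ away → v ≠ away → Le v (b.1.2 c) → f (b.set c v) = 0 := by
      intro v hb hv hle
      refine h _ fun d => ?_
      by_cases hd : d = c
      · subst hd; rwa [Dec.set_self hb hv]
      · rw [Dec.set_of_ne hd]; exact Or.inl rfl
    rw [koszul_apply]
    split_ifs with h₁ h₂
    · rw [hset (by simp [h₁]) (by simp) (by simp [Le]), mul_zero]
    · rw [hset (by simp [h₂]) (by simp) (by simp [Le, h₂]), mul_zero]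
    · rfl
  · intro a _
    by_cases hz : rectCoeff 𝕜 S a b = 0
    · rw [hz, zero_mul]
    · obtain ⟨r, hr⟩ := exists_rect_of_ne hz
      rw [h a fun c => (hr.2.2 c).le, mul_zero]

theorem totalD_eq_zero_of_le {f : g.Chains 𝕜} {b : g.Dec}
    (h : ∀ a : g.Dec, (∀ c, a.res c ≤ b.res c) → f a = 0) : totalD 𝕜 S f b = 0 :=
  totalD_eq_zero_of_label_le fun a ha => h a fun c => c.bit_le (ha c)

theorem Resolution.flip_self (I : g.Resolution) (c : g.Crossing) : I.flip c c = true := by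
  simp [flip]

theorem Resolution.flip_of_ne (I : g.Resolution) {c d : g.Crossing} (h : d ≠ c) :
    I.flip c d = I d := by simp [flip, h]

theorem Resolution.eq_flip_of_le {I J : g.Resolution} (h : ∀ c, I c ≤ J c)
    (hd : J.deg = I.deg + 1) : ∃ c, I c = false ∧ J = I.flip c := by
  classical
  have hs : Finset.univ.filter (fun c => I c = true) ⊆ Finset.univ.filter fun c => J c = true := by
    intro c hc
    rw [Finset.mem_filter] at hc ⊢
    have := h c
    rw [hc.2] at this
    exact ⟨hc.1, Bool.eq_true_of_true_le this⟩
  have e := Finset.card_sdiff_add_card_eq_card hs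
  change _ + I.deg = J.deg at e
  rw [hd, add_comm, Nat.add_left_cancel_iff] at e
  obtain ⟨c, hc⟩ := Finset.card_eq_one.1 e
  have hc' : ∀ d : g.Crossing, (J d = true ∧ ¬ I d = true) ↔ d = c := fun d => by
    have := Finset.ext_iff.1 hc d
    simpa using this
  have hcc := (hc' c).2 rfl
  refine ⟨c, by simpa using hcc.2, funext fun d => ?_⟩
  by_cases hdc : d = c
  · subst hdc
    rw [hcc.1]
    exact (I.flip_self d).symm
  · have h₁ := mt (hc' d).1 hdc
    have h₂ := h d
    rw [I.flip_of_ne hdc]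
    revert h₁ h₂
    cases I d <;> cases J d <;> decide

theorem totalD_flip {I : g.Resolution} {c : g.Crossing} (hc : I c = false)
    {t : g.Chains 𝕜} (ht : ∀ a, a.res ≠ I → t a = 0) {b : g.Dec}
    (hb : b.res = I.flip c) :
    totalD 𝕜 S t b = ∑ a, rectCoeff 𝕜 S a b * t a + koszul 𝕜 c t b := by
  rw [totalD_apply, rectD_apply, Finset.sum_eq_single c]
  · intro d _ hd
    have : ∀ v, t (b.set d v) = 0 := fun v => ht _ fun e => by
      have h₁ : (b.set d v).res c = b.res c := by unfold Dec.res; rw [Dec.set_of_ne hd.symm]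
      rw [e, hb, hc] at h₁
      rw [I.flip_self] at h₁
      simp at h₁
    rw [koszul_apply, this, this]
    simp
  · exact fun h => (h (Finset.mem_univ _)).elim

namespace Resolution

theorem sum_gen {I : g.Resolution} (F : g.Chains 𝕜)
    (hF : ∀ a : g.Dec, ¬ (a.res = I ∧ Dec.IsTgt Finset.univ a) → F a = 0) :
    ∑ a, F a = ∑ x, F (I.gen hsp hst x) := by
  refine (Fintype.sum_of_injective _ (gen_injective hsp hst) _ _ (fun a ha => hF a fun h => ?_)
    fun x => rfl).symm
  exact ha (exists_gen_of_res hsp hst h.2 h.1)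

theorem set_src_injective {I : g.Resolution} {c : g.Crossing} (hc : I.Singular c) :
    Function.Injective fun x => (I.gen hsp hst x).set c c.src := by
  intro x x' h
  refine gen_injective hsp hst ?_
  have h' := congrArg (fun a : g.Dec => a.set c c.tgt) h
  dsimp only at h'
  have e : ∀ x, ((I.gen hsp hst x).set c c.src).set c c.tgt = I.gen hsp hst x := fun x => by
    rw [Dec.set_set (by rw [gen_sing hsp hst x hc]; exact c.tgt_ne_away) c.src_ne_away,
      if_neg c.tgt_ne_away, Dec.set_eq_self (gen_sing hsp hst x hc)]
  rwa [e, e] at h'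

open scoped Classical in
theorem exists_set_src {I : g.Resolution} {c : g.Crossing} {a : g.Dec}
    (ha : a.res = I) (hac : a.1.2 c = c.src) (h : Dec.IsTgt (Finset.univ.erase c) a) :
    ∃ x, (I.gen hsp hst x).set c c.src = a := by
  have h₁ : (a.set c c.tgt).1.2 c = c.tgt :=
    Dec.set_self (by rw [hac]; exact c.src_ne_away) c.tgt_ne_away
  have hr := Dec.res_set_tgt hac
  obtain ⟨x, hx⟩ := exists_gen_of_res hsp hst (I := I) (a := a.set c c.tgt) (fun d _ hd => by
    by_cases e : d = c
    · subst e; exact h₁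
    · rw [Dec.set_of_ne e]
      exact h d (Finset.mem_erase.2 ⟨e, Finset.mem_univ _⟩) (hr ▸ hd)) (hr.trans ha)
  refine ⟨x, ?_⟩
  rw [hx, Dec.set_set (by rw [hac]; exact c.src_ne_away) c.tgt_ne_away, if_neg c.src_ne_away,
    Dec.set_eq_self hac]

open scoped Classical in
theorem sum_set_src {I : g.Resolution} {c : g.Crossing} (hc : I.Singular c)
    (F : g.Chains 𝕜) (hF : ∀ a : g.Dec,
      ¬ (a.res = I ∧ a.1.2 c = c.src ∧ Dec.IsTgt (Finset.univ.erase c) a) → F a = 0) :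
    ∑ a, F a = ∑ x, F ((I.gen hsp hst x).set c c.src) := by
  refine (Fintype.sum_of_injective _ (set_src_injective hsp hst hc) _ _
    (fun a ha => hF a fun h => ?_) fun x => rfl).symm
  exact ha (exists_set_src hsp hst h.1 h.2.1 h.2.2)

/-- `L` singularizes the crossing `c`, `K` smooths it, and they agree at the other crossings. -/
structure Adjacent (K L : g.Resolution) (c : g.Crossing) : Prop where
  smooth : ¬ K.Singular c
  sing : L.Singular c
  eq : ∀ d, d ≠ c → L d = K d

namespace Adjacent

variable {K L : g.Resolution} {c : g.Crossing} (h : Adjacent K L c)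

include h

theorem iff {d : g.Crossing} (hd : d ≠ c) : L.Singular d ↔ K.Singular d := by
  unfold Singular; rw [h.eq d hd]

theorem ideal_le : K.ideal 𝕜 ≤ L.ideal 𝕜 :=
  Ideal.span_mono (Set.image_mono fun d (hd : K.Singular d) => by
    by_cases e : d = c
    · subst e; exact h.sing
    · exact (h.iff e).2 hd)

open scoped Classical in
theorem idealOf_erase : L.idealOf 𝕜 (Finset.univ.erase c) = K.ideal 𝕜 := by
  unfold idealOf ideal
  congr 2
  ext d
  simp only [Finset.mem_erase, Finset.mem_univ, and_true, Set.mem_ofPred_eq]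
  constructor
  · rintro ⟨e, hd⟩
    exact (h.iff e).1 hd
  · intro hd
    have e : d ≠ c := by rintro rfl; exact h.smooth hd
    exact ⟨e, (h.iff e).2 hd⟩

theorem corners_eq : L.corners = insert c.corner K.corners := by
  ext t
  rw [Finset.mem_insert, mem_corners, mem_corners]
  constructor
  · rintro ⟨d, hd, rfl⟩
    by_cases e : d = c
    · subst e; exact Or.inl rfl
    · exact Or.inr ⟨d, (h.iff e).1 hd, rfl⟩
  · rintro (rfl | ⟨d, hd, rfl⟩)
    · exact ⟨c, h.sing, rfl⟩
    · have e : d ≠ c := by rintro rfl; exact h.smooth hd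
      exact ⟨d, (h.iff e).2 hd, rfl⟩

include hsp in
theorem corner_notMem : c.corner ∉ K.corners := by
  rw [mem_corners]
  rintro ⟨d, hd, e⟩
  rw [row_corner_injective hsp (congrArg row e)] at hd
  exact h.smooth hd

include hsp hst in
theorem isState_insert (y : L.diagram.State) :
    IsState K.diagram.rows K.diagram.cols (insert c.corner y.1) := by
  have e : insert c.corner y.1 = (y.1 ∪ L.corners) \ K.corners := by
    rw [h.corners_eq]
    ext t
    simp only [Finset.mem_insert, Finset.mem_sdiff, Finset.mem_union]
    have h₁ := h.corner_notMem hsp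
    have h₂ : t ∈ K.corners → t ∉ y.1 := fun ht =>
      disjoint_corners y (h.corners_eq ▸ Finset.mem_insert_of_mem ht)
    constructor
    · rintro (rfl | ht)
      · exact ⟨Or.inr (Or.inl rfl), h₁⟩
      · exact ⟨Or.inl ht, fun hk => h₂ hk ht⟩
    · rintro ⟨ht | ht | ht, hk⟩
      · exact Or.inr ht
      · exact Or.inl ht
      · exact (hk ht).elim
  rw [e]
  refine isState_sdiff (isState_union hsp hst y.2) ?_
  rw [h.corners_eq]
  exact (Finset.subset_insert _ _).trans Finset.subset_union_right

/-- The state of the smoothing that corresponds to a state of the singularization. -/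
def ins (y : L.diagram.State) : K.diagram.State := ⟨insert c.corner y.1, h.isState_insert hsp hst y⟩

theorem corner_mem_ins (y : L.diagram.State) : c.corner ∈ (h.ins hsp hst y).1 :=
  Finset.mem_insert_self _ _

theorem gen_ins_state (y : L.diagram.State) :
    (L.gen hsp hst y).1.1 = (K.gen hsp hst (h.ins hsp hst y)).1.1 := by
  refine Subtype.ext ?_
  change y.1 ∪ L.corners = insert c.corner y.1 ∪ K.corners
  rw [h.corners_eq, Finset.union_insert, Finset.insert_union]

theorem label_eq {y : L.diagram.State} {x : K.diagram.State}
    (hs : (L.gen hsp hst y).1.1 = (K.gen hsp hst x).1.1) {d : g.Crossing}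
    (hd : d ≠ c) : (L.gen hsp hst y).1.2 d = (K.gen hsp hst x).1.2 d := by
  classical
  have hs' : y.1 ∪ L.corners = x.1 ∪ K.corners := congrArg Subtype.val hs
  dsimp only [gen]
  rw [hs', if_congr (h.iff hd) rfl rfl]

theorem label_fin {y : L.diagram.State} {x : K.diagram.State}
    (hs : (L.gen hsp hst y).1.1 = (K.gen hsp hst x).1.1) : (K.gen hsp hst x).1.2 c = c.fin := by
  refine (gen_smooth hsp hst x h.smooth).resolve_right fun e => ?_
  have h₁ := ((K.gen hsp hst x).2 c).1 e
  rw [← hs] at h₁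
  exact h₁ (Finset.mem_union_right _ (mem_corners.2 ⟨c, h.sing, rfl⟩))

theorem gen_ins_set (y : L.diagram.State) :
    (K.gen hsp hst (h.ins hsp hst y)).set c c.tgt = L.gen hsp hst y := by
  have hs := h.gen_ins_state hsp hst y
  refine Dec.ext' ((Dec.set_state _ _ _).trans hs.symm) fun d => ?_
  by_cases hd : d = c
  · subst hd
    rw [gen_sing hsp hst y h.sing, Dec.set_self _ d.tgt_ne_away]
    rw [h.label_fin hsp hst hs]
    unfold Crossing.fin; split_ifs <;> simp
  · rw [Dec.set_of_ne hd, h.label_eq hsp hst hs hd]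

theorem exists_ins {x : K.diagram.State} (hx : c.corner ∈ x.1) : ∃ y, h.ins hsp hst y = x := by
  have e : insert c.corner (x.1 \ {c.corner}) = x.1 := by
    rw [Finset.sdiff_singleton_eq_erase, Finset.insert_erase hx]
  have hk : c.corner ∉ K.corners := h.corner_notMem hsp
  have e' : (x.1 ∪ K.corners) \ L.corners = x.1 \ {c.corner} := by
    rw [h.corners_eq]
    ext t
    have := disjoint_corners x (t := t)
    simp only [Finset.mem_sdiff, Finset.mem_union, Finset.mem_insert, Finset.mem_singleton]
    constructor
    · rintro ⟨ht | ht, hn⟩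
      · exact ⟨ht, fun e => hn (Or.inl e)⟩
      · exact (hn (Or.inr ht)).elim
    · rintro ⟨ht, hn⟩
      exact ⟨Or.inl ht, fun e => e.elim hn fun e => this e ht⟩
  refine ⟨⟨x.1 \ {c.corner}, ?_⟩, Subtype.ext e⟩
  rw [← e']
  refine isState_sdiff (isState_union hsp hst x.2) ?_
  rw [h.corners_eq]
  exact Finset.insert_subset (Finset.mem_union_left _ hx) Finset.subset_union_right

end Adjacent

theorem adjacent_of_neg {I : g.Resolution} {c : g.Crossing} (hc : ¬ c.Positive) (hI : I c = false) :
    Adjacent I (I.flip c) c where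
  smooth h := h.elim (fun h => hc h.1) fun h => by simp [hI] at h
  sing := Or.inr ⟨hc, I.flip_self c⟩
  eq d hd := I.flip_of_ne hd

theorem adjacent_of_pos {I : g.Resolution} {c : g.Crossing} (hc : c.Positive) (hI : I c = false) :
    Adjacent (I.flip c) I c where
  smooth h := h.elim (fun h => by
    simp [I.flip_self] at h) fun h => h.1 hc
  sing := Or.inl ⟨hc, hI⟩
  eq d hd := (I.flip_of_ne hd).symm

open scoped Classical in
theorem phiB_apply (I : g.Resolution) (c : g.Crossing) (v : I.diagram.CFK 𝕜) (y : I.diagram.State) :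
    I.phiB 𝕜 S c v y = ∑ x, (if (c.corner ∈ x.1 ∧ c.corner ∉ y.1) ∨ (c.corner ∉ x.1 ∧ c.corner ∈ y.1)
      then Diagram.count 𝕜 (I.signs S) (fun r => r.multAt c.B = 1 ∧
        r.multAt ((I.diagram.X ∪ I.diagram.XX) \ c.B) = 0) x.1 y.1 else 0) * v x := rfl

namespace Adjacent

variable {K L : g.Resolution} {c : g.Crossing} (h : Adjacent K L c)

include h

theorem ins_injective : Function.Injective (h.ins hsp hst) := fun y y' e => gen_injective hsp hst (by
  rw [← h.gen_ins_set hsp hst y, ← h.gen_ins_set hsp hst y', e])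

theorem removeCorner_apply (v : K.diagram.CFK 𝕜) (y : L.diagram.State) :
    K.removeCorner 𝕜 L c v y = v (h.ins hsp hst y) := by
  change ∑ x : K.diagram.State, (if x.1 = insert c.corner y.1 then 1 else 0) * v x = _
  rw [Finset.sum_eq_single (h.ins hsp hst y)]
  · have e : (h.ins hsp hst y).1 = insert c.corner y.1 := rfl
    rw [if_pos e, one_mul]
  · intro x _ hx
    have e : ¬ x.1 = insert c.corner y.1 := fun e => hx (Subtype.ext e)
    rw [if_neg e, zero_mul]
  · exact fun h => (h (Finset.mem_univ _)).elim

theorem addCorner_ins (v : L.diagram.CFK 𝕜) (y : L.diagram.State) :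
    L.addCorner 𝕜 K c v (h.ins hsp hst y) = v y := by
  change ∑ x : L.diagram.State, (if (h.ins hsp hst y).1 = insert c.corner x.1 then 1 else 0) * v x = _
  rw [Finset.sum_eq_single y]
  · have e : (h.ins hsp hst y).1 = insert c.corner y.1 := rfl
    rw [if_pos e, one_mul]
  · intro x _ hx
    have e : ¬ (h.ins hsp hst y).1 = insert c.corner x.1 := fun e =>
      hx (h.ins_injective hsp hst (Subtype.ext e)).symm
    rw [if_neg e, zero_mul]
  · exact fun h => (h (Finset.mem_univ _)).elim

omit h in
theorem addCorner_of_notMem (v : L.diagram.CFK 𝕜) {y : K.diagram.State} (hy : c.corner ∉ y.1) :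
    L.addCorner 𝕜 K c v y = 0 := by
  change ∑ x : L.diagram.State, (if y.1 = insert c.corner x.1 then 1 else 0) * v x = _
  refine Finset.sum_eq_zero fun x _ => ?_
  rw [if_neg, zero_mul]
  intro e
  exact hy (e ▸ Finset.mem_insert_self _ _)

end Adjacent

variable {I : g.Resolution} {c : g.Crossing}

theorem tgt_of_lam {d : g.Crossing} {l : Loc} {n : ℕ} (h : Lam l d.tgt n)
    (h' : l = d.src ∨ l = d.tgt) : l = d.tgt := by
  refine h'.resolve_left fun e => ?_
  subst e
  unfold Crossing.src Crossing.tgt at h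
  split_ifs at h <;> simp [Lam] at h

include hpq in
/-- The component of the differential at a negative crossing is the zip map, up to a sign. -/
theorem zip_component (hI : I c = false) (hc : ¬ c.Positive) {t : g.Chains 𝕜}
    (ht : ∀ a, a.res ≠ I → t a = 0) {v : I.diagram.CFK 𝕜}
    (hv : ∀ y, t (I.gen hsp hst y) - v y ∈ I.ideal 𝕜) (y : (I.flip c).diagram.State) :
    totalD 𝕜 S t ((I.flip c).gen hsp hst y) - ((I.sgnOf Finset.univ : ℤ) : MvPolynomial g.O 𝕜) *
      I.removeCorner 𝕜 (I.flip c) c (I.phiB 𝕜 S c v) y ∈ (I.flip c).ideal 𝕜 := by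
  classical
  have h := adjacent_of_neg hc hI
  have hlab : ((I.flip c).gen hsp hst y).1.2 c = p₂ := by
    rw [gen_sing hsp hst y h.sing, Crossing.tgt, if_neg hc]
  have hfin : c.fin = p₀ := if_neg hc
  have hk : koszul 𝕜 c t ((I.flip c).gen hsp hst y) = 0 := by
    rw [koszul_apply, if_neg (by rw [hlab]; simp), if_pos hlab, ht, mul_zero]
    intro e
    have := congrFun e c
    rw [Dec.res, Dec.set_self (by rw [hlab]; simp) (by simp), hI] at this
    simp [Crossing.bit, hc] at this
  have hlabel : ∀ a : g.Dec, a.res = I → ∀ r, RectOK a ((I.flip c).gen hsp hst y) r →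
      Dec.IsTgt Finset.univ a ∧ a.1.2 c = away := by
    intro a ha r hr
    refine ⟨fun d _ hd => ?_, ?_⟩
    · rw [ha] at hd
      have hdc : d ≠ c := by rintro rfl; exact h.smooth hd
      have h₁ := hr.2.2 d
      rw [gen_sing hsp hst y ((h.iff hdc).2 hd)] at h₁
      exact tgt_of_lam h₁ (Dec.sing_iff.1 (ha ▸ hd))
    · have h₁ := hr.2.2 c
      rw [hlab] at h₁
      have h₂ := congrFun ha c
      rw [hI] at h₂
      unfold Dec.res at h₂
      generalize a.1.2 c = l at *
      cases l <;> simp_all [Lam, Crossing.bit]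
  rw [totalD_flip hI ht (gen_res hsp hst y), hk, add_zero, sum_gen hsp hst (I := I),
    h.removeCorner_apply hsp hst, phiB_apply, Finset.mul_sum, ← Finset.sum_sub_distrib]
  · refine sum_mem fun x _ => ?_
    have hs := h.gen_ins_state hsp hst y
    by_cases hx : c.corner ∈ x.1
    · rw [if_neg (by simp [hx, h.corner_mem_ins hsp hst y]), zero_mul, mul_zero, sub_zero,
        rectCoeff_eq_zero, zero_mul]
      · exact zero_mem _
      · intro r hr
        exact ((I.gen hsp hst x).2 c).1 (hlabel _ (gen_res hsp hst x) r hr).2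
          (Finset.mem_union_left _ hx)
    · have hx' : (I.gen hsp hst x).1.2 c = away := ((I.gen hsp hst x).2 c).2 fun hm =>
        (Finset.mem_union.1 hm).elim hx (h.corner_notMem hsp)
      rw [if_pos (Or.inr ⟨hx, h.corner_mem_ins hsp hst y⟩), ← par_eq,
        rectCoeff_eq_count hsp hst 𝕜 S (x := x) (y := h.ins hsp hst y) rfl hs
          (fun r => rectOK_phiB hsp hst hpq h.smooth rfl hs (fun _ _ => rfl)
            (fun d hd => h.label_eq hsp hst hs hd) (Or.inr ⟨hc, hx', hlab⟩)), gen_par, mul_assoc,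
        ← mul_sub, ← mul_sub]
      exact Ideal.mul_mem_left _ _ (Ideal.mul_mem_left _ _ (h.ideal_le (hv x)))
  · intro a ha
    by_cases e : a.res = I
    · rw [rectCoeff_eq_zero, zero_mul]
      exact fun r hr => ha ⟨e, (hlabel a e r hr).1⟩
    · rw [ht a e, mul_zero]

include hpq in
/-- The component of the differential at a positive crossing is the unzip map, up to a sign: the
targets of the arrow with coefficient `u` move along the arrow with coefficient `1`, the sources
along rectangles. -/
theorem unzip_component (hI : I c = false) (hc : c.Positive) {t : g.Chains 𝕜}
    (ht : ∀ a, a.res ≠ I → t a = 0) {w z : I.diagram.CFK 𝕜}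
    (hw : ∀ y, t (I.gen hsp hst y) - w y ∈ (I.flip c).ideal 𝕜)
    (hz : ∀ y, t ((I.gen hsp hst y).set c c.src) +
      I.par 𝕜 * ((I.sgnOf c.before : ℤ) : MvPolynomial g.O 𝕜) * z y ∈ (I.flip c).ideal 𝕜)
    (y : (I.flip c).diagram.State) :
    totalD 𝕜 S t ((I.flip c).gen hsp hst y) - ((I.sgnOf c.before : ℤ) : MvPolynomial g.O 𝕜) *
      (I.addCorner 𝕜 (I.flip c) c w +
        (I.flip c).phiB 𝕜 S c (I.addCorner 𝕜 (I.flip c) c z)) y ∈ (I.flip c).ideal 𝕜 := by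
  classical
  have h := adjacent_of_pos hc hI
  have hfin : c.fin = p₂ := if_pos hc
  have hsrc : c.src = p₀ := if_pos hc
  have htgt : c.tgt = p₁ := if_pos hc
  have hlabel : ∀ a : g.Dec, a.res = I → ∀ r, RectOK a ((I.flip c).gen hsp hst y) r →
      Dec.IsTgt (Finset.univ.erase c) a ∧ a.1.2 c = c.src ∧ c.corner ∉ y.1 := by
    intro a ha r hr
    have h₁ := hr.2.2 c
    have h₂ := Dec.sing_iff.1 (ha.symm ▸ h.sing)
    have h₃ := gen_smooth hsp hst y h.smooth
    have key : a.1.2 c = c.src ∧ ((I.flip c).gen hsp hst y).1.2 c = away := by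
      rw [hsrc, htgt] at h₂
      rw [hfin] at h₃
      rw [hsrc]
      generalize a.1.2 c = l at *
      generalize ((I.flip c).gen hsp hst y).1.2 c = l' at *
      rcases h₂ with rfl | rfl <;> rcases h₃ with rfl | rfl <;> simp_all [Lam]
    refine ⟨fun d hd hds => ?_, key.1, fun hm => ?_⟩
    · rw [ha] at hds
      have hdc := Finset.ne_of_mem_erase hd
      have h₁ := hr.2.2 d
      rw [gen_sing hsp hst y ((h.iff hdc).1 hds)] at h₁
      exact tgt_of_lam h₁ (Dec.sing_iff.1 (ha ▸ hds))
    · exact (((I.flip c).gen hsp hst y).2 c).1 key.2 (Finset.mem_union_left _ hm)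
  -- the states that do not contain the crossing corner receive rectangles, the others the arrow
  rw [totalD_flip hI ht (gen_res hsp hst y), Pi.add_apply]
  by_cases hy : c.corner ∈ y.1
  · obtain ⟨x, rfl⟩ := h.exists_ins hsp hst hy
    have hlab : ((I.flip c).gen hsp hst (h.ins hsp hst x)).1.2 c = p₂ := by
      rw [h.label_fin hsp hst (h.gen_ins_state hsp hst x), hfin]
    rw [Finset.sum_eq_zero, zero_add, koszul_apply, if_neg (by rw [hlab]; simp), if_pos hlab,
      h.addCorner_ins hsp hst, phiB_apply, Finset.sum_eq_zero, add_zero, kB, if_pos hc, mul_one, ← htgt,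
      h.gen_ins_set hsp hst, Dec.eta_eq I, ← mul_sub]
    · exact Ideal.mul_mem_left _ _ (hw x)
    · exact fun d hd => ⟨fun hs => gen_sing hsp hst _ ((h.iff hd).1 hs),
        fun hs => gen_smooth hsp hst _ fun hk => hs ((h.iff hd).2 hk)⟩
    · intro X _
      by_cases hX : c.corner ∈ X.1
      · rw [if_neg (by simp [hX, hy]), zero_mul]
      · rw [Adjacent.addCorner_of_notMem z hX, mul_zero]
    · intro a _
      by_cases e : a.res = I
      · rw [rectCoeff_eq_zero, zero_mul]
        exact fun r hr => (hlabel a e r hr).2.2 hy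
      · rw [ht a e, mul_zero]
  · have hlab : ((I.flip c).gen hsp hst y).1.2 c = away :=
      (((I.flip c).gen hsp hst y).2 c).2 fun hm =>
        (Finset.mem_union.1 hm).elim hy (h.corner_notMem hsp)
    have hB : (I.flip c).phiB 𝕜 S c (I.addCorner 𝕜 (I.flip c) c z) y =
        ∑ x, Diagram.count 𝕜 ((I.flip c).signs S) (fun r => r.multAt c.B = 1 ∧
          r.multAt (((I.flip c).diagram.X ∪ (I.flip c).diagram.XX) \ c.B) = 0)
          (h.ins hsp hst x).1 y.1 * z x := by
      rw [phiB_apply]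
      symm
      refine Fintype.sum_of_injective _ (h.ins_injective hsp hst) _ _ (fun X hX => ?_) fun x => ?_
      · rw [Adjacent.addCorner_of_notMem z fun hm => hX (h.exists_ins hsp hst hm), mul_zero]
      · rw [if_pos (Or.inl ⟨h.corner_mem_ins hsp hst x, hy⟩), h.addCorner_ins hsp hst]
    rw [koszul_apply, if_neg (by rw [hlab]; simp), if_neg (by rw [hlab]; simp), add_zero,
      Adjacent.addCorner_of_notMem w hy, zero_add, hB, sum_set_src hsp hst h.sing, Finset.mul_sum,
      ← Finset.sum_sub_distrib]
    · refine sum_mem fun x _ => ?_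
      have hs := h.gen_ins_state hsp hst x
      have ht' : (I.gen hsp hst x).1.2 c = p₁ := by rw [gen_sing hsp hst x h.sing, htgt]
      rw [rectCoeff_eq_count hsp hst 𝕜 S (x := h.ins hsp hst x) (y := y)
        ((Dec.set_state _ _ _).trans hs) rfl (fun r => rectOK_phiB hsp hst hpq h.smooth
          ((Dec.set_state _ _ _).trans hs) rfl (fun d hd => by
            rw [Dec.set_of_ne hd, h.label_eq hsp hst hs hd]) (fun _ _ => rfl) (Or.inl ⟨hc, by
              rw [Dec.set_self (by rw [ht']; simp) c.src_ne_away, hsrc], hlab⟩)),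
        Dec.par_set (by rw [ht', hsrc]; simp [sign]) (by rw [ht']; simp) c.src_ne_away, gen_par]
      have hm := Ideal.mul_mem_left _ (-(I.par 𝕜) * Diagram.count 𝕜 ((I.flip c).signs S)
        (fun r => r.multAt c.B = 1 ∧
          r.multAt (((I.flip c).diagram.X ∪ (I.flip c).diagram.XX) \ c.B) = 0)
          (h.ins hsp hst x).1 y.1) (hz x)
      convert hm using 1
      linear_combination ((Diagram.count 𝕜 ((I.flip c).signs S)
        (fun r => r.multAt c.B = 1 ∧
          r.multAt (((I.flip c).diagram.X ∪ (I.flip c).diagram.XX) \ c.B) = 0)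
          (h.ins hsp hst x).1 y.1) * ((I.sgnOf c.before : ℤ) : MvPolynomial g.O 𝕜) * z x) *
          I.par_mul_self (𝕜 := 𝕜)
    · intro a ha
      by_cases e : a.res = I
      · rw [rectCoeff_eq_zero, zero_mul]
        exact fun r hr => ha ⟨e, (hlabel a e r hr).2.1, (hlabel a e r hr).1⟩
      · rw [ht a e, mul_zero]

variable {I : g.Resolution} {c : g.Crossing}

include hpq hsp hst in
theorem boundary_mem {J : Ideal (MvPolynomial g.O 𝕜)} {v : I.diagram.CFK 𝕜} (hv : ∀ y, v y ∈ J)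
    (y : I.diagram.State) : I.boundary 𝕜 S v y ∈ J := by
  rw [boundary_apply hpq hsp hst]
  exact J.mul_mem_left _ (sum_mem fun x _ => J.mul_mem_left _ (hv x))

open scoped Classical in
/-- The chain that consists of the generators of a complete resolution with the label of the
crossing `c` moved to the source. -/
def extSrc (c : g.Crossing) (v : I.diagram.CFK 𝕜) : g.Chains 𝕜 :=
  fun a => if a.1.2 c = c.src then ext hsp hst v (a.set c c.tgt) else 0

theorem set_src_set_tgt (hc : I.Singular c) (x : I.diagram.State) :
    ((I.gen hsp hst x).set c c.src).set c c.tgt = I.gen hsp hst x := by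
  rw [Dec.set_set (by rw [gen_sing hsp hst x hc]; exact c.tgt_ne_away) c.src_ne_away,
    if_neg c.tgt_ne_away, Dec.set_eq_self (gen_sing hsp hst x hc)]

theorem set_src_label (hc : I.Singular c) (x : I.diagram.State) :
    ((I.gen hsp hst x).set c c.src).1.2 c = c.src :=
  Dec.set_self (by rw [gen_sing hsp hst x hc]; exact c.tgt_ne_away) c.src_ne_away

theorem extSrc_set_src (hc : I.Singular c) (v : I.diagram.CFK 𝕜) (x : I.diagram.State) :
    extSrc hsp hst c v ((I.gen hsp hst x).set c c.src) = v x := by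
  unfold extSrc
  rw [if_pos (set_src_label hsp hst hc x), set_src_set_tgt hsp hst hc, ext_gen]

open scoped Classical in
theorem extSrc_eq_zero (v : I.diagram.CFK 𝕜) {a : g.Dec} (h : ¬ (a.res = I ∧ a.1.2 c = c.src ∧
    Dec.IsTgt (Finset.univ.erase c) a)) : extSrc hsp hst c v a = 0 := by
  unfold extSrc
  split_ifs with hs
  · have hr := Dec.res_set_tgt hs
    refine ext_eq_zero hsp hst v fun h' => h ⟨hr ▸ h'.1, hs, fun d hd hds => ?_⟩
    have := h'.2 d (Finset.mem_univ _) (hr ▸ hds)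
    rwa [Dec.set_of_ne (Finset.ne_of_mem_erase hd)] at this
  · rfl

theorem extSrc_gen (hc : I.Singular c) (v : I.diagram.CFK 𝕜) (x : I.diagram.State) :
    extSrc hsp hst c v (I.gen hsp hst x) = 0 := by
  refine if_neg fun e => c.src_ne_tgt ?_
  rw [← e, gen_sing hsp hst x hc]

include hpq in
theorem blockD_extSrc_gen (hc : I.Singular c) (v : I.diagram.CFK 𝕜) (y : I.diagram.State) :
    blockD 𝕜 S (extSrc hsp hst c v) (I.gen hsp hst y) =
      ((I.sgnOf c.before : ℤ) : MvPolynomial g.O 𝕜) * c.u 𝕜 * v y := by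
  classical
  have e : (fun x => extSrc hsp hst c v (I.gen hsp hst x)) = 0 :=
    funext fun x => extSrc_gen hsp hst hc v x
  rw [blockD_gen hpq, e, map_zero, Pi.zero_apply, mul_zero, zero_add, Finset.sum_eq_single c]
  · rw [if_pos hc, extSrc_set_src hsp hst hc, gen_eta]
  · intro d _ hd
    split_ifs with hds
    · rw [extSrc_eq_zero, mul_zero]
      rintro ⟨-, h, -⟩
      rw [Dec.set_of_ne hd.symm, gen_sing hsp hst y hc] at h
      exact c.src_ne_tgt h.symm
    · rfl
  · exact fun h => (h (Finset.mem_univ _)).elim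

include hpq in
theorem blockD_extSrc_set_src (hc : I.Singular c) (v : I.diagram.CFK 𝕜) (y : I.diagram.State) :
    blockD 𝕜 S (extSrc hsp hst c v) ((I.gen hsp hst y).set c c.src) =
      -(I.par 𝕜 * I.boundary 𝕜 S v y) := by
  classical
  have hl := set_src_label hsp hst hc y
  have hr : ((I.gen hsp hst y).set c c.src).res = I :=
    (Dec.res_set_src (gen_sing hsp hst y hc)).trans (gen_res hsp hst y)
  rw [blockD_apply, sum_set_src hsp hst hc, boundary_apply hpq hsp hst, ← mul_assoc, par_mul_self,
    one_mul, ← Finset.sum_neg_distrib, Finset.sum_eq_zero (s := Finset.univ (α := g.Crossing)),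
    add_zero]
  · refine Finset.sum_congr rfl fun x _ => ?_
    rw [if_pos, extSrc_set_src hsp hst hc, rectCoeff_set, neg_mul]
    · rw [gen_sing hsp hst x hc]; exact c.tgt_ne_away
    · rw [gen_sing hsp hst x hc, gen_sing hsp hst y hc]
    · exact c.src_ne_away
    · rw [gen_sing hsp hst x hc]
      unfold Crossing.src Crossing.tgt; split_ifs <;> simp [sign]
    · rw [hr, Dec.res_set_src (gen_sing hsp hst x hc), gen_res]
  · intro d _
    split_ifs with hd
    · have hdc : d ≠ c := by
        rintro rfl
        exact d.src_ne_tgt (hl.symm.trans hd)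
      have h₁ : (((I.gen hsp hst y).set c c.src).set d d.src).1.2 c = c.src := by
        rw [Dec.set_of_ne hdc.symm, hl]
      have h₂ : (I.gen hsp hst y).1.2 d = d.tgt := by rwa [Dec.set_of_ne hdc] at hd
      rw [extSrc, if_pos h₁, Dec.set_comm hdc, set_src_set_tgt hsp hst hc,
        ext_set_src hsp hst v h₂, mul_zero]
    · rfl
  · intro a ha
    split_ifs with e
    · rw [extSrc_eq_zero hsp hst v ha, mul_zero]
    · rfl

include hpq hD hreg in
/-- A pair `(z, w)` in the mapping cone at a positive crossing extends to a cycle. -/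
theorem exists_cycle_of_cone {K : g.Resolution} (hK : Adjacent K I c) {w z : I.diagram.CFK 𝕜}
    (h : ∀ y, I.boundary 𝕜 S w y - c.u 𝕜 * z y ∈ K.ideal 𝕜) :
    ∃ t : g.Chains 𝕜, (∀ a, a.res ≠ I → t a = 0) ∧ blockD 𝕜 S t = 0 ∧
      (∀ y, t (I.gen hsp hst y) - w y ∈ K.ideal 𝕜) ∧
      ∀ y, t ((I.gen hsp hst y).set c c.src) +
        I.par 𝕜 * ((I.sgnOf c.before : ℤ) : MvPolynomial g.O 𝕜) * z y ∈ K.ideal 𝕜 := by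
  classical
  have hc := hK.sing
  set η : MvPolynomial g.O 𝕜 := ((I.sgnOf c.before : ℤ) : MvPolynomial g.O 𝕜) with hη
  have hηη : η * η = 1 := units_cast_mul_self _ _
  -- the boundary of `z` lies in the ideal, by regularity
  have hz : ∀ y, I.boundary 𝕜 S z y ∈ K.ideal 𝕜 := fun y => by
    have h₁ := boundary_mem hpq hsp hst (S := S) (v := I.boundary 𝕜 S w - c.u 𝕜 • z) h y
    rw [map_sub, boundary_sq hpq hsp hst hD, zero_sub, map_smul, Pi.neg_apply, neg_mem_iff] at h₁
    exact hreg _ c _ hK.smooth h₁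
  let t₀ : g.Chains 𝕜 :=
    ext hsp hst w + (-(I.par 𝕜 * η)) • extSrc hsp hst c z
  have h₁ : ∀ a : g.Dec, a.res = I → Dec.IsTgt (Finset.univ.erase c) a →
      (∃ y, a = I.gen hsp hst y) ∨ ∃ y, a = (I.gen hsp hst y).set c c.src := by
    intro a ha hat
    rcases Dec.sing_iff.1 (ha.symm ▸ hc : a.res.Singular c) with e | e
    · obtain ⟨y, hy⟩ := exists_set_src hsp hst ha e hat
      exact Or.inr ⟨y, hy.symm⟩
    · obtain ⟨y, hy⟩ := exists_gen_of_res hsp hst (I := I) (a := a) (fun d _ hd => by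
        by_cases hdc : d = c
        · subst hdc; exact e
        · exact hat d (Finset.mem_erase.2 ⟨hdc, Finset.mem_univ _⟩) hd) ha
      exact Or.inl ⟨y, hy.symm⟩
  have hext : ∀ (v : I.diagram.CFK 𝕜) y, ext hsp hst v ((I.gen hsp hst y).set c c.src) = 0 :=
    fun v y => ext_set_src hsp hst v (gen_sing hsp hst y hc)
  obtain ⟨t, h₂, h₃, h₄⟩ := exists_cycle (I := I) hD hreg (Finset.univ.erase c) (t := t₀)
    (fun a ha => by
      dsimp only [t₀]
      rw [Pi.add_apply, Pi.smul_apply, ext_eq_zero hsp hst w fun h => ha h.1,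
        extSrc_eq_zero hsp hst z fun h => ha h.1, smul_zero, add_zero]) fun a ha hat => by
      dsimp only [t₀]
      rw [hK.idealOf_erase, map_add, map_smul, blockD_ext hpq, Pi.add_apply, Pi.smul_apply,
        Pi.smul_apply, smul_eq_mul, smul_eq_mul]
      rcases h₁ a ha hat with ⟨y, rfl⟩ | ⟨y, rfl⟩
      · rw [ext_gen, blockD_extSrc_gen hpq hsp hst hc, ← hη]
        convert (K.ideal 𝕜).mul_mem_left (I.par 𝕜) (h y) using 1
        linear_combination (-(I.par 𝕜 * c.u 𝕜 * z y)) * hηη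
      · rw [hext, mul_zero, zero_add, blockD_extSrc_set_src hpq hsp hst hc]
        exact Ideal.mul_mem_left _ _ (neg_mem (Ideal.mul_mem_left _ _ (hz y)))
  rw [hK.idealOf_erase] at h₄
  refine ⟨t, h₂, h₃, fun y => ?_, fun y => ?_⟩
  · have := h₄ _ (gen_res hsp hst y) fun d _ => gen_isTgt hsp hst y d (Finset.mem_univ _)
    dsimp only [t₀] at this
    rwa [Pi.add_apply, Pi.smul_apply, ext_gen, extSrc_gen hsp hst hc, smul_zero, add_zero] at this
  · have hr : ((I.gen hsp hst y).set c c.src).res = I :=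
      (Dec.res_set_src (gen_sing hsp hst y hc)).trans (gen_res hsp hst y)
    have := h₄ _ hr fun d hd hds => by
      rw [Dec.set_of_ne (Finset.ne_of_mem_erase hd)]
      rw [hr] at hds
      exact gen_sing hsp hst y hds
    dsimp only [t₀] at this
    rw [Pi.add_apply, Pi.smul_apply, hext, extSrc_set_src hsp hst hc, zero_add, smul_eq_mul] at this
    convert this using 1
    ring

end Resolution

theorem units_smul_smul {M : Type*} [AddCommGroup M] (e : ℤˣ) (x : M) :
    (e : ℤ) • (e : ℤ) • x = x := by
  rw [smul_smul, ← Units.val_mul, Int.units_mul_self, Units.val_one, one_smul]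

open scoped Classical in
/-- The sign of an edge of the cube in the differential of the first page: that of an arrow at a
positive, and that of a rectangle at a negative crossing. -/
def edgeSign (I : g.Resolution) (c : g.Crossing) : ℤˣ :=
  if c.Positive then I.sgnOf c.before else I.sgnOf Finset.univ

theorem deg_flip_cast {I : g.Resolution} {c : g.Crossing} (hc : I c = false) {s : ℤ}
    (hI : (I.deg : ℤ) = s) : ((I.flip c).deg : ℤ) = s + 1 := by
  rw [I.deg_flip c hc]; push_cast; rw [hI]

section

variable {s : ℤ} (δ : g.Cube 𝕜 S s →ₗ[MvPolynomial g.O 𝕜] g.Cube 𝕜 S (s + 1))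
  (hδ : ∀ t : Z (totalD 𝕜 S) (g.filt 𝕜) 1 s, δ (pageMap hpq hsp hst s t) =
    pageMap hpq hsp hst (s + 1) ⟨totalD 𝕜 S t, map_mem hD rfl t.2⟩)
  {I : g.Resolution} (hI : (I.deg : ℤ) = s)

/-- The component of the differential of the first page along an edge of the cube. -/
def edgeMap {c : g.Crossing} (hc : I c = false) :
    I.V 𝕜 S →ₗ[MvPolynomial g.O 𝕜] (I.flip c).V 𝕜 S :=
  ((edgeSign I c : ℤˣ) : ℤ) • (cubeProj 𝕜 S (s + 1) (I.flip c) (deg_flip_cast hc hI) ∘ₗ δ ∘ₗ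
    g.cubeOf 𝕜 S s I hI)

theorem edgeMap_apply {c : g.Crossing} (hc : I c = false) (v : I.V 𝕜 S) :
    edgeMap δ hI hc v = ((edgeSign I c : ℤˣ) : ℤ) •
      cubeProj 𝕜 S (s + 1) (I.flip c) (deg_flip_cast hc hI) (δ (g.cubeOf 𝕜 S s I hI v)) :=
  rfl

theorem edgeSign_smul_edgeMap {c : g.Crossing} (hc : I c = false) (v : I.V 𝕜 S) :
    ((edgeSign I c : ℤˣ) : ℤ) • edgeMap δ hI hc v =
      cubeProj 𝕜 S (s + 1) (I.flip c) (deg_flip_cast hc hI) (δ (g.cubeOf 𝕜 S s I hI v)) :=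
  units_smul_smul (edgeSign I c) _

include hδ hreg in
theorem exists_map_cubeOf (v : I.V 𝕜 S) : ∃ (t : g.Chains 𝕜)
    (hZ : t ∈ Z (totalD 𝕜 S) (g.filt 𝕜) 1 s), (∀ a : g.Dec, a.res ≠ I → t a = 0) ∧
      δ (g.cubeOf 𝕜 S s I hI v) =
        pageMap hpq hsp hst (s + 1) ⟨totalD 𝕜 S t, map_mem hD rfl hZ⟩ := by
  obtain ⟨v, hv, rfl⟩ := exists_cls v
  obtain ⟨t, ht, htD, htv⟩ := exists_cycle_of_dif hpq hsp hst hD hreg hv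
  have hZ := mem_Z_of_res ht htD hI
  obtain ⟨hv₁, e₁⟩ := comp_eq_cls hpq hsp hst hI ⟨t, hZ⟩ htv
  have e₂ : g.cubeOf 𝕜 S s I hI (Homology.cls _ (I.mk 𝕜 v) hv) = pageMap hpq hsp hst s ⟨t, hZ⟩ :=
    ((pageMap_of_res hpq hsp hst hI ⟨t, hZ⟩ ht).trans (congrArg _ e₁)).symm
  exact ⟨t, hZ, ht, (congrArg δ e₂).trans (hδ ⟨t, hZ⟩)⟩

include hδ in
theorem edgeMap_cls {c : g.Crossing} (hc : I c = false) {t : g.Chains 𝕜}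
    (ht : ∀ a, a.res ≠ I → t a = 0) (htD : blockD 𝕜 S t = 0) {v : I.diagram.CFK 𝕜}
    (htv : ∀ y, t (I.gen hsp hst y) - v y ∈ I.ideal 𝕜) (hv : I.dif 𝕜 S (I.mk 𝕜 v) = 0)
    {v' : (I.flip c).diagram.CFK 𝕜} (h : ∀ y, totalD 𝕜 S t ((I.flip c).gen hsp hst y) -
      ((edgeSign I c : ℤ) : MvPolynomial g.O 𝕜) * v' y ∈ (I.flip c).ideal 𝕜) :
    ∃ hv' : (I.flip c).dif 𝕜 S ((I.flip c).mk 𝕜 v') = 0,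
      edgeMap δ hI hc (Homology.cls _ (I.mk 𝕜 v) hv) = Homology.cls _ _ hv' := by
  have hZ := mem_Z_of_res ht htD hI
  obtain ⟨hv₁, e₁⟩ := comp_eq_cls hpq hsp hst hI ⟨t, hZ⟩ htv
  obtain ⟨hv', e'⟩ := comp_eq_smul_cls hpq hsp hst (deg_flip_cast hc hI) (edgeSign I c)
    ⟨totalD 𝕜 S t, map_mem hD rfl hZ⟩ h
  refine ⟨hv', ?_⟩
  have e₂ : g.cubeOf 𝕜 S s I hI (Homology.cls _ (I.mk 𝕜 v) hv) = pageMap hpq hsp hst s ⟨t, hZ⟩ :=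
    ((pageMap_of_res hpq hsp hst hI ⟨t, hZ⟩ ht).trans (congrArg _ e₁)).symm
  refine Eq.trans ?_ e'
  rw [edgeMap_apply, ← cubeProj_pageMap]
  exact congrArg (fun x => ((edgeSign I c : ℤˣ) : ℤ) •
    cubeProj 𝕜 S (s + 1) (I.flip c) (deg_flip_cast hc hI) x) ((congrArg δ e₂).trans (hδ _))

include hδ hreg in
theorem edgeMap_isEdge {c : g.Crossing} (hc : I c = false) :
    I.IsEdge 𝕜 S c (edgeMap δ hI hc) := by
  refine ⟨fun hp w z hw hwz => ?_, fun hp v hv => ?_⟩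
  · have hA := Resolution.adjacent_of_pos hp hc
    obtain ⟨t, ht, htD, h₁, h₂⟩ := Resolution.exists_cycle_of_cone hpq hsp hst hD hreg hA
      (w := w) (z := z) (mem_ideal_smul_top_pi.1 hwz)
    refine edgeMap_cls hpq hsp hst hD δ hδ hI hc ht htD (fun y => hA.ideal_le (h₁ y)) hw fun y => ?_
    rw [edgeSign, if_pos hp]
    exact Resolution.unzip_component hpq hsp hst hc hp ht h₁ h₂ y
  · obtain ⟨t, ht, htD, h₁⟩ := exists_cycle_of_dif hpq hsp hst hD hreg hv
    refine edgeMap_cls hpq hsp hst hD δ hδ hI hc ht htD h₁ hv fun y => ?_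
    rw [edgeSign, if_neg hp]
    exact Resolution.zip_component hpq hsp hst hc hp ht h₁ y

include hδ hreg in
theorem cubeProj_map_cubeOf (v : I.V 𝕜 S) {J : g.Resolution} (hJ : (J.deg : ℤ) = s + 1)
    (h : ¬ ∃ c, I c = false ∧ J = I.flip c) :
    cubeProj 𝕜 S (s + 1) J hJ (δ (g.cubeOf 𝕜 S s I hI v)) = 0 := by
  obtain ⟨t, hZ, ht, e⟩ := exists_map_cubeOf hpq hsp hst hD hreg δ hδ hI v
  have hz : ∀ b : g.Dec, b.res = J → totalD 𝕜 S t b = 0 := fun b hb => by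
    refine totalD_eq_zero_of_le fun a ha => ht a fun e => h ?_
    refine Resolution.eq_flip_of_le (fun c => ?_) (by omega)
    rw [← hb, ← e]; exact ha c
  exact (congrArg (cubeProj 𝕜 S (s + 1) J hJ) e).trans
    ((cubeProj_pageMap hpq hsp hst hJ ⟨totalD 𝕜 S t, map_mem hD rfl hZ⟩).trans
      (comp_eq_zero hpq hsp hst hJ ⟨totalD 𝕜 S t, map_mem hD rfl hZ⟩ hz))

theorem cubeProj_smul_cubeOf (e : ℤˣ) {J K : g.Resolution} (hJ : (J.deg : ℤ) = s)
    (hK : (K.deg : ℤ) = s) (h : K ≠ J) (x : K.V 𝕜 S) :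
    cubeProj 𝕜 S s J hJ ((e : ℤ) • g.cubeOf 𝕜 S s K hK x) = 0 :=
  (map_zsmul (cubeProj 𝕜 S s J hJ) _ _).trans
    ((congrArg (fun y => (e : ℤ) • y) (cubeProj_of_ne hJ hK h x)).trans (smul_zero _))

theorem cubeProj_smul_cubeOf_self (e : ℤˣ) {J : g.Resolution} (hJ : (J.deg : ℤ) = s)
    (x : J.V 𝕜 S) :
    cubeProj 𝕜 S s J hJ ((e : ℤ) • g.cubeOf 𝕜 S s J hJ x) = (e : ℤ) • x :=
  (map_zsmul (cubeProj 𝕜 S s J hJ) _ _).trans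
    (congrArg (fun y => (e : ℤ) • y) (cubeProj_self hJ x))

include hδ hreg in
/-- The differential of the first page is the signed sum of the edge maps. -/
theorem map_cubeOf (v : I.V 𝕜 S) :
    δ (g.cubeOf 𝕜 S s I hI v) = ∑ c : {c : g.Crossing // I c = false},
      ((edgeSign I c.1 : ℤˣ) : ℤ) • g.cubeOf 𝕜 S (s + 1) (I.flip c.1) (deg_flip_cast c.2 hI)
        (edgeMap δ hI c.2 v) := by
  classical
  refine cube_ext fun J hJ => ?_
  refine Eq.trans ?_ (map_sum (cubeProj 𝕜 S (s + 1) J hJ) _ _).symm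
  by_cases h : ∃ c, I c = false ∧ J = I.flip c
  · obtain ⟨c, hc, rfl⟩ := h
    refine Eq.trans ?_ (Finset.sum_eq_single (⟨c, hc⟩ : {c : g.Crossing // I c = false})
      (fun d _ hdc => ?_) fun h => (h (Finset.mem_univ _)).elim).symm
    · exact (edgeSign_smul_edgeMap δ hI hc v).symm.trans
        (cubeProj_smul_cubeOf_self (edgeSign I c) (deg_flip_cast hc hI) (edgeMap δ hI hc v)).symm
    · refine cubeProj_smul_cubeOf (edgeSign I d.1) _ (deg_flip_cast d.2 hI) (fun e => ?_) _
      have h₁ := congrFun e d.1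
      have hne : d.1 ≠ c := fun e => hdc (Subtype.ext e)
      rw [I.flip_self, I.flip_of_ne hne, d.2] at h₁
      simp at h₁
  · refine (cubeProj_map_cubeOf hpq hsp hst hD hreg δ hδ hI v hJ h).trans
      (Finset.sum_eq_zero fun c _ => ?_).symm
    exact cubeProj_smul_cubeOf (edgeSign I c.1) hJ (deg_flip_cast c.2 hI)
      (fun e => h ⟨c.1, c.2, e.symm⟩) _

end

end

end LinkGrid

namespace Filtered

variable {R M M' : Type} [CommRing R] [AddCommGroup M] [Module R M] [AddCommGroup M'] [Module R M']
  {D : M →ₗ[R] M} {d : M' →ₗ[R] M'}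

/-- Let `T` be a subcomplex onto which every cycle can be pushed, and `π : T → M'` a surjective
chain map whose kernel is acyclic. Then the homology of `M'` is that of `M`. -/
theorem exists_homology_map (hD : ∀ v, D (D v) = 0) (T : Submodule R M) (π : M →ₗ[R] M')
    (hT : ∀ f ∈ T, D f ∈ T) (hπ : ∀ f ∈ T, π (D f) = d (π f)) (hπ' : ∀ v, ∃ f ∈ T, π f = v)
    (h₁ : ∀ f, D f ∈ T → ∃ k, f - D k ∈ T)
    (h₂ : ∀ z ∈ T, π z = 0 → D z = 0 → ∃ k ∈ T, π k = 0 ∧ D k = z) :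
    ∃ θ : LinearMap.ker D →ₗ[R] Homology d, Function.Surjective θ ∧
      ∀ x, θ x = 0 ↔ x.1 ∈ LinearMap.range D := by
  let Q := (LinearMap.range D).submoduleOf (LinearMap.ker D)
  let φ : ↥(T ⊓ LinearMap.ker D) →ₗ[R] LinearMap.ker D ⧸ Q :=
    Q.mkQ ∘ₗ Submodule.inclusion inf_le_right
  let ψ : ↥(T ⊓ LinearMap.ker D) →ₗ[R] Homology d :=
    ((LinearMap.range d).submoduleOf (LinearMap.ker d)).mkQ ∘ₗ
      (π ∘ₗ (T ⊓ LinearMap.ker D).subtype).codRestrict _ fun f => by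
        have := hπ f.1 f.2.1
        rw [LinearMap.mem_ker.1 f.2.2, map_zero] at this
        exact LinearMap.mem_ker.2 this.symm
  have hφ : Function.Surjective φ := fun x => by
    obtain ⟨x, rfl⟩ := Submodule.Quotient.mk_surjective _ x
    obtain ⟨k, hk⟩ := h₁ x.1 (by rw [LinearMap.mem_ker.1 x.2]; exact zero_mem _)
    refine ⟨⟨x.1 - D k, hk, LinearMap.mem_ker.2 ?_⟩, (Submodule.Quotient.eq _).2 ⟨-k, ?_⟩⟩
    · rw [map_sub, hD, LinearMap.mem_ker.1 x.2, sub_zero]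
    · change D (-k) = x.1 - D k - x.1
      rw [map_neg]; abel
  have hψ : Function.Surjective ψ := fun v => by
    obtain ⟨⟨v, hv⟩, rfl⟩ := Submodule.Quotient.mk_surjective _ v
    obtain ⟨f, hf, rfl⟩ := hπ' v
    obtain ⟨k, hk, hk₀, hk₁⟩ := h₂ (D f) (hT f hf) ((hπ f hf).trans hv) (hD f)
    refine ⟨⟨f - k, sub_mem hf hk, LinearMap.mem_ker.2 ?_⟩,
      congrArg Submodule.Quotient.mk (Subtype.ext ?_)⟩
    · rw [map_sub, hk₁, sub_self]
    · change π (f - k) = π f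
      rw [map_sub, hk₀, sub_zero]
  have hker : ∀ f, φ f = 0 ↔ ψ f = 0 := fun f => by
    refine (Submodule.Quotient.mk_eq_zero _).trans
      (Iff.trans ?_ (Submodule.Quotient.mk_eq_zero _).symm)
    constructor
    · rintro ⟨y, hy⟩
      replace hy : D y = f.1 := hy
      obtain ⟨k, hk⟩ := h₁ y (hy ▸ f.2.1)
      refine ⟨π (y - D k), ?_⟩
      rw [← hπ _ hk, map_sub, hD, sub_zero, hy]
      rfl
    · rintro ⟨w, hw⟩
      obtain ⟨y, hy, rfl⟩ := hπ' w
      replace hw : d (π y) = π f.1 := hw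
      obtain ⟨k, hk, hk₀, hk₁⟩ := h₂ (f.1 - D y) (sub_mem f.2.1 (hT y hy))
        (by rw [map_sub, hπ y hy, hw, sub_self])
        (by rw [map_sub, hD, LinearMap.mem_ker.1 f.2.2, sub_zero])
      refine ⟨y + k, ?_⟩
      change D (y + k) = f.1
      rw [map_add, hk₁]; abel
  refine ⟨(equivOfKer φ ψ hφ hψ hker).toLinearMap ∘ₗ Q.mkQ,
    (equivOfKer φ ψ hφ hψ hker).surjective.comp Q.mkQ_surjective, fun x => ?_⟩
  rw [LinearMap.comp_apply, LinearEquiv.coe_coe, LinearEquiv.map_eq_zero_iff]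
  exact Submodule.Quotient.mk_eq_zero _

end Filtered

namespace LinkGrid

open Loc Filtered

section

variable {p : ℕ} {q : ℤ} {N : ℕ} [NeZero N] [NeZero p] {g : LinkGrid p q N}

variable {𝕜 : Type} [CommRing 𝕜] {S : Signs p q N}

/-! ### Cancelling the arrows with coefficient one -/

namespace Crossing

open scoped Classical in
/-- The source of the arrow with coefficient one. -/
def tail (c : g.Crossing) : Loc := if c.Positive then p₁ else p₀

open scoped Classical in
/-- The target of the arrow with coefficient one. -/
def head (c : g.Crossing) : Loc := if c.Positive then p₂ else p₁

variable (c : g.Crossing)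

theorem tail_ne_away : c.tail ≠ away := by unfold tail; split_ifs <;> simp

theorem head_ne_away : c.head ≠ away := by unfold head; split_ifs <;> simp

theorem tail_ne_head : c.tail ≠ c.head := by unfold tail head; split_ifs <;> simp

/-- The label is an end of the arrow with coefficient one. -/
def Bad (l : Loc) : Prop := l = c.tail ∨ l = c.head

theorem not_bad_iff {l : Loc} : ¬ c.Bad l ↔ l = c.ini ∨ l = away := by
  unfold Bad tail head ini; split_ifs <;> cases l <;> simp

theorem Bad.of_le {c : g.Crossing} (hc : ¬ c.Positive) {l l' : Loc} (h : Le l l') (h' : c.Bad l') :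
    c.Bad l := by
  simp only [Bad, tail, head, hc, if_false] at *
  unfold Le at h
  cases l <;> cases l' <;> simp_all

theorem not_bad_of_le {c : g.Crossing} (hc : c.Positive) {l l' : Loc} (h : Le l l')
    (h' : ¬ c.Bad l') : ¬ c.Bad l := by
  simp only [Bad, tail, head, hc, if_true] at *
  unfold Le at h
  cases l <;> cases l' <;> simp_all

theorem not_lam_tail_head {n : ℕ} : ¬ Lam c.tail c.head n := by
  unfold Lam tail head; split_ifs <;> simp

end Crossing

open scoped Classical in
/-- The inverse of the arrow with coefficient one at the crossing `c`. -/
def contract (c : g.Crossing) (f : g.Chains 𝕜) :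
    g.Chains 𝕜 :=
  fun b => if b.1.2 c = c.tail then b.eta _ c * f (b.set c c.head) else 0

variable {c : g.Crossing} {f : g.Chains 𝕜} {b : g.Dec}

theorem contract_of_ne (h : b.1.2 c ≠ c.tail) : contract c f b = 0 := if_neg h

theorem contract_of_eq (h : b.1.2 c = c.tail) :
    contract c f b = b.eta _ c * f (b.set c c.head) := if_pos h

theorem koszul_of_head (h : b.1.2 c = c.head) :
    koszul 𝕜 c f b = b.eta _ c * f (b.set c c.tail) := by
  rw [koszul_apply, h]
  by_cases hp : c.Positive <;> simp [Crossing.head, Crossing.tail, kA, kB, hp]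

open scoped Classical in
theorem koszul_contract (c : g.Crossing) (f : g.Chains 𝕜) :
    koszul 𝕜 c (contract c f) = fun b => if b.1.2 c = c.head then f b else 0 := by
  funext b
  split_ifs with h
  · have hb : b.1.2 c ≠ away := h ▸ c.head_ne_away
    rw [koszul_of_head h, contract_of_eq (Dec.set_self hb c.tail_ne_away), Dec.eta_set_self,
      ← mul_assoc, Dec.eta_mul_self, one_mul, Dec.set_set hb c.tail_ne_away, if_neg c.head_ne_away,
      Dec.set_eq_self h]
  · rw [koszul_apply]
    split_ifs with h₁ h₂
    · rw [contract_of_ne, mul_zero]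
      rw [Dec.set_self (by simp [h₁]) (by simp)]
      intro e; apply h; rw [h₁]
      unfold Crossing.tail at e; unfold Crossing.head; split_ifs at *; simp_all
    · rw [contract_of_ne, mul_zero]
      rw [Dec.set_self (by simp [h₂]) (by simp)]
      intro e; apply h; rw [h₂]
      unfold Crossing.tail at e; unfold Crossing.head; split_ifs at *; simp_all
    · rfl

theorem totalD_contract_of_head (h : b.1.2 c = c.head) :
    totalD 𝕜 S (contract c f) b = f b := by
  rw [totalD_apply, rectD_apply, Finset.sum_eq_zero, zero_add, Finset.sum_eq_single c]
  · rw [koszul_contract]; exact if_pos h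
  · intro d _ hd
    have : ∀ v, contract c f (b.set d v) = 0 := fun v => contract_of_ne (by
      rw [Dec.set_of_ne hd.symm, h]; exact c.tail_ne_head.symm)
    rw [koszul_apply, this, this, mul_zero, mul_zero, ite_self, ite_self]
  · exact fun h => (h (Finset.mem_univ _)).elim
  · intro a _
    by_cases ha : a.1.2 c = c.tail
    · rw [rectCoeff_eq_zero, zero_mul]
      intro r hr
      have := hr.2.2 c
      rw [ha, h] at this
      exact c.not_lam_tail_head this
    · rw [contract_of_ne ha, mul_zero]

/-- At the bad labels `contract` is a contracting homotopy, on chains that vanish at the smaller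
good ones. -/
theorem totalD_contract_of_tail (h : b.1.2 c = c.tail)
    (hf : ∀ a : g.Dec, (∀ d, Le (a.1.2 d) ((b.set c c.head).1.2 d)) → ¬ c.Bad (a.1.2 c) → f a = 0) :
    totalD 𝕜 S (contract c f) b + contract c (totalD 𝕜 S f) b = f b := by
  classical
  have hb : b.1.2 c ≠ away := h ▸ c.tail_ne_away
  set b' := b.set c c.head with hb'
  have hl : b'.1.2 c = c.head := Dec.set_self hb c.head_ne_away
  have hs : b'.set c c.tail = b := by
    rw [hb', Dec.set_set hb c.head_ne_away, if_neg c.tail_ne_away, Dec.set_eq_self h]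
  have hη : b'.eta (MvPolynomial g.O 𝕜) c = b.eta _ c := Dec.eta_set_self
  set ρ : g.Chains 𝕜 := fun b => if b.1.2 c = c.head then f b else 0 with hρ
  have hk : ∀ (k : g.Chains 𝕜), koszul 𝕜 c k b' = b.eta _ c * k b := fun k => by
    rw [koszul_of_head hl, hs, hη]
  have hηη := b.eta_mul_self (A := MvPolynomial g.O 𝕜) c
  -- the remaining part of the differential anticommutes with the arrow at `c`
  have e₁ : rectD 𝕜 S (contract c f) b = -(b.eta _ c * rectD 𝕜 S ρ b') := by
    have := koszul_rectD 𝕜 S c (contract c f) b'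
    rw [koszul_contract, hk] at this
    linear_combination (b.eta _ c) * this - rectD 𝕜 S (contract c f) b * hηη
  have e₂ : ∀ d, koszul 𝕜 d (contract c f) b = -(b.eta _ c * koszul 𝕜 d ρ b') := fun d => by
    by_cases hd : d = c
    · subst hd
      rw [koszul_contract, hk, hρ]
      dsimp only
      rw [if_neg (by rw [h]; exact d.tail_ne_head), mul_zero, mul_zero, neg_zero]
    · have := koszul_anticomm 𝕜 (Ne.symm hd) (contract c f) b'
      rw [koszul_contract, hk] at this
      linear_combination (b.eta _ c) * this - koszul 𝕜 d (contract c f) b * hηη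
  have e₃ : totalD 𝕜 S (f - ρ) b' = b.eta _ c * f b := by
    have hρ' : ∀ a : g.Dec, a.1.2 c = c.head → (f - ρ) a = 0 := fun a ha => by
      rw [Pi.sub_apply, hρ]; dsimp only; rw [if_pos ha, sub_self]
    rw [totalD_apply, rectD_apply, Finset.sum_eq_zero, zero_add, Finset.sum_eq_single c]
    · rw [hk, Pi.sub_apply, hρ]
      dsimp only
      rw [if_neg (by rw [h]; exact c.tail_ne_head), sub_zero]
    · intro d _ hd
      have : ∀ v, (f - ρ) (b'.set d v) = 0 := fun v => hρ' _ (by rw [Dec.set_of_ne hd.symm, hl])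
      rw [koszul_apply, this, this, mul_zero, mul_zero, ite_self, ite_self]
    · exact fun h => (h (Finset.mem_univ _)).elim
    · intro a _
      by_cases hz : rectCoeff 𝕜 S a b' = 0
      · rw [hz, zero_mul]
      · obtain ⟨r, hr⟩ := exists_rect_of_ne hz
        have hlam := hr.2.2 c
        by_cases ha : a.1.2 c = c.head
        · rw [hρ' a ha, mul_zero]
        · rw [Pi.sub_apply, hρ]
          dsimp only
          rw [if_neg ha, sub_zero, hf a (fun d => (hr.2.2 d).le), mul_zero]
          rintro (h' | h')
          · rw [h', hl] at hlam
            exact c.not_lam_tail_head hlam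
          · exact ha h'
  rw [contract_of_eq h, ← hb', totalD_apply, e₁]
  simp only [e₂]
  rw [Finset.sum_neg_distrib, ← Finset.mul_sum]
  rw [map_sub, Pi.sub_apply, totalD_apply 𝕜 S ρ] at e₃
  linear_combination (b.eta _ c) * e₃ + f b * hηη

/-- The chains without components at the bad labels of the crossings in `s`. -/
def goodChains (𝕜 : Type) [CommRing 𝕜] (s : Set g.Crossing) :
    Submodule (MvPolynomial g.O 𝕜) (g.Chains 𝕜) where
  carrier := {f | ∀ b : g.Dec, ∀ c ∈ s, c.Bad (b.1.2 c) → f b = 0}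
  add_mem' hf hf' b c hc h := by rw [Pi.add_apply, hf b c hc h, hf' b c hc h, add_zero]
  zero_mem' _ _ _ _ := rfl
  smul_mem' r f hf b c hc h := by rw [Pi.smul_apply, hf b c hc h, smul_zero]

theorem totalD_mem_goodChains {s : Set g.Crossing} (hs : ∀ c ∈ s, ¬ c.Positive)
    (hf : f ∈ goodChains 𝕜 s) : totalD 𝕜 S f ∈ goodChains 𝕜 s := fun _ c hc h =>
  totalD_eq_zero_of_label_le fun a ha => hf a c hc (h.of_le (hs c hc) (ha c))

theorem contract_mem_goodChains {s : Set g.Crossing} (hc : c ∉ s)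
    (hf : f ∈ goodChains 𝕜 s) : contract c f ∈ goodChains 𝕜 s := fun b d hd h => by
  by_cases e : b.1.2 c = c.tail
  · rw [contract_of_eq e, hf (b.set c c.head) d hd, mul_zero]
    rwa [Dec.set_of_ne (by rintro rfl; exact hc hd)]
  · exact contract_of_ne e

variable (hD : ∀ f : g.Chains 𝕜, totalD 𝕜 S (totalD 𝕜 S f) = 0)

include hD in
/-- At the negative crossings the bad labels form a contractible quotient complex. -/
theorem exists_sub_mem_goodChains (s : Finset g.Crossing) (hs : ∀ c ∈ s, ¬ c.Positive)
    (hf : totalD 𝕜 S f ∈ goodChains 𝕜 (s : Set g.Crossing)) :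
    ∃ k, f - totalD 𝕜 S k ∈ goodChains 𝕜 (s : Set g.Crossing) := by
  classical
  induction s using Finset.induction_on with
  | empty => exact ⟨0, fun b c hc => by simp at hc⟩
  | insert c s hc ih =>
    have hs' : ∀ d ∈ s, ¬ d.Positive := fun d hd => hs d (Finset.mem_insert_of_mem hd)
    obtain ⟨k, hk⟩ := ih hs' fun b d hd => hf b d (Finset.mem_insert_of_mem hd)
    set f₁ := f - totalD 𝕜 S k with hf₁
    have hD₁ : totalD 𝕜 S f₁ = totalD 𝕜 S f := by rw [hf₁, map_sub, hD, sub_zero]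
    refine ⟨k + contract c f₁, fun b d hd hb => ?_⟩
    rw [map_add, ← sub_sub, ← hf₁]
    rcases Finset.mem_insert.1 hd with rfl | hd
    · rw [Pi.sub_apply]
      rcases hb with hb | hb
      · have hb₀ : b.1.2 d ≠ away := hb ▸ d.tail_ne_away
        have hl : (b.set d d.head).1.2 d = d.head := Dec.set_self hb₀ d.head_ne_away
        have e := totalD_contract_of_tail (S := S) (f := f₁) hb fun a ha hn =>
          (hn (Crossing.Bad.of_le (hs d (Finset.mem_insert_self _ _)) (ha d)
            (Or.inr hl))).elim
        rw [contract_of_eq hb, hD₁, hf _ d (Finset.mem_insert_self _ _) (Or.inr hl), mul_zero,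
          add_zero] at e
        rw [e, sub_self]
      · rw [totalD_contract_of_head hb, sub_self]
    · exact sub_mem hk (totalD_mem_goodChains hs' (contract_mem_goodChains (by simpa using hc) hk))
        b d hd hb

include hD in
/-- At the positive crossings the bad labels form a contractible subcomplex. -/
theorem exists_totalD_eq_of_good {n : Set g.Crossing} (hn : ∀ c ∈ n, ¬ c.Positive)
    (s t : Finset g.Crossing) (hs : ∀ c ∈ s, c.Positive) (ht : ∀ c ∈ t, c.Positive)
    (hst : Disjoint s t) {z : g.Chains 𝕜} (hz : z ∈ goodChains 𝕜 n)
    (hDz : ∀ b : g.Dec, (∀ c ∈ t, ¬ c.Bad (b.1.2 c)) → totalD 𝕜 S z b = 0)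
    (hz₀ : ∀ b : g.Dec, (∀ c ∈ s ∪ t, ¬ c.Bad (b.1.2 c)) → z b = 0) :
    ∃ k ∈ goodChains 𝕜 n, (∀ b : g.Dec, (∀ c ∈ s ∪ t, ¬ c.Bad (b.1.2 c)) → k b = 0) ∧
      ∀ b : g.Dec, (∀ c ∈ t, ¬ c.Bad (b.1.2 c)) → totalD 𝕜 S k b = z b := by
  classical
  induction s using Finset.induction_on generalizing t z with
  | empty =>
    refine ⟨0, zero_mem _, fun _ _ => rfl, fun b hb => ?_⟩
    rw [map_zero, Pi.zero_apply, hz₀ b (by simpa using hb)]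
  | insert c s hc ih =>
    have hcp := hs c (Finset.mem_insert_self _ _)
    have hct : c ∉ t := Finset.disjoint_left.1 hst (Finset.mem_insert_self _ _)
    have hst' : Disjoint s (insert c t) := by
      rw [Finset.disjoint_insert_right]
      exact ⟨hc, hst.mono_left (Finset.subset_insert _ _)⟩
    have hu : s ∪ insert c t = insert c s ∪ t := by ext; simp
    obtain ⟨k, hk, hk₀, hk₁⟩ := ih (insert c t)
      (fun d hd => hs d (Finset.mem_insert_of_mem hd))
      (fun d hd => by
        rcases Finset.mem_insert.1 hd with rfl | hd
        exacts [hcp, ht d hd])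
      hst' hz (fun b hb => hDz b fun d hd => hb d (Finset.mem_insert_of_mem hd))
      (by rw [hu]; exact hz₀)
    rw [hu] at hk₀
    set z₁ := z - totalD 𝕜 S k with hz₁
    have hD₁ : totalD 𝕜 S z₁ = totalD 𝕜 S z := by rw [hz₁, map_sub, hD, sub_zero]
    have hg : z₁ ∈ goodChains 𝕜 n := sub_mem hz (totalD_mem_goodChains hn hk)
    have hv : ∀ b : g.Dec, (∀ d ∈ t, ¬ d.Bad (b.1.2 d)) → ¬ c.Bad (b.1.2 c) → z₁ b = 0 := by
      intro b hb hbc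
      rw [hz₁, Pi.sub_apply, hk₁, sub_self]
      intro d hd
      rcases Finset.mem_insert.1 hd with rfl | hd
      exacts [hbc, hb d hd]
    refine ⟨k + contract c z₁, add_mem hk (contract_mem_goodChains (fun h => hn c h hcp) hg),
      fun b hb => ?_, fun b hb => ?_⟩
    · rw [Pi.add_apply, hk₀ b hb, zero_add, contract_of_ne]
      exact fun e => hb c (by simp) (Or.inl e)
    · suffices h : totalD 𝕜 S (contract c z₁) b = z₁ b by
        rw [map_add, Pi.add_apply, h, hz₁, Pi.sub_apply]; ring
      by_cases hbc : c.Bad (b.1.2 c)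
      · rcases hbc with hb' | hb'
        · have hset : ∀ d ∈ t, ¬ d.Bad ((b.set c c.head).1.2 d) := fun d hd => by
            rw [Dec.set_of_ne (by rintro rfl; exact hct hd)]
            exact hb d hd
          have e := totalD_contract_of_tail (S := S) (f := z₁) hb' fun a ha hna =>
            hv a (fun d hd => Crossing.not_bad_of_le (ht d hd) (ha d) (hset d hd)) hna
          rwa [contract_of_eq hb', hD₁, hDz _ hset, mul_zero, add_zero] at e
        · exact totalD_contract_of_head hb'
      · rw [hv b hb hbc]
        refine totalD_eq_zero_of_label_le fun a ha => contract_of_ne fun e => ?_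
        exact Crossing.not_bad_of_le hcp (ha c) hbc (Or.inl e)

end

end LinkGrid

namespace Filtered

variable {R : Type} [CommRing R] {T : Type} [AddCommGroup T] [Module R T] {D : T →ₗ[R] T}
  {F : ℤ → Submodule R T} (hD : ∀ v, D (D v) = 0) (hF : Antitone F)
  {C : ℤ → Type} [∀ s, AddCommGroup (C s)] [∀ s, Module R (C s)]
  (ψ : ∀ s, Z D F 1 s →ₗ[R] C s) (hψ : ∀ s, Function.Surjective (ψ s))
  (hψ' : ∀ s v, ψ s v = 0 ↔ v.1 ∈ B D F 1 s)

include hψ hψ' in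
/-- The first page and its differential, described by representatives. -/
theorem exists_firstPage : ∃ (φ : ∀ s, ((specSeq F hD hF).page 1).X s ≃ₗ[R] C s)
    (δ : ∀ s, C s →ₗ[R] C (s + 1)),
    (∀ s x, φ (s + 1) (((specSeq F hD hF).page 1).d s (s + 1) ((φ s).symm x)) = δ s x) ∧
      ∀ s (v : Z D F 1 s), δ s (ψ s v) = ψ (s + 1) ⟨D v, map_mem hD rfl v.2⟩ :=
  ⟨firstPage hD hF ψ hψ hψ', fun s => (firstPage hD hF ψ hψ hψ' (s + 1)).toLinearMap ∘ₗ
    (((specSeq F hD hF).page 1).d s (s + 1)).hom ∘ₗ (firstPage hD hF ψ hψ hψ' s).symm.toLinearMap,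
    fun _ _ => rfl, firstPage_d hD hF ψ hψ hψ'⟩

end Filtered

namespace LinkGrid

open Loc Filtered

/-! ### Comparison with the complex of the diagram -/

section

variable {p : ℕ} {q : ℤ} {N : ℕ} [NeZero N] [NeZero p] {g : LinkGrid p q N}

variable (hpq : Int.gcd (p : ℤ) q = 1) (hsp : g.IsSpecial) (hst : ∀ c : g.Crossing, g.IsStandardAt c)

variable {𝕜 : Type} [CommRing 𝕜] {S : Signs p q N}

theorem Crossing.ini_ne_away (c : g.Crossing) : c.ini ≠ away := by unfold ini; split_ifs <;> simp

theorem Crossing.ini_ne_p₁ (c : g.Crossing) : c.ini ≠ p₁ := by unfold ini; split_ifs <;> simp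

open scoped Classical in
/-- The generator of the total complex that represents a generator of the complex of `g`. -/
def top (x : g.toDiagram.State) : g.Dec :=
  ⟨(⟨x.1, x.2⟩, fun c => if c.corner ∈ x.1 then c.ini else away), fun c => by
    dsimp only
    split_ifs with h
    · exact iff_of_false c.ini_ne_away (not_not.2 h)
    · exact iff_of_true rfl h⟩

theorem top_injective : Function.Injective (top (g := g)) := fun _ _ h =>
  Subtype.ext (congrArg (fun a : g.Dec => a.1.1.1) h)

theorem top_label (x : g.toDiagram.State) (c : g.Crossing) :
    (top x).1.2 c = c.ini ∨ (top x).1.2 c = away := by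
  unfold top; dsimp only; split_ifs <;> simp

theorem exists_top {a : g.Dec} (h : ∀ c : g.Crossing, ¬ c.Bad (a.1.2 c)) : ∃ x, top x = a := by
  refine ⟨⟨a.1.1.1, a.1.1.2⟩, Dec.ext' rfl fun c => ?_⟩
  have h₁ := a.2 c
  have h₂ := c.not_bad_iff.1 (h c)
  unfold top
  dsimp only
  split_ifs with hc
  · exact (h₂.resolve_right fun e => h₁.1 e hc).symm
  · exact (h₁.2 hc).symm

theorem top_par (x : g.toDiagram.State) : (top x).par (MvPolynomial g.O 𝕜) = 1 :=
  Finset.prod_eq_one fun c _ => if_neg (by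
    rcases top_label x c with h | h <;> rw [h]
    exacts [c.ini_ne_p₁, by simp])

include hpq hst in
theorem rectOK_top {x y : g.toDiagram.State} {r : Rect p q N} : RectOK (top x) (top y) r ↔
    r.IsEmptyFromTo x.1 y.1 ∧ r.multAt (g.toDiagram.X ∪ g.toDiagram.XX) = 0 := by
  refine and_congr_right fun h => ?_
  rw [forall_congr' fun c => lam_iff_A hpq (x := (top x).1.1) (y := (top y).1.1) h c ((top x).2 c)
    ((top y).2 c) (top_label x c) (top_label y c), Rect.multAt_eq_zero]
  simp only [← Rect.mult_eq_zero, mem_free_iff, toDiagram, Finset.mem_union]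
  constructor
  · rintro ⟨h₁, h₂⟩ t (ht | ht)
    · by_cases hA : ∃ c : g.Crossing, t ∈ c.A
      · exact h₂ hA.choose t hA.choose_spec
      · exact h₁ t (Or.inl ⟨ht, not_exists.1 hA⟩)
    · exact h₁ t (Or.inr ht)
  · refine fun h => ⟨fun t ht => h t (ht.imp_left And.left), fun c t ht => h t (Or.inl ?_)⟩
    obtain ⟨b, rfl⟩ := Crossing.mem_A.1 ht
    exact mark_mem hst c b

include hpq hst in
theorem rectCoeff_top (x y : g.toDiagram.State) : rectCoeff 𝕜 S (top x) (top y) =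
    Diagram.count 𝕜 S (fun r => r.multAt (g.toDiagram.X ∪ g.toDiagram.XX) = 0) x.1 y.1 := by
  classical
  unfold rectCoeff Diagram.count
  rw [top_par, one_mul, Finset.sum_filter]
  refine Finset.sum_congr rfl fun r _ => ?_
  by_cases hr : RectOK (top x) (top y) r
  · rw [if_pos hr, if_pos ((rectOK_top hpq hst).1 hr)]
    unfold sgn mono
    rw [map_intCast]
    rfl
  · rw [if_neg hr, if_neg fun h' => hr ((rectOK_top hpq hst).2 h')]

variable (g) in
/-- The negative crossings. -/
def negative : Set g.Crossing := {c | ¬ c.Positive}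

include hpq hst in
/-- On the remaining generators the differential is that of `CFK⁻(g)`. -/
theorem totalD_top {f : g.Chains 𝕜} (hf : f ∈ goodChains 𝕜 g.negative)
    (y : g.toDiagram.State) : totalD 𝕜 S f (top y) =
      g.toDiagram.boundary 𝕜 S (fun x => f (top x)) y := by
  have hy : ∀ c : g.Crossing, ¬ c.Bad ((top y).1.2 c) := fun c => c.not_bad_iff.2 (top_label y c)
  have e : g.toDiagram.boundary 𝕜 S (fun x => f (top x)) y =
      ∑ x, rectCoeff 𝕜 S (top x) (top y) * f (top x) := by
    simp only [rectCoeff_top hpq hst]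
    rfl
  rw [e, totalD_apply, rectD_apply, Finset.sum_eq_zero (s := Finset.univ (α := g.Crossing)), add_zero]
  · symm
    refine Fintype.sum_of_injective _ top_injective _ _ (fun a ha => ?_) fun x => rfl
    by_cases hz : rectCoeff 𝕜 S a (top y) = 0
    · rw [hz, zero_mul]
    · obtain ⟨r, hr⟩ := exists_rect_of_ne hz
      have : ∃ c : g.Crossing, c.Bad (a.1.2 c) := by
        by_contra h
        exact ha (exists_top (not_exists.1 h))
      obtain ⟨c, hc⟩ := this
      by_cases hp : c.Positive
      · exact (Crossing.not_bad_of_le hp (hr.2.2 c).le (hy c) hc).elim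
      · rw [hf a c hp hc, mul_zero]
  · intro c _
    rw [koszul_apply]
    have h₁ : (top y).1.2 c ≠ p₁ := by
      rcases top_label y c with h | h <;> rw [h]
      exacts [c.ini_ne_p₁, by simp]
    rw [if_neg h₁]
    split_ifs with h₂
    · have hp : ¬ c.Positive := fun hp => hy c (Or.inr (by rw [h₂, Crossing.head, if_pos hp]))
      rw [hf _ c hp (Or.inr ?_), mul_zero]
      rw [Dec.set_self (by simp [h₂]) (by simp), Crossing.head, if_neg hp]
    · rfl

theorem exists_goodChain (v : g.toDiagram.CFK 𝕜) :
    ∃ f ∈ goodChains 𝕜 g.negative, (fun x => f (top x)) = v := by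
  classical
  refine ⟨fun a => if h : ∃ x, top x = a then v h.choose else 0, fun b c _ hb => dif_neg ?_,
    funext fun x => ?_⟩
  · rintro ⟨x, rfl⟩
    exact c.not_bad_iff.2 (top_label x c) hb
  · have h : ∃ x', top x' = top x := ⟨x, rfl⟩
    dsimp only
    rw [dif_pos h, top_injective h.choose_spec]

variable (hD : ∀ f : g.Chains 𝕜, totalD 𝕜 S (totalD 𝕜 S f) = 0)

include hpq hst hD in
/-- The square of the differential of `CFK⁻(g)` vanishes because that of the total complex does. -/
theorem boundary_comp_boundary : g.toDiagram.boundary 𝕜 S ∘ₗ g.toDiagram.boundary 𝕜 S = 0 := by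
  refine LinearMap.ext fun v => funext fun y => ?_
  obtain ⟨f, hf, rfl⟩ := exists_goodChain v
  have e := totalD_top (S := S) hpq hst (totalD_mem_goodChains (S := S) (fun c hc => hc) hf) y
  rw [hD, Pi.zero_apply] at e
  rw [LinearMap.comp_apply, ← funext (totalD_top (S := S) hpq hst hf), ← e]
  rfl

include hpq hst hD in
/-- The homology of the total complex is that of the diagram. -/
theorem exists_totalD_homology_map :
    ∃ θ : LinearMap.ker (totalD (g := g) 𝕜 S) →ₗ[MvPolynomial g.O 𝕜] g.HFK 𝕜 S,
      Function.Surjective θ ∧ ∀ x, θ x = 0 ↔ x.1 ∈ LinearMap.range (totalD (g := g) 𝕜 S) := by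
  classical
  have hn : ((Finset.univ.filter fun c : g.Crossing => ¬ c.Positive : Finset g.Crossing) :
      Set g.Crossing) = g.negative := by
    ext c; simp [negative]
  refine exists_homology_map hD (goodChains 𝕜 g.negative) (LinearMap.funLeft _ _ top)
    (fun f => totalD_mem_goodChains fun c hc => hc)
    (fun f hf => funext fun y => totalD_top hpq hst hf y) exists_goodChain
    (fun f hf => ?_) fun z hz hz₀ hDz => ?_
  · rw [← hn] at hf ⊢
    exact exists_sub_mem_goodChains hD _ (fun c hc => (Finset.mem_filter.1 hc).2) hf
  · have key : ∀ {k : g.Chains 𝕜} {b : g.Dec}, k ∈ goodChains 𝕜 g.negative →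
        (∀ c ∈ (Finset.univ.filter fun c : g.Crossing => c.Positive) ∪ ∅, ¬ c.Bad (b.1.2 c)) →
        (∀ x, top x ≠ b) → k b = 0 := fun {k b} hk hb h => by
      have : ∃ c : g.Crossing, c.Bad (b.1.2 c) := by
        by_contra h'
        obtain ⟨x, hx⟩ := exists_top (not_exists.1 h')
        exact h x hx
      obtain ⟨c, hc⟩ := this
      exact hk b c (fun hp => hb c (by simp [hp]) hc) hc
    obtain ⟨k, hk, hk₀, hk₁⟩ := exists_totalD_eq_of_good hD (n := g.negative) (fun c hc => hc)
      (Finset.univ.filter fun c : g.Crossing => c.Positive) ∅ (fun c hc => (Finset.mem_filter.1 hc).2)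
      (by simp) (by simp) hz (fun b _ => by rw [hDz]; rfl) fun b hb => by
        by_cases h : ∃ x, top x = b
        · obtain ⟨x, rfl⟩ := h
          exact congrFun hz₀ x
        · exact key hz hb (not_exists.1 h)
    refine ⟨k, hk, funext fun x => hk₀ (top x) fun c _ => c.not_bad_iff.2 (top_label x c),
      funext fun b => hk₁ b (by simp)⟩

/-! ### The spectral sequence -/

theorem filt_eq_top {s : ℤ} (hs : s ≤ 0) : g.filt 𝕜 s = ⊤ :=
  eq_top_iff.2 fun _ _ a ha => by omega

theorem filt_eq_bot : g.filt 𝕜 (Fintype.card g.Crossing + 1) = ⊥ :=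
  eq_bot_iff.2 fun f hf => (Submodule.mem_bot _).2 <| funext fun a => hf a (by
    have : a.res.deg ≤ Fintype.card g.Crossing := Finset.card_le_univ _
    omega)

variable (hreg : g.IsRegular 𝕜)

include hpq hsp hst hD hreg in
theorem exists_cubePage :
    ∃ (φ : ∀ s, ((specSeq (g.filt 𝕜) hD filt_antitone).page 1).X s ≃ₗ[MvPolynomial g.O 𝕜]
        g.Cube 𝕜 S s)
      (δ : ∀ s, g.Cube 𝕜 S s →ₗ[MvPolynomial g.O 𝕜] g.Cube 𝕜 S (s + 1)),
      (∀ s x, φ (s + 1) (((specSeq (g.filt 𝕜) hD filt_antitone).page 1).d s (s + 1)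
        ((φ s).symm x)) = δ s x) ∧
      ∀ s (t : Z (totalD 𝕜 S) (g.filt 𝕜) 1 s), δ s (pageMap hpq hsp hst s t) =
        pageMap hpq hsp hst (s + 1) ⟨totalD 𝕜 S t, map_mem hD rfl t.2⟩ :=
  exists_firstPage hD filt_antitone (C := fun s => g.Cube 𝕜 S s) (pageMap hpq hsp hst)
    (pageMap_surjective hpq hsp hst hD hreg) (pageMap_eq_zero_iff hpq hsp hst hD hreg)

open scoped Classical in
/-- The map of an edge of the cube. -/
def edge (δ : ∀ s, g.Cube 𝕜 S s →ₗ[MvPolynomial g.O 𝕜] g.Cube 𝕜 S (s + 1))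
    (I : g.Resolution) (c : g.Crossing) : I.V 𝕜 S →ₗ[MvPolynomial g.O 𝕜] (I.flip c).V 𝕜 S :=
  if h : I c = false then edgeMap (δ (I.deg : ℤ)) rfl h else 0

theorem edge_of_deg (δ : ∀ s, g.Cube 𝕜 S s →ₗ[MvPolynomial g.O 𝕜] g.Cube 𝕜 S (s + 1)) {s : ℤ}
    {I : g.Resolution} (hI : (I.deg : ℤ) = s) {c : g.Crossing} (hc : I c = false) :
    edge δ I c = edgeMap (δ s) hI hc := by
  subst hI
  exact dif_pos hc

include hpq hsp hst hD hreg in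
theorem hasResolutionSpectralSequence : g.HasResolutionSpectralSequence 𝕜 S := by
  obtain ⟨θ, hθ, hθ'⟩ := exists_totalD_homology_map hpq hst hD
  obtain ⟨φ, δ, hφ, hδ⟩ := exists_cubePage hpq hsp hst hD hreg
  refine ⟨boundary_comp_boundary hpq hst hD,
    fun I => LinearMap.ext fun v => Resolution.boundary_sq hpq hsp hst hD v,
    edge δ, fun I c hc => ?_, specSeq (g.filt 𝕜) hD filt_antitone, φ, edgeSign,
    fun s I hI v => (hφ s _).trans ?_,
    convergesTo hD filt_antitone (fun s => filt_eq_top) filt_eq_bot θ hθ hθ'⟩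
  · rw [edge_of_deg δ rfl hc]
    exact edgeMap_isEdge hpq hsp hst hD hreg _ (hδ _) rfl hc
  · refine (map_cubeOf hpq hsp hst hD hreg _ (hδ s) hI v).trans
      (Finset.sum_congr rfl fun c _ => ?_)
    rw [edge_of_deg δ hI c.2]

end

end LinkGrid

end LensGrid

end

theorem mainTheorem5 (p N : ℕ) [NeZero p] [NeZero N] (q : ℤ) (hpq : Int.gcd (p : ℤ) q = 1)
    (hq₁ : -(p : ℤ) < q) (hq₂ : q < (p : ℤ)) (g : LensGrid.LinkGrid p q N)
    (hspecial : g.IsSpecial) (hstandard : ∀ c : g.Crossing, g.IsStandardAt c)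
    (hfree : g.HasFreeMarks) :
    g.HasResolutionSpectralSequence (ZMod 2) (fun _ _ _ => 1) ∧
      ∀ S : LensGrid.Signs p q N, LensGrid.IsSignAssignment S →
        g.HasResolutionSpectralSequence ℤ S := by
  constructor
  · have h : (1 : MvPolynomial g.O (ZMod 2)) = -1 := (CharTwo.neg_eq 1).symm
    exact LensGrid.LinkGrid.hasResolutionSpectralSequence hpq hspecial hstandard
      (LensGrid.LinkGrid.totalD_sq _ _ hpq hspecial hstandard (LensGrid.goodSigns_one _ h))
      (LensGrid.LinkGrid.u_regular hspecial hstandard hfree _)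
  · intro S hS
    exact LensGrid.LinkGrid.hasResolutionSpectralSequence hpq hspecial hstandard
      (LensGrid.LinkGrid.totalD_sq _ _ hpq hspecial hstandard (hS.goodSigns _))
      (LensGrid.LinkGrid.u_regular hspecial hstandard hfree _)
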